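/- Let $n\ge 2$ and let $g(x)=\{g_{ij}(x)\}_{i,j=1}^n$, $x\in\mathbb R^n$, be a real symmetric matrix field such that, for some constants $\lambda\ge 1$ and $\Lambda>0$, $$\lambda^{-1}\sum_i\xi_i^2\le \sum_{i,j}g_{ij}(x)\xi_i\xi_j\le\lambda\sum_i\xi_i^2,\qquad \sum_{i,j=1}^n|g_{ij}(x)-g_{ij}(y)|\le\Lambda\,\|x-y\|\qquad\text{for all }x,y,\xi\in\mathbb R^n,$$ where $\|\cdot\|$ is the Euclidean norm. Let $\{g^{ij}(x)\}$ be the inverse matrix of $g(x)$. Summing over repeated indices, write $$\nabla_g f=g^{-1}\nabla f,\qquad \Delta_g f=\operatorname{div}(\nabla_g f)=\partial_i(g^{ij}\partial_j f),\qquad |X|^2=g_{ij}(x)X_i\overline{X_j}\ \text{ for a vector } X\in\mathbb C^n\text{ at }x,$$ and, for $\zeta\in\mathbb C^n$, $$P(x,\zeta)=g^{ij}(x)\zeta_i\zeta_j,\qquad P^{(l)}(x,\zeta)=2g^{lk}(x)\zeta_k,\qquad P_{(s)}(x,\zeta)=\partial_s g^{jk}(x)\,\zeta_j\zeta_k$$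 (the derivatives of $g^{jk}$ exist for almost every $x$). Let $\Omega\subset\mathbb R^n$ be a bounded open set and let $\phi\in C^2(\overline\Omega)$ be real-valued, that is, $\phi\in C^2(\Omega)$ and $\phi$ and its partial derivatives of order at most $2$ extend continuously to $\overline\Omega$, with $\nabla\phi(x)\ne0$ for every $x\in\overline\Omega$. For $\xi\in\mathbb R^n$, $\tau\in\mathbb R\setminus\{0\}$ and $\zeta=\xi+i\tau\nabla\phi(x)$ put $$Q(x,\xi,\tau)=\partial^2_{jk}\phi(x)\,P^{(j)}(x,\zeta)\,\overline{P^{(k)}(x,\zeta)}+\tau^{-1}\,\mathrm{Im}\Big(P_{(k)}(x,\zeta)\,\overline{P^{(k)}(x,\zeta)}\Big).$$ Assume that there is a constant $c_0>0$ such that, for almost every $x\in\Omega$ and for all $\xi\in\mathbb R^n$ and $\tau\neq0$, $$P(x,\zeta)=0\ \text{ and }\ \zeta=\xi+i\tau\nabla\phi(x)\neq0\quad\Longrightarrow\quad Q(x,\xi,\tau)\ge c_0|\zeta|^2 .$$ Then there exist $C>0$ and $\tau_0>0$ such that for every $u\in C_0^\infty(\Omega)$ (real-valued) and every $\tau\ge\tau_0$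 $$\tau\int_\Omega\big(|\nabla_g u|^2+\tau^2u^2\big)e^{2\tau\phi}\,dx\le C\int_\Omega|\Delta_g u|^2e^{2\tau\phi}\,dx .$$ -/

import Mathlib

open MeasureTheory
open scoped ContDiff

noncomputable section

namespace Carleman

/-- The Euclidean space `ℝⁿ`. -/
abbrev Sp (n : ℕ) : Type := EuclideanSpace ℝ (Fin n)

variable {n : ℕ}

/-- The partial derivative `∂ᵢ f (x)`. -/
def pd (i : Fin n) (f : Sp n → ℝ) (x : Sp n) : ℝ :=
  fderiv ℝ f x (EuclideanSpace.single i 1)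

/-- The Euclidean gradient `∇ f (x) = (∂₁ f (x), …, ∂ₙ f (x))`. -/
def grad (f : Sp n → ℝ) (x : Sp n) : Fin n → ℝ := fun i => pd i f x

/-- `f`, considered on `Ω`, extends to a continuous function on the closure of `Ω`. -/
def ExtendsToClosure (Ω : Set (Sp n)) (f : Sp n → ℝ) : Prop :=
  ∃ F : Sp n → ℝ, ContinuousOn F (closure Ω) ∧ Set.EqOn F f Ω

/-- `f ∈ C²(Ω̄)`: `f` is `C²` in `Ω`, and `f` and its partial derivatives of first and second order
extend continuously to `Ω̄`. -/
def IsC2Closure (Ω : Set (Sp n)) (f : Sp n → ℝ) : Prop :=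
  ContDiffOn ℝ 2 f Ω ∧ ExtendsToClosure Ω f ∧ (∀ i, ExtendsToClosure Ω (pd i f)) ∧
    ∀ i j, ExtendsToClosure Ω (pd i (pd j f))

/-- `u ∈ C₀^∞(Ω)`. -/
def IsTestFunction (Ω : Set (Sp n)) (u : Sp n → ℝ) : Prop :=
  ContDiff ℝ ∞ u ∧ HasCompactSupport u ∧ tsupport u ⊆ Ω

/-- Uniform ellipticity: `lam⁻¹ |ξ|² ≤ g_{ij}(x) ξᵢ ξⱼ ≤ lam |ξ|²` for all `x, ξ`. -/
def IsElliptic (g : Sp n → Matrix (Fin n) (Fin n) ℝ) (lam : ℝ) : Prop :=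
  ∀ (x : Sp n) (ξ : Fin n → ℝ),
    lam⁻¹ * ∑ i, ξ i ^ 2 ≤ ∑ i, ∑ j, g x i j * ξ i * ξ j ∧
      ∑ i, ∑ j, g x i j * ξ i * ξ j ≤ lam * ∑ i, ξ i ^ 2

/-- The Lipschitz condition `∑ |g_{ij}(x) - g_{ij}(y)| ≤ Lam |x - y|` for all `x, y`. -/
def IsLipschitzField (g : Sp n → Matrix (Fin n) (Fin n) ℝ) (Lam : ℝ) : Prop :=
  ∀ x y : Sp n, ∑ i, ∑ j, |g x i j - g y i j| ≤ Lam * ‖x - y‖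

/-- The entry `g^{ij}(x)` of the inverse matrix of `g(x)`. -/
def ginv (g : Sp n → Matrix (Fin n) (Fin n) ℝ) (i j : Fin n) (x : Sp n) : ℝ := (g x)⁻¹ i j

/-- `∇_g f (x) = g(x)⁻¹ ∇ f (x)`. -/
def gradG (g : Sp n → Matrix (Fin n) (Fin n) ℝ) (f : Sp n → ℝ) (x : Sp n) : Fin n → ℝ :=
  fun i => ∑ j, ginv g i j x * pd j f x

/-- `|X|² = g_{ij}(x) Xᵢ Xⱼ`, for a real vector `X` at the point `x`. -/
def normSqG (g : Sp n → Matrix (Fin n) (Fin n) ℝ) (x : Sp n) (X : Fin n → ℝ) : ℝ :=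
  ∑ i, ∑ j, g x i j * X i * X j

/-- `Δ_g f = div (∇_g f) = ∂ᵢ (g^{ij} ∂ⱼ f)`. For smooth `f` and Lipschitz `g` the field `∇_g f` is
locally Lipschitz, so that these derivatives exist at almost every point. -/
def laplG (g : Sp n → Matrix (Fin n) (Fin n) ℝ) (f : Sp n → ℝ) (x : Sp n) : ℝ :=
  ∑ i, pd i (fun y => gradG g f y i) x

/-- The principal symbol `P(x, ζ) = g^{ij}(x) ζᵢ ζⱼ`, for complex `ζ`. -/
def symP (g : Sp n → Matrix (Fin n) (Fin n) ℝ) (x : Sp n) (ζ : Fin n → ℂ) : ℂ :=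
  ∑ i, ∑ j, (ginv g i j x : ℂ) * ζ i * ζ j

/-- `P^{(l)}(x, ζ) = ∂P/∂ζ_l (x, ζ) = 2 g^{lk}(x) ζ_k`. -/
def symPUp (g : Sp n → Matrix (Fin n) (Fin n) ℝ) (l : Fin n) (x : Sp n) (ζ : Fin n → ℂ) : ℂ :=
  2 * ∑ k, (ginv g l k x : ℂ) * ζ k

/-- `P_{(s)}(x, ζ) = ∂P/∂x_s (x, ζ) = ∂_s g^{jk}(x) ζⱼ ζ_k`. -/
def symPDown (g : Sp n → Matrix (Fin n) (Fin n) ℝ) (s : Fin n) (x : Sp n) (ζ : Fin n → ℂ) : ℂ :=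
  ∑ j, ∑ k, (pd s (ginv g j k) x : ℂ) * ζ j * ζ k

/-- `ζ = ξ + i τ ∇φ(x)`. -/
def zeta (φ : Sp n → ℝ) (x : Sp n) (ξ : Fin n → ℝ) (τ : ℝ) : Fin n → ℂ :=
  fun j => (ξ j : ℂ) + Complex.I * (τ : ℂ) * (grad φ x j : ℂ)

/-- `|ζ|² = g_{ij}(x) ζᵢ ζ̄ⱼ`, for a complex vector `ζ` at the point `x` (for symmetric `g(x)` the
sum is real). -/
def cnormSqG (g : Sp n → Matrix (Fin n) (Fin n) ℝ) (x : Sp n) (ζ : Fin n → ℂ) : ℝ :=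
  (∑ i, ∑ j, (g x i j : ℂ) * ζ i * star (ζ j)).re

/-- For `τ ≠ 0` and `ζ = ξ + i τ ∇φ(x)`,
`Q(x, ξ, τ) = ∂²_{jk}φ(x) P^{(j)}(x, ζ) conj P^{(k)}(x, ζ)
  + τ⁻¹ Im (P_{(k)}(x, ζ) conj P^{(k)}(x, ζ))`.
The first sum is real, because the Hessian of a `C²` function is symmetric. -/
def formQ (g : Sp n → Matrix (Fin n) (Fin n) ℝ) (φ : Sp n → ℝ) (x : Sp n) (ξ : Fin n → ℝ)
    (τ : ℝ) : ℝ :=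
  (∑ j, ∑ k, (pd j (pd k φ) x : ℂ) * symPUp g j x (zeta φ x ξ τ) *
      star (symPUp g k x (zeta φ x ξ τ))).re +
    τ⁻¹ * (∑ k, symPDown g k x (zeta φ x ξ τ) * star (symPUp g k x (zeta φ x ξ τ))).im

/-- Strong pseudoconvexity of `φ` in `Ω` with constant `c₀`: `P(x, ζ) = 0` and
`ζ = ξ + i τ ∇φ(x) ≠ 0` imply `Q(x, ξ, τ) ≥ c₀ |ζ|²`. As `g` is only Lipschitz, `Q(x, ·, ·)` is
defined for almost every `x`. The value `τ = 0` is left out since there the premises contradict each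
other: `P(x, ξ) = 0` with `ξ` real forces `ξ = 0` by ellipticity. -/
def MainAssumption (g : Sp n → Matrix (Fin n) (Fin n) ℝ) (φ : Sp n → ℝ) (Ω : Set (Sp n))
    (c₀ : ℝ) : Prop :=
  ∀ᵐ x ∂(volume.restrict Ω), ∀ (ξ : Fin n → ℝ) (τ : ℝ), τ ≠ 0 →
    symP g x (zeta φ x ξ τ) = 0 → zeta φ x ξ τ ≠ 0 →
      c₀ * cnormSqG g x (zeta φ x ξ τ) ≤ formQ g φ x ξ τ

end Carleman

end

noncomputable section

namespace Carleman

variable {n : ℕ}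

/-! ### Partial derivatives -/

/-! Write `a` for the inverse metric, `N = ∇φ` and `v = exp (τφ) u`. For smooth coefficients the
estimate is a commutator argument. The conjugated operator is, up to a term of order `τ v`, the sum
of a symmetric part `S v = div (a∇v) + τ² a(N,N) v` and a part `A v = -2τ aN·∇v - τ h v` with a free
multiplier `h`. By `energy_identity`, `2 ∫ Sv · Av` is `τ` times the integral of a quadratic form in
`(∇v, τv)`, plus one term containing `∇h`. For `h = div (aN) + m / (2 a(N,N))`, with `m = coefm`,
the form becomes `formR`. Its positivity on the hyperplane `a(N, ξ) = 0` is strong pseudoconvexity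
(`formQ_eq`, `le_formR_of_mainAssumption`). The remaining direction is paid for by `|Av|²`
(`exists_formS_pos`, `energy_lower`), and a small constant subtracted from `h` makes the form
positive in `τv` as well.

There are two obstacles. The first is that `h` contains the first derivatives of `a` and the Hessian
of `φ`, neither of which can be differentiated. The coefficients are therefore mollified at the
scale `ε = κ/τ`, and the Hessian is replaced by a uniformly close smooth field. Then `∇h = O(1/ε) =
O(τ/κ)`, and the term with `∇h` is absorbed once `κ` is large. Pseudoconvexity survives because the
form is affine in the derivatives of `a`: up to a small error its value at the mollified
coefficients is an average of values at nearby points (`Setting.le_formS_average`).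

The second is that near the boundary this average runs over points outside `Ω`, where nothing is
assumed. Let `ψ = hole` be the weighted proportion of such points. A further term in `h` trades the
deficit in `ψ |∇v|²` for a remainder `τ³ ∫ ψ v²` (`density_lower_bound`, `Setting.energy_estimate`).
Where `ψ` is not small, `v` vanishes on a fixed proportion of a ball of radius comparable to `1/τ`,
and unique continuation at that scale applies. Freezing the coefficients and multiplying by an
exponential leads to an elliptic operator with constant coefficients. A Gaussian average of the
function differs from a multiple of the function by a term controlled by the operator, is almost a
polynomial along segments, and is small on a set of positive measure, so the Remez inequality
`abs_eval_zero_le` makes it small everywhere nearby (`continuation_estimate`). Summed over all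
places, this bounds `τ² ∫ ψ v²` by a small part of the energy plus `τ⁻²` times the conjugated
operator squared (`Setting.hole_estimate`).

Finally, mollification changes `Δ_g u` by `O(|∇u|) + O(τ⁻¹ |D²u|)`. The weighted bound for second
derivatives (`hessian_estimate`) turns this into a constant multiple of the energy and a small
multiple of the operator (`Setting.integral_conjOp_sq_le`). Both are absorbed for large `τ`. -/

theorem pd_congr {i : Fin n} {f g : Sp n → ℝ} {x : Sp n} (h : f =ᶠ[nhds x] g) :
    pd i f x = pd i g x := by
  unfold pd; rw [h.fderiv_eq]

theorem pd_mul {i : Fin n} {f g : Sp n → ℝ} {x : Sp n} (hf : DifferentiableAt ℝ f x)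
    (hg : DifferentiableAt ℝ g x) :
    pd i (fun y => f y * g y) x = pd i f x * g x + f x * pd i g x := by
  unfold pd; rw [fderiv_fun_mul hf hg]; simp; ring

theorem pd_add {i : Fin n} {f g : Sp n → ℝ} {x : Sp n} (hf : DifferentiableAt ℝ f x)
    (hg : DifferentiableAt ℝ g x) :
    pd i (fun y => f y + g y) x = pd i f x + pd i g x := by
  unfold pd; rw [fderiv_fun_add hf hg]; simp

theorem pd_sum {ι : Type*} {s : Finset ι} {i : Fin n} {f : ι → Sp n → ℝ} {x : Sp n}
    (hf : ∀ k ∈ s, DifferentiableAt ℝ (f k) x) :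
    pd i (fun y => ∑ k ∈ s, f k y) x = ∑ k ∈ s, pd i (f k) x := by
  unfold pd; rw [fderiv_fun_sum hf]; simp

theorem pd_const (i : Fin n) (c : ℝ) (x : Sp n) : pd i (fun _ => c) x = 0 := by
  simp [pd]

theorem pd_const_mul {i : Fin n} {f : Sp n → ℝ} {x : Sp n} (c : ℝ) (hf : DifferentiableAt ℝ f x) :
    pd i (fun y => c * f y) x = c * pd i f x := by
  rw [pd_mul (differentiableAt_const c) hf, pd_const]; ring

theorem pd_sq {i : Fin n} {f : Sp n → ℝ} {x : Sp n} (hf : DifferentiableAt ℝ f x) :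
    pd i (fun y => f y ^ 2) x = 2 * f x * pd i f x := by
  simp_rw [sq]; rw [pd_mul hf hf]; ring

theorem pd_exp {i : Fin n} {f : Sp n → ℝ} {x : Sp n} (hf : DifferentiableAt ℝ f x) :
    pd i (fun y => Real.exp (f y)) x = Real.exp (f x) * pd i f x := by
  unfold pd; rw [fderiv_exp hf]; simp

theorem pd_eq_zero_of_notMem_tsupport {i : Fin n} {f : Sp n → ℝ} {x : Sp n}
    (hx : x ∉ tsupport f) : pd i f x = 0 := by
  unfold pd
  rw [Function.notMem_support.1 fun h => hx (support_fderiv_subset ℝ h)]; simp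

theorem hasCompactSupport_pd {f : Sp n → ℝ} (hf : HasCompactSupport f) (i : Fin n) :
    HasCompactSupport (pd i f) :=
  hf.fderiv_apply ℝ (EuclideanSpace.single i 1)

theorem tsupport_pd_subset (i : Fin n) (f : Sp n → ℝ) : tsupport (pd i f) ⊆ tsupport f :=
  closure_minimal (fun _ hx => by
    by_contra h
    exact hx (pd_eq_zero_of_notMem_tsupport h)) (isClosed_tsupport f)

theorem contDiff_pd {k m : WithTop ℕ∞} {f : Sp n → ℝ} (hf : ContDiff ℝ m f) (hk : k + 1 ≤ m)
    (i : Fin n) : ContDiff ℝ k (pd i f) :=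
  (hf.fderiv_right hk).clm_apply contDiff_const

theorem contDiff_one_pd {f : Sp n → ℝ} (hf : ContDiff ℝ 2 f) (i : Fin n) :
    ContDiff ℝ 1 (pd i f) :=
  contDiff_pd hf (by norm_num [one_add_one_eq_two]) i

theorem continuous_pd {f : Sp n → ℝ} (hf : ContDiff ℝ 1 f) (i : Fin n) :
    Continuous (pd i f) :=
  (contDiff_pd (k := 0) hf (by simp) i).continuous

theorem pd_comm {f : Sp n → ℝ} {x : Sp n} (hf : ContDiffAt ℝ 2 f x) (i j : Fin n) :
    pd i (pd j f) x = pd j (pd i f) x := by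
  have hd : DifferentiableAt ℝ (fderiv ℝ f) x :=
    (hf.fderiv_right (m := 1) (by norm_num [one_add_one_eq_two])).differentiableAt (by simp)
  have hs : IsSymmSndFDerivAt ℝ f x := hf.isSymmSndFDerivAt (by simp)
  unfold pd
  rw [fderiv_clm_apply hd (differentiableAt_const _), fderiv_clm_apply hd (differentiableAt_const _)]
  simp only [fderiv_fun_const, Pi.zero_apply, ContinuousLinearMap.comp_zero, zero_add,
    ContinuousLinearMap.flip_apply]
  exact hs _ _

/-! ### Continuous functions with compact support -/

/-- Continuous functions with compact support. -/
def CC (f : Sp n → ℝ) : Prop := Continuous f ∧ HasCompactSupport f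

theorem CC.integrable {f : Sp n → ℝ} (hf : CC f) : Integrable f :=
  hf.1.integrable_of_hasCompactSupport hf.2

theorem CC.mul_left {f g : Sp n → ℝ} (hf : CC f) (hg : Continuous g) :
    CC (fun x => g x * f x) :=
  ⟨hg.mul hf.1, hf.2.mul_left⟩

theorem CC.mul_right {f g : Sp n → ℝ} (hf : CC f) (hg : Continuous g) :
    CC (fun x => f x * g x) :=
  ⟨hf.1.mul hg, hf.2.mul_right⟩

theorem CC.add {f g : Sp n → ℝ} (hf : CC f) (hg : CC g) : CC (fun x => f x + g x) :=
  ⟨hf.1.add hg.1, hf.2.add hg.2⟩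

theorem CC.neg {f : Sp n → ℝ} (hf : CC f) : CC (fun x => - f x) :=
  ⟨hf.1.neg, hf.2.neg⟩

theorem CC.sub {f g : Sp n → ℝ} (hf : CC f) (hg : CC g) : CC (fun x => f x - g x) := by
  simpa [sub_eq_add_neg] using hf.add hg.neg

theorem CC.zero : CC (fun _ : Sp n => (0 : ℝ)) := ⟨continuous_const, HasCompactSupport.zero⟩

theorem CC.sum {ι : Type*} {s : Finset ι} {f : ι → Sp n → ℝ} (hf : ∀ k ∈ s, CC (f k)) :
    CC (fun x => ∑ k ∈ s, f k x) := by
  classical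
  induction s using Finset.induction_on with
  | empty => simpa using CC.zero
  | insert a s ha ih =>
    simp only [Finset.sum_insert ha]
    exact (hf a (by simp)).add (ih fun k hk => hf k (by simp [hk]))

theorem CC.sq {f : Sp n → ℝ} (hf : CC f) : CC (fun x => f x ^ 2) := by
  simp_rw [pow_two]; exact hf.mul_left hf.1

theorem cc_pd {v : Sp n → ℝ} (hv : ContDiff ℝ 1 v) (hc : HasCompactSupport v) (i : Fin n) :
    CC (pd i v) := ⟨continuous_pd hv i, hasCompactSupport_pd hc i⟩

/-- Integration by parts. -/
theorem integral_mul_pd {f g : Sp n → ℝ} (hf : ContDiff ℝ 1 f) (hg : ContDiff ℝ 1 g)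
    (hc : HasCompactSupport g) (i : Fin n) :
    ∫ x, f x * pd i g x = - ∫ x, pd i f x * g x := by
  have hgc : CC g := ⟨hg.continuous, hc⟩
  exact integral_mul_fderiv_eq_neg_fderiv_mul_of_integrable
    (hgc.mul_left (continuous_pd hf i)).integrable
    ((cc_pd hg hc i).mul_left hf.continuous).integrable
    (hgc.mul_left hf.continuous).integrable
    (fun x _ => hf.differentiable (by simp) x) (fun x _ => hg.differentiable (by simp) x)

theorem integral_pd_mul {f g : Sp n → ℝ} (hf : ContDiff ℝ 1 f) (hg : ContDiff ℝ 1 g)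
    (hc : HasCompactSupport g) (i : Fin n) :
    ∫ x, pd i f x * g x = - ∫ x, f x * pd i g x := by
  rw [integral_mul_pd hf hg hc i, neg_neg]

theorem integral_sum_pd_mul {F : Fin n → Sp n → ℝ} {g : Sp n → ℝ} (hF : ∀ i, ContDiff ℝ 1 (F i))
    (hg : ContDiff ℝ 1 g) (hc : ∀ i, HasCompactSupport (F i)) :
    ∫ x, (∑ i, pd i (F i) x) * g x = - ∫ x, ∑ i, F i x * pd i g x := by
  simp_rw [Finset.sum_mul]
  rw [integral_finsetSum, integral_finsetSum, ← Finset.sum_neg_distrib]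
  · refine Finset.sum_congr rfl fun i _ => ?_
    have := integral_mul_pd hg (hF i) (hc i) i
    simp_rw [mul_comm (g _)] at this
    rw [this]
    congr 1
    exact integral_congr_ae (.of_forall fun x => mul_comm _ _)
  · exact fun i _ => (CC.mul_right ⟨(hF i).continuous, hc i⟩ (continuous_pd hg i)).integrable
  · exact fun i _ => ((cc_pd (hF i) (hc i) i).mul_right hg.continuous).integrable

/-! ### The Rellich identity -/

section Rellich

variable {a : Fin n → Fin n → Sp n → ℝ} {B : Fin n → Sp n → ℝ} {v : Sp n → ℝ}

/-- The flux `a ∇v`. -/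
def flux (a : Fin n → Fin n → Sp n → ℝ) (v : Sp n → ℝ) (i : Fin n) (x : Sp n) : ℝ :=
  ∑ j, a i j x * pd j v x

/-- The divergence form operator `div (a ∇v)`. -/
def divOp (a : Fin n → Fin n → Sp n → ℝ) (v : Sp n → ℝ) (x : Sp n) : ℝ :=
  ∑ i, pd i (flux a v i) x

theorem contDiff_flux (ha : ∀ i j, ContDiff ℝ 1 (a i j)) (hv : ContDiff ℝ 2 v) (i : Fin n) :
    ContDiff ℝ 1 (flux a v i) :=
  ContDiff.sum fun j _ => (ha i j).mul (contDiff_one_pd hv j)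

theorem hasCompactSupport_flux (hc : HasCompactSupport v) (i : Fin n) :
    HasCompactSupport (flux a v i) := by
  refine hc.mono' (fun x hx => ?_)
  by_contra h
  exact hx (by simp [flux, pd_eq_zero_of_notMem_tsupport h])

theorem cc_flux (ha : ∀ i j, ContDiff ℝ 1 (a i j)) (hv : ContDiff ℝ 2 v)
    (hc : HasCompactSupport v) (i : Fin n) : CC (flux a v i) :=
  ⟨(contDiff_flux ha hv i).continuous, hasCompactSupport_flux hc i⟩

theorem cc_divOp (ha : ∀ i j, ContDiff ℝ 1 (a i j)) (hv : ContDiff ℝ 2 v)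
    (hc : HasCompactSupport v) : CC (divOp a v) :=
  CC.sum fun i _ => cc_pd (contDiff_flux ha hv i) (hasCompactSupport_flux hc i) i

/-- Product rule behind the Rellich identity. -/
theorem two_mul_flux_pd (hsymm : ∀ i j x, a i j x = a j i x) (ha : ∀ i j, ContDiff ℝ 1 (a i j))
    (hv : ContDiff ℝ 2 v) (k : Fin n) (x : Sp n) :
    2 * ∑ i, flux a v i x * pd i (pd k v) x =
      pd k (fun y => ∑ i, flux a v i y * pd i v y) x
        - ∑ i, ∑ j, pd k (a i j) x * pd i v x * pd j v x := by
  have hd : ∀ i, DifferentiableAt ℝ (pd i v) x := fun i =>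
    (contDiff_one_pd hv i).differentiable (by simp) x
  have hda : ∀ i j, DifferentiableAt ℝ (a i j) x := fun i j => (ha i j).differentiable (by simp) x
  have hfl : ∀ i, DifferentiableAt ℝ (flux a v i) x := fun i =>
    (contDiff_flux ha hv i).differentiable (by simp) x
  rw [pd_sum (fun i _ => (hfl i).fun_mul (hd i))]
  have h1 : ∀ i, pd k (fun y => flux a v i y * pd i v y) x =
      (∑ j, pd k (a i j) x * pd i v x * pd j v x) + (∑ j, a i j x * pd k (pd j v) x * pd i v x)
        + flux a v i x * pd i (pd k v) x := by
    intro i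
    rw [pd_mul (hfl i) (hd i), pd_comm hv.contDiffAt k i, add_left_inj]
    unfold flux
    rw [pd_sum (fun j _ => (hda i j).fun_mul (hd j)), ← Finset.sum_add_distrib, Finset.sum_mul]
    refine Finset.sum_congr rfl fun j _ => ?_
    rw [pd_mul (hda i j) (hd j)]; ring
  simp_rw [h1, Finset.sum_add_distrib]
  -- By the symmetry of `a`, the derivative falling on the inner gradient gives the same sum as the
  -- one falling on the outer gradient. This is the source of the factor 2.
  have h2 : ∑ i, ∑ j, a i j x * pd k (pd j v) x * pd i v x =
      ∑ i, flux a v i x * pd i (pd k v) x := by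
    rw [Finset.sum_comm]
    refine Finset.sum_congr rfl fun j _ => ?_
    unfold flux
    rw [Finset.sum_mul]
    refine Finset.sum_congr rfl fun i _ => ?_
    rw [hsymm i j, pd_comm hv.contDiffAt k j]; ring
  rw [h2]; ring

/-- After one integration by parts the second derivatives of `v` occur only in `B·∇` of the density
`a(∇v, ∇v)`, up to derivatives of `a`. A second integration by parts moves that derivative onto `B`.
-/
theorem rellich (hsymm : ∀ i j x, a i j x = a j i x) (ha : ∀ i j, ContDiff ℝ 1 (a i j))
    (hB : ∀ k, ContDiff ℝ 1 (B k)) (hv : ContDiff ℝ 2 v) (hc : HasCompactSupport v) :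
    ∫ x, divOp a v x * (2 * ∑ k, B k x * pd k v x) =
      ∫ x, (-2 * ∑ i, ∑ k, flux a v i x * pd i (B k) x * pd k v x
        + (∑ k, pd k (B k) x) * ∑ i, flux a v i x * pd i v x
        + ∑ k, B k x * ∑ i, ∑ j, pd k (a i j) x * pd i v x * pd j v x) := by
  have hd : ∀ i, ContDiff ℝ 1 (pd i v) := contDiff_one_pd hv
  have hv1 : ContDiff ℝ 1 v := hv.of_le (by norm_num)
  have hE : ContDiff ℝ 1 (fun y => ∑ i, flux a v i y * pd i v y) :=
    ContDiff.sum fun i _ => (contDiff_flux ha hv i).mul (hd i)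
  have hEc : CC (fun y => ∑ i, flux a v i y * pd i v y) :=
    CC.sum fun i _ => (cc_flux ha hv hc i).mul_right (hd i).continuous
  have hBv : ContDiff ℝ 1 (fun x => 2 * ∑ k, B k x * pd k v x) :=
    contDiff_const.mul (ContDiff.sum fun k _ => (hB k).mul (hd k))
  unfold divOp
  rw [integral_sum_pd_mul (fun i => contDiff_flux ha hv i) hBv
    (fun i => hasCompactSupport_flux hc i)]
  have hpt : ∀ x, ∑ i, flux a v i x * pd i (fun x => 2 * ∑ k, B k x * pd k v x) x =
      (2 * ∑ i, ∑ k, flux a v i x * pd i (B k) x * pd k v x)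
      - (∑ k, B k x * ∑ i, ∑ j, pd k (a i j) x * pd i v x * pd j v x)
      + ∑ k, B k x * pd k (fun y => ∑ i, flux a v i y * pd i v y) x := by
    intro x
    have e1 : ∀ i, pd i (fun x => 2 * ∑ k, B k x * pd k v x) x =
        2 * ∑ k, (pd i (B k) x * pd k v x + B k x * pd i (pd k v) x) := by
      intro i
      have hdB : ∀ k, DifferentiableAt ℝ (B k) x := fun k => (hB k).differentiable (by simp) x
      have hdv : ∀ k, DifferentiableAt ℝ (pd k v) x := fun k => (hd k).differentiable (by simp) x
      rw [pd_const_mul _ (DifferentiableAt.fun_sum fun k _ => (hdB k).fun_mul (hdv k)),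
        pd_sum (fun k _ => (hdB k).fun_mul (hdv k))]
      congr 1
      exact Finset.sum_congr rfl fun k _ => pd_mul (hdB k) (hdv k)
    have e2 : ∀ k, pd k (fun y => ∑ i, flux a v i y * pd i v y) x =
        2 * ∑ i, flux a v i x * pd i (pd k v) x
          + ∑ i, ∑ j, pd k (a i j) x * pd i v x * pd j v x := by
      intro k; rw [two_mul_flux_pd hsymm ha hv k x]; ring
    have e3 : ∑ i, flux a v i x * (2 * ∑ k, (pd i (B k) x * pd k v x + B k x * pd i (pd k v) x)) =
        2 * ∑ i, ∑ k, flux a v i x * pd i (B k) x * pd k v x +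
        ∑ k, B k x * (2 * ∑ i, flux a v i x * pd i (pd k v) x) := by
      have : ∑ k, B k x * (2 * ∑ i, flux a v i x * pd i (pd k v) x) =
          2 * ∑ i, ∑ k, flux a v i x * (B k x * pd i (pd k v) x) := by
        rw [Finset.sum_comm, Finset.mul_sum]
        refine Finset.sum_congr rfl fun k _ => ?_
        simp only [Finset.mul_sum]
        exact Finset.sum_congr rfl fun i _ => by ring
      rw [this, ← mul_add, ← Finset.sum_add_distrib, Finset.mul_sum]
      refine Finset.sum_congr rfl fun i _ => ?_
      rw [← Finset.sum_add_distrib]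
      simp only [Finset.mul_sum]
      exact Finset.sum_congr rfl fun k _ => by ring
    simp_rw [e1, e2]
    rw [e3]
    simp_rw [mul_add (B _ _), Finset.sum_add_distrib]
    ring
  simp_rw [hpt]
  have i1 : CC (fun x => 2 * ∑ i, ∑ k, flux a v i x * pd i (B k) x * pd k v x) :=
    (CC.sum fun i _ => CC.sum fun k _ => (((cc_flux ha hv hc i).mul_right
      (continuous_pd (hB k) i)).mul_right (hd k).continuous)).mul_left continuous_const
  have i2 : CC (fun x => ∑ k, B k x * ∑ i, ∑ j, pd k (a i j) x * pd i v x * pd j v x) :=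
    CC.sum fun k _ => (CC.sum fun i _ => CC.sum fun j _ => ((cc_pd hv1 hc i).mul_left
      (continuous_pd (ha i j) k)).mul_right (hd j).continuous).mul_left (hB k).continuous
  have i3 : ∀ k, CC (fun x => B k x * pd k (fun y => ∑ i, flux a v i y * pd i v y) x) :=
    fun k => (cc_pd hE hEc.2 k).mul_left (hB k).continuous
  have i4 : ∀ k, CC (fun x => pd k (B k) x * ∑ i, flux a v i x * pd i v x) :=
    fun k => hEc.mul_left (continuous_pd (hB k) k)
  have key : ∫ x, ∑ k, B k x * pd k (fun y => ∑ i, flux a v i y * pd i v y) x =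
      - ∫ x, (∑ k, pd k (B k) x) * ∑ i, flux a v i x * pd i v x := by
    simp_rw [Finset.sum_mul]
    rw [integral_finsetSum _ fun k _ => (i3 k).integrable,
      integral_finsetSum _ fun k _ => (i4 k).integrable, ← Finset.sum_neg_distrib]
    exact Finset.sum_congr rfl fun k _ => integral_mul_pd (hB k) hE hEc.2 k
  have i4' : CC (fun x => (∑ k, pd k (B k) x) * ∑ i, flux a v i x * pd i v x) := by
    simp_rw [Finset.sum_mul]; exact CC.sum fun k _ => i4 k
  rw [integral_add (i1.sub i2).integrable (CC.sum fun k _ => i3 k).integrable, key,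
    integral_sub i1.integrable i2.integrable]
  simp_rw [neg_mul]
  rw [integral_add (i1.neg.add i4').integrable i2.integrable,
    integral_add i1.neg.integrable i4'.integrable, integral_neg]
  ring

end Rellich

end Carleman

namespace Carleman

variable {n : ℕ}

/-! ### The energy identity -/

theorem integral_add_four {f₁ f₂ f₃ f₄ : Sp n → ℝ} (h₁ : CC f₁) (h₂ : CC f₂) (h₃ : CC f₃)
    (h₄ : CC f₄) (c₁ c₂ c₃ c₄ : ℝ) :
    ∫ x, (c₁ * f₁ x + c₂ * f₂ x + c₃ * f₃ x + c₄ * f₄ x) =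
      c₁ * (∫ x, f₁ x) + c₂ * (∫ x, f₂ x) + c₃ * (∫ x, f₃ x) + c₄ * ∫ x, f₄ x := by
  have h₁' := h₁.mul_left (g := fun _ => c₁) continuous_const
  have h₂' := h₂.mul_left (g := fun _ => c₂) continuous_const
  have h₃' := h₃.mul_left (g := fun _ => c₃) continuous_const
  have h₄' := h₄.mul_left (g := fun _ => c₄) continuous_const
  rw [integral_add ((h₁'.add h₂').add h₃').integrable h₄'.integrable,
    integral_add (h₁'.add h₂').integrable h₃'.integrable,
    integral_add h₁'.integrable h₂'.integrable]
  simp_rw [integral_const_mul]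

section Energy

variable {a : Fin n → Fin n → Sp n → ℝ} {B : Fin n → Sp n → ℝ} {q h v : Sp n → ℝ}

theorem integral_divOp_mul_mul (ha : ∀ i j, ContDiff ℝ 1 (a i j)) (hh : ContDiff ℝ 1 h)
    (hv : ContDiff ℝ 2 v) (hc : HasCompactSupport v) :
    ∫ x, divOp a v x * (h x * v x) =
      - ∫ x, (h x * (∑ i, flux a v i x * pd i v x) + v x * ∑ i, flux a v i x * pd i h x) := by
  have hv1 : ContDiff ℝ 1 v := hv.of_le (by norm_num)
  unfold divOp
  rw [integral_sum_pd_mul (fun i => contDiff_flux ha hv i) (hh.mul hv1)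
    (fun i => hasCompactSupport_flux hc i)]
  congr 2
  ext x
  rw [Finset.mul_sum, Finset.mul_sum, ← Finset.sum_add_distrib]
  refine Finset.sum_congr rfl fun i _ => ?_
  rw [pd_mul (hh.differentiable (by simp) x) (hv1.differentiable (by simp) x)]
  ring

/-- Since `2 v B·∇v = B·∇(v ^ 2)`, no derivative of `v` survives the integration by parts. -/
theorem integral_mul_transport (hB : ∀ k, ContDiff ℝ 1 (B k)) (hq : ContDiff ℝ 1 q)
    (hv : ContDiff ℝ 1 v) (hc : HasCompactSupport v) :
    ∫ x, q x * v x * (2 * ∑ k, B k x * pd k v x) =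
      - ∫ x, ((∑ k, pd k (B k) x) * q x + ∑ k, B k x * pd k q x) * v x ^ 2 := by
  have hvc : CC v := ⟨hv.continuous, hc⟩
  have hv2 : ContDiff ℝ 1 (fun x => v x ^ 2) := hv.pow 2
  have e1 : ∀ x, q x * v x * (2 * ∑ k, B k x * pd k v x) =
      ∑ k, (q x * B k x) * pd k (fun y => v y ^ 2) x := by
    intro x
    simp_rw [Finset.mul_sum, pd_sq (hv.differentiable (by simp) x)]
    exact Finset.sum_congr rfl fun k _ => by ring
  have e2 : ∀ x, ((∑ k, pd k (B k) x) * q x + ∑ k, B k x * pd k q x) * v x ^ 2 =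
      ∑ k, pd k (fun y => q y * B k y) x * v x ^ 2 := by
    intro x
    rw [Finset.sum_mul, ← Finset.sum_add_distrib, Finset.sum_mul]
    refine Finset.sum_congr rfl fun k _ => ?_
    rw [pd_mul (hq.differentiable (by simp) x) ((hB k).differentiable (by simp) x)]; ring
  simp_rw [e1, e2]
  have hqB : ∀ k, ContDiff ℝ 1 (fun y => q y * B k y) := fun k => hq.mul (hB k)
  rw [integral_finsetSum _ fun k _ =>
      ((cc_pd hv2 hvc.sq.2 k).mul_left (hqB k).continuous).integrable,
    integral_finsetSum _ fun k _ => (hvc.sq.mul_left (continuous_pd (hqB k) k)).integrable,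
    ← Finset.sum_neg_distrib]
  exact Finset.sum_congr rfl fun k _ => integral_mul_pd (hqB k) hv2 hvc.sq.2 k

/-- The density of the quadratic form in the energy identity. -/
def energyDensity (a : Fin n → Fin n → Sp n → ℝ) (B : Fin n → Sp n → ℝ) (q h v : Sp n → ℝ)
    (τ : ℝ) (x : Sp n) : ℝ :=
  4 * (∑ i, ∑ k, flux a v i x * pd i (B k) x * pd k v x)
    - 2 * (∑ k, B k x * ∑ i, ∑ j, pd k (a i j) x * pd i v x * pd j v x)
    + 2 * τ ^ 2 * (∑ k, B k x * pd k q x) * v x ^ 2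
    - 2 * ((∑ k, pd k (B k) x) - h x)
      * ((∑ i, flux a v i x * pd i v x) - τ ^ 2 * q x * v x ^ 2)

theorem cc_energyDensity (ha : ∀ i j, ContDiff ℝ 1 (a i j)) (hB : ∀ k, ContDiff ℝ 1 (B k))
    (hq : ContDiff ℝ 1 q) (hh : ContDiff ℝ 1 h) (hv : ContDiff ℝ 2 v) (hc : HasCompactSupport v)
    (τ : ℝ) : CC (energyDensity a B q h v τ) := by
  have hv1 : ContDiff ℝ 1 v := hv.of_le (by norm_num)
  have hvc : CC v := ⟨hv1.continuous, hc⟩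
  have hcd := fun k => continuous_pd hv1 k
  refine CC.sub (CC.add (CC.sub ?_ ?_) ?_) ?_
  · exact (CC.sum fun i _ => CC.sum fun k _ => (((cc_flux ha hv hc i).mul_right
      (continuous_pd (hB k) i)).mul_right (hcd k))).mul_left continuous_const
  · exact (CC.sum fun k _ => (CC.sum fun i _ => CC.sum fun j _ => ((cc_pd hv1 hc i).mul_left
      (continuous_pd (ha i j) k)).mul_right (hcd j)).mul_left (hB k).continuous).mul_left
      continuous_const
  · exact hvc.sq.mul_left (continuous_const.mul (continuous_finsetSum _ fun k _ =>
      (hB k).continuous.mul (continuous_pd hq k)))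
  · exact CC.mul_left (CC.sub (CC.sum fun i _ => (cc_flux ha hv hc i).mul_right (hcd i))
      (hvc.sq.mul_left (continuous_const.mul hq.continuous))) (continuous_const.mul
      ((continuous_finsetSum _ fun k _ => continuous_pd (hB k) k).sub hh.continuous))

/-- For `B = a∇φ` and `q = a(∇φ, ∇φ)` the first factor is the symmetric part of the conjugated
operator. The second is the antisymmetric part with `div B` replaced by a free multiplier `h`.
Pairing with `h v` only sees the difference `a(∇v, ∇v) - τ² q v²`, so `h` can redistribute weight
between gradient and function at the sole price of one term with `∇h`. -/
theorem energy_identity (hsymm : ∀ i j x, a i j x = a j i x) (ha : ∀ i j, ContDiff ℝ 1 (a i j))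
    (hB : ∀ k, ContDiff ℝ 1 (B k)) (hq : ContDiff ℝ 1 q) (hh : ContDiff ℝ 1 h)
    (hv : ContDiff ℝ 2 v) (hc : HasCompactSupport v) (τ : ℝ) :
    2 * ∫ x, (divOp a v x + τ ^ 2 * q x * v x)
        * (-2 * τ * (∑ k, B k x * pd k v x) - τ * h x * v x) =
      τ * (∫ x, energyDensity a B q h v τ x)
        + 2 * τ * ∫ x, v x * ∑ i, flux a v i x * pd i h x := by
  have hv1 : ContDiff ℝ 1 v := hv.of_le (by norm_num)
  have hvc : CC v := ⟨hv1.continuous, hc⟩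
  have hcd := fun k => continuous_pd hv1 k
  have hDv := cc_divOp ha hv hc
  have hBw : Continuous (fun x => 2 * ∑ k, B k x * pd k v x) :=
    continuous_const.mul (continuous_finsetSum _ fun k _ => (hB k).continuous.mul (hcd k))
  have hEa : CC (fun x => ∑ i, flux a v i x * pd i v x) :=
    CC.sum fun i _ => (cc_flux ha hv hc i).mul_right (hcd i)
  have X1 : CC (fun x => divOp a v x * (2 * ∑ k, B k x * pd k v x)) := hDv.mul_right hBw
  have X2 : CC (fun x => q x * v x * (2 * ∑ k, B k x * pd k v x)) :=
    (hvc.mul_left hq.continuous).mul_right hBw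
  have X3 : CC (fun x => divOp a v x * (h x * v x)) :=
    hDv.mul_right (hh.continuous.mul hv1.continuous)
  have X4 : CC (fun x => h x * q x * v x ^ 2) := hvc.sq.mul_left (hh.continuous.mul hq.continuous)
  have hL : ∫ x, (divOp a v x + τ ^ 2 * q x * v x)
        * (-2 * τ * (∑ k, B k x * pd k v x) - τ * h x * v x) =
      (-τ) * (∫ x, divOp a v x * (2 * ∑ k, B k x * pd k v x))
      + (-τ ^ 3) * (∫ x, q x * v x * (2 * ∑ k, B k x * pd k v x))
      + (-τ) * (∫ x, divOp a v x * (h x * v x)) + (-τ ^ 3) * ∫ x, h x * q x * v x ^ 2 := by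
    rw [← integral_add_four X1 X2 X3 X4]
    congr 1; ext x; ring
  have Y1 : CC (fun x => (-2 * ∑ i, ∑ k, flux a v i x * pd i (B k) x * pd k v x)
        + (∑ k, pd k (B k) x) * (∑ i, flux a v i x * pd i v x)
        + ∑ k, B k x * ∑ i, ∑ j, pd k (a i j) x * pd i v x * pd j v x) := by
    refine CC.add (CC.add ?_ ?_) ?_
    · exact (CC.sum fun i _ => CC.sum fun k _ => (((cc_flux ha hv hc i).mul_right
        (continuous_pd (hB k) i)).mul_right (hcd k))).mul_left continuous_const
    · exact hEa.mul_left (continuous_finsetSum _ fun k _ => continuous_pd (hB k) k)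
    · exact CC.sum fun k _ => (CC.sum fun i _ => CC.sum fun j _ => ((cc_pd hv1 hc i).mul_left
        (continuous_pd (ha i j) k)).mul_right (hcd j)).mul_left (hB k).continuous
  have Y2 : CC (fun x => ((∑ k, pd k (B k) x) * q x + ∑ k, B k x * pd k q x) * v x ^ 2) :=
    hvc.sq.mul_left (((continuous_finsetSum _ fun k _ => continuous_pd (hB k) k).mul
      hq.continuous).add (continuous_finsetSum _ fun k _ =>
      (hB k).continuous.mul (continuous_pd hq k)))
  have Y3 : CC (fun x => h x * (∑ i, flux a v i x * pd i v x)) := hEa.mul_left hh.continuous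
  have Y3' : CC (fun x => v x * ∑ i, flux a v i x * pd i h x) :=
    hvc.mul_right (continuous_finsetSum _ fun i _ =>
      (contDiff_flux ha hv i).continuous.mul (continuous_pd hh i))
  have hR : ∫ x, energyDensity a B q h v τ x =
      (-2) * (∫ x, ((-2 * ∑ i, ∑ k, flux a v i x * pd i (B k) x * pd k v x)
        + (∑ k, pd k (B k) x) * (∑ i, flux a v i x * pd i v x)
        + ∑ k, B k x * ∑ i, ∑ j, pd k (a i j) x * pd i v x * pd j v x))
      + (2 * τ ^ 2) * (∫ x, ((∑ k, pd k (B k) x) * q x + ∑ k, B k x * pd k q x) * v x ^ 2)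
      + 2 * (∫ x, h x * (∑ i, flux a v i x * pd i v x))
      + (-2 * τ ^ 2) * ∫ x, h x * q x * v x ^ 2 := by
    rw [← integral_add_four Y1 Y2 Y3 X4]
    congr 1; ext x; unfold energyDensity; ring
  rw [hL, rellich hsymm ha hB hv hc, integral_mul_transport hB hq hv1 hc,
    integral_divOp_mul_mul ha hh hv hc, integral_add Y3.integrable Y3'.integrable, hR]
  ring

end Energy

/-! ### Weighted estimate of second derivatives -/

/-- Two integrations by parts exchange indices: `∂ₖ(w a∇u)ᵢ ∂ᵢ∂ₖu` and `∂ᵢ(w a∇u)ᵢ ∂ₖ∂ₖu` have the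
same integral. Summed over `i`, the former is the Hessian form up to first-order terms, while the
latter contains the divergence operator. Third derivatives of `u` occur only in between. -/
theorem integral_hessian_identity {a : Fin n → Fin n → Sp n → ℝ} {w u : Sp n → ℝ}
    (ha : ∀ i j, ContDiff ℝ 1 (a i j)) (hw : ContDiff ℝ 1 w) (hu : ContDiff ℝ 3 u)
    (hc : HasCompactSupport u) (k : Fin n) :
    ∫ x, w x * ∑ i, ∑ j, a i j x * pd j (pd k u) x * pd i (pd k u) x =
      ∫ x, (w x * divOp a u x * pd k (pd k u) x
        + (∑ i, pd i w x * flux a u i x) * pd k (pd k u) x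
        - ∑ i, (pd k w x * flux a u i x
          + w x * ∑ j, pd k (a i j) x * pd j u x) * pd i (pd k u) x) := by
  have hu2 : ContDiff ℝ 2 u := hu.of_le (by norm_num)
  have hp : ∀ i, ContDiff ℝ 2 (pd i u) := fun i => contDiff_pd hu (by norm_num) i
  have hp1 : ∀ i, ContDiff ℝ 1 (pd i u) := fun i => contDiff_one_pd hu2 i
  have hpp : ∀ i j, ContDiff ℝ 1 (pd i (pd j u)) := fun i j => contDiff_one_pd (hp j) i
  have hfl := fun i => contDiff_flux ha hu2 i
  have hflc : ∀ i, HasCompactSupport (flux a u i) := fun i => hasCompactSupport_flux hc i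
  have hwf : ∀ i, ContDiff ℝ 1 (fun x => w x * flux a u i x) := fun i => hw.mul (hfl i)
  have hwfc : ∀ i, CC (fun x => w x * flux a u i x) := fun i =>
    CC.mul_left ⟨(hfl i).continuous, hflc i⟩ hw.continuous
  have hppc : ∀ i, CC (pd i (pd k u)) := fun i =>
    ⟨(hpp i k).continuous, hasCompactSupport_pd (hasCompactSupport_pd hc k) i⟩
  -- the flux of `∂ₖ u` is a derivative of the flux of `u` up to a term of first order
  have e0 : ∀ i x, pd k (fun y => w y * flux a u i y) x =
      (pd k w x * flux a u i x + w x * ∑ j, pd k (a i j) x * pd j u x)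
        + w x * ∑ j, a i j x * pd j (pd k u) x := by
    intro i x
    rw [pd_mul (hw.differentiable (by simp) x) ((hfl i).differentiable (by simp) x), add_assoc,
      add_right_inj, ← mul_add, ← Finset.sum_add_distrib]
    congr 1
    unfold flux
    rw [pd_sum fun j _ => ((ha i j).differentiable (by simp) x).fun_mul
      ((hp1 j).differentiable (by simp) x)]
    refine Finset.sum_congr rfl fun j _ => ?_
    rw [pd_mul ((ha i j).differentiable (by simp) x) ((hp1 j).differentiable (by simp) x),
      pd_comm hu2.contDiffAt k j]
  have e1 : ∀ i, ∫ x, pd k (fun y => w y * flux a u i y) x * pd i (pd k u) x =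
      ∫ x, pd i (fun y => w y * flux a u i y) x * pd k (pd k u) x := by
    intro i
    rw [integral_pd_mul (hwf i) (hpp i k) (hppc i).2, integral_pd_mul (hwf i) (hpp k k) (hppc k).2]
    congr 2; ext x
    rw [pd_comm (hp k).contDiffAt k i]
  have e2 : ∀ x, w x * divOp a u x * pd k (pd k u) x
      + (∑ i, pd i w x * flux a u i x) * pd k (pd k u) x =
      ∑ i, pd i (fun y => w y * flux a u i y) x * pd k (pd k u) x := by
    intro x
    rw [← add_mul, ← Finset.sum_mul]
    congr 1
    unfold divOp
    rw [Finset.mul_sum, ← Finset.sum_add_distrib]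
    refine Finset.sum_congr rfl fun i _ => ?_
    rw [pd_mul (hw.differentiable (by simp) x) ((hfl i).differentiable (by simp) x)]; ring
  have e3 : ∀ x, w x * ∑ i, ∑ j, a i j x * pd j (pd k u) x * pd i (pd k u) x =
      (∑ i, pd k (fun y => w y * flux a u i y) x * pd i (pd k u) x)
      - ∑ i, (pd k w x * flux a u i x
          + w x * ∑ j, pd k (a i j) x * pd j u x) * pd i (pd k u) x := by
    intro x
    rw [← Finset.sum_sub_distrib, Finset.mul_sum]
    refine Finset.sum_congr rfl fun i _ => ?_
    rw [e0, ← Finset.sum_mul]; ring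
  have c1 : ∀ i, CC (fun x => pd k (fun y => w y * flux a u i y) x * pd i (pd k u) x) := fun i =>
    (hppc i).mul_left (continuous_pd (hwf i) k)
  have c2 : ∀ i, CC (fun x => pd i (fun y => w y * flux a u i y) x * pd k (pd k u) x) := fun i =>
    (hppc k).mul_left (continuous_pd (hwf i) i)
  have c3 : CC (fun x => ∑ i, (pd k w x * flux a u i x
          + w x * ∑ j, pd k (a i j) x * pd j u x) * pd i (pd k u) x) :=
    CC.sum fun i _ => (hppc i).mul_left (((continuous_pd hw k).mul (hfl i).continuous).add
      (hw.continuous.mul (continuous_finsetSum _ fun j _ =>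
        (continuous_pd (ha i j) k).mul (hp1 j).continuous)))
  simp_rw [e2, e3]
  rw [integral_sub (CC.sum fun i _ => c1 i).integrable c3.integrable,
    integral_sub (CC.sum fun i _ => c2 i).integrable c3.integrable,
    integral_finsetSum _ fun i _ => (c1 i).integrable,
    integral_finsetSum _ fun i _ => (c2 i).integrable]
  simp_rw [e1]

end Carleman

namespace Carleman

/-! ### A Remez inequality on the line -/

/-- Greedy choice: take a point of `T` within `d` of the infimum and drop everything below that
point plus `d`. Each step uses up measure at most `2 * d`. -/
theorem exists_spaced_points {d : ℝ} (hd : 0 < d) (m : ℕ) : ∀ T : Set ℝ, BddBelow T →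
    ENNReal.ofReal (2 * m * d) ≤ volume T →
    ∃ x : ℕ → ℝ, (∀ i < m, x i ∈ T) ∧ ∀ i, i + 1 < m → x i + d ≤ x (i + 1) := by
  induction m with
  | zero => exact fun T _ _ => ⟨fun _ => 0, by simp, by simp⟩
  | succ m ih =>
    intro T hT hv
    have hne : T.Nonempty := by
      rw [Set.nonempty_iff_ne_empty]; rintro rfl
      have : 0 < ENNReal.ofReal (2 * (m + 1 : ℕ) * d) := by
        rw [ENNReal.ofReal_pos]; positivity
      rw [measure_empty] at hv
      exact absurd hv (not_le.2 this)
    obtain ⟨x₀, hx₀, hlt⟩ := exists_lt_of_csInf_lt hne (lt_add_of_pos_right (sInf T) hd)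
    have hsub : T ⊆ (T ∩ Set.Ici (x₀ + d)) ∪ Set.Icc (sInf T) (x₀ + d) := by
      intro t ht
      rcases le_total (x₀ + d) t with h | h
      · exact Or.inl ⟨ht, h⟩
      · exact Or.inr ⟨csInf_le hT ht, h⟩
    have h1 := (measure_mono hsub).trans (measure_union_le (μ := volume) _ _)
    rw [Real.volume_Icc] at h1
    have h2 : ENNReal.ofReal (2 * m * d) ≤ volume (T ∩ Set.Ici (x₀ + d)) := by
      have h3 : ENNReal.ofReal (2 * m * d) + ENNReal.ofReal (2 * d) ≤
          volume (T ∩ Set.Ici (x₀ + d)) + ENNReal.ofReal (2 * d) := by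
        rw [← ENNReal.ofReal_add (by positivity) (by positivity)]
        refine le_trans (le_trans (ENNReal.ofReal_le_ofReal ?_) (hv.trans h1))
          (add_le_add le_rfl (ENNReal.ofReal_le_ofReal (by linarith)))
        push_cast; linarith
      exact (ENNReal.add_le_add_iff_right ENNReal.ofReal_ne_top).1 h3
    obtain ⟨x, hx, hs⟩ := ih _ (hT.mono Set.inter_subset_left) h2
    refine ⟨fun i => Nat.casesOn i x₀ x, ?_, ?_⟩
    · rintro (_ | i) hi
      · exact hx₀
      · exact (hx i (by omega)).1
    · rintro (_ | i) hi
      · exact (hx 0 (by omega)).2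
      · exact hs i (by omega)

theorem spaced_sub_ge {d : ℝ} {m : ℕ} {x : ℕ → ℝ} (hs : ∀ i, i + 1 < m → x i + d ≤ x (i + 1))
    {i j : ℕ} (hij : i ≤ j) (hj : j < m) : ((j : ℝ) - i) * d ≤ x j - x i := by
  induction j, hij using Nat.le_induction with
  | base => simp
  | succ j hij ih =>
    have := ih (by omega)
    have := hs j hj
    push_cast; linarith

theorem prod_abs_sub_eq {m i : ℕ} (hi : i < m) :
    ∏ j ∈ (Finset.range m).erase i, |(i : ℝ) - j| = (i.factorial : ℝ) * (m - 1 - i).factorial := by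
  have h : (Finset.range m).erase i = Finset.range i ∪ Finset.Ico (i + 1) m := by
    ext j; simp only [Finset.mem_erase, Finset.mem_range, Finset.mem_union, Finset.mem_Ico]; omega
  rw [h, Finset.prod_union (by
    rw [Finset.disjoint_left]; intro j; simp only [Finset.mem_range, Finset.mem_Ico]; omega)]
  congr 1
  · rw [← Finset.prod_range_reflect, ← Finset.prod_range_add_one_eq_factorial]
    push_cast
    refine Finset.prod_congr rfl fun j hj => ?_
    have hj := Finset.mem_range.1 hj
    rw [Nat.sub_sub, Nat.cast_sub (by omega), abs_of_nonneg] <;> push_cast <;> linarith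
  · rw [Finset.prod_Ico_eq_prod_range, ← Finset.prod_range_add_one_eq_factorial,
      show m - (i + 1) = m - 1 - i by omega]
    push_cast
    refine Finset.prod_congr rfl fun j _ => ?_
    rw [abs_of_nonpos] <;> linarith

/-- A polynomial that is small on a subset of the unit interval of positive measure is small
at the origin. -/
theorem abs_eval_zero_le {m : ℕ} (hm : 0 < m) {p : Polynomial ℝ} (hp : p.degree < m) {T : Set ℝ}
    (hT : T ⊆ Set.Icc 0 1) {θ s : ℝ} (hθ : 0 < θ) (hv : ENNReal.ofReal θ ≤ volume T) (hs0 : 0 ≤ s)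
    (hs : ∀ t ∈ T, |p.eval t| ≤ s) : |p.eval 0| ≤ (12 / θ) ^ m * s := by
  have hm' : (0 : ℝ) < m := by exact_mod_cast hm
  have hθ1 : θ ≤ 1 := by
    have := hv.trans (measure_mono hT)
    rw [Real.volume_Icc] at this
    simpa using this
  -- The largest gap for which a set of measure `θ` is sure to contain `m` points.
  set d := θ / (2 * m) with hd
  have hd0 : 0 < d := by positivity
  obtain ⟨x, hx, hsp⟩ := exists_spaced_points hd0 m T (bddBelow_Icc.mono hT)
    (by convert hv using 2; rw [hd]; field_simp)
  have hinj : Set.InjOn x (Finset.range m : Set ℕ) := by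
    intro i hi j hj hij
    by_contra hne
    simp only [Finset.coe_range, Set.mem_Iio] at hi hj
    rcases lt_or_gt_of_ne hne with h | h
    · have := spaced_sub_ge hsp h.le hj
      rw [hij, sub_self] at this
      have : (0 : ℝ) < (j - i) * d := mul_pos (by simpa using h) hd0
      linarith
    · have := spaced_sub_ge hsp h.le hi
      rw [hij, sub_self] at this
      have : (0 : ℝ) < (i - j) * d := mul_pos (by simpa using h) hd0
      linarith
  -- Interpolation at `m` nodes is exact because the degree is below `m`. It remains to bound the
  -- Lagrange weights at the origin.
  have hlag := Lagrange.eq_interpolate hinj (f := p) (by simpa using hp)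
  have hev : p.eval 0 = ∑ i ∈ Finset.range m, p.eval (x i) *
      ∏ j ∈ (Finset.range m).erase i, ((x i - x j)⁻¹ * (0 - x j)) := by
    conv_lhs => rw [hlag]
    simp only [Lagrange.interpolate_apply, Polynomial.eval_finsetSum, Polynomial.eval_mul,
      Polynomial.eval_C, Lagrange.basis, Polynomial.eval_prod, Lagrange.basisDivisor,
      Polynomial.eval_sub, Polynomial.eval_X]
  -- The nodes lie in `[0, 1]` and satisfy `|x i - x j| ≥ |i - j| d`, so the weights are no worse
  -- than those of equidistant nodes.
  have hterm : ∀ i ∈ Finset.range m, |p.eval (x i) *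
      ∏ j ∈ (Finset.range m).erase i, ((x i - x j)⁻¹ * (0 - x j))| ≤
      s * ((d⁻¹) ^ (m - 1) * (((i.factorial : ℝ) * (m - 1 - i).factorial)⁻¹)) := by
    intro i hi
    have hi' := Finset.mem_range.1 hi
    rw [abs_mul, Finset.abs_prod]
    refine mul_le_mul (hs _ (hx i hi')) ?_ (Finset.prod_nonneg fun _ _ => abs_nonneg _) hs0
    rw [← prod_abs_sub_eq hi', ← Finset.prod_inv_distrib]
    have hcard : ((Finset.range m).erase i).card = m - 1 := by
      rw [Finset.card_erase_of_mem hi, Finset.card_range]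
    rw [← hcard, ← Finset.prod_const, ← Finset.prod_mul_distrib]
    refine Finset.prod_le_prod (fun _ _ => abs_nonneg _) fun j hj => ?_
    have hj' := Finset.mem_erase.1 hj
    have hjm := Finset.mem_range.1 hj'.2
    have hxj := hT (hx j hjm)
    have hdist : |(i : ℝ) - j| * d ≤ |x i - x j| := by
      rcases lt_or_gt_of_ne hj'.1 with h | h
      · rw [abs_of_nonneg (by simpa using h.le)]
        exact (spaced_sub_ge hsp h.le hi').trans (le_abs_self _)
      · rw [abs_sub_comm, abs_of_nonneg (by simpa using h.le), abs_sub_comm]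
        exact (spaced_sub_ge hsp h.le hjm).trans (le_abs_self _)
    have hpos : 0 < |(i : ℝ) - j| :=
      abs_pos.2 (sub_ne_zero.2 (by exact_mod_cast hj'.1.symm))
    rw [abs_mul, abs_inv, zero_sub, abs_neg, abs_of_nonneg hxj.1, ← mul_inv]
    calc |x i - x j|⁻¹ * x j ≤ |x i - x j|⁻¹ * 1 := by
          gcongr; exact hxj.2
      _ ≤ _ := by
          rw [mul_one]
          exact inv_anti₀ (by positivity) (by linarith)
  have hsum : ∑ i ∈ Finset.range m, (((i.factorial : ℝ) * (m - 1 - i).factorial)⁻¹) =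
      2 ^ (m - 1) / ((m - 1).factorial : ℝ) := by
    have h2 : ((2 : ℝ) ^ (m - 1)) = ∑ i ∈ Finset.range m, ((m - 1).choose i : ℝ) := by
      have := Nat.sum_range_choose (m - 1)
      rw [show m - 1 + 1 = m by omega] at this
      exact_mod_cast this.symm
    rw [h2, Finset.sum_div]
    refine Finset.sum_congr rfl fun i hi => ?_
    have hi' := Finset.mem_range.1 hi
    rw [Nat.cast_choose ℝ (by omega : i ≤ m - 1)]
    have : ((m - 1).factorial : ℝ) ≠ 0 := by positivity
    field_simp
  have hmain : |p.eval 0| ≤ s * ((d⁻¹) ^ (m - 1) * (2 ^ (m - 1) / ((m - 1).factorial : ℝ))) := by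
    rw [hev]
    refine (Finset.abs_sum_le_sum_abs _ _).trans ((Finset.sum_le_sum hterm).trans ?_)
    rw [← Finset.mul_sum, ← Finset.mul_sum, hsum]
  refine hmain.trans ?_
  rw [mul_comm]
  refine mul_le_mul_of_nonneg_right ?_ hs0
  -- `m ^ (m - 1) / (m - 1)! = m ^ m / m! ≤ exp m ≤ 3 ^ m`. Together with the factor `4 / θ` coming
  -- from `2 / d` this gives the base `12 / θ`.
  have hfact : (m : ℝ) ^ (m - 1) / ((m - 1).factorial : ℝ) ≤ 3 ^ m := by
    have h1 := Real.pow_div_factorial_le_exp (m : ℝ) hm'.le m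
    have h2 : (m : ℝ) ^ (m - 1) / ((m - 1).factorial : ℝ) = (m : ℝ) ^ m / (m.factorial : ℝ) := by
      obtain ⟨k, rfl⟩ : ∃ k, m = k + 1 := ⟨m - 1, by omega⟩
      rw [Nat.factorial_succ, pow_succ]; push_cast
      field_simp
    rw [h2]
    refine h1.trans ?_
    rw [← mul_one (m : ℝ), Real.exp_nat_mul]
    exact pow_le_pow_left₀ (Real.exp_pos _).le (by linarith [Real.exp_one_lt_d9]) _
  have h4 : (4 / θ) ^ (m - 1) ≤ (4 / θ) ^ m :=
    pow_le_pow_right₀ (by rw [le_div_iff₀ hθ]; linarith) (by omega)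
  calc (d⁻¹) ^ (m - 1) * (2 ^ (m - 1) / ((m - 1).factorial : ℝ))
      = (4 / θ) ^ (m - 1) * ((m : ℝ) ^ (m - 1) / ((m - 1).factorial : ℝ)) := by
        rw [← mul_div_assoc, ← mul_pow, ← mul_div_assoc, ← mul_pow]
        congr 2; rw [hd]; field_simp; norm_num
    _ ≤ (4 / θ) ^ m * 3 ^ m := by gcongr
    _ = (12 / θ) ^ m := by rw [← mul_pow]; congr 1; ring

end Carleman

namespace Carleman

variable {n : ℕ}

/-! ### Gaussian weights -/

/-- The weight `exp (-|y|²/2 + c |y|)`. -/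
def gw (c : ℝ) (y : Sp n) : ℝ := Real.exp (-‖y‖ ^ 2 / 2 + c * ‖y‖)

theorem gw_pos (c : ℝ) (y : Sp n) : 0 < gw c y := Real.exp_pos _

theorem continuous_gw (c : ℝ) : Continuous (gw c : Sp n → ℝ) := by unfold gw; fun_prop

theorem integrable_gw (c : ℝ) : Integrable (gw c : Sp n → ℝ) := by
  have h := (GaussianFourier.integrable_cexp_neg_mul_sq_norm_add (V := Sp n) (b := (1 / 4 : ℂ))
    (by norm_num) 0 0).norm
  -- Completing the square: `-‖y‖²/2 + c‖y‖ ≤ c² - ‖y‖²/4`.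
  refine (h.const_mul (Real.exp (c ^ 2))).mono' (continuous_gw c).aestronglyMeasurable
    (.of_forall fun y => ?_)
  rw [Real.norm_of_nonneg (gw_pos c y).le, Complex.norm_exp, ← Real.exp_add]
  refine Real.exp_le_exp.2 ?_
  have : (-(1 / 4 : ℂ) * ‖y‖ ^ 2 + 0 * (inner ℝ (0 : Sp n) y : ℝ)).re = -‖y‖ ^ 2 / 4 := by
    rw [show (-(1 / 4 : ℂ) * ‖y‖ ^ 2 + 0 * (inner ℝ (0 : Sp n) y : ℝ)) =
      ((-‖y‖ ^ 2 / 4 : ℝ) : ℂ) by push_cast; ring]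
    exact Complex.ofReal_re _
  rw [this]
  nlinarith [sq_nonneg (‖y‖ / 2 - c)]

theorem gw_mul_exp (c d : ℝ) (y : Sp n) : gw c y * Real.exp (d * ‖y‖) = gw (c + d) y := by
  unfold gw; rw [← Real.exp_add]; ring_nf

theorem integrable_gw_mul {c : ℝ} {f : Sp n → ℝ} (hf : Continuous f) {C d : ℝ}
    (hb : ∀ y, |f y| ≤ C * Real.exp (d * ‖y‖)) : Integrable (fun y => gw c y * f y) := by
  refine ((integrable_gw (c + d)).const_mul C).mono'
    ((continuous_gw c).mul hf).aestronglyMeasurable (.of_forall fun y => ?_)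
  rw [norm_mul, Real.norm_of_nonneg (gw_pos c y).le, ← gw_mul_exp, Real.norm_eq_abs]
  calc gw c y * |f y| ≤ gw c y * (C * Real.exp (d * ‖y‖)) :=
        mul_le_mul_of_nonneg_left (hb y) (gw_pos c y).le
    _ = _ := by ring

theorem integrable_gw_mul_bdd {c : ℝ} {f : Sp n → ℝ} (hf : Continuous f) {C : ℝ}
    (hb : ∀ y, |f y| ≤ C) : Integrable (fun y => gw c y * f y) :=
  integrable_gw_mul (d := 0) hf (C := C) (by simpa using hb)

/-- The Cauchy–Schwarz inequality with a weight. -/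
theorem sq_integral_mul_le {α : Type*} [MeasurableSpace α] {μ : Measure α} {κ f : α → ℝ}
    (hκ : ∀ x, 0 ≤ κ x) (h0 : Integrable κ μ) (h1 : Integrable (fun x => κ x * f x) μ)
    (h2 : Integrable (fun x => κ x * f x ^ 2) μ) :
    (∫ x, κ x * f x ∂μ) ^ 2 ≤ (∫ x, κ x ∂μ) * ∫ x, κ x * f x ^ 2 ∂μ := by
  have key : ∀ c : ℝ, 0 ≤ (∫ x, κ x * f x ^ 2 ∂μ) - 2 * c * (∫ x, κ x * f x ∂μ)
      + c ^ 2 * ∫ x, κ x ∂μ := by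
    intro c
    have : 0 ≤ ∫ x, κ x * (f x - c) ^ 2 ∂μ :=
      integral_nonneg fun x => mul_nonneg (hκ x) (sq_nonneg _)
    have e : ∫ x, κ x * (f x - c) ^ 2 ∂μ =
        ∫ x, (κ x * f x ^ 2 - 2 * c * (κ x * f x) + c ^ 2 * κ x) ∂μ := by
      congr 1; ext x; ring
    rw [e, integral_add (f := fun x => κ x * f x ^ 2 - 2 * c * (κ x * f x))
      (h2.sub (h1.const_mul _)) (h0.const_mul _),
      integral_sub h2 (h1.const_mul _), integral_const_mul, integral_const_mul] at this
    exact this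
  set Z := ∫ x, κ x ∂μ with hZ
  set I := ∫ x, κ x * f x ∂μ
  set J := ∫ x, κ x * f x ^ 2 ∂μ
  have hZ0 : 0 ≤ Z := integral_nonneg hκ
  rcases hZ0.eq_or_lt with h | h
  -- Without mass the quadratic in `c` is affine and bounded below, so its slope vanishes.
  · have hI : I = 0 := by
      by_contra hne
      have := key ((J + 1) / (2 * I))
      rw [← h] at this
      have e : 2 * ((J + 1) / (2 * I)) * I = J + 1 := by field_simp
      linarith
    rw [hI, ← h]; simp
  · have := key (I / Z)
    have e1 : 2 * (I / Z) * I = 2 * I ^ 2 / Z := by ring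
    have e2 : (I / Z) ^ 2 * Z = I ^ 2 / Z := by field_simp
    rw [e1, e2] at this
    have e3 : I ^ 2 / Z ≤ J := by
      have : 2 * I ^ 2 / Z = I ^ 2 / Z + I ^ 2 / Z := by ring
      linarith
    rwa [div_le_iff₀ h, mul_comm] at e3

section Smear

variable (A : Sp n →L[ℝ] Sp n)

theorem CC.exists_bound {F : Sp n → ℝ} (hF : CC F) : ∃ C, 0 ≤ C ∧ ∀ x, |F x| ≤ C := by
  obtain ⟨C, hC⟩ := hF.2.exists_bound_of_continuous hF.1
  exact ⟨C, (norm_nonneg _).trans (hC 0), hC⟩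

theorem continuous_smear (c : ℝ) {F : Sp n → ℝ} (hF : CC F) :
    Continuous (fun p : ℝ × Sp n => ∫ y, gw c y * F (p.2 - p.1 • A y)) := by
  obtain ⟨C, hC0, hC⟩ := hF.exists_bound
  refine continuous_of_dominated (bound := fun y => gw c y * C) (fun p => ?_) (fun p => ?_)
    ((integrable_gw c).mul_const C) (.of_forall fun y => ?_)
  · exact ((continuous_gw c).mul (hF.1.comp (by fun_prop))).aestronglyMeasurable
  · refine .of_forall fun y => ?_
    rw [norm_mul, Real.norm_of_nonneg (gw_pos c y).le]
    exact mul_le_mul_of_nonneg_left (hC _) (gw_pos c y).le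
  · exact continuous_const.mul (hF.1.comp (by fun_prop))

/-- Averages of `F` over Gaussian neighbourhoods of a ball are bounded by an integral of `F` with
an exponential weight. -/
theorem setIntegral_smear_le {α : ℝ} (hA : ‖A‖ ≤ α) (c M R : ℝ) (hM : 0 ≤ M)
    {F : Sp n → ℝ} (hF : CC F) (hF0 : ∀ x, 0 ≤ F x) {s : ℝ} (hs : s ∈ Set.Icc (0 : ℝ) 1) :
    ∫ z in Metric.closedBall (0 : Sp n) R, ∫ y, gw c y * F (z - s • A y) ≤
      (Real.exp (M * R) * ∫ y : Sp n, gw (c + M * α) y) * ∫ z, Real.exp (-M * ‖z‖) * F z := by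
  obtain ⟨C, hC0, hC⟩ := hF.exists_bound
  have hα : 0 ≤ α := (norm_nonneg _).trans hA
  set S := Metric.closedBall (0 : Sp n) R
  have hS : volume S ≠ ⊤ := measure_closedBall_lt_top.ne
  have hE : CC (fun z => Real.exp (-M * ‖z‖) * F z) := hF.mul_left (by fun_prop)
  have hint : Integrable (Function.uncurry fun (z y : Sp n) => gw c y * F (z - s • A y))
      ((volume.restrict S).prod volume) := by
    have h1 : Integrable (fun p : Sp n × Sp n => (1 : ℝ) * (gw c p.2 * C))
        ((volume.restrict S).prod volume) := by
      refine Integrable.mul_prod (f := fun _ : Sp n => (1 : ℝ)) (g := fun y => gw c y * C) ?_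
        ((integrable_gw c).mul_const C)
      exact integrableOn_const hS
    refine h1.mono' ?_ (.of_forall fun p => ?_)
    · refine Continuous.aestronglyMeasurable ?_
      exact ((continuous_gw c).comp continuous_snd).mul (hF.1.comp (by fun_prop))
    · simp only [Function.uncurry, one_mul]
      rw [norm_mul, Real.norm_of_nonneg (gw_pos c _).le]
      exact mul_le_mul_of_nonneg_left (hC _) (gw_pos c _).le
  rw [integral_integral_swap hint, ← integral_const_mul (Real.exp (M * R)),
    ← integral_mul_const (∫ z, Real.exp (-M * ‖z‖) * F z)]
  refine integral_mono_of_nonneg (.of_forall fun y => ?_) ?_ (.of_forall fun y => ?_)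
  · exact integral_nonneg fun z => mul_nonneg (gw_pos c y).le (hF0 _)
  · exact ((integrable_gw _).const_mul _).mul_const _
  · have hsy : ‖s • A y‖ ≤ α * ‖y‖ := by
      rw [norm_smul, Real.norm_of_nonneg hs.1]
      calc s * ‖A y‖ ≤ 1 * ‖A y‖ := by gcongr; exact hs.2
        _ ≤ ‖A‖ * ‖y‖ := by rw [one_mul]; exact A.le_opNorm y
        _ ≤ α * ‖y‖ := by gcongr
    have htr : Integrable (fun z => Real.exp (-M * ‖z - s • A y‖) * F (z - s • A y)) :=
      hE.integrable.comp_sub_right (s • A y)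
    -- Translating by `s • A y` changes the exponential weight by a factor at most `exp (M α ‖y‖)`,
    -- which the Gaussian absorbs as `gw (c + M α)`.
    have h1 : ∫ z in S, F (z - s • A y) ≤
        Real.exp (M * R + M * α * ‖y‖) * ∫ z, Real.exp (-M * ‖z‖) * F z := by
      rw [← integral_sub_right_eq_self (fun z => Real.exp (-M * ‖z‖) * F z) (s • A y),
        ← integral_const_mul]
      refine le_trans ?_ (setIntegral_le_integral (s := S) (htr.const_mul _)
        (.of_forall fun z => mul_nonneg (Real.exp_pos _).le
          (mul_nonneg (Real.exp_pos _).le (hF0 _))))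
      refine setIntegral_mono_on (hF.integrable.comp_sub_right _).integrableOn
        (htr.const_mul _).integrableOn Metric.isClosed_closedBall.measurableSet fun z hz => ?_
      rw [← mul_assoc, ← Real.exp_add]
      refine le_mul_of_one_le_left (hF0 _) (Real.one_le_exp ?_)
      have hz' : ‖z‖ ≤ R := by simpa [S] using hz
      have h2 : ‖z - s • A y‖ ≤ R + α * ‖y‖ := (norm_sub_le _ _).trans (add_le_add hz' hsy)
      nlinarith [mul_le_mul_of_nonneg_left h2 hM]
    simp only
    rw [integral_const_mul]
    calc gw c y * ∫ z in S, F (z - s • A y)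
        ≤ gw c y * (Real.exp (M * R + M * α * ‖y‖) * ∫ z, Real.exp (-M * ‖z‖) * F z) :=
          mul_le_mul_of_nonneg_left h1 (gw_pos c y).le
      _ = _ := by rw [← gw_mul_exp, Real.exp_add]; ring

end Smear

/-! ### The heat flow of a matrix with constant coefficients -/

section Heat

variable (A : Sp n →L[ℝ] Sp n) {U : Sp n → ℝ}

/-- The second order operator `∑ₖ D²U(A eₖ, A eₖ)`. -/
def heatOp (A : Sp n →L[ℝ] Sp n) (U : Sp n → ℝ) (z : Sp n) : ℝ :=
  ∑ k : Fin n, fderiv ℝ (fderiv ℝ U) z (A (EuclideanSpace.single k 1))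
    (A (EuclideanSpace.single k 1))

theorem cc_heatOp (hU : ContDiff ℝ 2 U) (hc : HasCompactSupport U) : CC (heatOp A U) := by
  have h1 : ContDiff ℝ 1 (fderiv ℝ U) := hU.fderiv_right (by norm_num [one_add_one_eq_two])
  refine CC.sum fun k _ => ⟨?_, ?_⟩
  · exact ((h1.continuous_fderiv (by simp)).clm_apply continuous_const).clm_apply continuous_const
  · refine ((hc.fderiv ℝ).fderiv ℝ).mono fun x hx h => hx ?_
    simp only at h ⊢
    rw [h]; simp

theorem hasFDerivAt_gw_zero (y : Sp n) :
    HasFDerivAt (gw 0 : Sp n → ℝ) (-(gw 0 y) • innerSL ℝ y) y := by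
  have h : HasFDerivAt (fun y : Sp n => -‖y‖ ^ 2 / 2) (-(innerSL ℝ y)) y := by
    have := ((hasStrictFDerivAt_norm_sq y).hasFDerivAt.neg).const_mul (1 / 2 : ℝ)
    refine (this.congr_fderiv ?_).congr_of_eventuallyEq (.of_forall fun z => ?_)
    · ext v; simp
    · simp; ring
  have e : (gw 0 : Sp n → ℝ) = fun y => Real.exp (-‖y‖ ^ 2 / 2) := by
    ext y; simp [gw]
  rw [e]
  refine (h.exp).congr_fderiv ?_
  ext v; simp

/-- The gradient of `gw 0` at `y` is `-gw 0 y • y`, so a factor `y k` can be exchanged for a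
derivative. -/
theorem integral_gaussian_ibp {G : Sp n → ℝ} (hG : ContDiff ℝ 1 G) {C : ℝ}
    (hb : ∀ y, |G y| ≤ C) (hb' : ∀ y, ‖fderiv ℝ G y‖ ≤ C) (k : Fin n) :
    ∫ y : Sp n, gw 0 y * (y k * G y) = ∫ y, gw 0 y * pd k G y := by
  have hC : 0 ≤ C := (abs_nonneg _).trans (hb 0)
  have hfd : ∀ y : Sp n, fderiv ℝ (gw 0) y (EuclideanSpace.single k 1) = -(gw 0 y * y k) := by
    intro y
    rw [(hasFDerivAt_gw_zero y).fderiv]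
    simp [EuclideanSpace.inner_single_right]
  have hpd : ∀ y, |pd k G y| ≤ C := fun y => by
    refine ((fderiv ℝ G y).le_opNorm _).trans ?_
    simpa using hb' y
  have hyk : ∀ y : Sp n, |y k * G y| ≤ C * Real.exp (1 * ‖y‖) := fun y => by
    rw [abs_mul, mul_comm C, one_mul]
    refine mul_le_mul ?_ (hb y) (abs_nonneg _) (Real.exp_pos _).le
    exact (PiLp.norm_apply_le y k).trans (by linarith [Real.add_one_le_exp ‖y‖])
  have i1 : Integrable (fun y : Sp n => gw 0 y * (y k * G y)) :=
    integrable_gw_mul (by have := hG.continuous; fun_prop) hyk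
  have := integral_mul_fderiv_eq_neg_fderiv_mul_of_integrable (μ := (volume : Measure (Sp n)))
    (f := gw 0) (g := G) (v := EuclideanSpace.single k 1) ?_ ?_ ?_ ?_ ?_
  · simp only [pd]
    rw [this, ← integral_neg]
    congr 1; ext y; rw [hfd]; ring
  · simp_rw [hfd]
    refine i1.neg.congr (.of_forall fun y => ?_)
    simp only [Pi.neg_apply]; ring
  · exact integrable_gw_mul_bdd (continuous_pd hG k) hpd
  · exact integrable_gw_mul_bdd hG.continuous hb
  · exact fun y _ => (hasFDerivAt_gw_zero y).differentiableAt
  · exact fun y _ => hG.differentiable (by simp) y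

theorem norm_apply_le_exp (y : Sp n) : ‖A y‖ ≤ ‖A‖ * Real.exp (1 * ‖y‖) :=
  (A.le_opNorm y).trans (mul_le_mul_of_nonneg_left (by rw [one_mul]; linarith [Real.add_one_le_exp ‖y‖])
    (norm_nonneg _))

theorem hasDerivAt_heat_aux (hU : ContDiff ℝ 2 U) (hc : HasCompactSupport U) (z : Sp n) (s : ℝ) :
    HasDerivAt (fun s : ℝ => ∫ y, gw 0 y * U (z - s • A y))
      (∫ y, gw 0 y * -(fderiv ℝ U (z - s • A y) (A y))) s := by
  have hU1 : ContDiff ℝ 1 (fderiv ℝ U) := hU.fderiv_right (by norm_num [one_add_one_eq_two])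
  have hUd : Differentiable ℝ U := hU.differentiable (by simp)
  have hUc : Continuous U := hU.continuous
  have hU1c : Continuous (fderiv ℝ U) := hU1.continuous
  obtain ⟨C₁, hC₁⟩ := (hc.fderiv ℝ).exists_bound_of_continuous hU1c
  have hC₁0 : 0 ≤ C₁ := (norm_nonneg _).trans (hC₁ 0)
  obtain ⟨C, hC0, hC⟩ := (show CC U from ⟨hUc, hc⟩).exists_bound
  have hlin : ∀ t : ℝ, Continuous (fun y => z - t • A y) := fun t => by fun_prop
  have b1 : ∀ᶠ t in nhds s, AEStronglyMeasurable (fun y => gw 0 y * U (z - t • A y)) volume :=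
    .of_forall fun t => ((continuous_gw 0).mul (hUc.comp (hlin t))).aestronglyMeasurable
  have b2 : Integrable (fun y => gw 0 y * U (z - s • A y)) :=
    integrable_gw_mul_bdd (hUc.comp (hlin s)) fun y => hC _
  have b3 : AEStronglyMeasurable (fun y => gw 0 y * -(fderiv ℝ U (z - s • A y) (A y))) volume :=
    ((continuous_gw 0).mul
      ((hU1c.comp (hlin s)).clm_apply A.continuous).neg).aestronglyMeasurable
  have b4 : Integrable (fun y : Sp n => gw 0 y * (C₁ * (‖A‖ * Real.exp (1 * ‖y‖)))) := by
    refine integrable_gw_mul (d := 1) (C := C₁ * ‖A‖) (by fun_prop) fun y => ?_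
    rw [abs_of_nonneg (by positivity), mul_assoc]
  refine (hasDerivAt_integral_of_dominated_loc_of_deriv_le (s := Set.univ) (x₀ := s)
    (F' := fun t y => gw 0 y * -(fderiv ℝ U (z - t • A y) (A y)))
    Filter.univ_mem b1 b2 b3 (.of_forall fun y t _ => ?_) b4 (.of_forall fun y t _ => ?_)).2
  · rw [norm_mul, Real.norm_of_nonneg (gw_pos 0 y).le, norm_neg]
    refine mul_le_mul_of_nonneg_left ?_ (gw_pos 0 y).le
    exact ((fderiv ℝ U _).le_opNorm _).trans
      (mul_le_mul (hC₁ _) (norm_apply_le_exp A y) (norm_nonneg _) hC₁0)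
  · have h1 : HasDerivAt (fun t : ℝ => z - t • A y) (-(A y)) t := by
      simpa using ((hasDerivAt_id t).smul_const (A y)).const_sub z
    have h2 := (hUd (z - t • A y)).hasFDerivAt.comp_hasDerivAt t h1
    rw [map_neg] at h2
    exact h2.const_mul (gw 0 y)

theorem hasFDerivAt_fderiv_comp (hU : ContDiff ℝ 2 U) (z w : Sp n) (s : ℝ) (y : Sp n) :
    HasFDerivAt (fun y => fderiv ℝ U (z - s • A y) w)
      ((-s) • ((fderiv ℝ (fderiv ℝ U) (z - s • A y)).flip w).comp A) y := by
  have hU1 : ContDiff ℝ 1 (fderiv ℝ U) := hU.fderiv_right (by norm_num [one_add_one_eq_two])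
  have h1 : HasFDerivAt (fun y => z - s • A y) (-(s • A)) y :=
    (A.hasFDerivAt.const_smul s).const_sub z
  have h2 : HasFDerivAt (fun y => fderiv ℝ U (z - s • A y))
      ((fderiv ℝ (fderiv ℝ U) (z - s • A y)).comp (-(s • A))) y :=
    (hU1.differentiable (by simp) (z - s • A y)).hasFDerivAt.comp y h1
  refine (h2.clm_apply (hasFDerivAt_const w y)).congr_fderiv ?_
  ext v; simp

theorem norm_flip_comp_le {L : Sp n →L[ℝ] Sp n →L[ℝ] ℝ} {C : ℝ} (hL : ‖L‖ ≤ C) {w : Sp n}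
    (hw : ‖w‖ ≤ ‖A‖) {s : ℝ} : ‖(-s) • (L.flip w).comp A‖ ≤ |s| * (C * ‖A‖ * ‖A‖) := by
  rw [norm_smul, norm_neg, Real.norm_eq_abs]
  refine mul_le_mul_of_nonneg_left ?_ (abs_nonneg s)
  refine (ContinuousLinearMap.opNorm_comp_le _ _).trans ?_
  refine mul_le_mul_of_nonneg_right ?_ (norm_nonneg _)
  refine (ContinuousLinearMap.le_opNorm _ _).trans ?_
  rw [ContinuousLinearMap.opNorm_flip]
  exact mul_le_mul hL hw (norm_nonneg _) ((norm_nonneg L).trans hL)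

theorem exists_bound_fderiv {E F : Type*} [NormedAddCommGroup E] [NormedSpace ℝ E]
    [NormedAddCommGroup F] [NormedSpace ℝ F] {f : E → F} (hf : ContDiff ℝ 1 f)
    (hc : HasCompactSupport f) : ∃ C, ∀ x, ‖fderiv ℝ f x‖ ≤ C :=
  (hc.fderiv ℝ).exists_bound_of_continuous (hf.continuous_fderiv (by simp))

theorem apply_eq_sum_single (y : Sp n) :
    A y = ∑ k, y k • A (EuclideanSpace.single k 1) := by
  conv_lhs => rw [← (EuclideanSpace.basisFun (Fin n) ℝ).sum_repr y]
  simp [map_sum]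

/-- The derivative of the heat flow along square-root time. -/
theorem hasDerivAt_heat (hU : ContDiff ℝ 2 U) (hc : HasCompactSupport U) (z : Sp n) (s : ℝ) :
    HasDerivAt (fun s : ℝ => ∫ y, gw 0 y * U (z - s • A y))
      (s * ∫ y, gw 0 y * heatOp A U (z - s • A y)) s := by
  have hU1 : ContDiff ℝ 1 (fderiv ℝ U) := hU.fderiv_right (by norm_num [one_add_one_eq_two])
  obtain ⟨C₁, hC₁⟩ := (hc.fderiv ℝ).exists_bound_of_continuous hU1.continuous
  obtain ⟨C₂, hC₂⟩ := exists_bound_fderiv hU1 (hc.fderiv ℝ)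
  have hC₁0 : 0 ≤ C₁ := (norm_nonneg _).trans (hC₁ 0)
  refine (hasDerivAt_heat_aux A hU hc z s).congr_deriv ?_
  obtain ⟨e, he⟩ : ∃ e : Fin n → Sp n, e = fun k => EuclideanSpace.single k 1 := ⟨_, rfl⟩
  obtain ⟨G, hGdef⟩ : ∃ G : Fin n → Sp n → ℝ, G = fun k y => fderiv ℝ U (z - s • A y) (A (e k)) :=
    ⟨_, rfl⟩
  have hG : ∀ k, ContDiff ℝ 1 (G k) := fun k => by
    rw [hGdef]
    exact (hU1.comp (by fun_prop : ContDiff ℝ 1 fun y => z - s • A y)).clm_apply contDiff_const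
  have hGf : ∀ k y, HasFDerivAt (G k)
      ((-s) • ((fderiv ℝ (fderiv ℝ U) (z - s • A y)).flip (A (e k))).comp A) y := fun k y => by
    rw [hGdef]; exact hasFDerivAt_fderiv_comp A hU z (A (e k)) s y
  have hek : ∀ k, ‖A (e k)‖ ≤ ‖A‖ := fun k => by simpa [he] using A.le_opNorm (e k)
  obtain ⟨D, hD⟩ : ∃ D, D = max (C₁ * ‖A‖) (|s| * (C₂ * ‖A‖ * ‖A‖)) := ⟨_, rfl⟩
  have hGb : ∀ k y, |G k y| ≤ D := fun k y => by
    rw [hD, hGdef]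
    refine le_trans (((fderiv ℝ U _).le_opNorm _).trans ?_) (le_max_left _ _)
    exact mul_le_mul (hC₁ _) (hek k) (norm_nonneg _) hC₁0
  have hGb' : ∀ k y, ‖fderiv ℝ (G k) y‖ ≤ D := fun k y => by
    rw [hD]
    refine le_trans ?_ (le_max_right _ _)
    rw [(hGf k y).fderiv]
    exact norm_flip_comp_le A (hC₂ _) (hek k)
  have hpd : ∀ k y, pd k (G k) y =
      -s * fderiv ℝ (fderiv ℝ U) (z - s • A y) (A (e k)) (A (e k)) := by
    intro k y
    unfold pd
    rw [(hGf k y).fderiv]; simp [he]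
  have iG : ∀ k, Integrable (fun y : Sp n => gw 0 y * (y k * G k y)) := fun k => by
    have hD0 : 0 ≤ D := (abs_nonneg _).trans (hGb k 0)
    have hGc := (hG k).continuous
    refine integrable_gw_mul (C := D) (d := 1) (by fun_prop) fun y => ?_
    rw [abs_mul, mul_comm D, one_mul]
    refine mul_le_mul ?_ (hGb k y) (abs_nonneg _) (Real.exp_pos _).le
    exact (PiLp.norm_apply_le y k).trans (by linarith [Real.add_one_le_exp ‖y‖])
  have ipd : ∀ k, Integrable (fun y : Sp n => gw 0 y * pd k (G k) y) := fun k =>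
    integrable_gw_mul_bdd (continuous_pd (hG k) k) (C := D) fun y => by
      refine ((fderiv ℝ (G k) y).le_opNorm _).trans ?_
      simpa using hGb' k y
  symm
  -- Heat equation in square-root time: expand `A y` in coordinates, then Gaussian integration by
  -- parts turns each factor `y k` into a second derivative in the direction `A eₖ`, with a further
  -- factor `-s`.
  calc s * ∫ y, gw 0 y * heatOp A U (z - s • A y)
      = - ∫ y, ∑ k, gw 0 y * pd k (G k) y := by
        rw [← integral_const_mul, ← integral_neg]
        congr 1; ext y
        simp_rw [hpd, heatOp, Finset.mul_sum, he]
        rw [← Finset.sum_neg_distrib]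
        exact Finset.sum_congr rfl fun k _ => by ring
    _ = - ∫ y, ∑ k, gw 0 y * (y k * G k y) := by
        rw [integral_finsetSum _ fun k _ => ipd k, integral_finsetSum _ fun k _ => iG k]
        congr 1
        exact Finset.sum_congr rfl fun k _ => (integral_gaussian_ibp (hG k) (hGb k) (hGb' k) k).symm
    _ = ∫ y, gw 0 y * -(fderiv ℝ U (z - s • A y) (A y)) := by
        rw [← integral_neg]
        congr 1; ext y
        rw [mul_neg, neg_inj, ← Finset.mul_sum]
        congr 1
        rw [congrArg (fderiv ℝ U (z - s • A y)) (apply_eq_sum_single A y)]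
        simp [hGdef, he]

end Heat

end Carleman

namespace Carleman

variable {n : ℕ}

/-! ### Unique continuation from sets of positive measure -/

/-- In the tail each term satisfies `r ^ k ≤ ρ⁻ᵐ (ρ r) ^ k`. The geometric gain `ρ⁻ᵐ` is paid for by
a larger exponential, which is harmless under a Gaussian. -/
theorem exp_sub_sum_le {ρ r : ℝ} (hρ : 1 ≤ ρ) (hr : 0 ≤ r) (m : ℕ) :
    Real.exp r - ∑ k ∈ Finset.range m, r ^ k / k.factorial ≤ (ρ⁻¹) ^ m * Real.exp (ρ * r) := by
  have hs : ∀ x : ℝ, HasSum (fun k : ℕ => x ^ k / (k.factorial : ℝ)) (Real.exp x) := fun x => by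
    rw [Real.exp_eq_exp_ℝ]; exact NormedSpace.expSeries_div_hasSum_exp x
  have h1 := (hasSum_nat_add_iff' m).2 (hs r)
  have h2 := (hasSum_nat_add_iff' m).2 (hs (ρ * r))
  have h3 : Real.exp (ρ * r) - ∑ k ∈ Finset.range m, (ρ * r) ^ k / k.factorial ≤
      Real.exp (ρ * r) := by
    have : 0 ≤ ∑ k ∈ Finset.range m, (ρ * r) ^ k / (k.factorial : ℝ) :=
      Finset.sum_nonneg fun k _ => by positivity
    linarith
  refine le_trans (hasSum_le (fun k => ?_) h1 (h2.mul_left ((ρ⁻¹) ^ m)))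
    (mul_le_mul_of_nonneg_left h3 (by positivity))
  rw [mul_pow, mul_div_assoc, ← mul_assoc]
  refine le_mul_of_one_le_left (by positivity) ?_
  rw [pow_add, mul_comm (ρ ^ k), ← mul_assoc, ← mul_pow, inv_mul_cancel₀ (by positivity), one_pow,
    one_mul]
  exact one_le_pow₀ hρ

theorem abs_exp_sub_sum_le {ρ x r : ℝ} (hρ : 1 ≤ ρ) (hx : |x| ≤ r) (m : ℕ) :
    |Real.exp x - ∑ k ∈ Finset.range m, x ^ k / k.factorial| ≤ (ρ⁻¹) ^ m * Real.exp (ρ * r) := by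
  have h := Complex.norm_exp_sub_sum_le_exp_norm_sub_sum (x : ℂ) m
  have e : Complex.exp x - ∑ k ∈ Finset.range m, (x : ℂ) ^ k / k.factorial =
      ((Real.exp x - ∑ k ∈ Finset.range m, x ^ k / k.factorial : ℝ) : ℂ) := by push_cast; rfl
  rw [e, Complex.norm_real, Complex.norm_real, Real.norm_eq_abs, Real.norm_eq_abs] at h
  refine h.trans ((exp_sub_sum_le hρ (abs_nonneg x) m).trans ?_)
  gcongr

/-- A set of positive measure meets some segment issuing from a given point in a set of
length bounded below. -/
theorem exists_segment {K θ : ℝ} (hK : 0 < K) (hθ : 0 < θ) :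
    ∃ θ' : ℝ, 0 < θ' ∧ θ' ≤ 1 ∧ ∀ (Z : Set (Sp n)) (z₀ : Sp n), MeasurableSet Z →
      Z ⊆ Metric.closedBall z₀ K → ENNReal.ofReal θ ≤ volume Z →
      ∃ y : Sp n, ‖y‖ ≤ K ∧
        ENNReal.ofReal θ' ≤ volume {t : ℝ | t ∈ Set.Icc (0 : ℝ) 1 ∧ z₀ + t • y ∈ Z} := by
  set V : ℝ := (volume (Metric.closedBall (0 : Sp n) K)).toReal with hV
  have hVtop : volume (Metric.closedBall (0 : Sp n) K) ≠ ⊤ := measure_closedBall_lt_top.ne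
  have hV0 : 0 < V := ENNReal.toReal_pos (Metric.measure_closedBall_pos _ _ hK).ne' hVtop
  -- For `t ≥ t₀` the ball of radius `t * K` misses at most measure `θ / 2` of the ball of radius
  -- `K`.
  obtain ⟨t₀, ht₀, ht₀1, ht₀V⟩ : ∃ t₀ : ℝ, 0 < t₀ ∧ t₀ < 1 ∧ V * (1 - t₀ ^ n) ≤ θ / 2 := by
    have hcont : Filter.Tendsto (fun t : ℝ => V * (1 - t ^ n)) (nhdsWithin 1 (Set.Iio 1))
        (nhds (V * (1 - 1 ^ n))) :=
      (Continuous.tendsto (by fun_prop) 1).mono_left nhdsWithin_le_nhds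
    have h1 : ∀ᶠ t in nhdsWithin (1 : ℝ) (Set.Iio 1), V * (1 - t ^ n) < θ / 2 :=
      hcont.eventually_lt_const (by simp; linarith)
    have h2 : ∀ᶠ t in nhdsWithin (1 : ℝ) (Set.Iio 1), (0 : ℝ) < t :=
      nhdsWithin_le_nhds (lt_mem_nhds one_pos)
    obtain ⟨t, ha, hb, hc⟩ := (h1.and (h2.and self_mem_nhdsWithin)).exists
    exact ⟨t, hb, hc, ha.le⟩
  set θ' : ℝ := min 1 ((1 - t₀) * (θ / 2) / V) with hθ'
  have hpos : 0 < θ' := lt_min one_pos (by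
    have : 0 < 1 - t₀ := by linarith
    positivity)
  refine ⟨θ', hpos, min_le_left _ _, fun Z z₀ hZ hsub hvol => ?_⟩
  by_contra! hcon
  set B := Metric.closedBall (0 : Sp n) K with hB
  -- Fubini for this cone over `Z`. For fixed `t ≥ t₀` the slice is a part of `Z` of measure at
  -- least `θ / 2`, dilated by `1 / t ≥ 1`. For fixed direction the slice would, by the contrary
  -- assumption, be shorter than `θ'`. The two counts are incompatible.
  set S : Set (Sp n × ℝ) := {p | p.1 ∈ B ∧ p.2 ∈ Set.Icc t₀ 1 ∧ z₀ + p.2 • p.1 ∈ Z} with hS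
  have hSm : MeasurableSet S := by
    refine (measurable_fst Metric.isClosed_closedBall.measurableSet).inter
      ((measurable_snd measurableSet_Icc).inter ?_)
    exact hZ.preimage (by fun_prop : Continuous fun p : Sp n × ℝ => z₀ + p.2 • p.1).measurable
  have hup : (volume : Measure (Sp n × ℝ)) S < ENNReal.ofReal θ' * volume B := by
    rw [Measure.volume_eq_prod, Measure.prod_apply hSm]
    have hle : ∀ y : Sp n, volume (Prod.mk y ⁻¹' S) ≤
        B.indicator (fun y => volume {t : ℝ | t ∈ Set.Icc (0 : ℝ) 1 ∧ z₀ + t • y ∈ Z}) y := by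
      intro y
      by_cases hy : y ∈ B
      · rw [Set.indicator_of_mem hy]
        exact measure_mono fun t ht => ⟨⟨ht₀.le.trans ht.2.1.1, ht.2.1.2⟩, ht.2.2⟩
      · rw [Set.indicator_of_notMem hy]
        refine le_of_eq ?_
        rw [show Prod.mk y ⁻¹' S = ∅ from Set.eq_empty_of_forall_notMem fun t ht => hy ht.1]
        simp
    have hTm : MeasurableSet {p : Sp n × ℝ | p.2 ∈ Set.Icc (0 : ℝ) 1 ∧ z₀ + p.2 • p.1 ∈ Z} :=
      (measurable_snd measurableSet_Icc).inter
        (hZ.preimage (by fun_prop : Continuous fun p : Sp n × ℝ => z₀ + p.2 • p.1).measurable)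
    have hmeas : Measurable fun y : Sp n =>
        volume {t : ℝ | t ∈ Set.Icc (0 : ℝ) 1 ∧ z₀ + t • y ∈ Z} :=
      measurable_measure_prodMk_left hTm
    refine (lintegral_mono hle).trans_lt ?_
    rw [lintegral_indicator Metric.isClosed_closedBall.measurableSet, ← setLIntegral_const]
    have hpB : volume B ≠ 0 := (Metric.measure_closedBall_pos _ _ hK).ne'
    refine setLIntegral_strict_mono Metric.isClosed_closedBall.measurableSet hpB measurable_const
      ?_ (.of_forall fun y hy => hcon y (by simpa [hB] using hy))
    refine ne_top_of_le_ne_top (b := ENNReal.ofReal θ' * volume B)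
      (ENNReal.mul_ne_top ENNReal.ofReal_ne_top hVtop) ?_
    rw [← setLIntegral_const]
    exact setLIntegral_mono measurable_const fun y hy => (hcon y (by simpa [hB] using hy)).le
  have hlow : ENNReal.ofReal ((1 - t₀) * (θ / 2)) ≤ (volume : Measure (Sp n × ℝ)) S := by
    rw [Measure.volume_eq_prod, Measure.prod_apply_symm hSm]
    have hsl : ∀ t ∈ Set.Icc t₀ 1, ENNReal.ofReal (θ / 2) ≤
        volume ((fun y : Sp n => (y, t)) ⁻¹' S) := by
      intro t ht
      have ht0 : 0 < t := ht₀.trans_le ht.1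
      have hset : (fun y : Sp n => (y, t)) ⁻¹' S =
          (fun y => t • y) ⁻¹' ((fun y => z₀ + y) ⁻¹' (Z ∩ Metric.closedBall z₀ (t * K))) := by
        ext y
        simp only [hS, Set.mem_preimage, Set.mem_ofPred_eq, Set.mem_inter_iff, hB,
          Metric.mem_closedBall, dist_zero_right, dist_self_add_left, norm_smul,
          Real.norm_of_nonneg ht0.le, mul_le_mul_iff_right₀ ht0]
        tauto
      rw [hset, Measure.addHaar_preimage_smul _ ht0.ne', measure_preimage_add]
      have hone : (1 : ENNReal) ≤ ENNReal.ofReal |(t ^ Module.finrank ℝ (Sp n))⁻¹| := by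
        rw [ENNReal.one_le_ofReal, abs_of_nonneg (by positivity)]
        exact (one_le_inv₀ (by positivity)).2 (pow_le_one₀ ht0.le ht.2)
      refine le_trans ?_ (le_mul_of_one_le_left zero_le hone)
      have hdiff : volume (Metric.closedBall z₀ K \ Metric.closedBall z₀ (t * K)) ≤
          ENNReal.ofReal (θ / 2) := by
        have hcc : Metric.closedBall z₀ (t * K) ⊆ Metric.closedBall z₀ K :=
          Metric.closedBall_subset_closedBall (by nlinarith [ht.2])
        rw [measure_sdiff hcc Metric.isClosed_closedBall.measurableSet.nullMeasurableSet
          measure_closedBall_lt_top.ne, Measure.addHaar_closedBall_mul _ _ ht0.le hK.le,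
          Measure.addHaar_closedBall_center]
        have e1 : volume B = ENNReal.ofReal V := (ENNReal.ofReal_toReal hVtop).symm
        rw [← hB, e1, ← ENNReal.ofReal_mul (by positivity), ← ENNReal.ofReal_sub _ (by positivity)]
        refine ENNReal.ofReal_le_ofReal ?_
        refine le_trans ?_ ht₀V
        have : t₀ ^ n ≤ t ^ n := pow_le_pow_left₀ ht₀.le ht.1 n
        rw [finrank_euclideanSpace_fin]
        nlinarith
      have hle : volume Z ≤ volume (Z ∩ Metric.closedBall z₀ (t * K)) + ENNReal.ofReal (θ / 2) := by
        refine le_trans (measure_mono (t := (Z ∩ Metric.closedBall z₀ (t * K)) ∪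
          (Metric.closedBall z₀ K \ Metric.closedBall z₀ (t * K))) fun z hz => ?_)
          ((measure_union_le _ _).trans (add_le_add le_rfl hdiff))
        by_cases h : z ∈ Metric.closedBall z₀ (t * K)
        · exact Or.inl ⟨hz, h⟩
        · exact Or.inr ⟨hsub hz, h⟩
      have h2 := hvol.trans hle
      have e2 : ENNReal.ofReal θ = ENNReal.ofReal (θ / 2) + ENNReal.ofReal (θ / 2) := by
        rw [← ENNReal.ofReal_add (by positivity) (by positivity), add_halves]
      rw [e2] at h2
      exact (ENNReal.add_le_add_iff_right ENNReal.ofReal_ne_top).1 h2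
    calc ENNReal.ofReal ((1 - t₀) * (θ / 2))
        = ∫⁻ _ in Set.Icc t₀ 1, ENNReal.ofReal (θ / 2) := by
          rw [setLIntegral_const, Real.volume_Icc, mul_comm, ENNReal.ofReal_mul (by positivity)]
      _ ≤ ∫⁻ t in Set.Icc t₀ 1, volume ((fun y : Sp n => (y, t)) ⁻¹' S) :=
          setLIntegral_mono' measurableSet_Icc hsl
      _ ≤ _ := setLIntegral_le_lintegral _ _
  have hfin := hlow.trans_lt hup
  rw [show volume B = ENNReal.ofReal V from (ENNReal.ofReal_toReal hVtop).symm,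
    ← ENNReal.ofReal_mul hpos.le, ENNReal.ofReal_lt_ofReal_iff (by positivity)] at hfin
  have : θ' * V ≤ (1 - t₀) * (θ / 2) := by
    calc θ' * V ≤ (1 - t₀) * (θ / 2) / V * V := by gcongr; exact min_le_right _ _
      _ = _ := by field_simp
  linarith

end Carleman

namespace Carleman

variable {n : ℕ}

/-! ### Gaussian averages along segments -/

section Continuation

variable (A : Sp n →L[ℝ] Sp n) {U : Sp n → ℝ}

/-- The (unnormalized) Gaussian average of `U` along `A`. -/
def gavg (A : Sp n →L[ℝ] Sp n) (U : Sp n → ℝ) (z : Sp n) : ℝ := ∫ y, gw 0 y * U (z - A y)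

/-- The total mass of the Gaussian weight. -/
def gmass (n : ℕ) (c : ℝ) : ℝ := ∫ y : Sp n, gw c y

theorem gmass_pos (n : ℕ) (c : ℝ) : 0 < gmass n c := by
  refine (integral_pos_iff_support_of_nonneg (fun y => (gw_pos c y).le) (integrable_gw c)).2 ?_
  rw [show Function.support (gw c : Sp n → ℝ) = Set.univ from
    Set.eq_univ_of_forall fun y => (gw_pos c y).ne']
  exact Measure.measure_univ_pos.2 (NeZero.ne _)

theorem continuous_smear_one (c : ℝ) {F : Sp n → ℝ} (hF : CC F) :
    Continuous (fun z => ∫ y, gw c y * F (z - A y)) := by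
  have := (continuous_smear A c hF).comp (by fun_prop : Continuous fun z : Sp n => ((1 : ℝ), z))
  simpa [Function.comp_def] using this

theorem continuous_smear_time (c : ℝ) {F : Sp n → ℝ} (hF : CC F) (z : Sp n) :
    Continuous (fun s : ℝ => ∫ y, gw c y * F (z - s • A y)) :=
  (continuous_smear A c hF).comp (by fun_prop : Continuous fun s : ℝ => (s, z))

theorem gavg_sub_eq (hU : ContDiff ℝ 2 U) (hc : HasCompactSupport U) (z : Sp n) :
    gavg A U z - gmass n 0 * U z =
      ∫ s in (0 : ℝ)..1, s * ∫ y, gw 0 y * heatOp A U (z - s • A y) := by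
  have hcont : Continuous (fun s : ℝ => s * ∫ y, gw 0 y * heatOp A U (z - s • A y)) :=
    continuous_id.mul (continuous_smear_time A 0 (cc_heatOp A hU hc) z)
  have h := intervalIntegral.integral_eq_sub_of_hasDerivAt
    (fun s _ => hasDerivAt_heat A hU hc z s) (hcont.intervalIntegrable 0 1)
  rw [h]
  simp only [one_smul, zero_smul, sub_zero, gavg, gmass]
  rw [integral_mul_const]

theorem sq_gavg_sub_le (hU : ContDiff ℝ 2 U) (hc : HasCompactSupport U) (z : Sp n) :
    (gavg A U z - gmass n 0 * U z) ^ 2 ≤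
      ∫ s in Set.Ioc (0 : ℝ) 1, (∫ y, gw 0 y * heatOp A U (z - s • A y)) ^ 2 := by
  have hI : Continuous (fun s : ℝ => ∫ y, gw 0 y * heatOp A U (z - s • A y)) :=
    continuous_smear_time A 0 (cc_heatOp A hU hc) z
  have hIs : Continuous (fun s : ℝ => s * ∫ y, gw 0 y * heatOp A U (z - s • A y)) :=
    continuous_id.mul hI
  rw [gavg_sub_eq A hU hc, intervalIntegral.integral_of_le zero_le_one]
  have hic : ∀ f : ℝ → ℝ, Continuous f → IntegrableOn f (Set.Ioc (0 : ℝ) 1) := fun f hf =>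
    (hf.integrableOn_Icc (a := 0) (b := 1)).mono_set Set.Ioc_subset_Icc_self
  have h := sq_integral_mul_le (μ := volume.restrict (Set.Ioc (0 : ℝ) 1)) (κ := fun _ => 1)
    (f := fun s => s * ∫ y, gw 0 y * heatOp A U (z - s • A y)) (by simp)
    (hic _ continuous_const)
    (by simp only [one_mul]; exact hic _ hIs)
    (by simp only [one_mul]; exact hic _ (hIs.pow 2))
  simp only [one_mul] at h
  refine h.trans ?_
  have h1 : ∫ _ in Set.Ioc (0 : ℝ) 1, (1 : ℝ) = 1 := by simp
  rw [h1, one_mul]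
  refine setIntegral_mono_on (hic _ (hIs.pow 2)) (hic _ (hI.pow 2))
    measurableSet_Ioc fun s hs => ?_
  rw [mul_pow]
  refine mul_le_of_le_one_left (sq_nonneg _) (pow_le_one₀ hs.1.le hs.2)

theorem sq_smear_le (c : ℝ) {F : Sp n → ℝ} (hF : CC F) (z : Sp n) (s : ℝ) :
    (∫ y, gw c y * F (z - s • A y)) ^ 2 ≤ gmass n c * ∫ y, gw c y * F (z - s • A y) ^ 2 := by
  obtain ⟨C, hC0, hC⟩ := hF.exists_bound
  have hl : Continuous fun y => F (z - s • A y) := hF.1.comp (by fun_prop)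
  refine sq_integral_mul_le (fun y => (gw_pos c y).le) (integrable_gw c)
    (integrable_gw_mul_bdd hl fun y => hC _)
    (integrable_gw_mul_bdd (hl.pow 2) (C := C ^ 2) fun y => ?_)
  rw [abs_pow]; exact pow_le_pow_left₀ (abs_nonneg _) (hC _) 2

theorem setIntegral_sq_smear_le {α : ℝ} (hA : ‖A‖ ≤ α) (c M R : ℝ) (hM : 0 ≤ M)
    {F : Sp n → ℝ} (hF : CC F) {s : ℝ} (hs : s ∈ Set.Icc (0 : ℝ) 1) :
    ∫ z in Metric.closedBall (0 : Sp n) R, (∫ y, gw c y * F (z - s • A y)) ^ 2 ≤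
      gmass n c * (Real.exp (M * R) * gmass n (c + M * α)) *
        ∫ z, Real.exp (-M * ‖z‖) * F z ^ 2 := by
  have h := setIntegral_smear_le A hA c M R hM hF.sq (fun x => sq_nonneg _) hs
  have hc1 : Continuous fun z => ∫ y, gw c y * F (z - s • A y) :=
    (continuous_smear A c hF).comp (by fun_prop : Continuous fun z : Sp n => (s, z))
  have hc2 : Continuous fun z => ∫ y, gw c y * F (z - s • A y) ^ 2 :=
    (continuous_smear A c hF.sq).comp (by fun_prop : Continuous fun z : Sp n => (s, z))
  have hcb := isCompact_closedBall (0 : Sp n) R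
  calc ∫ z in Metric.closedBall (0 : Sp n) R, (∫ y, gw c y * F (z - s • A y)) ^ 2
      ≤ ∫ z in Metric.closedBall (0 : Sp n) R, gmass n c * ∫ y, gw c y * F (z - s • A y) ^ 2 :=
        setIntegral_mono_on ((hc1.pow 2).continuousOn.integrableOn_compact hcb)
          ((hc2.const_mul _).continuousOn.integrableOn_compact hcb)
          Metric.isClosed_closedBall.measurableSet fun z _ => sq_smear_le A c hF z s
    _ ≤ _ := by
        rw [integral_const_mul, mul_assoc (gmass n c)]
        exact mul_le_mul_of_nonneg_left h (gmass_pos n c).le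

/-- Up to the total mass, `gavg` is the heat flow of `U` at time one, so its defect is a time
integral of averages of `heatOp A U`. The Gaussian tails reach beyond the ball, hence the
exponential weight over the whole space. -/
theorem setIntegral_sq_gavg_sub_le {α : ℝ} (hA : ‖A‖ ≤ α) (M R : ℝ) (hM : 0 ≤ M)
    (hU : ContDiff ℝ 2 U) (hc : HasCompactSupport U) :
    ∫ z in Metric.closedBall (0 : Sp n) R, (gavg A U z - gmass n 0 * U z) ^ 2 ≤
      gmass n 0 * (Real.exp (M * R) * gmass n (0 + M * α)) *
        ∫ z, Real.exp (-M * ‖z‖) * heatOp A U z ^ 2 := by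
  have hF := cc_heatOp A hU hc
  have hcont := continuous_smear A 0 hF
  have hcb := isCompact_closedBall (0 : Sp n) R
  set S := Metric.closedBall (0 : Sp n) R
  have hgc : Continuous fun z => (gavg A U z - gmass n 0 * U z) ^ 2 :=
    ((continuous_smear_one A 0 ⟨hU.continuous, hc⟩).sub
      (continuous_const.mul hU.continuous)).pow 2
  have hjoint : Integrable (Function.uncurry fun (z : Sp n) (s : ℝ) =>
      (∫ y, gw 0 y * heatOp A U (z - s • A y)) ^ 2)
      ((volume.restrict S).prod (volume.restrict (Set.Ioc (0 : ℝ) 1))) := by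
    rw [Measure.prod_restrict]
    have : Continuous (Function.uncurry fun (z : Sp n) (s : ℝ) =>
        (∫ y, gw 0 y * heatOp A U (z - s • A y)) ^ 2) :=
      (hcont.comp (continuous_snd.prodMk continuous_fst)).pow 2
    exact (this.continuousOn.integrableOn_compact (hcb.prod isCompact_Icc)).mono_set
      (Set.prod_mono subset_rfl Set.Ioc_subset_Icc_self)
  calc ∫ z in S, (gavg A U z - gmass n 0 * U z) ^ 2
      ≤ ∫ z in S, ∫ s in Set.Ioc (0 : ℝ) 1, (∫ y, gw 0 y * heatOp A U (z - s • A y)) ^ 2 :=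
        setIntegral_mono_on (hgc.continuousOn.integrableOn_compact hcb) hjoint.integral_prod_left
          Metric.isClosed_closedBall.measurableSet fun z _ => sq_gavg_sub_le A hU hc z
    _ = ∫ s in Set.Ioc (0 : ℝ) 1, ∫ z in S, (∫ y, gw 0 y * heatOp A U (z - s • A y)) ^ 2 :=
        integral_integral_swap hjoint
    _ ≤ ∫ s in Set.Ioc (0 : ℝ) 1, gmass n 0 * (Real.exp (M * R) * gmass n (0 + M * α)) *
        ∫ z, Real.exp (-M * ‖z‖) * heatOp A U z ^ 2 :=
        setIntegral_mono_on hjoint.integral_prod_right (integrableOn_const (by simp))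
          measurableSet_Ioc fun s hs =>
            setIntegral_sq_smear_le A hA 0 M R hM hF ⟨hs.1.le, hs.2⟩
    _ = _ := by simp

/-- Shift the Gaussian by `t • b` and complete the square. All dependence on `t` is then in `exp (-t
⟨y, b⟩)`, an entire function of `t`, which makes polynomial approximation possible. -/
theorem gavg_line {z₀ b : Sp n} (t : ℝ) :
    gavg A U (z₀ + t • A b) * Real.exp (t ^ 2 * ‖b‖ ^ 2 / 2) =
      ∫ y, gw 0 y * (Real.exp (t * -(inner ℝ y b)) * U (z₀ - A y)) := by
  unfold gavg
  rw [← integral_add_right_eq_self (fun y => gw 0 y * U (z₀ + t • A b - A y)) (t • b),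
    ← integral_mul_const]
  congr 1; ext y
  have e1 : z₀ + t • A b - A (y + t • b) = z₀ - A y := by rw [map_add, map_smul]; abel
  rw [e1]
  have e2 : gw 0 (y + t • b) * Real.exp (t ^ 2 * ‖b‖ ^ 2 / 2) =
      gw 0 y * Real.exp (t * -(inner ℝ y b)) := by
    unfold gw
    rw [← Real.exp_add, ← Real.exp_add, norm_add_sq_real, inner_smul_right, norm_smul, mul_pow,
      Real.norm_eq_abs, sq_abs]
    congr 1; ring
  calc gw 0 (y + t • b) * U (z₀ - A y) * Real.exp (t ^ 2 * ‖b‖ ^ 2 / 2)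
      = (gw 0 (y + t • b) * Real.exp (t ^ 2 * ‖b‖ ^ 2 / 2)) * U (z₀ - A y) := by ring
    _ = _ := by rw [e2]; ring

/-- Along a segment the Gaussian average is a polynomial up to a small error. -/
theorem exists_polynomial_gavg (hU : CC U) {z₀ b : Sp n} {β ρ : ℝ} (hb : ‖b‖ ≤ β) (hρ : 1 ≤ ρ)
    (m : ℕ) : ∃ p : Polynomial ℝ, p.degree < m ∧ ∀ t ∈ Set.Icc (0 : ℝ) 1,
      |gavg A U (z₀ + t • A b) * Real.exp (t ^ 2 * ‖b‖ ^ 2 / 2) - p.eval t| ≤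
        (ρ⁻¹) ^ m * ∫ y, gw (ρ * β) y * |U (z₀ - A y)| := by
  obtain ⟨C, hC0, hC⟩ := hU.exists_bound
  have hUl : Continuous fun y => U (z₀ - A y) := hU.1.comp (by fun_prop)
  have hinc : Continuous fun y : Sp n => inner ℝ y b := continuous_id.inner continuous_const
  have hβ : 0 ≤ β := (norm_nonneg _).trans hb
  have hin : ∀ y : Sp n, |-(inner ℝ y b)| ≤ β * ‖y‖ := fun y => by
    rw [abs_neg]
    exact (abs_real_inner_le_norm y b).trans (by rw [mul_comm]; gcongr)
  -- The Taylor coefficients in `t`, obtained by expanding the exponential under the integral.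
  set cf : ℕ → ℝ := fun k =>
    ∫ y, gw 0 y * ((-(inner ℝ y b)) ^ k / k.factorial * U (z₀ - A y)) with hcf
  have hint : ∀ k : ℕ, Integrable (fun y : Sp n =>
      gw 0 y * ((-(inner ℝ y b)) ^ k / k.factorial * U (z₀ - A y))) := fun k => by
    refine integrable_gw_mul (C := C) (d := β) (((hinc.neg.pow k).div_const _).mul hUl) fun y => ?_
    rw [abs_mul, mul_comm C]
    refine mul_le_mul ?_ (hC _) (abs_nonneg _) (Real.exp_pos _).le
    rw [abs_div, abs_pow, Nat.abs_cast]
    calc |-(inner ℝ y b)| ^ k / (k.factorial : ℝ) ≤ (β * ‖y‖) ^ k / k.factorial := by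
          gcongr; exact hin y
      _ ≤ _ := Real.pow_div_factorial_le_exp _ (by positivity) k
  refine ⟨∑ k ∈ Finset.range m, Polynomial.monomial k (cf k), ?_, fun t ht => ?_⟩
  · refine Polynomial.mem_degreeLT.1 (Submodule.sum_mem _ fun k hk => Polynomial.mem_degreeLT.2 ?_)
    exact (Polynomial.degree_monomial_le _ _).trans_lt (by exact_mod_cast Finset.mem_range.1 hk)
  · rw [gavg_line A]
    have hev : (∑ k ∈ Finset.range m, Polynomial.monomial k (cf k)).eval t =
        ∫ y, gw 0 y * ((∑ k ∈ Finset.range m, (t * -(inner ℝ y b)) ^ k / k.factorial)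
          * U (z₀ - A y)) := by
      rw [Polynomial.eval_finsetSum]
      have : ∀ y : Sp n, gw 0 y * ((∑ k ∈ Finset.range m, (t * -(inner ℝ y b)) ^ k / k.factorial)
          * U (z₀ - A y)) = ∑ k ∈ Finset.range m,
            (gw 0 y * ((-(inner ℝ y b)) ^ k / k.factorial * U (z₀ - A y))) * t ^ k := fun y => by
        rw [Finset.sum_mul, Finset.mul_sum]
        refine Finset.sum_congr rfl fun k _ => ?_
        rw [mul_pow]; ring
      simp_rw [this]
      rw [integral_finsetSum _ fun k _ => (hint k).mul_const _]
      refine Finset.sum_congr rfl fun k _ => ?_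
      rw [integral_mul_const, Polynomial.eval_monomial]
    have hi1 : Integrable (fun y : Sp n =>
        gw 0 y * (Real.exp (t * -(inner ℝ y b)) * U (z₀ - A y))) := by
      refine integrable_gw_mul (C := C) (d := β)
        ((Real.continuous_exp.comp (continuous_const.mul hinc.neg)).mul hUl) fun y => ?_
      rw [abs_mul, mul_comm C, Real.abs_exp]
      refine mul_le_mul (Real.exp_le_exp.2 ?_) (hC _) (abs_nonneg _) (Real.exp_pos _).le
      refine (le_abs_self _).trans ?_
      rw [abs_mul, abs_of_nonneg ht.1]
      exact (mul_le_of_le_one_left (abs_nonneg _) ht.2).trans (hin y)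
    have hi2 : Integrable (fun y : Sp n =>
        gw 0 y * ((∑ k ∈ Finset.range m, (t * -(inner ℝ y b)) ^ k / k.factorial)
          * U (z₀ - A y))) := by
      refine (integrable_finsetSum (Finset.range m) fun k _ => (hint k).mul_const (t ^ k)).congr
        (.of_forall fun y => ?_)
      simp only
      rw [Finset.sum_mul, Finset.mul_sum]
      refine Finset.sum_congr rfl fun k _ => ?_
      rw [mul_pow]; ring
    rw [hev, ← integral_sub hi1 hi2, ← integral_const_mul]
    refine (abs_integral_le_integral_abs).trans ?_
    refine integral_mono_of_nonneg (.of_forall fun y => abs_nonneg _) ?_ (.of_forall fun y => ?_)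
    · exact (integrable_gw_mul_bdd hUl.abs (C := C) fun y => by rw [abs_abs]; exact hC _).const_mul _
    · simp only
      rw [← mul_sub, ← sub_mul, abs_mul, abs_mul, abs_of_pos (gw_pos 0 y)]
      have hx : |t * -(inner ℝ y b)| ≤ β * ‖y‖ := by
        rw [abs_mul, abs_of_nonneg ht.1]
        exact (mul_le_of_le_one_left (abs_nonneg _) ht.2).trans (hin y)
      have := abs_exp_sub_sum_le hρ hx m
      calc gw 0 y * (|Real.exp (t * -(inner ℝ y b)) -
            ∑ k ∈ Finset.range m, (t * -(inner ℝ y b)) ^ k / k.factorial| * |U (z₀ - A y)|)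
          ≤ gw 0 y * (((ρ⁻¹) ^ m * Real.exp (ρ * (β * ‖y‖))) * |U (z₀ - A y)|) := by
            have := (gw_pos 0 y).le
            gcongr
        _ = (ρ⁻¹) ^ m * ((gw 0 y * Real.exp ((ρ * β) * ‖y‖)) * |U (z₀ - A y)|) := by
            rw [mul_assoc ρ β]; ring
        _ = _ := by rw [gw_mul_exp, zero_add]

end Continuation

end Carleman

namespace Carleman

variable {n : ℕ}

/-- Pointwise form of the continuation estimate: the Gaussian average of a function which vanishes
on a set of positive measure. -/
theorem sq_gavg_le {α K θ θ' : ℝ} (hθ : 0 < θ) (hθ' : 0 < θ') (hθ'1 : θ' ≤ 1)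
    (hseg : ∀ (Z : Set (Sp n)) (z₀ : Sp n), MeasurableSet Z →
      Z ⊆ Metric.closedBall z₀ (K + 1) → ENNReal.ofReal (θ / 2) ≤ volume Z →
      ∃ y : Sp n, ‖y‖ ≤ K + 1 ∧
        ENNReal.ofReal θ' ≤ volume {t : ℝ | t ∈ Set.Icc (0 : ℝ) 1 ∧ z₀ + t • y ∈ Z})
    {A A' : Sp n →L[ℝ] Sp n} (hA' : ‖A'‖ ≤ α) (hAA : ∀ x, A (A' x) = x) {U : Sp n → ℝ}
    (hU : CC U) (hvol : ENNReal.ofReal θ ≤ volume {z ∈ Metric.closedBall (0 : Sp n) K | U z = 0})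
    {m : ℕ} (hm : 0 < m) {z₀ : Sp n} (hz₀ : ‖z₀‖ ≤ 1) :
    gavg A U z₀ ^ 2 ≤
      2 * ((12 / θ') ^ m * Real.exp ((α * (K + 1)) ^ 2 / 2)) ^ 2 * (2 / θ) *
        (∫ z in Metric.closedBall (0 : Sp n) K, (gavg A U z - gmass n 0 * U z) ^ 2)
      + 8 * (1 / 4) ^ m *
        (∫ y, gw (24 / θ' * (α * (K + 1))) y * |U (z₀ - A y)|) ^ 2 := by
  set I := ∫ z in Metric.closedBall (0 : Sp n) K, (gavg A U z - gmass n 0 * U z) ^ 2 with hI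
  set N := ∫ y, gw (24 / θ' * (α * (K + 1))) y * |U (z₀ - A y)| with hN
  have hI0 : 0 ≤ I := integral_nonneg fun _ => sq_nonneg _
  have hN0 : 0 ≤ N := integral_nonneg fun y => mul_nonneg (gw_pos _ y).le (abs_nonneg _)
  have hgc : Continuous (gavg A U) := continuous_smear_one A 0 hU
  have hDc : Continuous fun z => (gavg A U z - gmass n 0 * U z) ^ 2 :=
    (hgc.sub (continuous_const.mul hU.1)).pow 2
  set E := Real.exp ((α * (K + 1)) ^ 2 / 2) with hE
  set Cm := (12 / θ') ^ m with hCm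
  have hCm1 : 0 ≤ Cm := by positivity
  -- it suffices to argue with an arbitrary level above the mean value
  have key : ∀ ε : ℝ, 0 < ε → gavg A U z₀ ^ 2 ≤
      2 * (Cm * E) ^ 2 * (2 / θ) * (I + ε) + 8 * (1 / 4) ^ m * N ^ 2 := by
    intro ε hε
    -- Chebyshev: the defect exceeds this level on a set of measure at most `θ / 2`, so half of the
    -- zero set remains. On it `gavg A U` is the defect itself, because `U` vanishes.
    set lev := (2 / θ) * (I + ε) with hlev
    have hlev0 : 0 < lev := by positivity
    set Z₀ := {z ∈ Metric.closedBall (0 : Sp n) K | U z = 0} with hZ₀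
    set Z := {z ∈ Z₀ | gavg A U z ^ 2 ≤ lev} with hZ
    have hZ₀m : MeasurableSet Z₀ := Metric.isClosed_closedBall.measurableSet.inter
      (hU.1.measurable (measurableSet_singleton 0))
    have hZm : MeasurableSet Z := hZ₀m.inter ((hgc.pow 2).measurable measurableSet_Iic)
    have hZvol : ENNReal.ofReal (θ / 2) ≤ volume Z := by
      have hmk : volume {z ∈ Metric.closedBall (0 : Sp n) K |
          lev ≤ (gavg A U z - gmass n 0 * U z) ^ 2} ≤ ENNReal.ofReal (θ / 2) := by
        have h1 := mul_meas_ge_le_integral_of_nonneg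
          (μ := volume.restrict (Metric.closedBall (0 : Sp n) K))
          (f := fun z => (gavg A U z - gmass n 0 * U z) ^ 2) (.of_forall fun z => sq_nonneg _)
          (hDc.continuousOn.integrableOn_compact (isCompact_closedBall _ _)) lev
        rw [← hI, measureReal_restrict_apply
          (show MeasurableSet {z | lev ≤ (gavg A U z - gmass n 0 * U z) ^ 2} from
            hDc.measurable measurableSet_Ici)] at h1
        have h2 : volume.real ({z | lev ≤ (gavg A U z - gmass n 0 * U z) ^ 2} ∩
            Metric.closedBall (0 : Sp n) K) ≤ θ / 2 := by
          have h3 : lev * volume.real ({z | lev ≤ (gavg A U z - gmass n 0 * U z) ^ 2} ∩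
            Metric.closedBall (0 : Sp n) K) ≤ lev * (θ / 2) := by
            refine h1.trans ?_
            rw [hlev]; field_simp; linarith
          exact le_of_mul_le_mul_left h3 hlev0
        have hfin : volume ({z | lev ≤ (gavg A U z - gmass n 0 * U z) ^ 2} ∩
            Metric.closedBall (0 : Sp n) K) ≠ ⊤ :=
          ((measure_mono Set.inter_subset_right).trans_lt measure_closedBall_lt_top).ne
        have h4 := ENNReal.ofReal_le_ofReal h2
        rw [measureReal_def, ENNReal.ofReal_toReal hfin] at h4
        refine le_trans (measure_mono ?_) h4
        exact fun z hz => ⟨hz.2, hz.1⟩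
      have hle : volume Z₀ ≤ volume Z + ENNReal.ofReal (θ / 2) := by
        refine le_trans (measure_mono fun z hz => ?_)
          ((measure_union_le _ _).trans (add_le_add le_rfl hmk))
        rcases le_total (gavg A U z ^ 2) lev with h | h
        · exact Or.inl ⟨hz, h⟩
        · refine Or.inr ⟨hz.1, ?_⟩
          rw [hz.2, mul_zero, sub_zero]; exact h
      have h2 := hvol.trans hle
      have e2 : ENNReal.ofReal θ = ENNReal.ofReal (θ / 2) + ENNReal.ofReal (θ / 2) := by
        rw [← ENNReal.ofReal_add (by positivity) (by positivity), add_halves]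
      rw [e2] at h2
      exact (ENNReal.add_le_add_iff_right ENNReal.ofReal_ne_top).1 h2
    have hZsub : Z ⊆ Metric.closedBall z₀ (K + 1) := fun z hz => by
      have h1 : ‖z‖ ≤ K := by simpa using hz.1.1
      rw [Metric.mem_closedBall, dist_eq_norm]
      exact (norm_sub_le _ _).trans (add_le_add h1 hz₀)
    obtain ⟨y, hy, hT⟩ := hseg Z z₀ hZm hZsub hZvol
    set T := {t : ℝ | t ∈ Set.Icc (0 : ℝ) 1 ∧ z₀ + t • y ∈ Z} with hTdef
    set b := A' y with hb
    have hα : 0 ≤ α := (norm_nonneg _).trans hA'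
    have hbn : ‖b‖ ≤ α * (K + 1) :=
      (A'.le_opNorm y).trans (mul_le_mul hA' hy (norm_nonneg _) hα)
    -- The approximation rate `24 / θ'` is twice the Remez base `12 / θ'`, so the amplified
    -- approximation error is still of size `(1 / 2) ^ m`.
    have hρ : (1 : ℝ) ≤ 24 / θ' := by rw [le_div_iff₀ hθ']; linarith
    obtain ⟨p, hpdeg, hp⟩ := exists_polynomial_gavg A hU (z₀ := z₀) hbn hρ m
    rw [hAA, ← hN] at hp
    set r := ((24 / θ')⁻¹) ^ m with hr
    have hr0 : 0 ≤ r := by positivity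
    have hrC : Cm * r = (1 / 2) ^ m := by
      rw [hCm, hr, ← mul_pow]; congr 1; field_simp; norm_num
    have hr2 : r ≤ (1 / 2) ^ m := by
      rw [hr]; refine pow_le_pow_left₀ (by positivity) ?_ m
      rw [inv_div, div_le_div_iff₀ (by norm_num) (by norm_num)]; linarith
    have hsl : 0 ≤ Real.sqrt lev := Real.sqrt_nonneg _
    have hE0 : 0 < E := Real.exp_pos _
    have hpT : ∀ t ∈ T, |p.eval t| ≤ Real.sqrt lev * E + r * N := by
      intro t ht
      have h1 := hp t ht.1
      have h2 : |gavg A U (z₀ + t • y)| ≤ Real.sqrt lev := Real.abs_le_sqrt ht.2.2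
      have h3 : Real.exp (t ^ 2 * ‖b‖ ^ 2 / 2) ≤ E := by
        refine Real.exp_le_exp.2 ?_
        have : t ^ 2 * ‖b‖ ^ 2 ≤ 1 * (α * (K + 1)) ^ 2 :=
          mul_le_mul (pow_le_one₀ ht.1.1 ht.1.2) (pow_le_pow_left₀ (norm_nonneg _) hbn 2)
            (sq_nonneg _) zero_le_one
        linarith
      have h4 : |gavg A U (z₀ + t • y) * Real.exp (t ^ 2 * ‖b‖ ^ 2 / 2)| ≤ Real.sqrt lev * E := by
        rw [abs_mul, Real.abs_exp]
        exact mul_le_mul h2 h3 (Real.exp_pos _).le hsl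
      have h5 := abs_sub_abs_le_abs_sub (p.eval t)
        (gavg A U (z₀ + t • y) * Real.exp (t ^ 2 * ‖b‖ ^ 2 / 2))
      rw [abs_sub_comm] at h5
      linarith
    have h0 := abs_eval_zero_le hm hpdeg (T := T) (fun t ht => ht.1) hθ' hT (by positivity) hpT
    have h00 := hp 0 ⟨le_rfl, zero_le_one⟩
    simp only [zero_smul, add_zero, ne_eq, OfNat.ofNat_ne_zero, not_false_eq_true, zero_pow,
      zero_mul, zero_div, Real.exp_zero, mul_one] at h00
    have hfin : |gavg A U z₀| ≤ Cm * E * Real.sqrt lev + 2 * (1 / 2) ^ m * N := by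
      have h6 := abs_sub_abs_le_abs_sub (gavg A U z₀) (p.eval 0)
      have h7 : Cm * (Real.sqrt lev * E + r * N) = Cm * E * Real.sqrt lev + (1 / 2) ^ m * N := by
        rw [← hrC]; ring
      rw [h7] at h0
      have h8 : r * N ≤ (1 / 2) ^ m * N := mul_le_mul_of_nonneg_right hr2 hN0
      linarith
    have hsq : gavg A U z₀ ^ 2 ≤ (Cm * E * Real.sqrt lev + 2 * (1 / 2) ^ m * N) ^ 2 := by
      rw [← sq_abs]; exact pow_le_pow_left₀ (abs_nonneg _) hfin 2
    have hq : ((1 / 2 : ℝ) ^ m) ^ 2 = (1 / 4) ^ m := by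
      rw [← pow_mul, mul_comm, pow_mul]; norm_num
    have hl2 : Real.sqrt lev ^ 2 = lev := Real.sq_sqrt hlev0.le
    calc gavg A U z₀ ^ 2 ≤ (Cm * E * Real.sqrt lev + 2 * (1 / 2) ^ m * N) ^ 2 := hsq
      _ ≤ 2 * (Cm * E * Real.sqrt lev) ^ 2 + 2 * (2 * (1 / 2) ^ m * N) ^ 2 := by
          nlinarith [sq_nonneg (Cm * E * Real.sqrt lev - 2 * (1 / 2) ^ m * N)]
      _ = 2 * (Cm * E) ^ 2 * (Real.sqrt lev ^ 2) + 8 * (((1 / 2 : ℝ) ^ m) ^ 2) * N ^ 2 := by ring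
      _ = _ := by rw [hl2, hq, hlev]; ring
  -- The slack `ε` kept the level positive even when `I = 0`. It is now removed.
  refine le_of_forall_pos_le_add fun ε hε => ?_
  set c := 2 * (Cm * E) ^ 2 * (2 / θ) with hc
  have hc0 : 0 ≤ c := by positivity
  have := key (ε / (c + 1)) (by positivity)
  have h2 : c * (ε / (c + 1)) ≤ ε := by
    rw [← mul_div_assoc, div_le_iff₀ (by positivity)]; nlinarith
  nlinarith

/-- Functions vanishing on a set of positive measure are controlled, at unit scale, by a constant
coefficient operator, up to a small multiple of a weighted norm. -/
theorem continuation_estimate (n : ℕ) {α K θ M δ : ℝ} (hK : 1 ≤ K) (hθ : 0 < θ) (hM : 0 ≤ M)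
    (hδ : 0 < δ) :
    ∃ C : ℝ, 0 ≤ C ∧ ∀ A A' : Sp n →L[ℝ] Sp n, ‖A‖ ≤ α → ‖A'‖ ≤ α → (∀ x, A (A' x) = x) →
      ∀ U : Sp n → ℝ, ContDiff ℝ 2 U → HasCompactSupport U →
        ENNReal.ofReal θ ≤ volume {z ∈ Metric.closedBall (0 : Sp n) K | U z = 0} →
        ∫ z in Metric.closedBall (0 : Sp n) 1, U z ^ 2 ≤
          δ * (∫ z, Real.exp (-M * ‖z‖) * U z ^ 2)
            + C * ∫ z, Real.exp (-M * ‖z‖) * heatOp A U z ^ 2 := by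
  obtain ⟨θ', hθ', hθ'1, hseg⟩ := exists_segment (n := n) (K := K + 1) (θ := θ / 2)
    (by linarith) (by linarith)
  set c := 24 / θ' * (α * (K + 1)) with hcdef
  set G := gmass n 0 with hG
  have hG0 : 0 < G := gmass_pos n 0
  set CN := gmass n c * (Real.exp (M * 1) * gmass n (c + M * α)) with hCN
  have hCN0 : 0 ≤ CN := by
    have := gmass_pos n c; have := gmass_pos n (c + M * α); positivity
  -- The degree is fixed here so that the approximation error costs at most `δ` times the weighted
  -- norm. It depends on neither the operator nor the function. The Remez inequality needs a
  -- positive degree bound, hence `m₀ + 1`.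
  obtain ⟨m₀, hm₀⟩ : ∃ m₀ : ℕ, (1 / 4 : ℝ) ^ m₀ < δ * G ^ 2 / (16 * (CN + 1)) :=
    exists_pow_lt_of_lt_one (by positivity) (by norm_num)
  set m := m₀ + 1 with hm
  have hmδ : 16 * (1 / 4 : ℝ) ^ m * CN ≤ δ * G ^ 2 := by
    have h1 : (1 / 4 : ℝ) ^ m ≤ (1 / 4 : ℝ) ^ m₀ :=
      pow_le_pow_of_le_one (by norm_num) (by norm_num) (by omega)
    have h2 := h1.trans hm₀.le
    rw [le_div_iff₀ (by positivity)] at h2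
    have : 0 ≤ (1 / 4 : ℝ) ^ m := by positivity
    nlinarith
  set C₁ := 2 * ((12 / θ') ^ m * Real.exp ((α * (K + 1)) ^ 2 / 2)) ^ 2 * (2 / θ) with hC₁
  have hC₁0 : 0 ≤ C₁ := by positivity
  set V := volume.real (Metric.closedBall (0 : Sp n) 1) with hV
  have hV0 : 0 ≤ V := measureReal_nonneg
  set CI := G * (Real.exp (M * K) * gmass n (0 + M * α)) with hCI
  have hCI0 : 0 ≤ CI := by
    have := gmass_pos n (0 + M * α); positivity
  refine ⟨(2 * C₁ * V + 2) * CI / G ^ 2, by positivity,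
    fun A A' hA hA' hAA U hU hc hvol => ?_⟩
  have hUc : CC U := ⟨hU.continuous, hc⟩
  have hUabs : CC fun z => |U z| := ⟨hU.continuous.abs, hc.comp_left abs_zero⟩
  have hgc : Continuous (gavg A U) := continuous_smear_one A 0 hUc
  have hDc : Continuous fun z => (gavg A U z - G * U z) ^ 2 :=
    (hgc.sub (continuous_const.mul hU.continuous)).pow 2
  set I := ∫ z in Metric.closedBall (0 : Sp n) K, (gavg A U z - G * U z) ^ 2 with hI
  set X := ∫ z, Real.exp (-M * ‖z‖) * U z ^ 2
  set Y := ∫ z, Real.exp (-M * ‖z‖) * heatOp A U z ^ 2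
  have hIY : I ≤ CI * Y := setIntegral_sq_gavg_sub_le A hA M K hM hU hc
  have hI0 : 0 ≤ I := integral_nonneg fun _ => sq_nonneg _
  set S := Metric.closedBall (0 : Sp n) 1 with hS
  have hcs : IsCompact S := isCompact_closedBall _ _
  have hSm : MeasurableSet S := Metric.isClosed_closedBall.measurableSet
  have hi : ∀ f : Sp n → ℝ, Continuous f → IntegrableOn f S := fun f hf =>
    hf.continuousOn.integrableOn_compact hcs
  have hNc : Continuous fun z => (∫ y, gw c y * |U (z - A y)|) ^ 2 :=
    (continuous_smear_one A c hUabs).pow 2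
  have hNX : ∫ z in S, (∫ y, gw c y * |U (z - A y)|) ^ 2 ≤ CN * X := by
    have := setIntegral_sq_smear_le A hA c M 1 hM hUabs (s := 1) ⟨zero_le_one, le_rfl⟩
    simp only [one_smul, sq_abs] at this
    exact this
  have hD1 : ∫ z in S, (gavg A U z - G * U z) ^ 2 ≤ I :=
    setIntegral_mono_set (hDc.continuousOn.integrableOn_compact (isCompact_closedBall _ _))
      (.of_forall fun z => sq_nonneg _) (Metric.closedBall_subset_closedBall hK).eventuallyLE
  -- `G U` is split into the defect `G U - gavg A U` and the average, which is bounded pointwise by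
  -- `sq_gavg_le`.
  have hpt : ∀ z ∈ S, G ^ 2 * U z ^ 2 ≤ 2 * (gavg A U z - G * U z) ^ 2 +
      (2 * C₁ * I + 16 * (1 / 4) ^ m * (∫ y, gw c y * |U (z - A y)|) ^ 2) := by
    intro z hz
    have h1 := sq_gavg_le hθ hθ' hθ'1 hseg hA' hAA hUc hvol (m := m) (by omega) (z₀ := z)
      (by simpa [hS] using hz)
    rw [← hG, ← hI, ← hC₁, ← hcdef] at h1
    nlinarith [sq_nonneg (2 * gavg A U z - G * U z)]
  have hint : G ^ 2 * ∫ z in S, U z ^ 2 ≤ 2 * I + (2 * C₁ * I * V + 16 * (1 / 4) ^ m * (CN * X)) := by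
    rw [← integral_const_mul]
    have i1 : IntegrableOn (fun z => 2 * (gavg A U z - G * U z) ^ 2) S :=
      hi _ (continuous_const.mul hDc)
    have i2 : IntegrableOn (fun _ => 2 * C₁ * I) S := hi _ continuous_const
    have i3 : IntegrableOn (fun z => 16 * (1 / 4 : ℝ) ^ m * (∫ y, gw c y * |U (z - A y)|) ^ 2) S :=
      hi _ (continuous_const.mul hNc)
    have i23 : IntegrableOn (fun z => 2 * C₁ * I +
        16 * (1 / 4 : ℝ) ^ m * (∫ y, gw c y * |U (z - A y)|) ^ 2) S := i2.add i3
    refine (setIntegral_mono_on (hi _ (continuous_const.mul (hU.continuous.pow 2)))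
      (i1.add i23) hSm hpt).trans ?_
    simp only [Pi.add_apply]
    rw [integral_add i1 i23, integral_add i2 i3,
      integral_const_mul, setIntegral_const, ← hV, smul_eq_mul, integral_const_mul]
    have h1 : 16 * (1 / 4 : ℝ) ^ m * ∫ z in S, (∫ y, gw c y * |U (z - A y)|) ^ 2 ≤
        16 * (1 / 4) ^ m * (CN * X) := mul_le_mul_of_nonneg_left hNX (by positivity)
    linarith
  have hX0 : 0 ≤ X := integral_nonneg fun _ => by positivity
  have hG2 : 0 < G ^ 2 := by positivity
  refine le_of_mul_le_mul_left ?_ hG2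
  calc G ^ 2 * ∫ z in S, U z ^ 2 ≤ 2 * I + (2 * C₁ * I * V + 16 * (1 / 4) ^ m * (CN * X)) := hint
    _ = (2 * C₁ * V + 2) * I + (16 * (1 / 4) ^ m * CN) * X := by ring
    _ ≤ (2 * C₁ * V + 2) * (CI * Y) + (δ * G ^ 2) * X := by gcongr
    _ = _ := by field_simp; ring

end Carleman

namespace Carleman

variable {n : ℕ}

/-! ### The inverse matrix field -/

section Inverse

variable {g : Sp n → Matrix (Fin n) (Fin n) ℝ} {lam Lam : ℝ}

theorem IsElliptic.isUnit_det (hlam : 1 ≤ lam) (hell : IsElliptic g lam) (x : Sp n) :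
    IsUnit (g x).det := by
  rw [isUnit_iff_ne_zero]
  intro h
  obtain ⟨v, hv, hgv⟩ := Matrix.exists_mulVec_eq_zero_iff.2 h
  have h1 := (hell x v).1
  have h2 : ∑ i, ∑ j, g x i j * v i * v j = 0 := by
    refine Finset.sum_eq_zero fun i _ => ?_
    have := congrFun hgv i
    simp only [Matrix.mulVec, dotProduct, Pi.zero_apply] at this
    calc ∑ j, g x i j * v i * v j = v i * ∑ j, g x i j * v j := by
          rw [Finset.mul_sum]; exact Finset.sum_congr rfl fun j _ => by ring
      _ = 0 := by rw [this, mul_zero]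
  rw [h2] at h1
  have h3 : 0 < ∑ i, v i ^ 2 := by
    obtain ⟨i, hi⟩ := Function.ne_iff.1 hv
    exact Finset.sum_pos' (fun _ _ => sq_nonneg _) ⟨i, Finset.mem_univ _, by
      have : v i ≠ 0 := hi
      positivity⟩
  have : 0 < lam⁻¹ := by positivity
  nlinarith

theorem mulVec_ginv (hlam : 1 ≤ lam) (hell : IsElliptic g lam) (x : Sp n) (ξ : Fin n → ℝ)
    (i : Fin n) : ∑ j, g x i j * ∑ k, ginv g j k x * ξ k = ξ i := by
  have h := congrFun (congrArg (fun M => Matrix.mulVec M ξ)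
    (Matrix.mul_nonsing_inv (g x) (hell.isUnit_det hlam x))) i
  simp only [Matrix.one_mulVec] at h
  rw [← Matrix.mulVec_mulVec] at h
  exact h

theorem ginv_symm (hsymm : ∀ x, (g x).IsSymm) (i j : Fin n) (x : Sp n) :
    ginv g i j x = ginv g j i x := by
  unfold ginv
  have : ((g x)⁻¹).transpose = (g x)⁻¹ := by
    rw [Matrix.transpose_nonsing_inv, hsymm x]
  conv_lhs => rw [← this]
  rfl

/-- The quadratic form of the inverse, at the image of a vector. -/
theorem sum_ginv_eq (hlam : 1 ≤ lam) (hell : IsElliptic g lam) (x : Sp n) (ξ : Fin n → ℝ) :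
    ∑ i, ∑ j, g x i j * (∑ k, ginv g i k x * ξ k) * (∑ k, ginv g j k x * ξ k) =
      ∑ i, (∑ j, ginv g i j x * ξ j) * ξ i := by
  refine Finset.sum_congr rfl fun i _ => ?_
  calc ∑ j, g x i j * (∑ k, ginv g i k x * ξ k) * (∑ k, ginv g j k x * ξ k)
      = (∑ k, ginv g i k x * ξ k) * ∑ j, g x i j * ∑ k, ginv g j k x * ξ k := by
        rw [Finset.mul_sum]; exact Finset.sum_congr rfl fun j _ => by ring
    _ = _ := by rw [mulVec_ginv hlam hell]

theorem sq_form_le {G : Fin n → Fin n → ℝ} (hs : ∀ i j, G i j = G j i)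
    (h0 : ∀ ξ : Fin n → ℝ, 0 ≤ ∑ i, ∑ j, G i j * ξ i * ξ j) (η ω' : Fin n → ℝ) :
    (∑ i, ∑ j, G i j * η i * ω' j) ^ 2 ≤
      (∑ i, ∑ j, G i j * η i * η j) * ∑ i, ∑ j, G i j * ω' i * ω' j := by
  have key : ∀ t : ℝ, 0 ≤ (∑ i, ∑ j, G i j * ω' i * ω' j) * (t * t)
      + (2 * ∑ i, ∑ j, G i j * η i * ω' j) * t + ∑ i, ∑ j, G i j * η i * η j := by
    intro t
    have h := h0 (fun i => η i + t * ω' i)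
    have e : ∑ i, ∑ j, G i j * η j * ω' i = ∑ i, ∑ j, G i j * η i * ω' j := by
      rw [Finset.sum_comm]
      exact Finset.sum_congr rfl fun i _ => Finset.sum_congr rfl fun j _ => by rw [hs j i]
    have e2 : ∑ i, ∑ j, G i j * (η i + t * ω' i) * (η j + t * ω' j) =
        (∑ i, ∑ j, G i j * η i * η j) + t * (∑ i, ∑ j, G i j * η i * ω' j)
        + t * (∑ i, ∑ j, G i j * η j * ω' i) + t * t * ∑ i, ∑ j, G i j * ω' i * ω' j := by
      simp only [Finset.mul_sum, ← Finset.sum_add_distrib]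
      exact Finset.sum_congr rfl fun i _ => Finset.sum_congr rfl fun j _ => by ring
    rw [e2, e] at h
    linarith
  have := discrim_le_zero key
  unfold discrim at this
  nlinarith

/-- With `η = g⁻¹ξ` one has `g(η, η) = η·ξ`. Ellipticity at `η` and the Cauchy–Schwarz inequality
for `η·ξ` give the two upper bounds. The lower bound comes from the Cauchy–Schwarz inequality for
the form `g` between `η` and `ξ`. -/
theorem ginv_elliptic (hsymm : ∀ x, (g x).IsSymm) (hlam : 1 ≤ lam) (hell : IsElliptic g lam)
    (x : Sp n) (ξ : Fin n → ℝ) :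
    lam⁻¹ * ∑ i, ξ i ^ 2 ≤ ∑ i, (∑ j, ginv g i j x * ξ j) * ξ i ∧
      ∑ i, (∑ j, ginv g i j x * ξ j) * ξ i ≤ lam * ∑ i, ξ i ^ 2 ∧
      ∑ i, (∑ j, ginv g i j x * ξ j) ^ 2 ≤ lam ^ 2 * ∑ i, ξ i ^ 2 := by
  have hl0 : 0 < lam := by linarith
  set η : Fin n → ℝ := fun i => ∑ j, ginv g i j x * ξ j with hη
  have hq : ∑ i, ∑ j, g x i j * η i * η j = ∑ i, η i * ξ i := sum_ginv_eq hlam hell x ξ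
  have hgη : ∀ i, ∑ j, g x i j * η j = ξ i := mulVec_ginv hlam hell x ξ
  have hnn : ∀ ω' : Fin n → ℝ, 0 ≤ ∑ i, ∑ j, g x i j * ω' i * ω' j := fun ω' =>
    le_trans (mul_nonneg (inv_nonneg.2 hl0.le) (Finset.sum_nonneg fun _ _ => sq_nonneg _))
      (hell x ω').1
  have hX0 : 0 ≤ ∑ i, ξ i ^ 2 := Finset.sum_nonneg fun _ _ => sq_nonneg _
  have hE0 : 0 ≤ ∑ i, η i ^ 2 := Finset.sum_nonneg fun _ _ => sq_nonneg _
  have hF0 : 0 ≤ ∑ i, η i * ξ i := hq ▸ hnn η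
  have hsym : ∀ i j, g x i j = g x j i := fun i j => (hsymm x).apply j i
  have hcs := sq_form_le hsym hnn η ξ
  have e1 : ∑ i, ∑ j, g x i j * η i * ξ j = ∑ i, ξ i ^ 2 := by
    rw [Finset.sum_comm]
    refine Finset.sum_congr rfl fun j _ => ?_
    rw [← Finset.sum_mul, sq]
    congr 1
    rw [← hgη j]
    exact Finset.sum_congr rfl fun i _ => by rw [hsym i j]
  rw [e1, hq] at hcs
  have hup := (hell x ξ).2
  have hlow := (hell x η).1
  rw [hq] at hlow
  have hcs2 : (∑ i, η i * ξ i) ^ 2 ≤ (∑ i, η i ^ 2) * ∑ i, ξ i ^ 2 :=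
    Finset.sum_mul_sq_le_sq_mul_sq _ _ _
  have hE : ∑ i, η i ^ 2 ≤ lam * ∑ i, η i * ξ i := by
    rw [inv_mul_le_iff₀ hl0] at hlow; exact hlow
  have hF : ∑ i, η i * ξ i ≤ lam * ∑ i, ξ i ^ 2 := by
    rcases hF0.eq_or_lt with h | h
    · rw [← h]; positivity
    · have : (∑ i, η i * ξ i) * (∑ i, η i * ξ i) ≤
          (∑ i, η i * ξ i) * (lam * ∑ i, ξ i ^ 2) := by nlinarith
      exact le_of_mul_le_mul_left this h
  refine ⟨?_, hF, ?_⟩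
  · rw [inv_mul_le_iff₀ hl0]
    rcases hX0.eq_or_lt with h | h
    · rw [← h]; positivity
    · have : (∑ i, ξ i ^ 2) * (∑ i, ξ i ^ 2) ≤
          (∑ i, ξ i ^ 2) * (lam * ∑ i, η i * ξ i) := by nlinarith
      exact le_of_mul_le_mul_left this h
  · nlinarith

theorem abs_ginv_le (hsymm : ∀ x, (g x).IsSymm) (hlam : 1 ≤ lam) (hell : IsElliptic g lam)
    (i j : Fin n) (x : Sp n) : |ginv g i j x| ≤ lam := by
  have h := (ginv_elliptic hsymm hlam hell x (Pi.single j 1)).2.2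
  have e1 : ∑ k, (Pi.single j (1 : ℝ) : Fin n → ℝ) k ^ 2 = 1 := by
    rw [Finset.sum_eq_single j] <;> simp +contextual
  have e2 : ∀ k, ∑ l, ginv g k l x * (Pi.single j (1 : ℝ) : Fin n → ℝ) l = ginv g k j x := by
    intro k; simp [Pi.single_apply]
  rw [e1, mul_one] at h
  simp_rw [e2] at h
  have h2 : ginv g i j x ^ 2 ≤ lam ^ 2 :=
    (Finset.single_le_sum (f := fun k => ginv g k j x ^ 2) (fun _ _ => sq_nonneg _)
      (Finset.mem_univ i)).trans h
  exact abs_le_of_sq_le_sq h2 (by linarith)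

/-- The resolvent identity `g(x)⁻¹ - g(y)⁻¹ = g(x)⁻¹ (g(y) - g(x)) g(y)⁻¹`, with the entries of both
outer factors bounded by `lam`. -/
theorem ginv_lipschitz (hsymm : ∀ x, (g x).IsSymm) (hlam : 1 ≤ lam) (hell : IsElliptic g lam)
    (hlip : IsLipschitzField g Lam) (i j : Fin n) (x y : Sp n) :
    |ginv g i j x - ginv g i j y| ≤ lam ^ 2 * Lam * ‖x - y‖ := by
  have hx := hell.isUnit_det hlam x
  have hy := hell.isUnit_det hlam y
  have e : (g x)⁻¹ - (g y)⁻¹ = (g x)⁻¹ * (g y - g x) * (g y)⁻¹ := by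
    rw [Matrix.mul_sub, Matrix.sub_mul, Matrix.nonsing_inv_mul _ hx, Matrix.one_mul,
      Matrix.mul_assoc, Matrix.mul_nonsing_inv _ hy, Matrix.mul_one]
  have e2 : ginv g i j x - ginv g i j y =
      ∑ l, ∑ k, ginv g i k x * (g y k l - g x k l) * ginv g l j y := by
    have := congrFun (congrFun e i) j
    simp only [Matrix.sub_apply, Matrix.mul_apply, Finset.sum_mul] at this
    exact this
  have hl0 : 0 ≤ lam := by linarith
  rw [e2]
  calc |∑ l, ∑ k, ginv g i k x * (g y k l - g x k l) * ginv g l j y|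
      ≤ ∑ l, ∑ k, |ginv g i k x * (g y k l - g x k l) * ginv g l j y| :=
        (Finset.abs_sum_le_sum_abs _ _).trans
          (Finset.sum_le_sum fun l _ => Finset.abs_sum_le_sum_abs _ _)
    _ ≤ ∑ l, ∑ k, lam ^ 2 * |g x k l - g y k l| := by
        refine Finset.sum_le_sum fun l _ => Finset.sum_le_sum fun k _ => ?_
        rw [abs_mul, abs_mul, abs_sub_comm]
        have h1 := abs_ginv_le hsymm hlam hell i k x
        have h2 := abs_ginv_le hsymm hlam hell l j y
        calc |ginv g i k x| * |g x k l - g y k l| * |ginv g l j y|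
            ≤ lam * |g x k l - g y k l| * lam := by gcongr
          _ = _ := by ring
    _ = lam ^ 2 * ∑ k, ∑ l, |g x k l - g y k l| := by
        rw [Finset.sum_comm]; simp only [Finset.mul_sum]
    _ ≤ lam ^ 2 * (Lam * ‖x - y‖) := by gcongr; exact hlip x y
    _ = _ := by ring

end Inverse

/-! ### The quadratic forms of the energy identity -/

/-- Values at a point of the coefficients, of their first derivatives, and of the gradient and the
Hessian of the weight. -/
abbrev Par (n : ℕ) : Type := (Fin n → Fin n → ℝ) × (Fin n → Fin n → Fin n → ℝ) ×
  (Fin n → ℝ) × (Fin n → Fin n → ℝ)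

/-- `a ξ`. -/
def aV (a : Fin n → Fin n → ℝ) (ξ : Fin n → ℝ) (i : Fin n) : ℝ := ∑ j, a i j * ξ j

/-- The form `a(ξ, ξ)`. -/
def ea (a : Fin n → Fin n → ℝ) (ξ : Fin n → ℝ) : ℝ := ∑ i, aV a ξ i * ξ i

/-- The derivatives of the field `a N`. -/
def dB (P : Par n) (i k : Fin n) : ℝ :=
  ∑ l, (P.2.1 i k l * P.2.2.1 l + P.1 k l * P.2.2.2 i l)

/-- The derivatives of `a(N, N)`. -/
def dq (P : Par n) (k : Fin n) : ℝ :=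
  ∑ l, (dB P k l * P.2.2.1 l + aV P.1 P.2.2.1 l * P.2.2.2 k l)

/-- The part of the energy density which is quadratic in the gradient. -/
def formM (P : Par n) (ξ : Fin n → ℝ) : ℝ :=
  4 * (∑ i, ∑ k, aV P.1 ξ i * dB P i k * ξ k)
    - 2 * ∑ k, aV P.1 P.2.2.1 k * ∑ i, ∑ j, P.2.1 k i j * ξ i * ξ j

/-- The coefficient of the zeroth order term of the energy density. -/
def coefm (P : Par n) : ℝ := 2 * ∑ k, aV P.1 P.2.2.1 k * dq P k

/-- The form whose positivity on the orthogonal complement of `a N` is strong pseudoconvexity. -/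
def formR (P : Par n) (ξ : Fin n → ℝ) : ℝ :=
  formM P ξ + coefm P / ea P.1 P.2.2.1 * ea P.1 ξ

/-- The parameters at the point `x`. -/
def parAt (a : Fin n → Fin n → Sp n → ℝ) (φ : Sp n → ℝ) (x : Sp n) : Par n :=
  (fun i j => a i j x, fun k i j => pd k (a i j) x, fun l => pd l φ x,
    fun i k => pd i (pd k φ) x)

theorem aV_bilin_symm {a : Fin n → Fin n → ℝ} (ha : ∀ i j, a i j = a j i) (ξ η : Fin n → ℝ) :
    ∑ i, aV a ξ i * η i = ∑ i, aV a η i * ξ i := by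
  unfold aV
  simp only [Finset.sum_mul]
  rw [Finset.sum_comm]
  exact Finset.sum_congr rfl fun i _ => Finset.sum_congr rfl fun j _ => by rw [ha j i]; ring

/-- Here and in `formM_eq` the Hessian of the weight is separated from the derivatives of `a`. This
is the shape in which `formQ` is given, and it shows that the forms are affine in the derivatives of
`a`. -/
theorem coefm_eq {P : Par n} (ha : ∀ i j, P.1 i j = P.1 j i) :
    coefm P = 4 * (∑ j, ∑ k, P.2.2.2 j k * aV P.1 P.2.2.1 j * aV P.1 P.2.2.1 k)
      + 2 * ∑ k, aV P.1 P.2.2.1 k * ∑ i, ∑ j, P.2.1 k i j * P.2.2.1 i * P.2.2.1 j := by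
  unfold coefm dq
  have h : ∀ k, ∑ l, (dB P k l * P.2.2.1 l + aV P.1 P.2.2.1 l * P.2.2.2 k l) =
      (∑ i, ∑ j, P.2.1 k i j * P.2.2.1 i * P.2.2.1 j)
        + 2 * ∑ l, P.2.2.2 k l * aV P.1 P.2.2.1 l := by
    intro k
    have h1 := aV_bilin_symm ha (P.2.2.2 k) P.2.2.1
    rw [Finset.sum_add_distrib]
    have h2 : ∑ l, dB P k l * P.2.2.1 l = (∑ i, ∑ j, P.2.1 k i j * P.2.2.1 i * P.2.2.1 j)
        + ∑ l, aV P.1 (P.2.2.2 k) l * P.2.2.1 l := by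
      rw [← Finset.sum_add_distrib]
      refine Finset.sum_congr rfl fun l _ => ?_
      unfold dB aV
      rw [Finset.sum_add_distrib, add_mul, Finset.sum_mul]
      congr 1
      exact Finset.sum_congr rfl fun j _ => by ring
    rw [h2, h1, two_mul, add_assoc]
    congr 2
    all_goals exact Finset.sum_congr rfl fun l _ => mul_comm _ _
  simp_rw [h]
  rw [Finset.mul_sum, Finset.mul_sum, Finset.mul_sum, ← Finset.sum_add_distrib]
  refine Finset.sum_congr rfl fun k _ => ?_
  have : ∑ l, P.2.2.2 k l * aV P.1 P.2.2.1 k * aV P.1 P.2.2.1 l =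
      aV P.1 P.2.2.1 k * ∑ l, P.2.2.2 k l * aV P.1 P.2.2.1 l := by
    rw [Finset.mul_sum]; exact Finset.sum_congr rfl fun l _ => by ring
  rw [this]; ring

theorem formM_eq {P : Par n} (ha : ∀ i j, P.1 i j = P.1 j i) (ξ : Fin n → ℝ) :
    formM P ξ = 4 * (∑ j, ∑ k, P.2.2.2 j k * aV P.1 ξ j * aV P.1 ξ k)
      + 4 * (∑ k, aV P.1 ξ k * ∑ i, ∑ j, P.2.1 k i j * ξ i * P.2.2.1 j)
      - 2 * ∑ k, aV P.1 P.2.2.1 k * ∑ i, ∑ j, P.2.1 k i j * ξ i * ξ j := by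
  unfold formM
  congr 1
  rw [← mul_add, ← Finset.sum_add_distrib]
  congr 1
  refine Finset.sum_congr rfl fun i _ => ?_
  have h1 := aV_bilin_symm ha (P.2.2.2 i) ξ
  have h2 : ∑ k, aV P.1 ξ i * dB P i k * ξ k = aV P.1 ξ i *
      ((∑ k, ∑ j, P.2.1 i k j * ξ k * P.2.2.1 j) + ∑ l, aV P.1 (P.2.2.2 i) l * ξ l) := by
    rw [← Finset.sum_add_distrib, Finset.mul_sum]
    refine Finset.sum_congr rfl fun k _ => ?_
    rw [mul_assoc]
    congr 1
    unfold dB aV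
    rw [Finset.sum_add_distrib, add_mul, Finset.sum_mul]
    congr 1
    exact Finset.sum_congr rfl fun j _ => by ring
  have h3 : ∑ k, P.2.2.2 i k * aV P.1 ξ i * aV P.1 ξ k =
      aV P.1 ξ i * ∑ k, aV P.1 ξ k * P.2.2.2 i k := by
    rw [Finset.mul_sum]; exact Finset.sum_congr rfl fun k _ => by ring
  rw [h2, h1, h3]; ring

section Symbols

variable {g : Sp n → Matrix (Fin n) (Fin n) ℝ} {φ : Sp n → ℝ} {x : Sp n}

theorem symPUp_zeta (l : Fin n) (ξ : Fin n → ℝ) (s : ℝ) :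
    symPUp g l x (zeta φ x ξ s) =
      ((2 * aV (fun i j => ginv g i j x) ξ l : ℝ) : ℂ)
        + Complex.I * ((2 * s * aV (fun i j => ginv g i j x) (grad φ x) l : ℝ) : ℂ) := by
  unfold symPUp zeta aV
  push_cast
  simp only [Finset.mul_sum, ← Finset.sum_add_distrib]
  exact Finset.sum_congr rfl fun k _ => by ring

theorem form_zeta (d : Fin n → Fin n → ℝ) (ξ : Fin n → ℝ) (s : ℝ) :
    ∑ j, ∑ k, (d j k : ℂ) * zeta φ x ξ s j * zeta φ x ξ s k =
      (((∑ i, ∑ j, d i j * ξ i * ξ j) - s ^ 2 * ∑ i, ∑ j, d i j * grad φ x i * grad φ x j : ℝ) : ℂ)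
        + Complex.I * ((s * ((∑ i, ∑ j, d i j * ξ i * grad φ x j)
          + ∑ i, ∑ j, d i j * grad φ x i * ξ j) : ℝ) : ℂ) := by
  unfold zeta
  push_cast
  simp only [Finset.mul_sum, ← Finset.sum_add_distrib, ← Finset.sum_sub_distrib]
  refine Finset.sum_congr rfl fun i _ => Finset.sum_congr rfl fun j _ => ?_
  linear_combination (s ^ 2 * (d i j : ℂ) * (grad φ x i : ℂ) * (grad φ x j : ℂ)) * Complex.I_sq

/-- The real part of `ζ` produces `formM` and the imaginary part `s ^ 2 * coefm`. The mixed
contributions of the derivatives of `a` carry a factor `s`, which the inverse in `formQ` cancels. So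
`Q` is the energy density at `ξ = ∇v`, `s = τ v`, without the multiplier term. -/
theorem formQ_eq (hsymm : ∀ x, (g x).IsSymm) (ξ : Fin n → ℝ) {s : ℝ} (hs : s ≠ 0)
    (hd : ∀ k i j, pd k (ginv g i j) x = pd k (ginv g j i) x) :
    formQ g φ x ξ s = formM (parAt (ginv g) φ x) ξ + s ^ 2 * coefm (parAt (ginv g) φ x) := by
  have ha : ∀ i j, (parAt (ginv g) φ x).1 i j = (parAt (ginv g) φ x).1 j i :=
    fun i j => ginv_symm hsymm i j x
  rw [formM_eq ha, coefm_eq ha]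
  unfold formQ
  have e1 : (∑ j, ∑ k, (pd j (pd k φ) x : ℂ) * symPUp g j x (zeta φ x ξ s) *
      star (symPUp g k x (zeta φ x ξ s))).re =
      4 * (∑ j, ∑ k, pd j (pd k φ) x * aV (fun i j => ginv g i j x) ξ j
        * aV (fun i j => ginv g i j x) ξ k)
      + s ^ 2 * (4 * ∑ j, ∑ k, pd j (pd k φ) x * aV (fun i j => ginv g i j x) (grad φ x) j
        * aV (fun i j => ginv g i j x) (grad φ x) k) := by
    simp only [Complex.re_sum, Finset.mul_sum, ← Finset.sum_add_distrib]
    refine Finset.sum_congr rfl fun j _ => Finset.sum_congr rfl fun k _ => ?_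
    rw [symPUp_zeta, symPUp_zeta]
    simp only [star_add, star_mul', Complex.star_def, Complex.conj_I, Complex.conj_ofReal,
      Complex.mul_re, Complex.add_re, Complex.ofReal_re, Complex.ofReal_im, Complex.I_re,
      Complex.I_im, Complex.mul_im, Complex.add_im, Complex.neg_re, Complex.neg_im]
    ring
  have e2 : ∀ k, (symPDown g k x (zeta φ x ξ s) * star (symPUp g k x (zeta φ x ξ s))).im =
      s * (4 * (aV (fun i j => ginv g i j x) ξ k
          * ∑ i, ∑ j, pd k (ginv g i j) x * ξ i * grad φ x j)
        - 2 * (aV (fun i j => ginv g i j x) (grad φ x) k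
          * ∑ i, ∑ j, pd k (ginv g i j) x * ξ i * ξ j)
        + s ^ 2 * (2 * (aV (fun i j => ginv g i j x) (grad φ x) k
          * ∑ i, ∑ j, pd k (ginv g i j) x * grad φ x i * grad φ x j))) := by
    intro k
    have esymm : ∑ i, ∑ j, pd k (ginv g i j) x * grad φ x i * ξ j =
        ∑ i, ∑ j, pd k (ginv g i j) x * ξ i * grad φ x j := by
      rw [Finset.sum_comm]
      exact Finset.sum_congr rfl fun i _ => Finset.sum_congr rfl fun j _ => by
        rw [hd k j i]; ring
    unfold symPDown
    rw [form_zeta (fun i j => pd k (ginv g i j) x), symPUp_zeta, esymm]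
    simp only [star_add, star_mul', Complex.star_def, Complex.conj_I, Complex.conj_ofReal,
      Complex.mul_re, Complex.add_re, Complex.ofReal_re, Complex.ofReal_im, Complex.I_re,
      Complex.I_im, Complex.mul_im, Complex.add_im, Complex.neg_re, Complex.neg_im]
    ring
  rw [e1, Complex.im_sum]
  simp_rw [e2]
  rw [← Finset.mul_sum, inv_mul_cancel_left₀ hs, Finset.sum_add_distrib,
    Finset.sum_sub_distrib]
  simp only [← Finset.mul_sum]
  simp only [parAt]
  change _ = 4 * _ + 4 * _ - 2 * _ + s ^ 2 * (4 * _ + 2 * _)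
  have hg : (fun l => pd l φ x) = grad φ x := rfl
  rw [hg]
  simp only [grad]
  ring

/-- The complex equation `P = 0` is a pair of real ones: the first fixes `s` in terms of `ξ`, the
second says that `ξ` is orthogonal to `a ∇φ`. -/
theorem symP_zeta (ξ : Fin n → ℝ) (s : ℝ) (hsymm : ∀ x, (g x).IsSymm) :
    symP g x (zeta φ x ξ s) =
      ((ea (fun i j => ginv g i j x) ξ - s ^ 2 * ea (fun i j => ginv g i j x) (grad φ x) : ℝ) : ℂ)
        + Complex.I * ((s * (2 * ∑ k, aV (fun i j => ginv g i j x) (grad φ x) k * ξ k) : ℝ) : ℂ) := by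
  unfold symP
  rw [form_zeta (fun i j => ginv g i j x)]
  have h : ∀ ξ η : Fin n → ℝ, ∑ i, ∑ j, ginv g i j x * ξ i * η j =
      ∑ i, aV (fun i j => ginv g i j x) η i * ξ i := fun ξ η =>
    Finset.sum_congr rfl fun i _ => by
      unfold aV; rw [Finset.sum_mul]; exact Finset.sum_congr rfl fun j _ => by ring
  rw [h, h, h, h, aV_bilin_symm (fun i j => ginv_symm hsymm i j x) ξ (grad φ x)]
  unfold ea
  push_cast
  ring

end Symbols

end Carleman

namespace Carleman

variable {n : ℕ}

/-! ### Uniformity of strong pseudoconvexity -/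

/-- The Euclidean square of a vector. -/
def nsq (ξ : Fin n → ℝ) : ℝ := ∑ i, ξ i ^ 2

theorem nsq_nonneg (ξ : Fin n → ℝ) : 0 ≤ nsq ξ := Finset.sum_nonneg fun _ _ => sq_nonneg _

theorem nsq_smul (t : ℝ) (ξ : Fin n → ℝ) : nsq (t • ξ) = t ^ 2 * nsq ξ := by
  simp [nsq, Finset.mul_sum, mul_pow]

theorem nsq_eq_zero {ξ : Fin n → ℝ} (h : nsq ξ = 0) : ξ = 0 := by
  unfold nsq at h
  rw [Finset.sum_eq_zero_iff_of_nonneg fun _ _ => sq_nonneg _] at h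
  ext i
  simpa using h i (Finset.mem_univ i)

theorem sq_le_nsq (ξ : Fin n → ℝ) (i : Fin n) : ξ i ^ 2 ≤ nsq ξ :=
  Finset.single_le_sum (f := fun k => ξ k ^ 2) (fun _ _ => sq_nonneg _) (Finset.mem_univ i)

theorem nsq_pos {ξ : Fin n → ℝ} (h : ξ ≠ 0) : 0 < nsq ξ :=
  (nsq_nonneg ξ).lt_of_ne fun h0 => h (nsq_eq_zero h0.symm)

theorem continuous_nsq : Continuous (nsq : (Fin n → ℝ) → ℝ) := by
  unfold nsq; fun_prop

theorem isCompact_nsq_sphere : IsCompact {ξ : Fin n → ℝ | nsq ξ = 1} := by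
  refine Metric.isCompact_of_isClosed_isBounded (isClosed_eq continuous_nsq continuous_const) ?_
  refine (Metric.isBounded_iff_subset_closedBall 0).2 ⟨1, fun ξ hξ => ?_⟩
  rw [mem_closedBall_zero_iff, pi_norm_le_iff_of_nonneg zero_le_one]
  intro i
  have h := sq_le_nsq ξ i
  rw [show nsq ξ = 1 from hξ] at h
  exact (sq_le_one_iff_abs_le_one _).1 h

theorem aV_smul (a : Fin n → Fin n → ℝ) (t : ℝ) (ξ : Fin n → ℝ) (i : Fin n) :
    aV a (t • ξ) i = t * aV a ξ i := by
  unfold aV; rw [Finset.mul_sum]; exact Finset.sum_congr rfl fun j _ => by simp; ring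

theorem ea_smul (a : Fin n → Fin n → ℝ) (t : ℝ) (ξ : Fin n → ℝ) :
    ea a (t • ξ) = t ^ 2 * ea a ξ := by
  unfold ea; rw [Finset.mul_sum]
  exact Finset.sum_congr rfl fun j _ => by rw [aV_smul]; simp; ring

/-- The form of strong pseudoconvexity, with a multiple of the square of `a(N, ξ)` added. -/
def formS (K : ℝ) (P : Par n) (ξ : Fin n → ℝ) : ℝ :=
  formR P ξ + K * (∑ k, aV P.1 P.2.2.1 k * ξ k) ^ 2

theorem formM_smul (P : Par n) (t : ℝ) (ξ : Fin n → ℝ) :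
    formM P (t • ξ) = t ^ 2 * formM P ξ := by
  unfold formM
  rw [mul_sub]
  congr 1
  · rw [mul_left_comm]; congr 1
    simp only [Finset.mul_sum]
    exact Finset.sum_congr rfl fun j _ => Finset.sum_congr rfl fun k _ => by
      rw [aV_smul]; simp; ring
  · rw [mul_left_comm]; congr 1
    simp only [Finset.mul_sum]
    exact Finset.sum_congr rfl fun j _ => Finset.sum_congr rfl fun k _ =>
      Finset.sum_congr rfl fun l _ => by simp; ring

theorem formS_smul (K : ℝ) (P : Par n) (t : ℝ) (ξ : Fin n → ℝ) :
    formS K P (t • ξ) = t ^ 2 * formS K P ξ := by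
  unfold formS formR
  rw [formM_smul, ea_smul]
  have : ∑ k, aV P.1 P.2.2.1 k * (t • ξ) k = t * ∑ k, aV P.1 P.2.2.1 k * ξ k := by
    rw [Finset.mul_sum]; exact Finset.sum_congr rfl fun j _ => by simp; ring
  rw [this]; ring

theorem continuous_ea :
    Continuous fun p : (Fin n → Fin n → ℝ) × (Fin n → ℝ) => ea p.1 p.2 := by
  unfold ea aV; fun_prop

theorem continuous_coefm : Continuous (coefm : Par n → ℝ) := by
  unfold coefm dq dB aV; fun_prop

theorem continuous_formM : Continuous fun p : Par n × (Fin n → ℝ) => formM p.1 p.2 := by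
  unfold formM dB aV; fun_prop

/-- A compact set of parameters. -/
def parSet (n : ℕ) (lam R cN : ℝ) : Set (Par n) :=
  {P | ‖P‖ ≤ R ∧ (∀ ξ, lam⁻¹ * nsq ξ ≤ ea P.1 ξ) ∧ cN ≤ nsq P.2.2.1}

theorem isCompact_parSet (lam R cN : ℝ) : IsCompact (parSet n lam R cN) := by
  refine Metric.isCompact_of_isClosed_isBounded ?_
    ((Metric.isBounded_iff_subset_closedBall 0).2 ⟨R, fun P hP => by simpa using hP.1⟩)
  refine (isClosed_le continuous_norm continuous_const).inter (IsClosed.inter ?_ ?_)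
  · have : {P : Par n | ∀ ξ, lam⁻¹ * nsq ξ ≤ ea P.1 ξ} =
        ⋂ ξ : Fin n → ℝ, {P : Par n | lam⁻¹ * nsq ξ ≤ ea P.1 ξ} := by ext P; simp
    change IsClosed {P : Par n | ∀ ξ, lam⁻¹ * nsq ξ ≤ ea P.1 ξ}
    rw [this]
    exact isClosed_iInter fun ξ => isClosed_le continuous_const
      (continuous_ea.comp (continuous_fst.prodMk continuous_const))
  · exact isClosed_le continuous_const (continuous_nsq.comp (by fun_prop))

theorem ea_N_pos {lam R cN : ℝ} (hlam : 1 ≤ lam) (hcN : 0 < cN) {P : Par n}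
    (hP : P ∈ parSet n lam R cN) : 0 < ea P.1 P.2.2.1 := by
  have h1 := hP.2.1 P.2.2.1
  have : 0 < lam⁻¹ := by positivity
  have := mul_pos this (hcN.trans_le hP.2.2)
  linarith

theorem continuousOn_formR {s : Set (Par n × (Fin n → ℝ))} (hs : ∀ p ∈ s, ea p.1.1 p.1.2.2.1 ≠ 0) :
    ContinuousOn (fun p : Par n × (Fin n → ℝ) => formR p.1 p.2) s := by
  unfold formR
  refine (continuous_formM.continuousOn).add (ContinuousOn.mul (ContinuousOn.div
    (continuous_coefm.comp continuous_fst).continuousOn ?_ hs) ?_)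
  · exact (continuous_ea.comp (f := fun p : Par n × (Fin n → ℝ) => (p.1.1, p.1.2.2.1))
      (by fun_prop)).continuousOn
  · exact (continuous_ea.comp (f := fun p : Par n × (Fin n → ℝ) => (p.1.1, p.2))
      (by fun_prop)).continuousOn

theorem continuousOn_formS (K : ℝ) {s : Set (Par n × (Fin n → ℝ))}
    (hs : ∀ p ∈ s, ea p.1.1 p.1.2.2.1 ≠ 0) :
    ContinuousOn (fun p : Par n × (Fin n → ℝ) => formS K p.1 p.2) s := by
  unfold formS
  refine (continuousOn_formR hs).add (Continuous.continuousOn ?_)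
  unfold aV
  fun_prop

/-- A bound for a homogeneous form follows from the bound on the unit sphere. -/
theorem le_formS_of_sphere {K c : ℝ} {P : Par n} (h : ∀ ξ, nsq ξ = 1 → c ≤ formS K P ξ)
    (ξ : Fin n → ℝ) : c * nsq ξ ≤ formS K P ξ := by
  by_cases h0 : ξ = 0
  · subst h0
    have := formS_smul K P 0 0
    simp only [smul_zero] at this
    rw [this]; simp [nsq]
  · have hp := nsq_pos h0
    set t := (Real.sqrt (nsq ξ))⁻¹ with ht
    have hs : Real.sqrt (nsq ξ) ^ 2 = nsq ξ := Real.sq_sqrt hp.le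
    have ht2 : t ^ 2 * nsq ξ = 1 := by
      rw [ht, inv_pow, hs, inv_mul_cancel₀ hp.ne']
    have := h (t • ξ) (by rw [nsq_smul, ht2])
    rw [formS_smul] at this
    have h3 := mul_le_mul_of_nonneg_right this hp.le
    have h4 : t ^ 2 * formS K P ξ * nsq ξ = formS K P ξ := by
      rw [mul_right_comm, ht2, one_mul]
    linarith

theorem abs_formS_sub_le_of_sphere {K δ : ℝ} {P P' : Par n}
    (h : ∀ ξ, nsq ξ = 1 → |formS K P ξ - formS K P' ξ| ≤ δ) (ξ : Fin n → ℝ) :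
    |formS K P ξ - formS K P' ξ| ≤ δ * nsq ξ := by
  by_cases h0 : ξ = 0
  · subst h0
    have e : ∀ Q : Par n, formS K Q 0 = 0 := fun Q => by
      have := formS_smul K Q 0 0
      simpa using this
    rw [e, e]; simp [nsq]
  · have hp := nsq_pos h0
    set t := (Real.sqrt (nsq ξ))⁻¹ with ht
    have hs : Real.sqrt (nsq ξ) ^ 2 = nsq ξ := Real.sq_sqrt hp.le
    have ht2 : t ^ 2 * nsq ξ = 1 := by
      rw [ht, inv_pow, hs, inv_mul_cancel₀ hp.ne']
    have := h (t • ξ) (by rw [nsq_smul, ht2])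
    rw [formS_smul, formS_smul, ← mul_sub, abs_mul, abs_of_nonneg (sq_nonneg t)] at this
    have h3 := mul_le_mul_of_nonneg_right this hp.le
    have h4 : t ^ 2 * |formS K P ξ - formS K P' ξ| * nsq ξ = |formS K P ξ - formS K P' ξ| := by
      rw [mul_right_comm, ht2, one_mul]
    linarith

/-- Positivity of the form on the complement of `a N` gives positivity after adding a multiple of
the square of `a(N, ξ)`, uniformly on compact sets of parameters. -/
theorem exists_formS_pos {lam R cN c : ℝ} (hlam : 1 ≤ lam) (hcN : 0 < cN) (hc : 0 < c) :
    ∃ K, 0 ≤ K ∧ ∀ P ∈ parSet n lam R cN,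
      (∀ ξ, ∑ k, aV P.1 P.2.2.1 k * ξ k = 0 → c * nsq ξ ≤ formR P ξ) →
      ∀ ξ, c / 2 * nsq ξ ≤ formS K P ξ := by
  -- The projection along `N` onto the hyperplane `a(N, ·) = 0`. With it, positivity on a hyperplane
  -- that moves with the parameters becomes a condition on all vectors.
  set pr : Par n → (Fin n → ℝ) → (Fin n → ℝ) := fun P η =>
    η - ((∑ k, aV P.1 P.2.2.1 k * η k) / ea P.1 P.2.2.1) • P.2.2.1 with hpr
  have hprc : ContinuousOn (fun p : Par n × (Fin n → ℝ) => (p.1, pr p.1 p.2))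
      (parSet n lam R cN ×ˢ Set.univ) := by
    refine continuousOn_fst.prodMk (continuousOn_snd.sub (ContinuousOn.smul
      (ContinuousOn.div ?_ ?_ fun p hp => (ea_N_pos hlam hcN hp.1).ne') (by fun_prop)))
    · unfold aV; fun_prop
    · exact (continuous_ea.comp (f := fun p : Par n × (Fin n → ℝ) => (p.1.1, p.1.2.2.1))
        (by fun_prop)).continuousOn
  -- In this form the good parameters are an intersection of closed conditions in a compact set, so
  -- they form a compact set.
  set 𝒢 : Set (Par n) := {P ∈ parSet n lam R cN | ∀ η, c * nsq (pr P η) ≤ formR P (pr P η)}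
    with h𝒢
  have hpo : ∀ P ∈ parSet n lam R cN, ∀ η, ∑ k, aV P.1 P.2.2.1 k * pr P η k = 0 := by
    intro P hP η
    have hq := (ea_N_pos hlam hcN hP).ne'
    have : ∑ k, aV P.1 P.2.2.1 k * pr P η k = (∑ k, aV P.1 P.2.2.1 k * η k)
        - ((∑ k, aV P.1 P.2.2.1 k * η k) / ea P.1 P.2.2.1) * ea P.1 P.2.2.1 := by
      conv_rhs => rw [ea, Finset.mul_sum, ← Finset.sum_sub_distrib]
      exact Finset.sum_congr rfl fun k _ => by
        simp only [hpr, Pi.sub_apply, Pi.smul_apply, smul_eq_mul, ea]; ring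
    rw [this, div_mul_cancel₀ _ hq, sub_self]
  have h𝒢c : IsCompact 𝒢 := by
    refine (isCompact_parSet lam R cN).of_isClosed_subset ?_ fun P hP => hP.1
    have : 𝒢 = ⋂ η : Fin n → ℝ,
        {P ∈ parSet n lam R cN | c * nsq (pr P η) ≤ formR P (pr P η)} := by
      ext P
      simp only [h𝒢, Set.mem_ofPred_eq, Set.mem_iInter]
      exact ⟨fun h η => ⟨h.1, h.2 η⟩, fun h => ⟨(h 0).1, fun η => (h η).2⟩⟩
    rw [this]
    refine isClosed_iInter fun η => ?_
    have h1 : ContinuousOn (fun P : Par n => (P, pr P η)) (parSet n lam R cN) :=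
      hprc.comp (f := fun P => (P, η)) (by fun_prop) fun P hP => ⟨hP, trivial⟩
    refine (isCompact_parSet lam R cN).isClosed.isClosed_le
      (continuousOn_const.mul (continuous_nsq.comp_continuousOn
        (continuous_snd.comp_continuousOn h1))) ?_
    have h2 := continuousOn_formR (s := (parSet n lam R cN) ×ˢ Set.univ)
      fun p hp => (ea_N_pos hlam hcN hp.1).ne'
    exact ContinuousOn.comp (t := (parSet n lam R cN) ×ˢ Set.univ)
      (g := fun p : Par n × (Fin n → ℝ) => formR p.1 p.2) (f := fun P : Par n => (P, pr P η))
      h2 h1 fun P hP => ⟨hP, trivial⟩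
  set 𝒯 : Set (Par n × (Fin n → ℝ)) := 𝒢 ×ˢ {ξ | nsq ξ = 1} with h𝒯
  have h𝒯c : IsCompact 𝒯 := h𝒢c.prod isCompact_nsq_sphere
  have hne : ∀ p ∈ 𝒯, ea p.1.1 p.1.2.2.1 ≠ 0 := fun p hp => (ea_N_pos hlam hcN hp.1.1).ne'
  have hpos : ∀ p ∈ 𝒯, ∑ k, aV p.1.1 p.1.2.2.1 k * p.2 k = 0 → c ≤ formR p.1 p.2 := by
    intro p hp h0
    have h1 := hp.1.2 p.2
    have h2 : pr p.1 p.2 = p.2 := by simp [hpr, h0]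
    rw [h2, show nsq p.2 = 1 from hp.2, mul_one] at h1
    exact h1
  -- Otherwise counterexamples with `K → ∞` accumulate somewhere. A limit on the hyperplane
  -- contradicts `formR ≥ c` there. Off the hyperplane the added square, multiplied by `K`, tends to
  -- infinity.
  have hcov : ∃ K : ℕ, ∀ p ∈ 𝒯, c / 2 < formS K p.1 p.2 := by
    by_contra! hcon
    choose p hpT hp using hcon
    obtain ⟨q, hq, ι, hι, hlim⟩ := h𝒯c.tendsto_subseq hpT
    have hR := ((continuousOn_formR hne) q hq)
    have hwith : Filter.Tendsto (fun m => p (ι m)) Filter.atTop (nhdsWithin q 𝒯) :=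
      tendsto_nhdsWithin_iff.2 ⟨hlim, Filter.Eventually.of_forall fun m => hpT _⟩
    have hR' : Filter.Tendsto (fun m => formR (p (ι m)).1 (p (ι m)).2) Filter.atTop
      (nhds (formR q.1 q.2)) := hR.tendsto.comp hwith
    have hBc : Continuous fun p : Par n × (Fin n → ℝ) =>
        (∑ k, aV p.1.1 p.1.2.2.1 k * p.2 k) ^ 2 := by unfold aV; fun_prop
    have hB' := (hBc.tendsto q).comp hlim
    by_cases h0 : ∑ k, aV q.1.1 q.1.2.2.1 k * q.2 k = 0
    · have h1 := hpos q hq h0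
      have h2 : formR q.1 q.2 ≤ c / 2 := by
        refine le_of_tendsto hR' (Filter.Eventually.of_forall fun m => ?_)
        have := hp (ι m)
        unfold formS at this
        have h3 : 0 ≤ ((ι m : ℕ) : ℝ) * (∑ k, aV (p (ι m)).1.1 (p (ι m)).1.2.2.1 k
          * (p (ι m)).2 k) ^ 2 := by positivity
        linarith
      linarith
    · have hpos' : 0 < (∑ k, aV q.1.1 q.1.2.2.1 k * q.2 k) ^ 2 := by positivity
      have hinf : Filter.Tendsto (fun m => formR (p (ι m)).1 (p (ι m)).2 + ((ι m : ℕ) : ℝ)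
          * (∑ k, aV (p (ι m)).1.1 (p (ι m)).1.2.2.1 k * (p (ι m)).2 k) ^ 2) Filter.atTop
          Filter.atTop :=
        hR'.add_atTop (Filter.Tendsto.atTop_mul_pos hpos'
          (tendsto_natCast_atTop_atTop.comp hι.tendsto_atTop) hB')
      obtain ⟨m, hm⟩ := (hinf.eventually_gt_atTop (c / 2)).exists
      have := hp (ι m)
      unfold formS at this
      linarith
  obtain ⟨K, hK⟩ := hcov
  refine ⟨K, by positivity, fun P hP h => le_formS_of_sphere fun ξ hξ => ?_⟩
  exact (hK (P, ξ) ⟨⟨hP, fun η => h _ (hpo P hP η)⟩, hξ⟩).le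

theorem formS_modulus {lam R cN δ : ℝ} (hlam : 1 ≤ lam) (hcN : 0 < cN) (hδ : 0 < δ) (K : ℝ) :
    ∃ r, 0 < r ∧ ∀ P ∈ parSet n lam R cN, ∀ P' ∈ parSet n lam R cN, ‖P - P'‖ < r →
      ∀ ξ, |formS K P ξ - formS K P' ξ| ≤ δ * nsq ξ := by
  have hcomp := (isCompact_parSet (n := n) lam R cN).prod (isCompact_nsq_sphere (n := n))
  have huc := hcomp.uniformContinuousOn_of_continuous (continuousOn_formS K
    fun p hp => (ea_N_pos hlam hcN hp.1).ne')
  obtain ⟨r, hr, h⟩ := Metric.uniformContinuousOn_iff.1 huc δ hδ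
  refine ⟨r, hr, fun P hP P' hP' hd => abs_formS_sub_le_of_sphere fun ξ hξ => ?_⟩
  have := h (P, ξ) ⟨hP, hξ⟩ (P', ξ) ⟨hP', hξ⟩ (by
    rw [Prod.dist_eq, dist_self, max_eq_left dist_nonneg, dist_eq_norm]; exact hd)
  rw [Real.dist_eq] at this
  exact this.le

theorem formS_bound {lam R cN : ℝ} (hlam : 1 ≤ lam) (hcN : 0 < cN) (K : ℝ) :
    ∃ C, 0 ≤ C ∧ ∀ P ∈ parSet n lam R cN, ∀ ξ, -(C * nsq ξ) ≤ formS K P ξ := by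
  have hcomp := (isCompact_parSet (n := n) lam R cN).prod (isCompact_nsq_sphere (n := n))
  obtain ⟨C, hC⟩ := hcomp.exists_bound_of_continuousOn (continuousOn_formS K
    fun p hp => (ea_N_pos hlam hcN hp.1).ne')
  refine ⟨max C 0, le_max_right _ _, fun P hP ξ => ?_⟩
  rw [← neg_mul]
  refine le_formS_of_sphere (fun ξ hξ => ?_) ξ
  have := hC (P, ξ) ⟨hP, hξ⟩
  rw [Real.norm_eq_abs] at this
  exact neg_le_of_abs_le (this.trans (le_max_left _ _))

/-- The coefficients of the derivatives of `a` in the form. -/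
def formCoef (P : Par n) (ξ : Fin n → ℝ) (k i j : Fin n) : ℝ :=
  4 * aV P.1 ξ k * ξ i * P.2.2.1 j - 2 * aV P.1 P.2.2.1 k * ξ i * ξ j
    + ea P.1 ξ / ea P.1 P.2.2.1 * (2 * aV P.1 P.2.2.1 k * P.2.2.1 i * P.2.2.1 j)

/-- The form is affine in the derivatives of `a`. -/
theorem formS_affine (K : ℝ) {P : Par n} (ha : ∀ i j, P.1 i j = P.1 j i) (ξ : Fin n → ℝ) :
    formS K P ξ = formS K (P.1, 0, P.2.2) ξ
      + ∑ k, ∑ i, ∑ j, formCoef P ξ k i j * P.2.1 k i j := by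
  unfold formS formR
  rw [formM_eq ha, coefm_eq ha, formM_eq (P := (P.1, 0, P.2.2)) ha,
    coefm_eq (P := (P.1, 0, P.2.2)) ha]
  have e : ∑ k, ∑ i, ∑ j, formCoef P ξ k i j * P.2.1 k i j =
      4 * (∑ k, aV P.1 ξ k * ∑ i, ∑ j, P.2.1 k i j * ξ i * P.2.2.1 j)
      - 2 * (∑ k, aV P.1 P.2.2.1 k * ∑ i, ∑ j, P.2.1 k i j * ξ i * ξ j)
      + ea P.1 ξ / ea P.1 P.2.2.1 *
        (2 * ∑ k, aV P.1 P.2.2.1 k * ∑ i, ∑ j, P.2.1 k i j * P.2.2.1 i * P.2.2.1 j) := by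
    simp only [Finset.mul_sum, ← Finset.sum_add_distrib, ← Finset.sum_sub_distrib]
    refine Finset.sum_congr rfl fun k _ => Finset.sum_congr rfl fun i _ =>
      Finset.sum_congr rfl fun j _ => ?_
    unfold formCoef
    ring
  rw [e]
  simp only [Pi.zero_apply, zero_mul, Finset.sum_const_zero, mul_zero]
  ring

end Carleman

namespace Carleman

variable {n : ℕ}

/-! ### Consequences of the assumptions on the weight -/

/-- Strong pseudoconvexity in terms of the real form. -/
theorem le_formR_of_mainAssumption {g : Sp n → Matrix (Fin n) (Fin n) ℝ} {lam c₀ : ℝ}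
    {φ : Sp n → ℝ} {x : Sp n} (hsymm : ∀ x, (g x).IsSymm) (hlam : 1 ≤ lam)
    (hell : IsElliptic g lam) (hc₀ : 0 < c₀) (hN : grad φ x ≠ 0)
    (hmain : ∀ (ξ : Fin n → ℝ) (τ : ℝ), τ ≠ 0 →
      symP g x (zeta φ x ξ τ) = 0 → zeta φ x ξ τ ≠ 0 →
        c₀ * cnormSqG g x (zeta φ x ξ τ) ≤ formQ g φ x ξ τ)
    (ξ : Fin n → ℝ) (hξ : ∑ k, aV (fun i j => ginv g i j x) (grad φ x) k * ξ k = 0) :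
    c₀ * lam⁻¹ * nsq ξ ≤ formR (parAt (ginv g) φ x) ξ := by
  by_cases h0 : ξ = 0
  · subst h0
    have := formS_smul 0 (parAt (ginv g) φ x) 0 0
    simp only [smul_zero, formS, zero_mul, add_zero] at this
    rw [this]; simp [nsq]
  have hl : 0 < lam⁻¹ := by positivity
  have hea : ∀ η : Fin n → ℝ, lam⁻¹ * nsq η ≤ ea (fun i j => ginv g i j x) η := fun η =>
    (ginv_elliptic hsymm hlam hell x η).1
  have hp1 : 0 < ea (fun i j => ginv g i j x) ξ :=
    lt_of_lt_of_le (mul_pos hl (nsq_pos h0)) (hea ξ)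
  have hp2 : 0 < ea (fun i j => ginv g i j x) (grad φ x) :=
    lt_of_lt_of_le (mul_pos hl (nsq_pos hN)) (hea _)
  -- The value of `s` for which `ξ + i s ∇φ` is characteristic: the real part of the symbol vanishes
  -- by this choice, the imaginary part by orthogonality. At it `formQ` takes the value `formR`.
  set s := Real.sqrt (ea (fun i j => ginv g i j x) ξ / ea (fun i j => ginv g i j x) (grad φ x))
    with hs
  have hs0 : 0 < s := Real.sqrt_pos.2 (div_pos hp1 hp2)
  have hs2 : s ^ 2 = ea (fun i j => ginv g i j x) ξ / ea (fun i j => ginv g i j x) (grad φ x) :=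
    Real.sq_sqrt (div_pos hp1 hp2).le
  have hz : zeta φ x ξ s ≠ 0 := by
    intro hz
    refine h0 (funext fun j => ?_)
    have := congrArg Complex.re (congrFun hz j)
    simpa [zeta] using this
  have hP : symP g x (zeta φ x ξ s) = 0 := by
    rw [symP_zeta ξ s hsymm, hξ, hs2, div_mul_cancel₀ _ hp2.ne']
    simp
  have h := hmain ξ s hs0.ne' hP hz
  rw [formQ_eq hsymm ξ hs0.ne' fun k i j => by
    rw [show ginv g i j = ginv g j i from funext fun y => ginv_symm hsymm i j y]] at h
  have hQ : formM (parAt (ginv g) φ x) ξ + s ^ 2 * coefm (parAt (ginv g) φ x) =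
      formR (parAt (ginv g) φ x) ξ := by
    unfold formR
    rw [hs2]
    change _ = _ + _ / ea (fun i j => ginv g i j x) (grad φ x) * ea (fun i j => ginv g i j x) ξ
    ring
  rw [hQ] at h
  refine le_trans ?_ h
  have hcn : cnormSqG g x (zeta φ x ξ s) = (∑ i, ∑ j, g x i j * ξ i * ξ j)
      + s ^ 2 * ∑ i, ∑ j, g x i j * grad φ x i * grad φ x j := by
    unfold cnormSqG zeta
    simp only [Complex.re_sum, Finset.mul_sum, ← Finset.sum_add_distrib]
    refine Finset.sum_congr rfl fun i _ => Finset.sum_congr rfl fun j _ => ?_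
    simp only [star_add, star_mul', Complex.star_def, Complex.conj_I, Complex.conj_ofReal,
      Complex.mul_re, Complex.add_re, Complex.ofReal_re, Complex.ofReal_im, Complex.I_re,
      Complex.I_im, Complex.mul_im, Complex.add_im, Complex.neg_re, Complex.neg_im]
    ring
  rw [hcn, mul_assoc]
  refine mul_le_mul_of_nonneg_left ?_ hc₀.le
  have h1 := (hell x ξ).1
  have h2 := (hell x (grad φ x)).1
  have h3 : 0 ≤ lam⁻¹ * ∑ i, grad φ x i ^ 2 := mul_nonneg hl.le (nsq_nonneg _)
  have h4 := mul_nonneg (sq_nonneg s) (h3.trans h2)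
  change lam⁻¹ * ∑ i, ξ i ^ 2 ≤ _
  linarith

section Extends

variable {Ω : Set (Sp n)} {f : Sp n → ℝ}

theorem ExtendsToClosure.exists_bound (hf : ExtendsToClosure Ω f) (hb : Bornology.IsBounded Ω) :
    ∃ R, 0 ≤ R ∧ ∀ x ∈ Ω, |f x| ≤ R := by
  obtain ⟨F, hF, hFf⟩ := hf
  obtain ⟨R, hR⟩ := hb.isCompact_closure.exists_bound_of_continuousOn hF
  refine ⟨max R 0, le_max_right _ _, fun x hx => ?_⟩
  rw [← hFf hx]
  exact (hR x (subset_closure hx)).trans (le_max_left _ _)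

theorem ExtendsToClosure.uniform (hf : ExtendsToClosure Ω f) (hb : Bornology.IsBounded Ω)
    {δ : ℝ} (hδ : 0 < δ) :
    ∃ r, 0 < r ∧ ∀ x ∈ Ω, ∀ y ∈ Ω, ‖x - y‖ < r → |f x - f y| < δ := by
  obtain ⟨F, hF, hFf⟩ := hf
  obtain ⟨r, hr, h⟩ := Metric.uniformContinuousOn_iff.1
    (hb.isCompact_closure.uniformContinuousOn_of_continuous hF) δ hδ
  refine ⟨r, hr, fun x hx y hy hxy => ?_⟩
  rw [← hFf hx, ← hFf hy]
  exact h x (subset_closure hx) y (subset_closure hy) (by rwa [dist_eq_norm])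

/-- Since `Ω` need not be convex or regular, bounded second derivatives of `φ` give no Lipschitz
bound for `∇φ`. Uniform continuity and boundedness give this substitute, in which `δ` is as small as
desired. -/
theorem ExtendsToClosure.modulus (hf : ExtendsToClosure Ω f) (hb : Bornology.IsBounded Ω)
    {δ : ℝ} (hδ : 0 < δ) :
    ∃ C, 0 ≤ C ∧ ∀ x ∈ Ω, ∀ y ∈ Ω, |f x - f y| ≤ δ + C * ‖x - y‖ := by
  obtain ⟨R, hR0, hR⟩ := hf.exists_bound hb
  obtain ⟨r, hr, h⟩ := hf.uniform hb hδ
  refine ⟨2 * R / r, by positivity, fun x hx y hy => ?_⟩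
  by_cases hxy : ‖x - y‖ < r
  · have := h x hx y hy hxy
    have : 0 ≤ 2 * R / r * ‖x - y‖ := by positivity
    linarith
  · push Not at hxy
    have h1 : |f x - f y| ≤ 2 * R := (abs_sub _ _).trans (by linarith [hR x hx, hR y hy])
    have h2 : 2 * R ≤ 2 * R / r * ‖x - y‖ := by
      rw [div_mul_eq_mul_div, le_div_iff₀ hr]; gcongr
    linarith

/-- Tietze extension followed by smooth approximation. It is meant for the Hessian of `φ`, which is
only continuous but enters a multiplier that has to be differentiated. -/
theorem ExtendsToClosure.exists_smooth (hf : ExtendsToClosure Ω f) (hb : Bornology.IsBounded Ω)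
    {δ : ℝ} (hδ : 0 < δ) :
    ∃ F : Sp n → ℝ, ContDiff ℝ ∞ F ∧ (∀ x ∈ Ω, |F x - f x| ≤ δ) ∧
      ∃ C, ∀ x ∈ Ω, ∀ i, |pd i F x| ≤ C := by
  obtain ⟨F, hF, hFf⟩ := hf
  obtain ⟨G, hG⟩ := ContinuousMap.exists_restrict_eq (isClosed_closure (s := Ω))
    ⟨(closure Ω).domRestrict F, hF.domRestrict⟩
  have hGF : ∀ x ∈ Ω, G x = f x := fun x hx => by
    have := congrArg (fun φ : C(closure Ω, ℝ) => φ ⟨x, subset_closure hx⟩) hG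
    exact this.trans (hFf hx)
  obtain ⟨S, hS, hSG, -⟩ := G.continuous.exists_contDiff_approx ⊤ (ε := fun _ => δ)
    continuous_const (fun _ => hδ)
  have hS1 : ContDiff ℝ 1 S := hS.of_le (by norm_cast)
  refine ⟨S, hS, fun x hx => ?_, ?_⟩
  · rw [← hGF x hx]; exact (hSG x).le
  · have : ∀ i, ∃ C, ∀ x ∈ closure Ω, |pd i S x| ≤ C := fun i =>
      hb.isCompact_closure.exists_bound_of_continuousOn (continuous_pd hS1 i).continuousOn
    choose C hC using this
    refine ⟨∑ i, |C i|, fun x hx i => ?_⟩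
    exact (hC i x (subset_closure hx)).trans ((le_abs_self _).trans
      (Finset.single_le_sum (f := fun i => |C i|) (fun _ _ => abs_nonneg _) (Finset.mem_univ i)))

theorem exists_nsq_grad_ge {φ : Sp n → ℝ} (hb : Bornology.IsBounded Ω)
    (hφ : ∀ i, ExtendsToClosure Ω (pd i φ))
    (hgrad : ∀ x ∈ closure Ω, extendFrom Ω (grad φ) x ≠ 0) :
    ∃ c, 0 < c ∧ ∀ x ∈ Ω, c ≤ nsq (grad φ x) := by
  choose F hF hFf using hφ
  have h1 : ∀ x ∈ closure Ω, extendFrom Ω (grad φ) x = fun i => F i x := by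
    intro x hx
    refine extendFrom_eq hx ?_
    rw [tendsto_pi_nhds]
    intro i
    refine (((hF i) x hx).mono_left (nhdsWithin_mono _ subset_closure)).congr' ?_
    filter_upwards [self_mem_nhdsWithin] with y hy
    exact hFf i hy
  have hc : ContinuousOn (fun x => nsq fun i => F i x) (closure Ω) :=
    continuous_nsq.comp_continuousOn (continuousOn_pi.2 hF)
  obtain ⟨c, hc0, hc⟩ := hb.isCompact_closure.exists_forall_le' hc (a := 0) fun x hx =>
    nsq_pos (h1 x hx ▸ hgrad x hx)
  refine ⟨c, hc0, fun x hx => ?_⟩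
  have := hc x (subset_closure hx)
  rwa [show (fun i => F i x) = grad φ x from funext fun i => hFf i hx] at this

/-- A function which is `C^k` on an open set agrees near a given compact subset with a function
which is `C^k` everywhere. -/
theorem exists_contDiff_eqOn {k : ℕ∞} (hΩ : IsOpen Ω) (hf : ContDiffOn ℝ k f Ω) {K : Set (Sp n)}
    (hK : IsCompact K) (hKΩ : K ⊆ Ω) :
    ∃ F : Sp n → ℝ, ContDiff ℝ k F ∧ ∃ V, IsOpen V ∧ K ⊆ V ∧ V ⊆ Ω ∧ Set.EqOn F f V := by
  obtain ⟨K', hK', hKK', hK'Ω⟩ := exists_compact_between hK hΩ hKΩ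
  obtain ⟨χ, hχ1, hχ0, -⟩ := exists_contMDiffMap_one_nhds_of_subset_interior
    (modelWithCornersSelf ℝ (Sp n)) (n := k) hK.isClosed hKK'
  have hχ : ContDiff ℝ k χ := χ.contMDiff.contDiff
  obtain ⟨V, hV, hKV, hVχ⟩ := mem_nhdsSet_iff_exists.1 hχ1
  -- A cutoff equal to 1 near `K`. The product is as smooth as `f` inside `Ω` and vanishes near
  -- every point outside.
  refine ⟨fun x => χ x * f x, ?_, V ∩ Ω, hV.inter hΩ, Set.subset_inter hKV hKΩ,
    Set.inter_subset_right, fun x hx => ?_⟩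
  · rw [contDiff_iff_contDiffAt]
    intro x
    by_cases hx : x ∈ Ω
    · exact hχ.contDiffAt.mul (hf.contDiffAt (hΩ.mem_nhds hx))
    · have : (fun x => χ x * f x) =ᶠ[nhds x] fun _ => 0 := by
        filter_upwards [hK'.isClosed.isOpen_compl.mem_nhds fun h => hx (hK'Ω h)] with y hy
        rw [hχ0 y hy, zero_mul]
      exact contDiffAt_const.congr_of_eventuallyEq this
  · have : χ x = 1 := hVχ hx.1
    simp only [this, one_mul]

end Extends

end Carleman

namespace Carleman

variable {n : ℕ}

/-! ### Mollification -/

/-- The average of `f` near `x` at scale `ε` with weight `ρ`. -/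
def moll (ρ : Sp n → ℝ) (ε : ℝ) (f : Sp n → ℝ) (x : Sp n) : ℝ := ∫ z, ρ z * f (x - ε • z)

/-- A mollifier supported in the unit ball. -/
structure IsMollifier (η : Sp n → ℝ) : Prop where
  smooth : ContDiff ℝ ∞ η
  compact : HasCompactSupport η
  nonneg : ∀ z, 0 ≤ η z
  integral_one : ∫ z, η z = 1
  support : ∀ z, 1 < ‖z‖ → η z = 0

theorem exists_isMollifier (n : ℕ) : ∃ η : Sp n → ℝ, IsMollifier η := by
  let b : ContDiffBump (0 : Sp n) := ⟨1 / 2, 1, by norm_num, by norm_num⟩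
  refine ⟨b.normed volume, b.contDiff_normed, b.hasCompactSupport_normed, b.nonneg_normed,
    b.integral_normed, fun z hz => ?_⟩
  by_contra h
  have : z ∈ Function.support (b.normed volume) := h
  rw [b.support_normed_eq] at this
  have : ‖z‖ < 1 := by simpa [b] using this
  linarith

section

variable {ρ f : Sp n → ℝ} {ε M : ℝ}

theorem integrable_moll (hρ : CC ρ) (hf : Measurable f) (hM : ∀ x, |f x| ≤ M) (ε : ℝ)
    (x : Sp n) : Integrable fun z => ρ z * f (x - ε • z) := by
  exact hρ.integrable.mul_bdd (c := M) (hf.comp (by fun_prop)).aestronglyMeasurable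
    (Filter.Eventually.of_forall fun z => hM _)

/-- The rescaled weight. -/
def rescale (ρ : Sp n → ℝ) (ε : ℝ) (t : Sp n) : ℝ := |(ε ^ n)⁻¹| * ρ (ε⁻¹ • t)

theorem convolution_rescale (hε : ε ≠ 0) (ρ f : Sp n → ℝ) (x : Sp n) :
    convolution f (rescale ρ ε) (ContinuousLinearMap.mul ℝ ℝ) volume x = moll ρ ε f x := by
  unfold convolution moll rescale
  rw [← integral_sub_left_eq_self _ volume x]
  have h := Measure.integral_comp_smul (volume : Measure (Sp n))
    (fun z => ρ (ε⁻¹ • z) * f (x - z)) ε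
  simp only [finrank_euclideanSpace, Fintype.card_fin, inv_smul_smul₀ hε] at h
  rw [h, smul_eq_mul, ← integral_const_mul]
  congr 1; ext t
  simp only [ContinuousLinearMap.mul_apply', sub_sub_cancel]
  ring

theorem contDiff_rescale (hρ : ContDiff ℝ ∞ ρ) (ε : ℝ) : ContDiff ℝ ∞ (rescale ρ ε) :=
  contDiff_const.mul (hρ.comp (contDiff_const_smul _))

theorem hasCompactSupport_rescale (hρ : HasCompactSupport ρ) (hε : ε ≠ 0) :
    HasCompactSupport (rescale ρ ε) :=
  HasCompactSupport.mul_left (f := fun _ : Sp n => |(ε ^ n)⁻¹|)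
    (hρ.comp_homeomorph (Homeomorph.smulOfNeZero ε⁻¹ (inv_ne_zero hε)))

theorem locallyIntegrable_of_bounded (hf : Measurable f) (hM : ∀ x, |f x| ≤ M) :
    LocallyIntegrable f (volume : Measure (Sp n)) := by
  refine (locallyIntegrable_const M).mono hf.aestronglyMeasurable
    (Filter.Eventually.of_forall fun x => ?_)
  rw [Real.norm_eq_abs, Real.norm_eq_abs]
  exact (hM x).trans (le_abs_self _)

theorem contDiff_moll (hρ : ContDiff ℝ ∞ ρ) (hc : HasCompactSupport ρ) (hε : ε ≠ 0)
    (hf : Measurable f) (hM : ∀ x, |f x| ≤ M) : ContDiff ℝ ∞ (moll ρ ε f) := by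
  rw [show moll ρ ε f = convolution f (rescale ρ ε) (ContinuousLinearMap.mul ℝ ℝ) volume from
    funext fun x => (convolution_rescale hε ρ f x).symm]
  exact (hasCompactSupport_rescale hc hε).contDiff_convolution_right _
    (locallyIntegrable_of_bounded hf hM) (contDiff_rescale hρ ε)

theorem pd_rescale (hρ : ContDiff ℝ ∞ ρ) (ε : ℝ) (k : Fin n) (t : Sp n) :
    pd k (rescale ρ ε) t = ε⁻¹ * rescale (pd k ρ) ε t := by
  have h1 : HasFDerivAt (fun t : Sp n => ε⁻¹ • t) (ε⁻¹ • ContinuousLinearMap.id ℝ (Sp n)) t :=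
    (hasFDerivAt_id t).const_smul ε⁻¹
  have h2 := ((hρ.differentiable (by simp) (ε⁻¹ • t)).hasFDerivAt.comp t h1).const_mul
    (|(ε ^ n)⁻¹|)
  have h3 : fderiv ℝ (rescale ρ ε) t = _ := h2.fderiv
  unfold pd
  rw [h3]
  simp [rescale]
  ring

/-- The derivative is put on the weight, at the price `ε⁻¹`, so `f` need only be bounded and
measurable. This serves for the indicator of the complement of `Ω` and for second derivatives of the
coefficients. -/
theorem pd_moll (hρ : ContDiff ℝ ∞ ρ) (hc : HasCompactSupport ρ) (hε : ε ≠ 0)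
    (hf : Measurable f) (hM : ∀ x, |f x| ≤ M) (k : Fin n) (x : Sp n) :
    pd k (moll ρ ε f) x = ε⁻¹ * moll (pd k ρ) ε f x := by
  have hr := contDiff_rescale hρ ε
  have hrc := hasCompactSupport_rescale hc hε
  have hli := locallyIntegrable_of_bounded hf hM
  have hr1 : ContDiff ℝ 1 (rescale ρ ε) := hr.of_le (by norm_cast)
  have h := (hrc.hasFDerivAt_convolution_right (ContinuousLinearMap.mul ℝ ℝ) hli hr1 x).fderiv
  rw [show moll ρ ε f = convolution f (rescale ρ ε) (ContinuousLinearMap.mul ℝ ℝ) volume from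
    funext fun x => (convolution_rescale hε ρ f x).symm]
  rw [pd, h, convolution_precompR_apply _ hli (hrc.fderiv ℝ) (hr1.continuous_fderiv (by simp))]
  change convolution f (pd k (rescale ρ ε)) _ _ x = _
  rw [show pd k (rescale ρ ε) = fun t => ε⁻¹ * rescale (pd k ρ) ε t from
    funext (pd_rescale hρ ε k), ← convolution_rescale hε]
  unfold convolution
  rw [← integral_const_mul]
  congr 1; ext t
  simp only [ContinuousLinearMap.mul_apply']
  ring

theorem abs_moll_le (hρ : CC ρ) (hM : ∀ x, |f x| ≤ M) (ε : ℝ) (x : Sp n) :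
    |moll ρ ε f x| ≤ M * ∫ z, |ρ z| := by
  unfold moll
  rw [mul_comm, ← integral_mul_const]
  refine (abs_integral_le_integral_abs).trans (integral_mono_of_nonneg
    (Filter.Eventually.of_forall fun _ => abs_nonneg _) (hρ.integrable.abs.mul_const _)
    (Filter.Eventually.of_forall fun z => ?_))
  simp only [abs_mul]
  exact mul_le_mul_of_nonneg_left (hM _) (abs_nonneg _)

theorem abs_moll_sub_le (hρ : CC ρ) (hf : Measurable f) (hM : ∀ x, |f x| ≤ M) {L : ℝ}
    (hL : ∀ x y, |f x - f y| ≤ L * ‖x - y‖) (ε : ℝ) (x y : Sp n) :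
    |moll ρ ε f x - moll ρ ε f y| ≤ L * (∫ z, |ρ z|) * ‖x - y‖ := by
  unfold moll
  rw [← integral_sub (integrable_moll hρ hf hM ε x) (integrable_moll hρ hf hM ε y),
    mul_right_comm, mul_comm, ← integral_mul_const]
  refine (abs_integral_le_integral_abs).trans (integral_mono_of_nonneg
    (Filter.Eventually.of_forall fun _ => abs_nonneg _) (hρ.integrable.abs.mul_const _)
    (Filter.Eventually.of_forall fun z => ?_))
  simp only [← mul_sub, abs_mul]
  refine mul_le_mul_of_nonneg_left ?_ (abs_nonneg _)
  have := hL (x - ε • z) (y - ε • z)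
  rwa [sub_sub_sub_cancel_right] at this

theorem abs_pd_le_of_lipschitz {L : ℝ} (hL0 : 0 ≤ L) (hL : ∀ x y, |f x - f y| ≤ L * ‖x - y‖)
    (k : Fin n) (x : Sp n) : |pd k f x| ≤ L := by
  have h : LipschitzWith ⟨L, hL0⟩ f := LipschitzWith.of_dist_le_mul fun x y => by
    rw [Real.dist_eq, dist_eq_norm]; exact hL x y
  have h2 : ‖fderiv ℝ f x‖ ≤ L := norm_fderiv_le_of_lipschitz ℝ h
  unfold pd
  have := (fderiv ℝ f x).le_opNorm (EuclideanSpace.single k 1)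
  rw [PiLp.norm_single, norm_one, mul_one] at this
  exact this.trans h2

theorem continuous_of_lipschitz {L : ℝ} (hL0 : 0 ≤ L) (hL : ∀ x y, |f x - f y| ≤ L * ‖x - y‖) :
    Continuous f :=
  (LipschitzWith.of_dist_le_mul (K := ⟨L, hL0⟩) fun x y => by
    rw [Real.dist_eq, dist_eq_norm]; exact hL x y : LipschitzWith ⟨L, hL0⟩ f).continuous

theorem ae_differentiableAt_of_lipschitz {L : ℝ} (hL0 : 0 ≤ L)
    (hL : ∀ x y, |f x - f y| ≤ L * ‖x - y‖) : ∀ᵐ x, DifferentiableAt ℝ f x :=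
  (LipschitzWith.of_dist_le_mul (K := ⟨L, hL0⟩) fun x y => by
    rw [Real.dist_eq, dist_eq_norm]; exact hL x y :
      LipschitzWith ⟨L, hL0⟩ f).ae_differentiableAt

theorem measurable_pd (k : Fin n) (f : Sp n → ℝ) : Measurable (pd k f) :=
  measurable_fderiv_apply_const ℝ f _

end

section

variable {η f : Sp n → ℝ} {ε M L : ℝ}

theorem IsMollifier.cc (hη : IsMollifier η) : CC η := ⟨hη.smooth.continuous, hη.compact⟩

theorem IsMollifier.integral_abs (hη : IsMollifier η) : ∫ z, |η z| = 1 := by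
  rw [← hη.integral_one]; congr 1; ext z; exact abs_of_nonneg (hη.nonneg z)

theorem moll_mono (hη : IsMollifier η) (hf : Measurable f) (hM : ∀ x, |f x| ≤ M) {c : ℝ}
    {x : Sp n} (hc : ∀ y, c ≤ f y) : c ≤ moll η ε f x := by
  have : c = ∫ z, η z * c := by rw [integral_mul_const, hη.integral_one, one_mul]
  rw [this]
  exact integral_mono (hη.cc.integrable.mul_const c) (integrable_moll hη.cc hf hM ε x)
    fun z => mul_le_mul_of_nonneg_left (hc _) (hη.nonneg z)

theorem abs_moll_sub_self_le (hη : IsMollifier η) (hε : 0 ≤ ε) (hf : Measurable f)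
    (hM : ∀ x, |f x| ≤ M) (hL0 : 0 ≤ L) (hL : ∀ x y, |f x - f y| ≤ L * ‖x - y‖) (x : Sp n) :
    |moll η ε f x - f x| ≤ L * ε := by
  have e : moll η ε f x - f x = ∫ z, η z * (f (x - ε • z) - f x) := by
    simp only [mul_sub]
    rw [integral_sub (integrable_moll hη.cc hf hM ε x) (hη.cc.integrable.mul_const _),
      integral_mul_const, hη.integral_one, one_mul, moll]
  rw [e]
  have e2 : L * ε = ∫ z, η z * (L * ε) := by rw [integral_mul_const, hη.integral_one, one_mul]
  rw [e2]
  refine (abs_integral_le_integral_abs).trans (integral_mono_of_nonneg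
    (Filter.Eventually.of_forall fun _ => abs_nonneg _) (hη.cc.integrable.mul_const _)
    (Filter.Eventually.of_forall fun z => ?_))
  simp only [abs_mul, abs_of_nonneg (hη.nonneg z)]
  by_cases hz : 1 < ‖z‖
  · rw [hη.support z hz]; simp
  · refine mul_le_mul_of_nonneg_left ((hL _ _).trans ?_) (hη.nonneg z)
    push Not at hz
    rw [sub_sub_cancel_left, norm_neg, norm_smul, Real.norm_of_nonneg hε]
    exact mul_le_mul_of_nonneg_left (mul_le_of_le_one_right hε hz) hL0

/-- The derivative of a mollified Lipschitz function is the mollification of its derivative, which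
exists almost everywhere. -/
theorem pd_moll_eq_moll_pd (hη : IsMollifier η) (hε : ε ≠ 0) (hM : ∀ x, |f x| ≤ M) (hL0 : 0 ≤ L)
    (hL : ∀ x y, |f x - f y| ≤ L * ‖x - y‖) (k : Fin n) (x : Sp n) :
    pd k (moll η ε f) x = moll η ε (pd k f) x := by
  have hf := (continuous_of_lipschitz hL0 hL).measurable
  set e : Sp n := EuclideanSpace.single k 1 with he
  have hen : ‖e‖ = 1 := by rw [he, PiLp.norm_single, norm_one]
  -- Rademacher's theorem; `z ↦ x - ε • z` pulls null sets back to null sets because `ε ≠ 0`.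
  have hdiff : ∀ᵐ z, DifferentiableAt ℝ f (x - ε • z) := by
    have h0 := ae_differentiableAt_of_lipschitz hL0 hL
    have hq : Measure.QuasiMeasurePreserving (fun z : Sp n => x - ε • z) volume volume := by
      have h1 : Measure.QuasiMeasurePreserving (fun z : Sp n => x - z) volume volume :=
        quasiMeasurePreserving_sub_left volume x
      have h2 : Measure.QuasiMeasurePreserving (fun z : Sp n => ε • z) volume volume := by
        refine ⟨by fun_prop, ?_⟩
        rw [Measure.map_addHaar_smul _ hε]
        exact Measure.smul_absolutelyContinuous
      exact h1.comp h2
    exact hq.ae h0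
  have hder : ∀ᵐ z, HasDerivAt (fun t : ℝ => η z * f (x + t • e - ε • z))
      (η z * pd k f (x - ε • z)) 0 := by
    filter_upwards [hdiff] with z hz
    have h1 : HasDerivAt (fun t : ℝ => x + t • e - ε • z) e 0 := by
      have := (((hasDerivAt_id (0 : ℝ)).smul_const e).const_add x).sub_const (ε • z)
      simpa using this
    have h2 : HasFDerivAt f (fderiv ℝ f (x - ε • z)) (x + (0 : ℝ) • e - ε • z) := by
      rw [zero_smul, add_zero]; exact hz.hasFDerivAt
    exact (h2.comp_hasDerivAt 0 h1).const_mul (η z)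
  have key := (hasDerivAt_integral_of_dominated_loc_of_lip (μ := (volume : Measure (Sp n)))
    (F := fun (t : ℝ) z => η z * f (x + t • e - ε • z))
    (F' := fun z => η z * pd k f (x - ε • z)) (x₀ := 0) (s := Set.univ)
    (bound := fun z => η z * L) Filter.univ_mem
    (Filter.Eventually.of_forall fun t => (integrable_moll hη.cc hf hM ε _).aestronglyMeasurable)
    (integrable_moll hη.cc hf hM ε _)
    (hη.cc.integrable.aestronglyMeasurable.mul
      ((measurable_pd k f).comp (by fun_prop)).aestronglyMeasurable)
    (Filter.Eventually.of_forall fun z => LipschitzOnWith.of_dist_le_mul fun t _ s _ => by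
      rw [Real.dist_eq, ← mul_sub, abs_mul, abs_of_nonneg (hη.nonneg z), Real.coe_nnabs,
        abs_of_nonneg (mul_nonneg (hη.nonneg z) hL0), mul_assoc]
      refine mul_le_mul_of_nonneg_left ((hL _ _).trans (le_of_eq ?_)) (hη.nonneg z)
      rw [sub_sub_sub_cancel_right, add_sub_add_left_eq_sub, ← sub_smul, norm_smul, hen, mul_one,
        Real.dist_eq, Real.norm_eq_abs])
    (hη.cc.integrable.mul_const L) hder).2
  have hsm : DifferentiableAt ℝ (moll η ε f) x :=
    (contDiff_moll hη.smooth hη.compact hε hf hM).differentiable (by simp) x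
  have h1 : HasDerivAt (fun t : ℝ => x + t • e) e 0 := by
    have := ((hasDerivAt_id (0 : ℝ)).smul_const e).const_add x
    simpa using this
  have h2 : HasFDerivAt (moll η ε f) (fderiv ℝ (moll η ε f) x) (x + (0 : ℝ) • e) := by
    rw [zero_smul, add_zero]; exact hsm.hasFDerivAt
  have h3 := h2.comp_hasDerivAt 0 h1
  exact h3.unique key

end

end Carleman

namespace Carleman

variable {n : ℕ}

/-! ### Smoothed coefficients -/

/-- Smooth symmetric elliptic coefficients with bounds for the first derivatives. -/
structure IsCoeff (lam L : ℝ) (a : Fin n → Fin n → Sp n → ℝ) : Prop where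
  smooth : ∀ i j, ContDiff ℝ ∞ (a i j)
  symm : ∀ i j x, a i j x = a j i x
  bound : ∀ i j x, |a i j x| ≤ lam
  elliptic : ∀ x ξ, lam⁻¹ * nsq ξ ≤ ea (fun i j => a i j x) ξ
  deriv : ∀ k i j x, |pd k (a i j) x| ≤ L

theorem IsCoeff.contDiff {lam L : ℝ} {a : Fin n → Fin n → Sp n → ℝ} (h : IsCoeff lam L a)
    (k : ℕ) (i j : Fin n) : ContDiff ℝ k (a i j) := (h.smooth i j).of_le (by norm_cast; exact le_top)

/-- The assumptions of the Carleman estimate. -/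
structure Setting (g : Sp n → Matrix (Fin n) (Fin n) ℝ) (lam Lam : ℝ) (Ω : Set (Sp n))
    (φ : Sp n → ℝ) (c₀ : ℝ) : Prop where
  symm : ∀ x, (g x).IsSymm
  one_le : 1 ≤ lam
  Lam_pos : 0 < Lam
  elliptic : IsElliptic g lam
  lipschitz : IsLipschitzField g Lam
  isOpen : IsOpen Ω
  bounded : Bornology.IsBounded Ω
  weight : IsC2Closure Ω φ
  grad_ne : ∀ x ∈ closure Ω, extendFrom Ω (grad φ) x ≠ 0
  c_pos : 0 < c₀
  main : MainAssumption g φ Ω c₀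

theorem par_norm_le {P : Par n} {R : ℝ} (hR : 0 ≤ R) (h1 : ∀ i j, |P.1 i j| ≤ R)
    (h2 : ∀ k i j, |P.2.1 k i j| ≤ R) (h3 : ∀ i, |P.2.2.1 i| ≤ R)
    (h4 : ∀ i j, |P.2.2.2 i j| ≤ R) : ‖P‖ ≤ R := by
  simp only [Prod.norm_def, max_le_iff, pi_norm_le_iff_of_nonneg hR, Real.norm_eq_abs]
  exact ⟨h1, h2, h3, h4⟩

section

variable {g : Sp n → Matrix (Fin n) (Fin n) ℝ} {lam Lam c₀ : ℝ} {Ω : Set (Sp n)} {φ : Sp n → ℝ}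

theorem Setting.lam_pos (S : Setting g lam Lam Ω φ c₀) : 0 < lam := by linarith [S.one_le]

theorem Setting.lip_nonneg (S : Setting g lam Lam Ω φ c₀) : 0 ≤ lam ^ 2 * Lam := by
  have := S.Lam_pos; positivity

theorem Setting.ginv_lip (S : Setting g lam Lam Ω φ c₀) (i j : Fin n) (x y : Sp n) :
    |ginv g i j x - ginv g i j y| ≤ lam ^ 2 * Lam * ‖x - y‖ :=
  ginv_lipschitz S.symm S.one_le S.elliptic S.lipschitz i j x y

theorem Setting.abs_ginv (S : Setting g lam Lam Ω φ c₀) (i j : Fin n) (x : Sp n) :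
    |ginv g i j x| ≤ lam := abs_ginv_le S.symm S.one_le S.elliptic i j x

theorem Setting.ginv_meas (S : Setting g lam Lam Ω φ c₀) (i j : Fin n) : Measurable (ginv g i j) :=
  (continuous_of_lipschitz S.lip_nonneg (S.ginv_lip i j)).measurable

theorem Setting.abs_pd_ginv (S : Setting g lam Lam Ω φ c₀) (k i j : Fin n) (x : Sp n) :
    |pd k (ginv g i j) x| ≤ lam ^ 2 * Lam :=
  abs_pd_le_of_lipschitz S.lip_nonneg (S.ginv_lip i j) k x

theorem Setting.ginv_ell (S : Setting g lam Lam Ω φ c₀) (x : Sp n) (ξ : Fin n → ℝ) :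
    lam⁻¹ * nsq ξ ≤ ea (fun i j => ginv g i j x) ξ :=
  (ginv_elliptic S.symm S.one_le S.elliptic x ξ).1

/-- The mollified coefficients. -/
def smoothCoeff (η : Sp n → ℝ) (g : Sp n → Matrix (Fin n) (Fin n) ℝ) (ε : ℝ) (i j : Fin n) :
    Sp n → ℝ := moll η ε (ginv g i j)

/-- The weighted proportion of the complement of `Ω` near a point. -/
def hole (η : Sp n → ℝ) (Ω : Set (Sp n)) (ε : ℝ) : Sp n → ℝ :=
  moll η ε (Ωᶜ.indicator fun _ => 1)

theorem Setting.isCoeff (S : Setting g lam Lam Ω φ c₀) {η : Sp n → ℝ} (hη : IsMollifier η)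
    {ε : ℝ} (hε : ε ≠ 0) : IsCoeff lam (lam ^ 2 * Lam) (smoothCoeff η g ε) where
  smooth i j := contDiff_moll hη.smooth hη.compact hε (S.ginv_meas i j) (S.abs_ginv i j)
  symm i j x := by
    unfold smoothCoeff
    rw [show ginv g i j = ginv g j i from funext fun y => ginv_symm S.symm i j y]
  bound i j x := by
    have := abs_moll_le hη.cc (S.abs_ginv i j) ε x
    rwa [hη.integral_abs, mul_one] at this
  elliptic x ξ := by
    have e : ea (fun i j => smoothCoeff η g ε i j x) ξ =
        moll η ε (fun y => ea (fun i j => ginv g i j y) ξ) x := by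
      unfold ea aV smoothCoeff moll
      have hi : ∀ i j, Integrable fun z => η z * ginv g i j (x - ε • z) * ξ j * ξ i := fun i j =>
        ((integrable_moll hη.cc (S.ginv_meas i j) (S.abs_ginv i j) ε x).mul_const _).mul_const _
      have : ∀ z, η z * ∑ i, (∑ j, ginv g i j (x - ε • z) * ξ j) * ξ i =
          ∑ i, ∑ j, η z * ginv g i j (x - ε • z) * ξ j * ξ i := fun z => by
        rw [Finset.mul_sum]
        refine Finset.sum_congr rfl fun i _ => ?_
        rw [Finset.sum_mul, Finset.mul_sum]
        exact Finset.sum_congr rfl fun j _ => by ring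
      simp_rw [this]
      rw [integral_finsetSum _ fun i _ => integrable_finsetSum _ fun j _ => hi i j]
      refine Finset.sum_congr rfl fun i _ => ?_
      rw [integral_finsetSum _ fun j _ => hi i j, Finset.sum_mul]
      exact Finset.sum_congr rfl fun j _ => by rw [integral_mul_const, integral_mul_const]
    rw [e]
    have hmeas : Measurable fun y => ea (fun i j => ginv g i j y) ξ := by
      unfold ea aV
      exact Finset.measurable_sum _ fun i _ => (Finset.measurable_sum _ fun j _ =>
        (S.ginv_meas i j).mul_const _).mul_const _
    refine moll_mono hη hmeas (M := lam * nsq ξ) (fun y => ?_) fun y => S.ginv_ell y ξ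
    rw [abs_le]
    have h1 := S.ginv_ell y ξ
    have h2 : ea (fun i j => ginv g i j y) ξ ≤ lam * nsq ξ :=
      (ginv_elliptic S.symm S.one_le S.elliptic y ξ).2.1
    have h3 : 0 ≤ lam⁻¹ * nsq ξ := mul_nonneg (inv_nonneg.2 S.lam_pos.le) (nsq_nonneg ξ)
    exact ⟨by linarith, h2⟩
  deriv k i j x := by
    refine abs_pd_le_of_lipschitz S.lip_nonneg (fun x y => ?_) k x
    have := abs_moll_sub_le hη.cc (S.ginv_meas i j) (S.abs_ginv i j) (S.ginv_lip i j) ε x y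
    rwa [hη.integral_abs, mul_one] at this

theorem Setting.smoothCoeff_sub (S : Setting g lam Lam Ω φ c₀) {η : Sp n → ℝ}
    (hη : IsMollifier η) {ε : ℝ} (hε : 0 ≤ ε) (i j : Fin n) (x : Sp n) :
    |smoothCoeff η g ε i j x - ginv g i j x| ≤ lam ^ 2 * Lam * ε :=
  abs_moll_sub_self_le hη hε (S.ginv_meas i j) (S.abs_ginv i j) S.lip_nonneg (S.ginv_lip i j) x

/-- One derivative falls on the mollifier and costs `ε⁻¹`; the other is paid for by the Lipschitz
constant. This rate determines the size of the gradient of the multiplier. -/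
theorem Setting.abs_pd_pd_smoothCoeff (S : Setting g lam Lam Ω φ c₀) {η : Sp n → ℝ}
    (hη : IsMollifier η) : ∃ C, 0 ≤ C ∧ ∀ ε : ℝ, 0 < ε → ∀ l k i j x,
      |pd l (pd k (smoothCoeff η g ε i j)) x| ≤ C / ε := by
  have hcp : ∀ k, CC (pd k η) := fun k => cc_pd (hη.smooth.of_le (by norm_cast)) hη.compact k
  refine ⟨∑ k, lam ^ 2 * Lam * ∫ z, |pd k η z|, Finset.sum_nonneg fun k _ =>
    mul_nonneg S.lip_nonneg (integral_nonneg fun _ => abs_nonneg _), fun ε hε l k i j x => ?_⟩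
  have hle : lam ^ 2 * Lam * (∫ z, |pd k η z|) ≤ ∑ k, lam ^ 2 * Lam * ∫ z, |pd k η z| :=
    Finset.single_le_sum (f := fun k => lam ^ 2 * Lam * ∫ z, |pd k η z|) (fun k _ =>
      mul_nonneg S.lip_nonneg (integral_nonneg fun _ => abs_nonneg _)) (Finset.mem_univ k)
  have hk0 : 0 ≤ lam ^ 2 * Lam * ∫ z, |pd k η z| :=
    mul_nonneg S.lip_nonneg (integral_nonneg fun _ => abs_nonneg _)
  refine (abs_pd_le_of_lipschitz (L := (lam ^ 2 * Lam * ∫ z, |pd k η z|) / ε) (by positivity)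
    (fun x y => ?_) l x).trans (by gcongr)
  unfold smoothCoeff
  rw [pd_moll hη.smooth hη.compact hε.ne' (S.ginv_meas i j) (S.abs_ginv i j),
    pd_moll hη.smooth hη.compact hε.ne' (S.ginv_meas i j) (S.abs_ginv i j), ← mul_sub, abs_mul,
    abs_of_pos (inv_pos.2 hε)]
  have := abs_moll_sub_le (hcp k) (S.ginv_meas i j) (S.abs_ginv i j) (S.ginv_lip i j) ε x y
  calc ε⁻¹ * _ ≤ ε⁻¹ * (lam ^ 2 * Lam * (∫ z, |pd k η z|) * ‖x - y‖) := by gcongr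
    _ = _ := by ring

theorem measurable_hole_ind (hΩ : IsOpen Ω) :
    Measurable (Ωᶜ.indicator fun _ => 1 : Sp n → ℝ) :=
  measurable_const.indicator hΩ.measurableSet.compl

theorem abs_hole_ind (x : Sp n) : |(Ωᶜ.indicator fun _ => 1 : Sp n → ℝ) x| ≤ 1 := by
  by_cases h : x ∈ Ω <;> simp [h]

theorem contDiff_hole (hΩ : IsOpen Ω) {η : Sp n → ℝ} (hη : IsMollifier η) {ε : ℝ} (hε : ε ≠ 0) :
    ContDiff ℝ ∞ (hole η Ω ε) :=
  contDiff_moll hη.smooth hη.compact hε (measurable_hole_ind hΩ) abs_hole_ind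

theorem hole_nonneg {η : Sp n → ℝ} (hη : IsMollifier η) (ε : ℝ) (x : Sp n) : 0 ≤ hole η Ω ε x :=
  integral_nonneg fun z => mul_nonneg (hη.nonneg z) (Set.indicator_nonneg (fun _ _ => zero_le_one) _)

theorem hole_le_one {η : Sp n → ℝ} (hη : IsMollifier η) (ε : ℝ) (x : Sp n) :
    hole η Ω ε x ≤ 1 := by
  have := abs_moll_le (f := (Ωᶜ.indicator fun _ => 1 : Sp n → ℝ)) hη.cc abs_hole_ind ε x
  rw [hη.integral_abs, one_mul] at this
  exact (le_abs_self _).trans this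

theorem abs_pd_hole (hΩ : IsOpen Ω) {η : Sp n → ℝ} (hη : IsMollifier η) :
    ∃ C, 0 ≤ C ∧ ∀ ε : ℝ, 0 < ε → ∀ k x, |pd k (hole η Ω ε) x| ≤ C / ε := by
  have hcp : ∀ k, CC (pd k η) := fun k => cc_pd (hη.smooth.of_le (by norm_cast)) hη.compact k
  have h0 : ∀ k, 0 ≤ ∫ z, |pd k η z| := fun k => integral_nonneg fun _ => abs_nonneg _
  refine ⟨∑ k, ∫ z, |pd k η z|, Finset.sum_nonneg fun k _ => h0 k, fun ε hε k x => ?_⟩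
  unfold hole
  rw [pd_moll hη.smooth hη.compact hε.ne' (measurable_hole_ind hΩ) abs_hole_ind, abs_mul,
    abs_of_pos (inv_pos.2 hε), inv_mul_eq_div]
  have h1 := abs_moll_le (f := (Ωᶜ.indicator fun _ => 1 : Sp n → ℝ)) (hcp k) abs_hole_ind ε x
  rw [one_mul] at h1
  exact div_le_div_of_nonneg_right (h1.trans (Finset.single_le_sum
    (f := fun k => ∫ z, |pd k η z|) (fun k _ => h0 k) (Finset.mem_univ k))) hε.le

/-- Averaging of the lower bound for the form of strong pseudoconvexity. -/
theorem Setting.le_formS_average (S : Setting g lam Lam Ω φ c₀) {η : Sp n → ℝ}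
    (hη : IsMollifier η) {ε : ℝ} (hε : 0 < ε) {K c C : ℝ} (x : Sp n) (ξ : Fin n → ℝ)
    (hin : ∀ᵐ y, y ∈ Ω → ‖x - y‖ ≤ ε → c * nsq ξ ≤
      formS K (fun i j => smoothCoeff η g ε i j x, fun k i j => pd k (ginv g i j) y,
        fun l => pd l φ x, fun i k => pd i (pd k φ) x) ξ)
    (hout : ∀ y, -(C * nsq ξ) ≤
      formS K (fun i j => smoothCoeff η g ε i j x, fun k i j => pd k (ginv g i j) y,
        fun l => pd l φ x, fun i k => pd i (pd k φ) x) ξ) :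
    (c - (C + c) * hole η Ω ε x) * nsq ξ ≤ formS K (parAt (smoothCoeff η g ε) φ x) ξ := by
  have hcf := S.isCoeff hη hε.ne'
  set P0 : Par n := (fun i j => smoothCoeff η g ε i j x, 0, fun l => pd l φ x,
    fun i k => pd i (pd k φ) x) with hP0
  have haff : ∀ d : Fin n → Fin n → Fin n → ℝ, formS K (P0.1, d, P0.2.2) ξ =
      formS K P0 ξ + ∑ k, ∑ i, ∑ j, formCoef P0 ξ k i j * d k i j := fun d =>
    formS_affine K (P := (P0.1, d, P0.2.2)) (fun i j => hcf.symm i j x) ξ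
  have hexp : (fun z => η z * formS K (P0.1, (fun k i j => pd k (ginv g i j) (x - ε • z)),
      P0.2.2) ξ) = fun z => η z * formS K P0 ξ
        + η z * ∑ k, ∑ i, ∑ j, formCoef P0 ξ k i j * pd k (ginv g i j) (x - ε • z) := by
    funext z
    rw [haff, mul_add]
  have hint : ∀ k i j, Integrable fun z => η z * pd k (ginv g i j) (x - ε • z) := fun k i j =>
    integrable_moll hη.cc (measurable_pd k _) (S.abs_pd_ginv k i j) ε x
  -- The derivatives of the mollified coefficients are averages of the derivatives of `ginv g`. The
  -- form is affine in them, so the average may be taken outside. All other parameters stay fixed at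
  -- `x`.
  have hlhs : formS K (parAt (smoothCoeff η g ε) φ x) ξ =
      ∫ z, η z * formS K (P0.1, (fun k i j => pd k (ginv g i j) (x - ε • z)), P0.2.2) ξ := by
    have e1 : parAt (smoothCoeff η g ε) φ x =
        (P0.1, (fun k i j => moll η ε (pd k (ginv g i j)) x), P0.2.2) := by
      unfold parAt smoothCoeff
      simp only [hP0, smoothCoeff]
      congr 2
      funext k i j
      exact pd_moll_eq_moll_pd hη hε.ne' (S.abs_ginv i j) S.lip_nonneg (S.ginv_lip i j) k x
    rw [e1, haff, hexp]
    have hi3 : ∀ k i j, Integrable fun z =>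
        η z * (formCoef P0 ξ k i j * pd k (ginv g i j) (x - ε • z)) := fun k i j => by
      have := (hint k i j).const_mul (formCoef P0 ξ k i j)
      refine this.congr (Filter.Eventually.of_forall fun z => ?_)
      simp only; ring
    have hi2 : Integrable fun z =>
        η z * ∑ k, ∑ i, ∑ j, formCoef P0 ξ k i j * pd k (ginv g i j) (x - ε • z) := by
      simp only [Finset.mul_sum]
      exact integrable_finsetSum _ fun k _ => integrable_finsetSum _ fun i _ =>
        integrable_finsetSum _ fun j _ => hi3 k i j
    rw [integral_add (hη.cc.integrable.mul_const _) hi2, integral_mul_const, hη.integral_one,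
      one_mul]
    congr 1
    simp only [Finset.mul_sum]
    rw [integral_finsetSum _ fun k _ => integrable_finsetSum _ fun i _ =>
        integrable_finsetSum _ fun j _ => hi3 k i j]
    refine Finset.sum_congr rfl fun k _ => ?_
    rw [integral_finsetSum _ fun i _ => integrable_finsetSum _ fun j _ => hi3 k i j]
    refine Finset.sum_congr rfl fun i _ => ?_
    rw [integral_finsetSum _ fun j _ => hi3 k i j]
    refine Finset.sum_congr rfl fun j _ => ?_
    unfold moll
    rw [← integral_const_mul]
    congr 1; ext z; ring
  have hrint : Integrable fun z =>
      η z * formS K (P0.1, (fun k i j => pd k (ginv g i j) (x - ε • z)), P0.2.2) ξ := by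
    rw [hexp]
    simp only [Finset.mul_sum]
    refine (hη.cc.integrable.mul_const _).add (integrable_finsetSum _ fun k _ =>
      integrable_finsetSum _ fun i _ => integrable_finsetSum _ fun j _ => ?_)
    have := (hint k i j).const_mul (formCoef P0 ξ k i j)
    refine this.congr (Filter.Eventually.of_forall fun z => ?_)
    simp only; ring
  have hholeint := integrable_moll hη.cc (measurable_hole_ind S.isOpen) abs_hole_ind ε x
  have hl : (c - (C + c) * hole η Ω ε x) * nsq ξ = ∫ z, (η z * (c * nsq ξ)
      - ((C + c) * nsq ξ) * (η z * (Ωᶜ.indicator fun _ => 1 : Sp n → ℝ) (x - ε • z))) := by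
    rw [integral_sub (hη.cc.integrable.mul_const _) (hholeint.const_mul _), integral_mul_const,
      hη.integral_one, integral_const_mul]
    unfold hole moll
    ring
  rw [hlhs, hl]
  refine integral_mono_ae ((hη.cc.integrable.mul_const _).sub (hholeint.const_mul _)) hrint ?_
  have hq : Measure.QuasiMeasurePreserving (fun z : Sp n => x - ε • z) volume volume := by
    refine (quasiMeasurePreserving_sub_left volume x).comp ⟨by fun_prop, ?_⟩
    rw [Measure.map_addHaar_smul _ hε.ne']
    exact Measure.smul_absolutelyContinuous
  filter_upwards [hq.ae hin] with z hz
  -- Three cases under the integral: no weight beyond the unit ball, the lower bound `c` at points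
  -- of `Ω`, and only `-C` at points outside, which are counted by `hole`.
  by_cases hz1 : 1 < ‖z‖
  · simp [hη.support z hz1]
  have hz2 : ‖x - (x - ε • z)‖ ≤ ε := by
    push Not at hz1
    rw [sub_sub_cancel, norm_smul, Real.norm_of_nonneg hε.le]
    exact mul_le_of_le_one_right hε.le hz1
  by_cases hzΩ : x - ε • z ∈ Ω
  · have := mul_le_mul_of_nonneg_left (hz hzΩ hz2) (hη.nonneg z)
    simpa [hzΩ] using this
  · have h1 := mul_le_mul_of_nonneg_left (hout (x - ε • z)) (hη.nonneg z)
    have h2 : (Ωᶜ.indicator fun _ => 1 : Sp n → ℝ) (x - ε • z) = 1 := by simp [hzΩ]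
    simp only [h2]
    refine le_trans (le_of_eq ?_) h1
    ring

end

end Carleman

namespace Carleman

variable {n : ℕ}

/-! ### The multiplier -/

/-- The divergence of the field `a N`. -/
def trB (P : Par n) : ℝ := ∑ k, dB P k k

/-- The principal part of the multiplier. -/
def mult (P : Par n) : ℝ := trB P + coefm P / (2 * ea P.1 P.2.2.1)

theorem continuous_trB : Continuous (trB : Par n → ℝ) := by unfold trB dB; fun_prop

theorem contDiff_ea_N : ContDiff ℝ ∞ fun P : Par n => ea P.1 P.2.2.1 := by
  unfold ea aV; fun_prop

theorem isOpen_ea_ne : IsOpen {P : Par n | ea P.1 P.2.2.1 ≠ 0} :=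
  isOpen_ne_fun contDiff_ea_N.continuous continuous_const

theorem contDiffOn_mult : ContDiffOn ℝ ∞ (mult : Par n → ℝ) {P | ea P.1 P.2.2.1 ≠ 0} := by
  have h1 : ContDiff ℝ ∞ (trB : Par n → ℝ) := by unfold trB dB; fun_prop
  have h2 : ContDiff ℝ ∞ (coefm : Par n → ℝ) := by unfold coefm dq dB aV; fun_prop
  refine h1.contDiffOn.add (h2.contDiffOn.div (contDiff_const.mul contDiff_ea_N).contDiffOn ?_)
  intro P hP
  exact mul_ne_zero two_ne_zero hP

theorem exists_fderiv_bound {E : Type*} [NormedAddCommGroup E] [NormedSpace ℝ E] {f : E → ℝ}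
    {U K : Set E} (hU : IsOpen U) (hf : ContDiffOn ℝ 1 f U) (hK : IsCompact K) (hKU : K ⊆ U) :
    ∃ C, 0 ≤ C ∧ ∀ x ∈ K, ∀ v, |fderiv ℝ f x v| ≤ C * ‖v‖ := by
  have hc : ContinuousOn (fderiv ℝ f) K := (hf.continuousOn_fderiv_of_isOpen hU le_rfl).mono hKU
  obtain ⟨C, hC⟩ := hK.exists_bound_of_continuousOn hc
  refine ⟨max C 0, le_max_right _ _, fun x hx v => ?_⟩
  refine ((fderiv ℝ f x).le_opNorm v).trans ?_
  gcongr
  exact (hC x hx).trans (le_max_left _ _)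

theorem parSet_subset {lam R cN : ℝ} (hlam : 1 ≤ lam) (hcN : 0 < cN) :
    parSet n lam R cN ⊆ {P | ea P.1 P.2.2.1 ≠ 0} := fun _ hP => (ea_N_pos hlam hcN hP).ne'

theorem mult_modulus {lam R cN δ : ℝ} (hlam : 1 ≤ lam) (hcN : 0 < cN) (hδ : 0 < δ) :
    ∃ r, 0 < r ∧ ∀ P ∈ parSet n lam R cN, ∀ P' ∈ parSet n lam R cN, ‖P - P'‖ < r →
      |mult P - mult P'| < δ := by
  have huc := (isCompact_parSet (n := n) lam R cN).uniformContinuousOn_of_continuous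
    (contDiffOn_mult.continuousOn.mono (parSet_subset hlam hcN))
  obtain ⟨r, hr, h⟩ := Metric.uniformContinuousOn_iff.1 huc δ hδ
  exact ⟨r, hr, fun P hP P' hP' hd => h P hP P' hP' (by rwa [dist_eq_norm])⟩

theorem mult_bound {lam R cN : ℝ} (hlam : 1 ≤ lam) (hcN : 0 < cN) :
    ∃ C, 0 ≤ C ∧ ∀ P ∈ parSet n lam R cN, |mult P| ≤ C ∧ |trB P| ≤ C ∧
      ea P.1 P.2.2.1 ≤ C ∧ (∀ v, |fderiv ℝ mult P v| ≤ C * ‖v‖) := by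
  have hcomp := isCompact_parSet (n := n) lam R cN
  obtain ⟨C1, h1⟩ := hcomp.exists_bound_of_continuousOn
    (contDiffOn_mult.continuousOn.mono (parSet_subset hlam hcN))
  obtain ⟨C2, h2⟩ := hcomp.exists_bound_of_continuousOn continuous_trB.continuousOn
  obtain ⟨C3, h3⟩ := hcomp.exists_bound_of_continuousOn
    (contDiff_ea_N (n := n)).continuous.continuousOn
  obtain ⟨C4, h40, h4⟩ := exists_fderiv_bound isOpen_ea_ne
    (contDiffOn_mult.of_le (by norm_cast)) hcomp (parSet_subset hlam hcN)
  refine ⟨|C1| + |C2| + |C3| + C4, by positivity, fun P hP => ⟨?_, ?_, ?_, fun v => ?_⟩⟩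
  · have := h1 P hP
    rw [Real.norm_eq_abs] at this
    linarith [le_abs_self C1, abs_nonneg C2, abs_nonneg C3]
  · have := h2 P hP
    rw [Real.norm_eq_abs] at this
    linarith [le_abs_self C2, abs_nonneg C1, abs_nonneg C3]
  · have := h3 P hP
    rw [Real.norm_eq_abs] at this
    linarith [le_abs_self C3, abs_nonneg C1, abs_nonneg C2, le_abs_self (ea P.1 P.2.2.1)]
  · refine (h4 P hP v).trans ?_
    gcongr
    linarith [abs_nonneg C1, abs_nonneg C2, abs_nonneg C3]

theorem ea_le {a : Fin n → Fin n → ℝ} {lam : ℝ} (h : ∀ i j, |a i j| ≤ lam) (ξ : Fin n → ℝ) :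
    ea a ξ ≤ n * lam * nsq ξ := by
  have hpt : ∀ i j, a i j * ξ j * ξ i ≤ lam * (ξ i ^ 2 + ξ j ^ 2) / 2 := fun i j => by
    have h1 : a i j * ξ j * ξ i ≤ |a i j| * (|ξ j| * |ξ i|) := by
      rw [mul_assoc, ← abs_mul, ← abs_mul]; exact le_abs_self _
    have h2 : |ξ j| * |ξ i| ≤ (ξ i ^ 2 + ξ j ^ 2) / 2 := by
      nlinarith [sq_nonneg (|ξ j| - |ξ i|), sq_abs (ξ i), sq_abs (ξ j)]
    have h3 : |a i j| * (|ξ j| * |ξ i|) ≤ lam * ((ξ i ^ 2 + ξ j ^ 2) / 2) :=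
      mul_le_mul (h i j) h2 (by positivity) ((abs_nonneg _).trans (h i j))
    linarith
  unfold ea aV
  calc ∑ i, (∑ j, a i j * ξ j) * ξ i = ∑ i, ∑ j, a i j * ξ j * ξ i := by
        simp only [Finset.sum_mul]
    _ ≤ ∑ i, ∑ j, lam * (ξ i ^ 2 + ξ j ^ 2) / 2 :=
        Finset.sum_le_sum fun i _ => Finset.sum_le_sum fun j _ => hpt i j
    _ = n * lam * nsq ξ := by
        have : ∀ i j, lam * (ξ i ^ 2 + ξ j ^ 2) / 2 = lam / 2 * ξ i ^ 2 + lam / 2 * ξ j ^ 2 :=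
          fun i j => by ring
        simp only [this, Finset.sum_add_distrib, Finset.sum_const, Finset.card_univ,
          Fintype.card_fin, nsmul_eq_mul, ← Finset.mul_sum]
        unfold nsq; ring

/-- The lower bound for the energy density which the choice of the multiplier is made for. -/
theorem density_lower_bound {P : Par n} {ξ : Fin n → ℝ} {s h c C c1 κ ψ lam K q0 q1 E : ℝ}
    (hq : 0 < ea P.1 P.2.2.1) (hq0 : q0 ≤ ea P.1 P.2.2.1) (hq1 : ea P.1 P.2.2.1 ≤ q1)
    (hψ : 0 ≤ ψ) (hc1 : 0 ≤ c1) (hell : lam⁻¹ * nsq ξ ≤ ea P.1 ξ) (hup : ea P.1 ξ ≤ E * nsq ξ)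
    (hlam : 0 < lam) (hκ : κ = C * lam / 2) (hC : 0 ≤ C) (hcE : 3 * c1 * E ≤ c / 2)
    (hform : (c - C * ψ) * nsq ξ ≤ formS K P ξ)
    (hh : |h - (mult P - c1 + κ * ψ)| ≤ c1 / 2) :
    c / 2 * nsq ξ + c1 * q0 * s ^ 2 - 2 * κ * q1 * ψ * s ^ 2
        - K * (∑ k, aV P.1 P.2.2.1 k * ξ k) ^ 2 ≤
      formM P ξ + s ^ 2 * coefm P - 2 * (trB P - h) * (ea P.1 ξ - s ^ 2 * ea P.1 P.2.2.1) := by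
  set e := h - (mult P - c1 + κ * ψ) with he
  -- For `h = mult P` the factor `-2 (trB - h)` equals `coefm / a(N,N)`. The two terms `s ^ 2 *
  -- coefm` cancel and exactly `formR` remains.
  have hid : formM P ξ + s ^ 2 * coefm P - 2 * (trB P - h) * (ea P.1 ξ - s ^ 2 * ea P.1 P.2.2.1) =
      formS K P ξ - K * (∑ k, aV P.1 P.2.2.1 k * ξ k) ^ 2
        + 2 * (e - c1 + κ * ψ) * (ea P.1 ξ - s ^ 2 * ea P.1 P.2.2.1) := by
    have : h = e + (mult P - c1 + κ * ψ) := by rw [he]; ring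
    rw [this]
    unfold formS formR mult
    field_simp
    ring
  rw [hid]
  have hea0 : 0 ≤ ea P.1 ξ := (mul_nonneg (inv_nonneg.2 hlam.le) (nsq_nonneg ξ)).trans hell
  have hκ0 : 0 ≤ κ := by rw [hκ]; positivity
  have he1 := (abs_le.1 hh).1
  have he2 := (abs_le.1 hh).2
  -- The constant `-c1` gives up a little of the gradient for positivity in `s ^ 2`. The term `κ ψ`
  -- does the opposite: by the choice of `κ` it offsets the deficit `C ψ |ξ|²` and leaves a negative
  -- multiple of `ψ s ^ 2`.
  have hA : -(3 * c1) * ea P.1 ξ ≤ 2 * (e - c1) * ea P.1 ξ := by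
    apply mul_le_mul_of_nonneg_right _ hea0; linarith
  have hA' : 3 * c1 * ea P.1 ξ ≤ c / 2 * nsq ξ := by
    calc 3 * c1 * ea P.1 ξ ≤ 3 * c1 * (E * nsq ξ) := by gcongr
      _ = (3 * c1 * E) * nsq ξ := by ring
      _ ≤ _ := mul_le_mul_of_nonneg_right hcE (nsq_nonneg ξ)
  have hB : C * ψ * nsq ξ ≤ 2 * (κ * ψ) * ea P.1 ξ := by
    calc C * ψ * nsq ξ = 2 * (κ * ψ) * (lam⁻¹ * nsq ξ) := by rw [hκ]; field_simp
      _ ≤ _ := by gcongr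
  have hs := sq_nonneg s
  have hD : c1 * q0 * s ^ 2 ≤ -(2 * (e - c1)) * (s ^ 2 * ea P.1 P.2.2.1) := by
    calc c1 * q0 * s ^ 2 ≤ c1 * ea P.1 P.2.2.1 * s ^ 2 := by gcongr
      _ = c1 * (s ^ 2 * ea P.1 P.2.2.1) := by ring
      _ ≤ _ := mul_le_mul_of_nonneg_right (by linarith) (by positivity)
  have hF : 2 * (κ * ψ) * (s ^ 2 * ea P.1 P.2.2.1) ≤ 2 * κ * q1 * ψ * s ^ 2 := by
    calc 2 * (κ * ψ) * (s ^ 2 * ea P.1 P.2.2.1) ≤ 2 * (κ * ψ) * (s ^ 2 * q1) := by gcongr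
      _ = _ := by ring
  nlinarith

end Carleman

namespace Carleman

variable {n : ℕ} {g : Sp n → Matrix (Fin n) (Fin n) ℝ} {lam Lam c₀ : ℝ} {Ω : Set (Sp n)}
  {φ : Sp n → ℝ}

/-! ### Bounds that are uniform on `Ω`, and the construction of the multiplier -/

theorem exists_uniform_radius {ι : Type*} [Finite ι] {f : ι → Sp n → ℝ}
    (hf : ∀ i, ExtendsToClosure Ω (f i)) (hb : Bornology.IsBounded Ω) {δ : ℝ} (hδ : 0 < δ) :
    ∃ r, 0 < r ∧ ∀ i, ∀ x ∈ Ω, ∀ y ∈ Ω, ‖x - y‖ < r → |f i x - f i y| < δ := by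
  have h : ∀ i, ∀ᶠ r in nhdsWithin (0 : ℝ) (Set.Ioi 0),
      ∀ x ∈ Ω, ∀ y ∈ Ω, ‖x - y‖ < r → |f i x - f i y| < δ := by
    intro i
    obtain ⟨r0, hr0, h0⟩ := (hf i).uniform hb hδ
    filter_upwards [Ioo_mem_nhdsGT hr0] with r hr x hx y hy hxy
    exact h0 x hx y hy (hxy.trans hr.2)
  obtain ⟨r, hr, hr0⟩ := ((Filter.eventually_all.2 h).and self_mem_nhdsWithin).exists
  exact ⟨r, hr0, hr⟩

theorem exists_uniform_bound {ι : Type*} [Finite ι] {f : ι → Sp n → ℝ}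
    (hf : ∀ i, ExtendsToClosure Ω (f i)) (hb : Bornology.IsBounded Ω) :
    ∃ R, 0 ≤ R ∧ ∀ i, ∀ x ∈ Ω, |f i x| ≤ R := by
  have h : ∀ i, ∀ᶠ R in Filter.atTop, ∀ x ∈ Ω, |f i x| ≤ R := by
    intro i
    obtain ⟨R, -, h0⟩ := (hf i).exists_bound hb
    filter_upwards [Filter.eventually_ge_atTop R] with r hr x hx
    exact (h0 x hx).trans hr
  obtain ⟨R, hR, hR0⟩ := ((Filter.eventually_all.2 h).and (Filter.eventually_ge_atTop 0)).exists
  exact ⟨R, hR0, hR⟩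

/-- Bounds for the weight on `Ω`. -/
theorem Setting.exists_weight_bounds (S : Setting g lam Lam Ω φ c₀) :
    ∃ R cN, 0 ≤ R ∧ 0 < cN ∧ (∀ x ∈ Ω, ∀ i, |pd i φ x| ≤ R) ∧
      (∀ x ∈ Ω, ∀ i j, |pd i (pd j φ) x| ≤ R) ∧ ∀ x ∈ Ω, cN ≤ nsq (fun i => pd i φ x) := by
  obtain ⟨R1, h10, h1⟩ := exists_uniform_bound S.weight.2.2.1 S.bounded
  obtain ⟨R2, h20, h2⟩ := exists_uniform_bound
    (f := fun (p : Fin n × Fin n) => pd p.1 (pd p.2 φ))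
    (fun p => S.weight.2.2.2 p.1 p.2) S.bounded
  obtain ⟨c, hc, h3⟩ := exists_nsq_grad_ge S.bounded S.weight.2.2.1 S.grad_ne
  refine ⟨R1 + R2, c, by positivity, hc, fun x hx i => ?_, fun x hx i j => ?_, h3⟩
  · linarith [h1 i x hx]
  · linarith [h2 (i, j) x hx]

/-- The lower bound for the form with the smoothed coefficients. -/
theorem Setting.exists_formS_lower (S : Setting g lam Lam Ω φ c₀) {η : Sp n → ℝ}
    (hη : IsMollifier η) {R cN : ℝ} (hcN : 0 < cN) (hRl : lam + lam ^ 2 * Lam ≤ R)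
    (hN : ∀ x ∈ Ω, ∀ i, |pd i φ x| ≤ R) (hH : ∀ x ∈ Ω, ∀ i j, |pd i (pd j φ) x| ≤ R)
    (hNl : ∀ x ∈ Ω, cN ≤ nsq (fun i => pd i φ x)) :
    ∃ K c C ε₀ : ℝ, 0 ≤ K ∧ 0 < c ∧ 0 ≤ C ∧ 0 < ε₀ ∧ ∀ ε, 0 < ε → ε ≤ ε₀ → ∀ x ∈ Ω, ∀ ξ,
      (c - C * hole η Ω ε x) * nsq ξ ≤ formS K (parAt (smoothCoeff η g ε) φ x) ξ := by
  have hl := S.lam_pos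
  have hL := S.lip_nonneg
  have hR0 : 0 ≤ R := by linarith
  set c := c₀ * lam⁻¹ with hc
  have hcpos : 0 < c := mul_pos S.c_pos (inv_pos.2 hl)
  obtain ⟨K, hK0, hK⟩ := exists_formS_pos (n := n) (R := R) S.one_le hcN hcpos
  obtain ⟨C, hC0, hC⟩ := formS_bound (n := n) (R := R) S.one_le hcN K
  obtain ⟨r, hr, hmod⟩ := formS_modulus (n := n) (R := R) S.one_le hcN
    (show 0 < c / 4 by positivity) K
  obtain ⟨r1, hr1, h1⟩ := exists_uniform_radius S.weight.2.2.1 S.bounded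
    (show 0 < r / 2 by positivity)
  obtain ⟨r2, hr2, h2⟩ := exists_uniform_radius
    (f := fun (p : Fin n × Fin n) => pd p.1 (pd p.2 φ))
    (fun p => S.weight.2.2.2 p.1 p.2) S.bounded (show 0 < r / 2 by positivity)
  -- Adding the square leaves `c / 2`, and moving parameters from `y` to `x` costs `c / 4`. The
  -- thresholds on `ε` keep the parameters at distance less than `r`; the last one covers both the
  -- mollification error and the variation of the coefficients, each at most `lam ^ 2 * Lam * ε`.
  refine ⟨K, c / 4, C + c / 4, min (min (r1 / 2) (r2 / 2)) (r / (4 * (lam ^ 2 * Lam + 1))), hK0,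
    by positivity, by positivity, by positivity, fun ε hε hε0 x hx ξ => ?_⟩
  have hεr1 : ε < r1 := by
    have := (hε0.trans (min_le_left _ _)).trans (min_le_left _ _)
    linarith
  have hεr2 : ε < r2 := by
    have := (hε0.trans (min_le_left _ _)).trans (min_le_right _ _)
    linarith
  have hεr : 2 * (lam ^ 2 * Lam * ε) ≤ r / 2 := by
    have := hε0.trans (min_le_right _ _)
    rw [le_div_iff₀ (by positivity)] at this
    nlinarith
  have hcf := S.isCoeff hη hε.ne'
  have hmem1 : ∀ y ∈ Ω, parAt (ginv g) φ y ∈ parSet n lam R cN := fun y hy =>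
    ⟨par_norm_le hR0 (fun i j => (S.abs_ginv i j y).trans (by linarith))
      (fun k i j => (S.abs_pd_ginv k i j y).trans (by linarith)) (fun i => hN y hy i)
      (fun i j => hH y hy i j), fun ξ => S.ginv_ell y ξ, hNl y hy⟩
  -- Mixed parameters: everything is taken at `x` except the derivatives of the coefficients, which
  -- are taken at `y`. Those are not continuous, so they must not be moved; the remaining ones are
  -- continuous.
  have hmem2 : ∀ y, ((fun i j => smoothCoeff η g ε i j x, fun k i j => pd k (ginv g i j) y,
        fun l => pd l φ x, fun i k => pd i (pd k φ) x) : Par n) ∈ parSet n lam R cN := fun y =>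
    ⟨par_norm_le hR0 (fun i j => (hcf.bound i j x).trans (by linarith))
      (fun k i j => (S.abs_pd_ginv k i j y).trans (by linarith)) (fun i => hN x hx i)
      (fun i j => hH x hx i j), fun ξ => hcf.elliptic x ξ, hNl x hx⟩
  refine S.le_formS_average hη hε x ξ ?_ fun y => hC _ (hmem2 y) ξ
  have hmain := S.main
  unfold MainAssumption at hmain
  rw [ae_restrict_iff' S.isOpen.measurableSet] at hmain
  filter_upwards [hmain] with y hy hyΩ hxy
  have hNy : grad φ y ≠ 0 := by
    intro h0
    have := hNl y hyΩ
    rw [show (fun i => pd i φ y) = grad φ y from rfl, h0] at this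
    simp [nsq] at this
    linarith
  have hgood := hK _ (hmem1 y hyΩ) (fun ξ hξ => le_formR_of_mainAssumption S.symm S.one_le
    S.elliptic S.c_pos hNy (hy hyΩ) ξ hξ) ξ
  have hd := hmod _ (hmem2 y) _ (hmem1 y hyΩ) (lt_of_le_of_lt (par_norm_le (R := r / 2)
    (by positivity) (fun i j => ?_) (fun k i j => ?_) (fun i => ?_) fun i j => ?_)
    (by linarith)) ξ
  · have := (abs_le.1 hd).1
    nlinarith [nsq_nonneg ξ]
  · change |smoothCoeff η g ε i j x - ginv g i j y| ≤ r / 2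
    have h3 := S.smoothCoeff_sub hη hε.le i j x
    have h4 := S.ginv_lip i j x y
    have h5 : lam ^ 2 * Lam * ‖x - y‖ ≤ lam ^ 2 * Lam * ε := by gcongr
    have := abs_sub_le (smoothCoeff η g ε i j x) (ginv g i j x) (ginv g i j y)
    linarith
  · change |pd k (ginv g i j) y - pd k (ginv g i j) y| ≤ r / 2
    rw [sub_self, abs_zero]; positivity
  · exact (h1 i x hx y hyΩ (hxy.trans_lt hεr1)).le
  · exact (h2 (i, j) x hx y hyΩ (hxy.trans_lt hεr2)).le

/-- The existence of the multiplier. -/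
theorem Setting.exists_multiplier (S : Setting g lam Lam Ω φ c₀) {η : Sp n → ℝ}
    (hη : IsMollifier η) :
    ∃ K c C ε₀ : ℝ, 0 ≤ K ∧ 0 < c ∧ 0 ≤ C ∧ 0 < ε₀ ∧ ∀ ε, 0 < ε → ε ≤ ε₀ →
      ∃ h : Sp n → ℝ, ContDiffOn ℝ 1 h Ω ∧ ∀ x ∈ Ω, |h x| ≤ C ∧
        |trB (parAt (smoothCoeff η g ε) φ x)| ≤ C ∧ (∀ i, |pd i h x| ≤ C / ε) ∧
        ∀ ξ s, c * (nsq ξ + s ^ 2) - C * hole η Ω ε x * s ^ 2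
          - K * (∑ k, aV (parAt (smoothCoeff η g ε) φ x).1 (fun l => pd l φ x) k * ξ k) ^ 2 ≤
          formM (parAt (smoothCoeff η g ε) φ x) ξ + s ^ 2 * coefm (parAt (smoothCoeff η g ε) φ x)
            - 2 * (trB (parAt (smoothCoeff η g ε) φ x) - h x) *
              (ea (parAt (smoothCoeff η g ε) φ x).1 ξ
                - s ^ 2 * ea (parAt (smoothCoeff η g ε) φ x).1 (fun l => pd l φ x)) := by
  have hl := S.lam_pos
  have hL := S.lip_nonneg
  obtain ⟨R0, cN, hR00, hcN, hN, hH, hNl⟩ := S.exists_weight_bounds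
  set R := lam + lam ^ 2 * Lam + R0 + 1 with hR
  have hRpos : 0 ≤ R := by positivity
  have hlR : lam ≤ R := by linarith
  have hLR : lam ^ 2 * Lam ≤ R := by linarith
  obtain ⟨K, c, C, ε₀, hK0, hc, hC0, hε₀, hlow⟩ := S.exists_formS_lower hη hcN
    (show lam + lam ^ 2 * Lam ≤ R by linarith)
    (fun x hx i => (hN x hx i).trans (by linarith))
    (fun x hx i j => (hH x hx i j).trans (by linarith)) hNl
  -- Chosen so that the gradient part lost through `c1` stays below `c / 2`: `a(ξ, ξ) ≤ n lam |ξ|²`,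
  -- and three times `c1` is lost.
  set c1 := c / (6 * (n * lam + 1)) with hc1
  have hc1pos : 0 < c1 := by positivity
  obtain ⟨r, hr, hmod⟩ := mult_modulus (n := n) (R := R) S.one_le hcN
    (show 0 < c1 / 2 by positivity)
  obtain ⟨CM, hCM0, hCM⟩ := mult_bound (n := n) (R := R) S.one_le hcN
  have hFex : ∀ i j, ∃ F : Sp n → ℝ, ContDiff ℝ ∞ F ∧
      (∀ x ∈ Ω, |F x - pd i (pd j φ) x| ≤ min (r / 2) 1) ∧
      ∃ C, ∀ x ∈ Ω, ∀ i, |pd i F x| ≤ C := fun i j =>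
    (S.weight.2.2.2 i j).exists_smooth S.bounded (by positivity)
  choose F hF hFa CF hCF using hFex
  set CFs := ∑ i, ∑ j, |CF i j| with hCFs
  have hCF' : ∀ i j, CF i j ≤ CFs := fun i j =>
    (le_abs_self _).trans ((Finset.single_le_sum (f := fun j => |CF i j|)
      (fun _ _ => abs_nonneg _) (Finset.mem_univ j)).trans
      (Finset.single_le_sum (f := fun i => ∑ j, |CF i j|)
        (fun _ _ => Finset.sum_nonneg fun _ _ => abs_nonneg _) (Finset.mem_univ i)))
  have hCFs0 : 0 ≤ CFs := Finset.sum_nonneg fun _ _ => Finset.sum_nonneg fun _ _ => abs_nonneg _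
  obtain ⟨C2, hC20, hC2⟩ := S.abs_pd_pd_smoothCoeff hη
  obtain ⟨Cψ, hCψ0, hCψ⟩ := abs_pd_hole S.isOpen hη
  set κ := C * lam / 2 with hκ
  have hκ0 : 0 ≤ κ := by positivity
  set c2 := min (c / 2) (c1 * (lam⁻¹ * cN)) with hc2
  have hc2pos : 0 < c2 := by
    have : 0 < lam⁻¹ := inv_pos.2 hl
    positivity
  set Ct := CM + c1 + κ + 2 * κ * CM + (CM * (R + C2 + CFs) + κ * Cψ) with hCt
  have hCt0 : 0 ≤ Ct := by positivity
  refine ⟨K, c2, Ct, min ε₀ 1, hK0, hc2pos, hCt0, by positivity, fun ε hε hεle => ?_⟩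
  have hε1 : ε ≤ 1 := hεle.trans (min_le_right _ _)
  have hεε₀ : ε ≤ ε₀ := hεle.trans (min_le_left _ _)
  have hcf := S.isCoeff hη hε.ne'
  -- The true parameters with the Hessian replaced by a smooth approximation. With the true Hessian
  -- `mult` would be merely continuous along `x`.
  set Q : Sp n → Par n := fun x => (fun i j => smoothCoeff η g ε i j x,
    fun k i j => pd k (smoothCoeff η g ε i j) x, fun l => pd l φ x, fun i j => F i j x) with hQ
  have hQmem : ∀ x ∈ Ω, Q x ∈ parSet n lam R cN := fun x hx =>
    ⟨par_norm_le hRpos (fun i j => (hcf.bound i j x).trans hlR)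
      (fun k i j => (hcf.deriv k i j x).trans hLR)
      (fun i => (hN x hx i).trans (by linarith)) (fun i j => by
        have h1 := (hFa i j x hx).trans (min_le_right _ _)
        have h2 := hH x hx i j
        change |F i j x| ≤ R
        have h3 := abs_sub_abs_le_abs_sub (F i j x) (pd i (pd j φ) x)
        linarith), fun ξ => hcf.elliptic x ξ, hNl x hx⟩
  have hPmem : ∀ x ∈ Ω, parAt (smoothCoeff η g ε) φ x ∈ parSet n lam R cN := fun x hx =>
    ⟨par_norm_le hRpos (fun i j => (hcf.bound i j x).trans hlR)
      (fun k i j => (hcf.deriv k i j x).trans hLR)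
      (fun i => (hN x hx i).trans (by linarith)) (fun i j => (hH x hx i j).trans (by linarith)),
      fun ξ => hcf.elliptic x ξ, hNl x hx⟩
  have hφat : ∀ x ∈ Ω, ContDiffAt ℝ 2 φ x := fun x hx =>
    S.weight.1.contDiffAt (S.isOpen.mem_nhds hx)
  have hpdat : ∀ x ∈ Ω, ∀ i, ContDiffAt ℝ 1 (pd i φ) x := fun x hx i => by
    have := (hφat x hx).fderiv_right (m := 1) (by norm_num [one_add_one_eq_two])
    exact this.clm_apply contDiffAt_const
  have hpdsm : ∀ k i j, ContDiff ℝ 1 (pd k (smoothCoeff η g ε i j)) := fun k i j =>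
    contDiff_one_pd (hcf.contDiff 2 i j) k
  have hQat : ∀ x ∈ Ω, ContDiffAt ℝ 1 Q x := fun x hx => by
    refine ContDiffAt.prodMk ?_ (ContDiffAt.prodMk ?_ (ContDiffAt.prodMk ?_ ?_))
    · exact contDiffAt_pi.2 fun i => contDiffAt_pi.2 fun j => (hcf.contDiff 1 i j).contDiffAt
    · exact contDiffAt_pi.2 fun k => contDiffAt_pi.2 fun i => contDiffAt_pi.2 fun j =>
        (hpdsm k i j).contDiffAt
    · exact contDiffAt_pi.2 fun l => hpdat x hx l
    · exact contDiffAt_pi.2 fun i => contDiffAt_pi.2 fun j =>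
        ((hF i j).of_le (by norm_cast)).contDiffAt
  have hmat : ∀ x ∈ Ω, ContDiffAt ℝ 1 mult (Q x) := fun x hx =>
    (contDiffOn_mult.contDiffAt (isOpen_ea_ne.mem_nhds
      (parSet_subset S.one_le hcN (hQmem x hx)))).of_le (by norm_cast)
  have hψs := contDiff_hole S.isOpen hη hε.ne'
  have hψ1 : ContDiff ℝ 1 (hole η Ω ε) := hψs.of_le (by norm_cast)
  -- The three terms turn the density into `formR`, create positivity in `s`, and compensate for the
  -- holes of `Ω`.
  refine ⟨fun x => mult (Q x) - c1 + κ * hole η Ω ε x, fun x hx => ?_, fun x hx => ?_⟩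
  · exact (((ContDiffAt.comp x (hmat x hx) (hQat x hx)).sub contDiffAt_const).add
      (contDiffAt_const.mul hψ1.contDiffAt)).contDiffWithinAt
  have hψ0 := hole_nonneg (Ω := Ω) hη ε x
  have hψle := hole_le_one (Ω := Ω) hη ε x
  obtain ⟨hQ1, -, -, hQ4⟩ := hCM _ (hQmem x hx)
  obtain ⟨-, hP2, hP3, -⟩ := hCM _ (hPmem x hx)
  have hrest : 0 ≤ CM * (R + C2 + CFs) + κ * Cψ := by positivity
  have hrest2 : 0 ≤ 2 * κ * CM := by positivity
  have hκψ : κ * hole η Ω ε x ≤ κ := mul_le_of_le_one_right hκ0 hψle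
  have hκψ0 : 0 ≤ κ * hole η Ω ε x := mul_nonneg hκ0 hψ0
  refine ⟨?_, hP2.trans (by linarith), fun i => ?_, fun ξ s => ?_⟩
  · rw [abs_le] at hQ1 ⊢
    constructor <;> linarith
  · have hdQ : DifferentiableAt ℝ Q x := (hQat x hx).differentiableAt (by simp)
    have hdm : DifferentiableAt ℝ mult (Q x) := (hmat x hx).differentiableAt (by simp)
    have hdψ : DifferentiableAt ℝ (hole η Ω ε) x := hψ1.differentiable (by simp) x
    have hpd : pd i (fun x => mult (Q x) - c1 + κ * hole η Ω ε x) x =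
        fderiv ℝ mult (Q x) (fderiv ℝ Q x (EuclideanSpace.single i 1))
          + κ * pd i (hole η Ω ε) x := by
      have := ((hdm.hasFDerivAt.comp x hdQ.hasFDerivAt).sub_const c1).add
        (hdψ.hasFDerivAt.const_mul κ)
      have h2 : fderiv ℝ (fun x => mult (Q x) - c1 + κ * hole η Ω ε x) x = _ := this.fderiv
      unfold pd
      rw [h2]
      simp
    have hQd : fderiv ℝ Q x (EuclideanSpace.single i 1) =
        ((fun k l => pd i (smoothCoeff η g ε k l) x,
          fun m k l => pd i (pd m (smoothCoeff η g ε k l)) x, fun l => pd i (pd l φ) x,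
          fun k l => pd i (F k l) x) : Par n) := by
      have h1 : HasFDerivAt Q (fderiv ℝ Q x) x := hdQ.hasFDerivAt
      have e1 := hasFDerivAt_pi'.1 h1.fst
      have e2 := hasFDerivAt_pi'.1 h1.snd.fst
      have e3 := hasFDerivAt_pi'.1 h1.snd.snd.fst
      have e4 := hasFDerivAt_pi'.1 h1.snd.snd.snd
      refine Prod.ext ?_ (Prod.ext ?_ (Prod.ext ?_ ?_))
      · funext k l
        have := (hasFDerivAt_pi'.1 (e1 k) l).fderiv
        exact (congrArg (fun T => T (EuclideanSpace.single i 1)) this).symm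
      · funext m k l
        have := (hasFDerivAt_pi'.1 (hasFDerivAt_pi'.1 (e2 m) k) l).fderiv
        exact (congrArg (fun T => T (EuclideanSpace.single i 1)) this).symm
      · funext l
        have := (e3 l).fderiv
        exact (congrArg (fun T => T (EuclideanSpace.single i 1)) this).symm
      · funext k l
        have := (hasFDerivAt_pi'.1 (e4 k) l).fderiv
        exact (congrArg (fun T => T (EuclideanSpace.single i 1)) this).symm
    have hdiv : ∀ t : ℝ, 0 ≤ t → t ≤ t / ε := fun t ht => by
      rw [le_div_iff₀ hε]; exact mul_le_of_le_one_right ht hε1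
    -- Only the second derivatives of the mollified coefficients are as large as `1 / ε`. The other
    -- components are bounded, hence also `O(1 / ε)` because `ε ≤ 1`.
    have hQn : ‖fderiv ℝ Q x (EuclideanSpace.single i 1)‖ ≤ (R + C2 + CFs) / ε := by
      rw [hQd]
      have hd1 := hdiv R hRpos
      have hd2 := hdiv CFs hCFs0
      have hd3 : 0 ≤ C2 / ε := by positivity
      have hd4 : 0 ≤ CFs / ε := by positivity
      have hd5 : 0 ≤ R / ε := by positivity
      have hsum : (R + C2 + CFs) / ε = R / ε + C2 / ε + CFs / ε := by ring
      rw [hsum]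
      refine par_norm_le (by positivity) (fun k l => ?_) (fun m k l => ?_) (fun l => ?_)
        fun k l => ?_
      · exact (hcf.deriv i k l x).trans (by linarith)
      · exact (hC2 ε hε i m k l x).trans (by linarith)
      · exact (hH x hx i l).trans (by linarith)
      · exact (hCF k l x hx i).trans ((hCF' k l).trans (by linarith))
    rw [hpd]
    have h1 := (hQ4 (fderiv ℝ Q x (EuclideanSpace.single i 1))).trans
      (mul_le_mul_of_nonneg_left hQn hCM0)
    have h2 : |κ * pd i (hole η Ω ε) x| ≤ κ * (Cψ / ε) := by
      rw [abs_mul, abs_of_nonneg hκ0]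
      exact mul_le_mul_of_nonneg_left (hCψ ε hε i x) hκ0
    refine (abs_add_le _ _).trans ((add_le_add h1 h2).trans ?_)
    rw [show CM * ((R + C2 + CFs) / ε) + κ * (Cψ / ε) = (CM * (R + C2 + CFs) + κ * Cψ) / ε by ring]
    exact div_le_div_of_nonneg_right (by linarith) hε.le
  · have hPQ : ‖Q x - parAt (smoothCoeff η g ε) φ x‖ < r := by
      refine lt_of_le_of_lt (par_norm_le (R := r / 2) (by positivity) (fun i j => ?_)
        (fun k i j => ?_) (fun i => ?_) fun i j => ?_) (half_lt_self hr)
      · change |smoothCoeff η g ε i j x - smoothCoeff η g ε i j x| ≤ r / 2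
        rw [sub_self, abs_zero]; positivity
      · change |pd k (smoothCoeff η g ε i j) x - pd k (smoothCoeff η g ε i j) x| ≤ r / 2
        rw [sub_self, abs_zero]; positivity
      · change |pd i φ x - pd i φ x| ≤ r / 2
        rw [sub_self, abs_zero]; positivity
      · exact (hFa i j x hx).trans (min_le_left _ _)
    have hm := hmod _ (hQmem x hx) _ (hPmem x hx) hPQ
    have hqpos := ea_N_pos S.one_le hcN (hPmem x hx)
    have key := density_lower_bound (P := parAt (smoothCoeff η g ε) φ x) (ξ := ξ) (s := s)
      (h := mult (Q x) - c1 + κ * hole η Ω ε x) (c := c) (C := C) (c1 := c1) (κ := κ)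
      (ψ := hole η Ω ε x) (lam := lam) (K := K) (q0 := lam⁻¹ * cN) (q1 := CM) (E := n * lam)
      hqpos (((mul_le_mul_of_nonneg_left (hNl x hx) (inv_nonneg.2 hl.le))).trans
        (hcf.elliptic x _)) hP3 hψ0 hc1pos.le (hcf.elliptic x ξ)
      (ea_le (fun i j => hcf.bound i j x) ξ) hl rfl hC0 (by
        rw [hc1, ← sub_nonneg]
        have : c / 2 - 3 * (c / (6 * (n * lam + 1))) * (n * lam) = c / (2 * (n * lam + 1)) := by
          field_simp; ring
        rw [this]; positivity) (hlow ε hε hεε₀ x hx ξ) (by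
        rw [show mult (Q x) - c1 + κ * hole η Ω ε x - (mult (parAt (smoothCoeff η g ε) φ x) - c1
          + κ * hole η Ω ε x) = mult (Q x) - mult (parAt (smoothCoeff η g ε) φ x) by ring]
        exact hm.le)
    refine le_trans ?_ key
    have h1 : c2 * nsq ξ ≤ c / 2 * nsq ξ :=
      mul_le_mul_of_nonneg_right (min_le_left _ _) (nsq_nonneg ξ)
    have h2 : c2 * s ^ 2 ≤ c1 * (lam⁻¹ * cN) * s ^ 2 :=
      mul_le_mul_of_nonneg_right (min_le_right _ _) (sq_nonneg s)
    have h3 : 2 * κ * CM * hole η Ω ε x * s ^ 2 ≤ Ct * hole η Ω ε x * s ^ 2 := by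
      have : 2 * κ * CM ≤ Ct := by linarith
      gcongr
    change _ - K * (∑ k, aV (parAt (smoothCoeff η g ε) φ x).1 (fun l => pd l φ x) k * ξ k) ^ 2 ≤
      _ - K * (∑ k, aV (parAt (smoothCoeff η g ε) φ x).1 (fun l => pd l φ x) k * ξ k) ^ 2
    linarith

end Carleman

namespace Carleman

variable {n : ℕ}

/-! ### Conjugation with the weight, and the energy estimate -/

/-- `e^{τφ} u`. -/
def conjW (φ : Sp n → ℝ) (τ : ℝ) (u : Sp n → ℝ) (x : Sp n) : ℝ := Real.exp (τ * φ x) * u x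

/-- `a(∇φ, ∇φ)`. -/
def gradForm (a : Fin n → Fin n → Sp n → ℝ) (φ : Sp n → ℝ) (x : Sp n) : ℝ :=
  ∑ k, flux a φ k x * pd k φ x

/-- The conjugated operator. -/
def conjOp (a : Fin n → Fin n → Sp n → ℝ) (φ : Sp n → ℝ) (τ : ℝ) (v : Sp n → ℝ) (x : Sp n) : ℝ :=
  divOp a v x + τ ^ 2 * gradForm a φ x * v x - 2 * τ * (∑ k, flux a φ k x * pd k v x)
    - τ * (∑ k, pd k (flux a φ k) x) * v x

/-- The energy density. -/
def enr (τ : ℝ) (v : Sp n → ℝ) (x : Sp n) : ℝ := nsq (fun i => pd i v x) + τ ^ 2 * v x ^ 2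

theorem enr_nonneg (τ : ℝ) (v : Sp n → ℝ) (x : Sp n) : 0 ≤ enr τ v x := by
  have := nsq_nonneg fun i => pd i v x
  unfold enr; positivity

section

variable {a : Fin n → Fin n → Sp n → ℝ} {φ u v h : Sp n → ℝ} {τ : ℝ}

theorem contDiff_conjW (hφ : ContDiff ℝ 2 φ) (hu : ContDiff ℝ 2 u) : ContDiff ℝ 2 (conjW φ τ u) :=
  (Real.contDiff_exp.comp (contDiff_const.mul hφ)).mul hu

theorem tsupport_conjW : tsupport (conjW φ τ u) = tsupport u := by
  unfold tsupport
  congr 1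
  ext x
  simp [conjW, Real.exp_ne_zero]

theorem hasCompactSupport_conjW (hc : HasCompactSupport u) : HasCompactSupport (conjW φ τ u) := by
  unfold HasCompactSupport; rw [tsupport_conjW]; exact hc

theorem pd_exp_mul {x : Sp n} (hφ : DifferentiableAt ℝ φ x) (hu : DifferentiableAt ℝ u x)
    (j : Fin n) : pd j (fun y => Real.exp (τ * φ y) * u y) x =
      Real.exp (τ * φ x) * (pd j u x + τ * u x * pd j φ x) := by
  have h := ((hφ.hasFDerivAt.const_mul τ).exp).mul hu.hasFDerivAt
  have h2 : fderiv ℝ (fun y => Real.exp (τ * φ y) * u y) x = _ := h.fderiv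
  unfold pd
  rw [h2]
  simp
  ring

theorem pd_conjW {x : Sp n} (hφ : DifferentiableAt ℝ φ x) (hu : DifferentiableAt ℝ u x)
    (j : Fin n) : pd j (conjW φ τ u) x = Real.exp (τ * φ x) * (pd j u x + τ * u x * pd j φ x) :=
  pd_exp_mul hφ hu j

/-- The two first-order cross terms coincide by the symmetry of `a`. The zeroth-order terms with
`a(∇φ, ∇φ)` combine to the coefficient `τ ^ 2` with a positive sign. -/
theorem conjOp_conjW (hsymm : ∀ i j x, a i j x = a j i x) (ha : ∀ i j, ContDiff ℝ 1 (a i j))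
    (hφ : ContDiff ℝ 2 φ) (hu : ContDiff ℝ 2 u) (x : Sp n) :
    conjOp a φ τ (conjW φ τ u) x = Real.exp (τ * φ x) * divOp a u x := by
  have hφ1 := hφ.differentiable (by simp)
  have hu1 := hu.differentiable (by simp)
  have hflux : ∀ i, flux a (conjW φ τ u) i =
      fun y => Real.exp (τ * φ y) * (flux a u i y + τ * (u y * flux a φ i y)) := by
    intro i; ext y
    unfold flux
    simp only [Finset.mul_sum, ← Finset.sum_add_distrib]
    exact Finset.sum_congr rfl fun j _ => by rw [pd_conjW (hφ1 y) (hu1 y)]; ring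
  have hfu := fun i => (contDiff_flux ha hu i).differentiable (by simp)
  have hfφ := fun i => (contDiff_flux ha hφ i).differentiable (by simp)
  have hdiv : ∀ i, pd i (flux a (conjW φ τ u) i) x = Real.exp (τ * φ x) *
      (pd i (flux a u i) x + τ * (pd i u x * flux a φ i x + u x * pd i (flux a φ i) x)
        + τ * (flux a u i x + τ * (u x * flux a φ i x)) * pd i φ x) := by
    intro i
    rw [hflux]
    have hd : DifferentiableAt ℝ (fun y => u y * flux a φ i y) x := (hu1 x).fun_mul (hfφ i x)
    rw [pd_exp_mul (hφ1 x) ((hfu i x).fun_add (hd.const_mul τ)), pd_add (hfu i x)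
      (hd.const_mul τ), pd_const_mul τ hd, pd_mul (hu1 x) (hfφ i x)]
  have hs : ∑ i, flux a u i x * pd i φ x = ∑ i, flux a φ i x * pd i u x :=
    aV_bilin_symm (a := fun i j => a i j x) (fun i j => hsymm i j x) (fun j => pd j u x)
      (fun j => pd j φ x)
  unfold conjOp divOp gradForm
  simp_rw [hdiv, pd_conjW (hφ1 x) (hu1 x)]
  have e1 : ∑ i, Real.exp (τ * φ x) *
      (pd i (flux a u i) x + τ * (pd i u x * flux a φ i x + u x * pd i (flux a φ i) x)
        + τ * (flux a u i x + τ * (u x * flux a φ i x)) * pd i φ x) =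
      Real.exp (τ * φ x) * ((∑ i, pd i (flux a u i) x) + τ * (∑ i, flux a φ i x * pd i u x)
        + τ * u x * (∑ i, pd i (flux a φ i) x) + τ * (∑ i, flux a u i x * pd i φ x)
        + τ ^ 2 * u x * ∑ i, flux a φ i x * pd i φ x) := by
    simp only [Finset.mul_sum, ← Finset.sum_add_distrib]
    exact Finset.sum_congr rfl fun i _ => by ring
  have e2 : ∑ k, flux a φ k x * (Real.exp (τ * φ x) * (pd k u x + τ * u x * pd k φ x)) =
      Real.exp (τ * φ x) * ((∑ i, flux a φ i x * pd i u x)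
        + τ * u x * ∑ i, flux a φ i x * pd i φ x) := by
    simp only [Finset.mul_sum, ← Finset.sum_add_distrib]
    exact Finset.sum_congr rfl fun i _ => by ring
  rw [e1, e2, hs]
  unfold conjW
  ring

theorem pd_flux_eq (ha : ∀ i j, ContDiff ℝ 1 (a i j)) (hφ : ContDiff ℝ 2 φ) (i k : Fin n)
    (x : Sp n) : pd i (flux a φ k) x = dB (parAt a φ x) i k := by
  have hp := fun l => (contDiff_one_pd hφ l).differentiable (by simp) x
  have hd := fun l => (ha k l).differentiable (by simp) x
  change pd i (fun y => ∑ j, a k j y * pd j φ y) x = _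
  rw [pd_sum fun l _ => (hd l).fun_mul (hp l)]
  unfold dB parAt
  exact Finset.sum_congr rfl fun l _ => by rw [pd_mul (hd l) (hp l)]

theorem contDiff_gradForm (ha : ∀ i j, ContDiff ℝ 1 (a i j)) (hφ : ContDiff ℝ 2 φ) :
    ContDiff ℝ 1 (gradForm a φ) :=
  ContDiff.sum fun k _ => (contDiff_flux ha hφ k).mul (contDiff_one_pd hφ k)

theorem pd_gradForm_eq (ha : ∀ i j, ContDiff ℝ 1 (a i j)) (hφ : ContDiff ℝ 2 φ) (k : Fin n)
    (x : Sp n) : pd k (gradForm a φ) x = dq (parAt a φ x) k := by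
  have hp := fun l => (contDiff_one_pd hφ l).differentiable (by simp) x
  have hd := fun l => (contDiff_flux ha hφ l).differentiable (by simp) x
  change pd k (fun y => ∑ j, flux a φ j y * pd j φ y) x = _
  rw [pd_sum fun l _ => (hd l).fun_mul (hp l)]
  unfold dq
  refine Finset.sum_congr rfl fun l _ => ?_
  rw [pd_mul (hd l) (hp l), pd_flux_eq ha hφ]
  rfl

/-- For the field `a ∇φ` the density at a point is a quadratic form in `(∇v, τ v)` determined by
`parAt`, so the pointwise bounds for the forms apply. -/
theorem energyDensity_eq (ha : ∀ i j, ContDiff ℝ 1 (a i j)) (hφ : ContDiff ℝ 2 φ) (x : Sp n) :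
    energyDensity a (flux a φ) (gradForm a φ) h v τ x =
      formM (parAt a φ x) (fun i => pd i v x) + (τ * v x) ^ 2 * coefm (parAt a φ x)
        - 2 * (trB (parAt a φ x) - h x) * (ea (parAt a φ x).1 (fun i => pd i v x)
          - (τ * v x) ^ 2 * ea (parAt a φ x).1 (fun l => pd l φ x)) := by
  unfold energyDensity
  simp only [pd_flux_eq ha hφ, pd_gradForm_eq ha hφ]
  unfold formM coefm trB
  have e1 : ∀ (w : Sp n → ℝ) i, flux a w i x = aV (parAt a φ x).1 (fun j => pd j w x) i :=
    fun w i => rfl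
  have e2 : gradForm a φ x = ea (parAt a φ x).1 (fun l => pd l φ x) := rfl
  have e3 : (parAt a φ x).2.2.1 = fun l => pd l φ x := rfl
  have e4 : (parAt a φ x).2.1 = fun k i j => pd k (a i j) x := rfl
  simp only [e1, e2, e3, e4]
  unfold ea
  ring

theorem cc_enr (hv : ContDiff ℝ 2 v) (hc : HasCompactSupport v) : CC (enr τ v) := by
  have hv1 : ContDiff ℝ 1 v := hv.of_le (by norm_num)
  have hvc : CC v := ⟨hv1.continuous, hc⟩
  exact CC.add (CC.sum fun i _ => (cc_pd hv1 hc i).sq) (hvc.sq.mul_left continuous_const)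

theorem cc_conjOp (ha : ∀ i j, ContDiff ℝ 1 (a i j)) (hφ : ContDiff ℝ 2 φ)
    (hv : ContDiff ℝ 2 v) (hc : HasCompactSupport v) : CC (conjOp a φ τ v) := by
  have hv1 : ContDiff ℝ 1 v := hv.of_le (by norm_num)
  have hvc : CC v := ⟨hv1.continuous, hc⟩
  refine CC.sub (CC.sub (CC.add (cc_divOp ha hv hc) ?_) ?_) ?_
  · exact hvc.mul_left (continuous_const.mul (contDiff_gradForm ha hφ).continuous)
  · exact (CC.sum fun k _ => (cc_pd hv1 hc k).mul_left
      (contDiff_flux ha hφ k).continuous).mul_left continuous_const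
  · exact hvc.mul_left (continuous_const.mul (continuous_finsetSum _ fun k _ =>
      continuous_pd (contDiff_flux ha hφ k) k))

theorem integral_lin_three {f₁ f₂ f₃ : Sp n → ℝ} (h₁ : CC f₁) (h₂ : CC f₂) (h₃ : CC f₃)
    (c₁ c₂ c₃ : ℝ) : ∫ x, (c₁ * f₁ x + c₂ * f₂ x + c₃ * f₃ x) =
      c₁ * (∫ x, f₁ x) + c₂ * (∫ x, f₂ x) + c₃ * ∫ x, f₃ x := by
  have i12 : Integrable fun x => c₁ * f₁ x + c₂ * f₂ x :=
    (h₁.integrable.const_mul _).add (h₂.integrable.const_mul _)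
  rw [integral_add i12 (h₃.integrable.const_mul _), integral_add (h₁.integrable.const_mul _)
    (h₂.integrable.const_mul _), integral_const_mul, integral_const_mul, integral_const_mul]

/-- The conjugated operator is `S + A + m`, where `m = τ (h - trB) v` corrects the zeroth-order part
of `A`. From `2 (S + A + m)² ≥ S² + A² + 2 S A - 2 m²` the product is evaluated by the energy
identity. The square `A²` supplies `2 τ² b²` with `b = a∇φ·∇v`, which beats the term `K τ b²` once
`K ≤ τ`. All errors have size `C0² τ² v²` and are absorbed for large `τ`. -/
theorem energy_lower {ψ : Sp n → ℝ} {c C K C0 : ℝ} (hsymm : ∀ i j x, a i j x = a j i x)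
    (ha : ∀ i j, ContDiff ℝ 1 (a i j)) (hφ : ContDiff ℝ 2 φ) (hh : ContDiff ℝ 1 h)
    (hv : ContDiff ℝ 2 v) (hc : HasCompactSupport v) (hψ : Continuous ψ) (hτ : 0 < τ)
    (hτK : K ≤ τ) (hτC : 36 * C0 ^ 2 ≤ c * τ)
    (hh0 : ∀ x ∈ tsupport v, |h x| ≤ C0) (htr : ∀ x ∈ tsupport v, |trB (parAt a φ x)| ≤ C0)
    (hgh : ∀ x ∈ tsupport v, |v x * ∑ i, flux a v i x * pd i h x| ≤ c / 8 * enr τ v x)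
    (hdens : ∀ x ∈ tsupport v, ∀ ξ s, c * (nsq ξ + s ^ 2) - C * ψ x * s ^ 2
          - K * (∑ k, aV (parAt a φ x).1 (fun l => pd l φ x) k * ξ k) ^ 2 ≤
          formM (parAt a φ x) ξ + s ^ 2 * coefm (parAt a φ x)
            - 2 * (trB (parAt a φ x) - h x) *
              (ea (parAt a φ x).1 ξ - s ^ 2 * ea (parAt a φ x).1 (fun l => pd l φ x))) :
    c / 2 * τ * (∫ x, enr τ v x) ≤
      2 * (∫ x, conjOp a φ τ v x ^ 2) + C * τ ^ 3 * ∫ x, ψ x * v x ^ 2 := by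
  have hv1 : ContDiff ℝ 1 v := hv.of_le (by norm_num)
  have hvc : CC v := ⟨hv1.continuous, hc⟩
  have hB := fun k => contDiff_flux ha hφ k
  have hq := contDiff_gradForm ha hφ
  have hid := energy_identity hsymm ha hB hq hh hv hc τ
  have i1 := (cc_enr (τ := τ) hv hc)
  have i2 := (cc_conjOp (τ := τ) ha hφ hv hc).sq
  have i3 : CC fun x => ψ x * v x ^ 2 := hvc.sq.mul_left hψ
  have i4 := cc_energyDensity ha hB hq hh hv hc τ
  have i5 : CC fun x => v x * ∑ i, flux a v i x * pd i h x :=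
    hvc.mul_right (continuous_finsetSum _ fun i _ =>
      (contDiff_flux ha hv i).continuous.mul (continuous_pd hh i))
  have i6 : CC fun x => (divOp a v x + τ ^ 2 * gradForm a φ x * v x)
        * (-2 * τ * (∑ k, flux a φ k x * pd k v x) - τ * h x * v x) := by
    refine CC.mul_right (CC.add (cc_divOp ha hv hc) (hvc.mul_left
      (continuous_const.mul hq.continuous))) ?_
    exact (continuous_const.mul (continuous_finsetSum _ fun k _ => (hB k).continuous.mul
      (continuous_pd hv1 k))).sub ((continuous_const.mul hh.continuous).mul hv1.continuous)
  have hpt : ∀ x, c / 2 * τ * enr τ v x - C * τ ^ 3 * (ψ x * v x ^ 2)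
      - 2 * conjOp a φ τ v x ^ 2 ≤
      τ * energyDensity a (flux a φ) (gradForm a φ) h v τ x
        + 2 * τ * (v x * ∑ i, flux a v i x * pd i h x)
        - 2 * ((divOp a v x + τ ^ 2 * gradForm a φ x * v x)
          * (-2 * τ * (∑ k, flux a φ k x * pd k v x) - τ * h x * v x)) := by
    intro x
    by_cases hx : x ∈ tsupport v
    · have hd := hdens x hx (fun i => pd i v x) (τ * v x)
      rw [← energyDensity_eq (h := h) ha hφ x] at hd
      have h1 := (abs_le.1 (hgh x hx)).1
      have htr' : ∑ k, pd k (flux a φ k) x = trB (parAt a φ x) := by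
        unfold trB; exact Finset.sum_congr rfl fun k _ => pd_flux_eq ha hφ k k x
      have hL : conjOp a φ τ v x = (divOp a v x + τ ^ 2 * gradForm a φ x * v x)
          + (-2 * τ * (∑ k, flux a φ k x * pd k v x) - τ * h x * v x)
          + τ * (h x - trB (parAt a φ x)) * v x := by
        unfold conjOp; rw [htr']; ring
      have hb : ∑ k, aV (parAt a φ x).1 (fun l => pd l φ x) k * pd k v x =
        ∑ k, flux a φ k x * pd k v x := rfl
      rw [hb] at hd
      have hE : nsq (fun i => pd i v x) + (τ * v x) ^ 2 = enr τ v x := by unfold enr; ring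
      rw [hE] at hd
      have hE2 : τ ^ 2 * v x ^ 2 ≤ enr τ v x := by
        unfold enr; linarith [nsq_nonneg fun i => pd i v x]
      set Sv := divOp a v x + τ ^ 2 * gradForm a φ x * v x with hSv
      set b := ∑ k, flux a φ k x * pd k v x with hbdef
      set T := trB (parAt a φ x) with hT
      set D := energyDensity a (flux a φ) (gradForm a φ) h v τ x with hD
      set E := enr τ v x with hEdef
      set G := v x * ∑ i, flux a v i x * pd i h x with hG
      rw [hL]
      have hhx := hh0 x hx
      have hTx := htr x hx
      have hh2 : (h x) ^ 2 ≤ C0 ^ 2 := sq_le_sq' (abs_le.1 hhx).1 (abs_le.1 hhx).2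
      have hm2 : (h x - T) ^ 2 ≤ 4 * C0 ^ 2 := by
        have : |h x - T| ≤ 2 * C0 := (abs_sub _ _).trans (by linarith)
        nlinarith [sq_abs (h x - T), abs_nonneg (h x - T)]
      have hA : τ ^ 2 * (2 * b ^ 2 - C0 ^ 2 * v x ^ 2) ≤ (-2 * τ * b - τ * h x * v x) ^ 2 := by
        have : (-2 * τ * b - τ * h x * v x) ^ 2 =
            τ ^ 2 * (2 * b ^ 2 - h x ^ 2 * v x ^ 2) + τ ^ 2 * (2 * (b + h x * v x) ^ 2) := by ring
        rw [this]
        have h3 : h x ^ 2 * v x ^ 2 ≤ C0 ^ 2 * v x ^ 2 := by gcongr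
        have h4 : 0 ≤ τ ^ 2 * (2 * (b + h x * v x) ^ 2) := by positivity
        have h5 : τ ^ 2 * (2 * b ^ 2 - C0 ^ 2 * v x ^ 2) ≤
          τ ^ 2 * (2 * b ^ 2 - h x ^ 2 * v x ^ 2) := by gcongr
        linarith
      have hM : (τ * (h x - T) * v x) ^ 2 ≤ 4 * C0 ^ 2 * τ ^ 2 * v x ^ 2 := by
        have : (τ * (h x - T) * v x) ^ 2 = (h x - T) ^ 2 * (τ ^ 2 * v x ^ 2) := by ring
        rw [this]
        calc (h x - T) ^ 2 * (τ ^ 2 * v x ^ 2) ≤ 4 * C0 ^ 2 * (τ ^ 2 * v x ^ 2) := by gcongr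
          _ = _ := by ring
      have hKb : τ * (K * b ^ 2) ≤ τ ^ 2 * b ^ 2 := by
        have : K * b ^ 2 ≤ τ * b ^ 2 := by gcongr
        calc τ * (K * b ^ 2) ≤ τ * (τ * b ^ 2) := by gcongr
          _ = _ := by ring
      -- The nine is `1 + 2 * 4`, from `A²` and from `2 m²`. This quarter of `c`, and another for
      -- the term with `∇h`, leave `c / 2`.
      have habs : 9 * C0 ^ 2 * (τ ^ 2 * v x ^ 2) ≤ c / 4 * τ * E := by
        have h6 : 0 ≤ τ ^ 2 * v x ^ 2 := by positivity
        have h7 : 0 ≤ c * τ := le_trans (by positivity) hτC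
        calc 9 * C0 ^ 2 * (τ ^ 2 * v x ^ 2) ≤ c * τ / 4 * (τ ^ 2 * v x ^ 2) := by
              gcongr; linarith
          _ ≤ c * τ / 4 * E := by gcongr
          _ = _ := by ring
      have hτD := mul_le_mul_of_nonneg_left hd hτ.le
      have hτG : -(c / 4 * τ * E) ≤ 2 * τ * G := by
        have := mul_le_mul_of_nonneg_left h1 (show 0 ≤ 2 * τ by positivity)
        linarith
      -- `2 (S + A + m)² = (S + A)² - 2 m² + (S + A + 2m)²`, and the last square is discarded.
      have hsq : 0 ≤ (Sv + (-2 * τ * b - τ * h x * v x)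
          + 2 * (τ * (h x - T) * v x)) ^ 2 := sq_nonneg _
      have hS2 := sq_nonneg Sv
      have hb2 : 0 ≤ τ ^ 2 * b ^ 2 := by positivity
      set A := -2 * τ * b - τ * h x * v x with hAdef
      set m := τ * (h x - T) * v x with hm
      have hfin : τ * (c * E - C * ψ x * (τ * v x) ^ 2 - K * b ^ 2) =
        c * τ * E - C * τ ^ 3 * (ψ x * v x ^ 2) - τ * (K * b ^ 2) := by ring
      rw [hfin] at hτD
      linarith [show (Sv + A + 2 * m) ^ 2 = Sv ^ 2 + A ^ 2 + 4 * m ^ 2 + 2 * Sv * A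
        + 4 * (Sv + A) * m by ring, show (Sv + A + m) ^ 2 = Sv ^ 2 + A ^ 2 + m ^ 2 + 2 * Sv * A
        + 2 * (Sv + A) * m by ring]
    · have h0 : v x = 0 := image_eq_zero_of_notMem_tsupport hx
      have hp : ∀ k, pd k v x = 0 := fun k => pd_eq_zero_of_notMem_tsupport hx
      have hf : ∀ k, flux a v k x = 0 := fun k => by unfold flux; simp [hp]
      unfold energyDensity enr
      simp only [h0, hp, hf, nsq]
      simp
      positivity
  have hmono := integral_mono (μ := (volume : Measure (Sp n)))
    (((i1.integrable.const_mul (c / 2 * τ)).sub (i3.integrable.const_mul (C * τ ^ 3))).sub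
      (i2.integrable.const_mul 2))
    (((i4.integrable.const_mul τ).add (i5.integrable.const_mul (2 * τ))).sub
      (i6.integrable.const_mul 2)) hpt
  have l1 : ∫ x, (c / 2 * τ * enr τ v x - C * τ ^ 3 * (ψ x * v x ^ 2)
      - 2 * conjOp a φ τ v x ^ 2) = c / 2 * τ * (∫ x, enr τ v x)
      - C * τ ^ 3 * (∫ x, ψ x * v x ^ 2) - 2 * ∫ x, conjOp a φ τ v x ^ 2 := by
    refine Eq.trans ?_ ((integral_lin_three i1 i3 i2 (c / 2 * τ) (-(C * τ ^ 3)) (-2)).trans ?_)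
    · congr 1; ext x; ring
    · ring
  -- The right side of the pointwise inequality integrates to zero: this is the energy identity.
  have l2 : ∫ x, (τ * energyDensity a (flux a φ) (gradForm a φ) h v τ x
        + 2 * τ * (v x * ∑ i, flux a v i x * pd i h x)
        - 2 * ((divOp a v x + τ ^ 2 * gradForm a φ x * v x)
          * (-2 * τ * (∑ k, flux a φ k x * pd k v x) - τ * h x * v x))) = 0 := by
    refine Eq.trans ?_ ((integral_lin_three i4 i5 i6 τ (2 * τ) (-2)).trans ?_)
    · congr 1; ext x; ring
    · linarith
  have hmono' : c / 2 * τ * (∫ x, enr τ v x) - C * τ ^ 3 * (∫ x, ψ x * v x ^ 2)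
      - 2 * (∫ x, conjOp a φ τ v x ^ 2) ≤ 0 := by
    rw [← l1, ← l2]; exact hmono
  linarith

end

end Carleman

namespace Carleman

variable {n : ℕ} {g : Sp n → Matrix (Fin n) (Fin n) ℝ} {lam Lam c₀ : ℝ} {Ω : Set (Sp n)}
  {φ φ' u : Sp n → ℝ}

/-- `φ'` is of class `C²` everywhere and agrees with `φ` near the support of the test function
`u`. -/
structure Adapted (Ω : Set (Sp n)) (φ φ' u : Sp n → ℝ) : Prop where
  test : IsTestFunction Ω u
  contDiff : ContDiff ℝ 2 φ'
  eq : ∃ V, IsOpen V ∧ tsupport u ⊆ V ∧ V ⊆ Ω ∧ Set.EqOn φ' φ V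

/-- The integrations by parts need a weight on the whole space, while `φ` is `C²` only in `Ω`. The
replacement depends on `u`, but only its values near the support of `u` matter there, so no constant
depends on it. -/
theorem Setting.exists_adapted (S : Setting g lam Lam Ω φ c₀) (hu : IsTestFunction Ω u) :
    ∃ φ', Adapted Ω φ φ' u := by
  obtain ⟨φ', h1, h2⟩ := exists_contDiff_eqOn (k := 2) S.isOpen S.weight.1 hu.2.1 hu.2.2
  exact ⟨φ', hu, h1, h2⟩

theorem Adapted.contDiff_u (A : Adapted Ω φ φ' u) (k : ℕ) : ContDiff ℝ k u :=
  A.test.1.of_le (by norm_cast; exact le_top)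

theorem Adapted.contDiff_v (A : Adapted Ω φ φ' u) (τ : ℝ) : ContDiff ℝ 2 (conjW φ' τ u) :=
  contDiff_conjW A.contDiff (A.contDiff_u 2)

theorem Adapted.compact_v (A : Adapted Ω φ φ' u) (τ : ℝ) : HasCompactSupport (conjW φ' τ u) :=
  hasCompactSupport_conjW A.test.2.1

theorem Adapted.mem (A : Adapted Ω φ φ' u) {x : Sp n} (hx : x ∈ tsupport u) : x ∈ Ω := A.test.2.2 hx

theorem Adapted.eventuallyEq (A : Adapted Ω φ φ' u) {x : Sp n} (hx : x ∈ tsupport u) :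
    φ' =ᶠ[nhds x] φ := by
  obtain ⟨V, hV, huV, -, he⟩ := A.eq
  exact Filter.eventuallyEq_of_mem (hV.mem_nhds (huV hx)) he

theorem Adapted.pd_eq (A : Adapted Ω φ φ' u) {x : Sp n} (hx : x ∈ tsupport u) (i : Fin n) :
    pd i φ' x = pd i φ x := pd_congr (A.eventuallyEq hx)

theorem Adapted.pd_pd_eq (A : Adapted Ω φ φ' u) {x : Sp n} (hx : x ∈ tsupport u) (i j : Fin n) :
    pd i (pd j φ') x = pd i (pd j φ) x := by
  refine pd_congr ?_
  filter_upwards [(A.eventuallyEq hx).eventuallyEq_nhds] with y hy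
  exact pd_congr hy

theorem Adapted.parAt_eq (A : Adapted Ω φ φ' u) {x : Sp n} (hx : x ∈ tsupport u)
    (a : Fin n → Fin n → Sp n → ℝ) : parAt a φ' x = parAt a φ x := by
  unfold parAt
  simp only [A.pd_eq hx, A.pd_pd_eq hx]

/-- A gradient of `h` of size `τ` is just admissible, because `τ |v| |∂ⱼ v|` is bounded by the
energy density. -/
theorem abs_mul_sum_flux_le {a : Fin n → Fin n → Sp n → ℝ} {lam : ℝ} (hl : 0 ≤ lam) {x : Sp n}
    (ha : ∀ i j, |a i j x| ≤ lam) {v h : Sp n → ℝ} {τ b : ℝ} (hb : 0 ≤ b)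
    (hh : ∀ i, |pd i h x| ≤ b * τ) :
    |v x * ∑ i, flux a v i x * pd i h x| ≤ b * (n * lam * (n + 1)) * enr τ v x := by
  have hE : 0 ≤ enr τ v x := enr_nonneg τ v x
  have hj : ∀ j, |v x| * τ * |pd j v x| ≤ enr τ v x := fun j => by
    have h1 := sq_le_nsq (fun i => pd i v x) j
    unfold enr
    nlinarith [sq_nonneg (|v x| * τ - |pd j v x|), sq_abs (v x), sq_abs (pd j v x),
      nsq_nonneg fun i => pd i v x, sq_nonneg (τ * v x)]
  have hterm : ∀ i, |v x * (flux a v i x * pd i h x)| ≤ b * (n * lam) * enr τ v x := fun i => by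
    have hf : |flux a v i x| ≤ ∑ j, lam * |pd j v x| := by
      unfold flux
      refine (Finset.abs_sum_le_sum_abs _ _).trans (Finset.sum_le_sum fun j _ => ?_)
      rw [abs_mul]; exact mul_le_mul_of_nonneg_right (ha i j) (abs_nonneg _)
    rw [abs_mul, abs_mul]
    calc |v x| * (|flux a v i x| * |pd i h x|)
        ≤ |v x| * ((∑ j, lam * |pd j v x|) * (b * τ)) := by
          gcongr
          exact hh i
      _ = b * lam * ∑ j, |v x| * τ * |pd j v x| := by
          rw [Finset.sum_mul, Finset.mul_sum, Finset.mul_sum]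
          exact Finset.sum_congr rfl fun j _ => by ring
      _ ≤ b * lam * ∑ _j : Fin n, enr τ v x := by
          gcongr with j _; exact hj j
      _ = b * (n * lam) * enr τ v x := by
          simp only [Finset.sum_const, Finset.card_univ, Fintype.card_fin, nsmul_eq_mul]; ring
  rw [Finset.mul_sum]
  calc |∑ i, v x * (flux a v i x * pd i h x)| ≤ ∑ i, |v x * (flux a v i x * pd i h x)| :=
        Finset.abs_sum_le_sum_abs _ _
    _ ≤ ∑ _i : Fin n, b * (n * lam) * enr τ v x := Finset.sum_le_sum fun i _ => hterm i
    _ = b * (n * lam * n) * enr τ v x := by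
        simp only [Finset.sum_const, Finset.card_univ, Fintype.card_fin, nsmul_eq_mul]; ring
    _ ≤ _ := by
        gcongr; linarith

/-- The energy estimate, with a remainder on the part of `Ω` where the complement of `Ω` is
visible at the scale of the mollification. -/
theorem Setting.energy_estimate (S : Setting g lam Lam Ω φ c₀) {η : Sp n → ℝ}
    (hη : IsMollifier η) :
    ∃ κ c C τ₀ : ℝ, 1 ≤ κ ∧ 0 < c ∧ 0 ≤ C ∧ 1 ≤ τ₀ ∧ ∀ φ' u, Adapted Ω φ φ' u → ∀ τ, τ₀ ≤ τ →
      c * τ * (∫ x, enr τ (conjW φ' τ u) x) ≤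
        2 * (∫ x, conjOp (smoothCoeff η g (κ / τ)) φ' τ (conjW φ' τ u) x ^ 2)
          + C * τ ^ 3 * ∫ x, hole η Ω (κ / τ) x * conjW φ' τ u x ^ 2 := by
  obtain ⟨K, c, C, ε₀, hK0, hc, hC0, hε₀, hex⟩ := S.exists_multiplier hη
  have hl := S.lam_pos
  set N : ℝ := n * lam * (n + 1) with hN
  have hN0 : 0 ≤ N := by positivity
  -- At the scale `κ / τ` the multiplier has gradient at most `C τ / κ`. This `κ` makes the
  -- resulting term at most `c / 8` of the energy density, as `energy_lower` requires.
  set κ := 1 + 8 * C * N / c with hκ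
  have hκ1 : 1 ≤ κ := by
    have : 0 ≤ 8 * C * N / c := by positivity
    linarith
  have hκpos : 0 < κ := by linarith
  refine ⟨κ, c / 2, C, max 1 (max (κ / ε₀) (max K (36 * C ^ 2 / c))), hκ1, by positivity, hC0,
    le_max_left _ _, fun φ' u A τ hτ => ?_⟩
  have hτ1 : 1 ≤ τ := (le_max_left _ _).trans hτ
  have hτ0 : 0 < τ := by linarith
  have hτ2 : κ / ε₀ ≤ τ := ((le_max_left _ _).trans (le_max_right _ _)).trans hτ
  have hτ3 : K ≤ τ :=
    ((le_max_left _ _).trans ((le_max_right _ _).trans (le_max_right _ _))).trans hτ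
  have hτ4 : 36 * C ^ 2 / c ≤ τ :=
    ((le_max_right _ _).trans ((le_max_right _ _).trans (le_max_right _ _))).trans hτ
  have hε : 0 < κ / τ := by positivity
  have hεle : κ / τ ≤ ε₀ := by
    rw [div_le_iff₀ hε₀] at hτ2
    rw [div_le_iff₀ hτ0]; linarith
  obtain ⟨h0, hh0, hpt⟩ := hex (κ / τ) hε hεle
  obtain ⟨h, hh, V, hV, huV, hVΩ, heq⟩ := exists_contDiff_eqOn (k := 1) S.isOpen
    (by exact_mod_cast hh0) A.test.2.1 A.test.2.2
  have hh1 : ContDiff ℝ 1 h := by exact_mod_cast hh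
  have hcf := S.isCoeff hη hε.ne'
  have hpdh : ∀ x ∈ tsupport u, ∀ i, pd i h x = pd i h0 x := fun x hx i =>
    pd_congr (Filter.eventuallyEq_of_mem (hV.mem_nhds (huV hx)) heq)
  refine energy_lower (h := h) (K := K) (C0 := C) hcf.symm (fun i j => hcf.contDiff 1 i j)
    A.contDiff hh1 (A.contDiff_v τ) (A.compact_v τ) (contDiff_hole S.isOpen hη hε.ne').continuous
    hτ0 hτ3 (by rw [div_le_iff₀ hc] at hτ4; linarith) ?_ ?_ ?_ ?_
  all_goals rw [tsupport_conjW]; intro x hx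
  · rw [heq (huV hx)]; exact (hpt x (A.mem hx)).1
  · rw [A.parAt_eq hx]; exact (hpt x (A.mem hx)).2.1
  · refine (abs_mul_sum_flux_le hl.le (fun i j => hcf.bound i j x) (τ := τ) (b := C / κ)
      (by positivity) fun i => ?_).trans ?_
    · rw [hpdh x hx]
      refine ((hpt x (A.mem hx)).2.2.1 i).trans (le_of_eq ?_)
      field_simp
    · refine mul_le_mul_of_nonneg_right ?_ (enr_nonneg _ _ _)
      rw [div_mul_eq_mul_div, div_le_iff₀ hκpos, hκ]
      have : c / 8 * (1 + 8 * C * N / c) = c / 8 + C * N := by field_simp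
      rw [this]; linarith
  · rw [A.parAt_eq hx, heq (huV hx)]
    simp only [A.pd_eq hx]
    exact (hpt x (A.mem hx)).2.2.2

end Carleman

namespace Carleman

variable {n : ℕ}

/-! ### The weighted estimate of the second derivatives -/

/-- The sum of the squares of the second derivatives. -/
def hsq (u : Sp n → ℝ) (x : Sp n) : ℝ := ∑ k, ∑ i, pd i (pd k u) x ^ 2

theorem hsq_nonneg (u : Sp n → ℝ) (x : Sp n) : 0 ≤ hsq u x :=
  Finset.sum_nonneg fun _ _ => Finset.sum_nonneg fun _ _ => sq_nonneg _

theorem mul_le_young {δ : ℝ} (hδ : 0 < δ) (X Y : ℝ) : X * Y ≤ δ * Y ^ 2 + X ^ 2 / (4 * δ) := by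
  have h : δ * Y ^ 2 + X ^ 2 / (4 * δ) - X * Y = (2 * δ * Y - X) ^ 2 / (4 * δ) := by
    field_simp; ring
  have : 0 ≤ (2 * δ * Y - X) ^ 2 / (4 * δ) := by positivity
  linarith

theorem sq_sum_mul_le {b ξ : Fin n → ℝ} {M : ℝ} (hb : ∀ j, |b j| ≤ M) :
    (∑ j, b j * ξ j) ^ 2 ≤ n * M ^ 2 * nsq ξ := by
  refine (Finset.sum_mul_sq_le_sq_mul_sq _ _ _).trans ?_
  refine mul_le_mul_of_nonneg_right ?_ (nsq_nonneg ξ)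
  calc ∑ j, b j ^ 2 ≤ ∑ _j : Fin n, M ^ 2 := Finset.sum_le_sum fun j _ => by
        rw [← sq_abs]; exact pow_le_pow_left₀ (abs_nonneg _) (hb j) 2
    _ = _ := by simp

/-- Ellipticity bounds the Hessian by the form in `integral_hessian_identity`. Derivatives of the
weight cost a factor `τ`. In every remaining product Young's inequality puts `δ` on the second
derivatives, and `(n + 2) δ = lam⁻¹ / 2` lets them be absorbed. -/
theorem hessian_estimate (lam L R : ℝ) (hlam : 1 ≤ lam) :
    ∃ C, 0 ≤ C ∧ ∀ (a : Fin n → Fin n → Sp n → ℝ) (φ u : Sp n → ℝ) (τ : ℝ), IsCoeff lam L a →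
      1 ≤ τ → ContDiff ℝ 2 φ → ContDiff ℝ 3 u → HasCompactSupport u →
      (∀ x ∈ tsupport u, ∀ i, |pd i φ x| ≤ R) →
      ∫ x, Real.exp (2 * τ * φ x) * hsq u x ≤
        C * ((∫ x, Real.exp (2 * τ * φ x) * divOp a u x ^ 2)
          + τ ^ 2 * ∫ x, Real.exp (2 * τ * φ x) * nsq (fun i => pd i u x)) := by
  have hl : 0 < lam := by linarith
  set δ : ℝ := lam⁻¹ / (2 * (n + 2)) with hδ
  have hδ0 : 0 < δ := by positivity
  set C' : ℝ := 12 * n ^ 2 * R ^ 2 * lam ^ 2 + 2 * n ^ 2 * L ^ 2 with hC'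
  have hC'0 : 0 ≤ C' := by positivity
  refine ⟨n * (2 * lam * ((1 + C') / (4 * δ))), by positivity,
    fun a φ u τ ha hτ hφ hu hc hR => ?_⟩
  set w : Sp n → ℝ := fun x => Real.exp (2 * τ * φ x) with hw
  have hwc : ContDiff ℝ 2 w := Real.contDiff_exp.comp (contDiff_const.mul hφ)
  have hw1 : ContDiff ℝ 1 w := hwc.of_le (by norm_num)
  have hw0 : ∀ x, 0 < w x := fun x => Real.exp_pos _
  have hpw : ∀ i x, pd i w x = 2 * τ * pd i φ x * w x := fun i x => by
    have hd : DifferentiableAt ℝ φ x := hφ.differentiable (by simp) x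
    rw [hw, pd_exp (hd.const_mul _), pd_const_mul _ hd]; ring
  have hu2 : ContDiff ℝ 2 u := hu.of_le (by norm_num)
  have hu1 : ContDiff ℝ 1 u := hu.of_le (by norm_num)
  have ha1 := fun i j => ha.contDiff 1 i j
  have hp : ∀ i, ContDiff ℝ 2 (pd i u) := fun i => contDiff_pd hu (by norm_num) i
  have hppc : ∀ i k, CC (pd i (pd k u)) := fun i k =>
    cc_pd ((hp k).of_le (by norm_num)) (hasCompactSupport_pd hc k) i
  have hD := (cc_divOp ha1 hu2 hc)
  have iD : CC fun x => w x * divOp a u x ^ 2 := hD.sq.mul_left hw1.continuous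
  have iG : CC fun x => w x * nsq (fun i => pd i u x) :=
    CC.mul_left (CC.sum fun i _ => (cc_pd hu1 hc i).sq) hw1.continuous
  have iH : ∀ k, CC fun x => w x * ∑ i, pd i (pd k u) x ^ 2 := fun k =>
    CC.mul_left (CC.sum fun i _ => (hppc i k).sq) hw1.continuous
  have hk : ∀ k, ∫ x, w x * ∑ i, pd i (pd k u) x ^ 2 ≤
      2 * lam * ((1 + C') / (4 * δ)) * ((∫ x, w x * divOp a u x ^ 2)
        + τ ^ 2 * ∫ x, w x * nsq (fun i => pd i u x)) := by
    intro k
    have hid := integral_hessian_identity ha1 hw1 hu hc k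
    have hpt : ∀ x, w x * divOp a u x * pd k (pd k u) x
        + (∑ i, pd i w x * flux a u i x) * pd k (pd k u) x
        - ∑ i, (pd k w x * flux a u i x
          + w x * ∑ j, pd k (a i j) x * pd j u x) * pd i (pd k u) x ≤
        lam⁻¹ / 2 * (w x * ∑ i, pd i (pd k u) x ^ 2) + 1 / (4 * δ) * (w x * divOp a u x ^ 2)
          + C' * τ ^ 2 / (4 * δ) * (w x * nsq (fun i => pd i u x)) := by
      intro x
      by_cases hx : x ∈ tsupport u
      · set G := nsq (fun i => pd i u x) with hG
        have hG0 : 0 ≤ G := nsq_nonneg _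
        have hf : ∀ i, flux a u i x ^ 2 ≤ n * lam ^ 2 * G := fun i =>
          sq_sum_mul_le fun j => ha.bound i j x
        have he : ∀ i, (∑ j, pd k (a i j) x * pd j u x) ^ 2 ≤ n * L ^ 2 * G := fun i =>
          sq_sum_mul_le fun j => ha.deriv k i j x
        have hN : ∀ i, pd i φ x ^ 2 ≤ R ^ 2 := fun i => by
          rw [← sq_abs]; exact pow_le_pow_left₀ (abs_nonneg _) (hR x hx i) 2
        have t1 := mul_le_young hδ0 (divOp a u x) (pd k (pd k u) x)
        have hkk : pd k (pd k u) x ^ 2 ≤ ∑ i, pd i (pd k u) x ^ 2 :=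
          Finset.single_le_sum (f := fun i => pd i (pd k u) x ^ 2) (fun _ _ => sq_nonneg _)
            (Finset.mem_univ k)
        have hτ2 : (0 : ℝ) ≤ τ ^ 2 := by positivity
        have t2 : ∀ i, 2 * τ * pd i φ x * flux a u i x * pd k (pd k u) x ≤
            δ * pd k (pd k u) x ^ 2 + 4 * τ ^ 2 * R ^ 2 * (n * lam ^ 2 * G) / (4 * δ) := fun i => by
          refine (mul_le_young hδ0 _ _).trans ?_
          have : (2 * τ * pd i φ x * flux a u i x) ^ 2 ≤ 4 * τ ^ 2 * R ^ 2 * (n * lam ^ 2 * G) := by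
            calc (2 * τ * pd i φ x * flux a u i x) ^ 2
                = 4 * τ ^ 2 * pd i φ x ^ 2 * flux a u i x ^ 2 := by ring
              _ ≤ _ := mul_le_mul (mul_le_mul_of_nonneg_left (hN i) (by positivity)) (hf i)
                (sq_nonneg _) (by positivity)
          gcongr
        have t3 : ∀ i, -(2 * τ * pd k φ x * flux a u i x + ∑ j, pd k (a i j) x * pd j u x)
            * pd i (pd k u) x ≤ δ * pd i (pd k u) x ^ 2
            + τ ^ 2 * (8 * R ^ 2 * (n * lam ^ 2 * G) + 2 * (n * L ^ 2 * G)) / (4 * δ) := fun i => by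
          refine (mul_le_young hδ0 _ _).trans ?_
          have h1 : (2 * τ * pd k φ x * flux a u i x) ^ 2 ≤ 4 * τ ^ 2 * R ^ 2 * (n * lam ^ 2 * G) := by
            calc (2 * τ * pd k φ x * flux a u i x) ^ 2
                = 4 * τ ^ 2 * pd k φ x ^ 2 * flux a u i x ^ 2 := by ring
              _ ≤ _ := mul_le_mul (mul_le_mul_of_nonneg_left (hN k) (by positivity)) (hf i)
                (sq_nonneg _) (by positivity)
          have h2 : n * L ^ 2 * G ≤ τ ^ 2 * (n * L ^ 2 * G) :=
            le_mul_of_one_le_left (by positivity) (one_le_pow₀ hτ)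
          have h3 := he i
          have : (-(2 * τ * pd k φ x * flux a u i x + ∑ j, pd k (a i j) x * pd j u x)) ^ 2 ≤
              τ ^ 2 * (8 * R ^ 2 * (n * lam ^ 2 * G) + 2 * (n * L ^ 2 * G)) := by
            rw [neg_sq]
            refine add_sq_le.trans ?_
            linarith
          gcongr
        have e1 : w x * divOp a u x * pd k (pd k u) x
            + (∑ i, pd i w x * flux a u i x) * pd k (pd k u) x
            - ∑ i, (pd k w x * flux a u i x
              + w x * ∑ j, pd k (a i j) x * pd j u x) * pd i (pd k u) x =
            w x * (divOp a u x * pd k (pd k u) x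
              + (∑ i, 2 * τ * pd i φ x * flux a u i x * pd k (pd k u) x)
              + ∑ i, -(2 * τ * pd k φ x * flux a u i x + ∑ j, pd k (a i j) x * pd j u x)
                * pd i (pd k u) x) := by
          rw [mul_add, mul_add, Finset.mul_sum (f := fun i =>
              2 * τ * pd i φ x * flux a u i x * pd k (pd k u) x), Finset.sum_mul,
            sub_eq_add_neg, ← Finset.sum_neg_distrib, Finset.mul_sum (f := fun i =>
              -(2 * τ * pd k φ x * flux a u i x + ∑ j, pd k (a i j) x * pd j u x)
                * pd i (pd k u) x)]
          congr 1
          · congr 1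
            · ring
            · exact Finset.sum_congr rfl fun i _ => by rw [hpw]; ring
          · exact Finset.sum_congr rfl fun i _ => by rw [hpw]; ring
        have s2 := Finset.sum_le_sum fun i (_ : i ∈ Finset.univ) => t2 i
        have s3 := Finset.sum_le_sum fun i (_ : i ∈ Finset.univ) => t3 i
        simp only [Finset.sum_add_distrib, ← Finset.mul_sum, Finset.sum_const, Finset.card_univ,
          Fintype.card_fin, nsmul_eq_mul] at s2
        rw [Finset.sum_add_distrib, ← Finset.mul_sum, Finset.sum_const, Finset.card_univ,
          Fintype.card_fin, nsmul_eq_mul] at s3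
        rw [e1]
        have e2 : lam⁻¹ / 2 * (w x * ∑ i, pd i (pd k u) x ^ 2) + 1 / (4 * δ) * (w x * divOp a u x ^ 2)
          + C' * τ ^ 2 / (4 * δ) * (w x * G) = w x * (lam⁻¹ / 2 * (∑ i, pd i (pd k u) x ^ 2)
            + divOp a u x ^ 2 / (4 * δ) + C' * τ ^ 2 * G / (4 * δ)) := by ring
        rw [e2]
        refine mul_le_mul_of_nonneg_left ?_ (hw0 x).le
        have hδn : lam⁻¹ / 2 = (n + 2) * δ := by rw [hδ]; field_simp
        rw [hδn]
        have h5 : (n + 1) * δ * pd k (pd k u) x ^ 2 ≤ (n + 1) * δ * ∑ i, pd i (pd k u) x ^ 2 := by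
          gcongr
        have h6 : C' * τ ^ 2 * G / (4 * δ) = n * (4 * τ ^ 2 * R ^ 2 * (n * lam ^ 2 * G) / (4 * δ))
          + n * (τ ^ 2 * (8 * R ^ 2 * (n * lam ^ 2 * G) + 2 * (n * L ^ 2 * G)) / (4 * δ)) := by
          rw [hC']; ring
        rw [h6]
        linarith
      · have hp0 : ∀ j, pd j u x = 0 := fun j => pd_eq_zero_of_notMem_tsupport hx
        have hpp0 : ∀ j l, pd j (pd l u) x = 0 := fun j l =>
          pd_eq_zero_of_notMem_tsupport fun h => hx (tsupport_pd_subset l u h)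
        simp only [hpp0]
        have h1 : 0 ≤ 1 / (4 * δ) * (w x * divOp a u x ^ 2) := by
          have := (hw0 x).le; positivity
        have h2 : 0 ≤ C' * τ ^ 2 / (4 * δ) * (w x * nsq fun i => pd i u x) := by
          have := (hw0 x).le; have := nsq_nonneg fun i => pd i u x; positivity
        simp only [mul_zero, Finset.sum_const_zero]
        norm_num
        norm_num at h1
        linarith
    have hlow : lam⁻¹ * (∫ x, w x * ∑ i, pd i (pd k u) x ^ 2) ≤
        ∫ x, w x * ∑ i, ∑ j, a i j x * pd j (pd k u) x * pd i (pd k u) x := by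
      rw [← integral_const_mul]
      refine integral_mono ((iH k).integrable.const_mul _) (CC.integrable (CC.mul_left
        (CC.sum fun i _ => CC.sum fun j _ => ((hppc j k).mul_left (ha1 i j).continuous).mul_right
          (hppc i k).1) hw1.continuous)) fun x => ?_
      have h1 := ha.elliptic x (fun i => pd i (pd k u) x)
      unfold ea aV at h1
      simp only [Finset.sum_mul] at h1
      have := mul_le_mul_of_nonneg_left h1 (hw0 x).le
      refine le_trans (le_of_eq ?_) this
      unfold nsq
      ring
    have hmono : ∫ x, (w x * divOp a u x * pd k (pd k u) x
        + (∑ i, pd i w x * flux a u i x) * pd k (pd k u) x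
        - ∑ i, (pd k w x * flux a u i x
          + w x * ∑ j, pd k (a i j) x * pd j u x) * pd i (pd k u) x) ≤
        ∫ x, (lam⁻¹ / 2 * (w x * ∑ i, pd i (pd k u) x ^ 2) + 1 / (4 * δ) * (w x * divOp a u x ^ 2)
          + C' * τ ^ 2 / (4 * δ) * (w x * nsq (fun i => pd i u x))) := by
      refine integral_mono ?_ ?_ hpt
      · refine CC.integrable (CC.sub (CC.add ?_ ?_) (CC.sum fun i _ => ?_))
        · exact (hppc k k).mul_left (hw1.continuous.mul hD.1)
        · exact (hppc k k).mul_left (continuous_finsetSum _ fun i _ =>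
            (continuous_pd hw1 i).mul (contDiff_flux ha1 hu2 i).continuous)
        · exact (hppc i k).mul_left (((continuous_pd hw1 k).mul
            (contDiff_flux ha1 hu2 i).continuous).add (hw1.continuous.mul
            (continuous_finsetSum _ fun j _ => (continuous_pd (ha1 i j) k).mul
              (continuous_pd hu1 j))))
      · exact CC.integrable (CC.add (CC.add ((iH k).mul_left continuous_const)
          (iD.mul_left continuous_const)) (iG.mul_left continuous_const))
    rw [integral_lin_three (iH k) iD iG, ← hid] at hmono
    have hI := hlow.trans hmono
    have hDnn : 0 ≤ ∫ x, w x * divOp a u x ^ 2 :=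
      integral_nonneg fun x => mul_nonneg (hw0 x).le (sq_nonneg _)
    have hGnn : 0 ≤ ∫ x, w x * nsq (fun i => pd i u x) :=
      integral_nonneg fun x => mul_nonneg (hw0 x).le (nsq_nonneg _)
    set I := ∫ x, w x * ∑ i, pd i (pd k u) x ^ 2 with hIdef
    set X := ∫ x, w x * divOp a u x ^ 2 with hX
    set Y := ∫ x, w x * nsq (fun i => pd i u x) with hY
    have h7 : I = 2 * lam * (lam⁻¹ * I - lam⁻¹ / 2 * I) := by field_simp; ring
    rw [h7]
    have h8 : lam⁻¹ * I - lam⁻¹ / 2 * I ≤ (1 + C') / (4 * δ) * (X + τ ^ 2 * Y) := by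
      have h9 : 0 ≤ C' / (4 * δ) * X := by positivity
      have h10 : 0 ≤ 1 / (4 * δ) * (τ ^ 2 * Y) := by positivity
      have h11 : (1 + C') / (4 * δ) * (X + τ ^ 2 * Y) = 1 / (4 * δ) * X + C' * τ ^ 2 / (4 * δ) * Y
        + C' / (4 * δ) * X + 1 / (4 * δ) * (τ ^ 2 * Y) := by ring
      linarith
    calc 2 * lam * (lam⁻¹ * I - lam⁻¹ / 2 * I) ≤ 2 * lam * ((1 + C') / (4 * δ) * (X + τ ^ 2 * Y)) := by
          gcongr
      _ = _ := by ring
  have hsum : ∫ x, w x * hsq u x = ∑ k, ∫ x, w x * ∑ i, pd i (pd k u) x ^ 2 := by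
    rw [← integral_finsetSum _ fun k _ => (iH k).integrable]
    congr 1; ext x
    unfold hsq
    rw [Finset.mul_sum]
  change ∫ x, w x * hsq u x ≤ _
  rw [hsum]
  refine (Finset.sum_le_sum fun k _ => hk k).trans (le_of_eq ?_)
  simp only [Finset.sum_const, Finset.card_univ, Fintype.card_fin, nsmul_eq_mul]
  ring

end Carleman

namespace Carleman

variable {n : ℕ}

/-! ### Square roots of coefficient matrices -/

theorem norm_sq_eq_nsq (x : Sp n) : ‖x‖ ^ 2 = nsq fun i => x i := by
  rw [EuclideanSpace.norm_sq_eq]; simp [nsq]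

open scoped MatrixOrder Matrix.Norms.L2Operator in
theorem exists_transpose_mul_self {M : Matrix (Fin n) (Fin n) ℝ} (hM : M.PosSemidef) :
    ∃ B : Matrix (Fin n) (Fin n) ℝ, M = B.transpose * B := by
  obtain ⟨B, hB⟩ := CStarAlgebra.nonneg_iff_eq_star_mul_self.1 hM.nonneg
  refine ⟨B, ?_⟩
  rw [hB, Matrix.star_eq_conjTranspose, Matrix.conjTranspose_eq_transpose_of_trivial]

/-- Any factorization `a = Bᵀ B` will do: `A = Bᵀ` has the right inverse `B a⁻¹`. The norm of `A` is
controlled by the diagonal of `a`, and that of `A'` by the form `a` evaluated at `a⁻¹ x`. Both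
bounds depend only on `n` and `lam`, so the continuation estimate applies uniformly. -/
theorem exists_sqrt_coeff {lam : ℝ} (hlam : 1 ≤ lam) {a : Fin n → Fin n → ℝ}
    (hs : ∀ i j, a i j = a j i) (hb : ∀ i j, |a i j| ≤ lam)
    (hell : ∀ ξ, lam⁻¹ * nsq ξ ≤ ea a ξ) :
    ∃ A A' : Sp n →L[ℝ] Sp n, ‖A‖ ≤ n * lam + lam ∧ ‖A'‖ ≤ n * lam + lam ∧
      (∀ x, A (A' x) = x) ∧
      ∀ i j, ∑ k, A (EuclideanSpace.single k 1) i * A (EuclideanSpace.single k 1) j = a i j := by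
  have hl : 0 < lam := by linarith
  set M : Matrix (Fin n) (Fin n) ℝ := Matrix.of a with hM
  have hea : ∀ ξ : Fin n → ℝ, ξ ⬝ᵥ M.mulVec ξ = ea a ξ := fun ξ => by
    unfold ea aV
    simp only [dotProduct, Matrix.mulVec, hM, Matrix.of_apply]
    exact Finset.sum_congr rfl fun i _ => mul_comm _ _
  have hpsd : M.PosSemidef := by
    refine Matrix.PosSemidef.of_dotProduct_mulVec_nonneg ?_ fun ξ => ?_
    · ext i j; simp [hM, hs i j]
    · rw [star_trivial, hea]
      exact (mul_nonneg (inv_nonneg.2 hl.le) (nsq_nonneg ξ)).trans (hell ξ)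
  obtain ⟨B, hB⟩ := exists_transpose_mul_self hpsd
  have hdet : IsUnit M.det := by
    rw [isUnit_iff_ne_zero]
    intro h
    obtain ⟨v, hv, hMv⟩ := Matrix.exists_mulVec_eq_zero_iff.2 h
    have h1 := hell v
    rw [← hea, hMv, dotProduct_zero] at h1
    have := mul_pos (inv_pos.2 hl) (nsq_pos hv)
    linarith
  have hBij : ∀ i j, ∑ k, B k i * B k j = a i j := fun i j => by
    have := congrFun (congrFun hB i) j
    rw [Matrix.mul_apply] at this
    simpa [hM] using this.symm
  set A := Matrix.toEuclideanCLM (n := Fin n) (𝕜 := ℝ) B.transpose with hA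
  set A' := Matrix.toEuclideanCLM (n := Fin n) (𝕜 := ℝ) (B * M⁻¹) with hA'
  have hone : 1 ≤ n * lam + lam := by nlinarith [Nat.cast_nonneg (α := ℝ) n]
  refine ⟨A, A', ?_, ?_, fun x => ?_, fun i j => ?_⟩
  · refine A.opNorm_le_bound (by positivity) fun x => ?_
    refine abs_le_of_sq_le_sq' ?_ (by positivity) |>.2
    have h1 : ∀ i, (A x i) ^ 2 ≤ lam * nsq fun j => x j := fun i => by
      have : A x i = ∑ k, B k i * x k := by
        rw [hA, Matrix.ofLp_toEuclideanCLM]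
        simp [Matrix.mulVec, dotProduct]
      rw [this]
      refine (Finset.sum_mul_sq_le_sq_mul_sq _ _ _).trans (mul_le_mul_of_nonneg_right ?_
        (nsq_nonneg _))
      have := hBij i i
      simp only [← sq] at this
      rw [this]
      exact (le_abs_self _).trans (hb i i)
    rw [norm_sq_eq_nsq, mul_pow, norm_sq_eq_nsq]
    calc nsq (fun i => A x i) ≤ ∑ _i : Fin n, lam * nsq fun j => x j :=
          Finset.sum_le_sum fun i _ => h1 i
      _ = n * lam * nsq fun j => x j := by simp [mul_assoc]
      _ ≤ (n * lam + lam) ^ 2 * nsq fun j => x j := by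
          refine mul_le_mul_of_nonneg_right ?_ (nsq_nonneg _)
          nlinarith
  · refine A'.opNorm_le_bound (by positivity) fun x => ?_
    refine abs_le_of_sq_le_sq' ?_ (by positivity) |>.2
    set y : Fin n → ℝ := M⁻¹.mulVec (WithLp.ofLp x) with hy
    have hMy : M.mulVec y = WithLp.ofLp x := by
      rw [hy, Matrix.mulVec_mulVec, Matrix.mul_nonsing_inv _ hdet, Matrix.one_mulVec]
    have e1 : nsq (fun i => A' x i) = ea a y := by
      have : WithLp.ofLp (A' x) = B.mulVec y := by
        rw [hA', Matrix.ofLp_toEuclideanCLM, hy, Matrix.mulVec_mulVec]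
      rw [show (fun i => A' x i) = B.mulVec y from this, ← hea, hB, ← Matrix.mulVec_mulVec,
        Matrix.dotProduct_mulVec, Matrix.vecMul_transpose]
      simp [nsq, dotProduct, sq]
    have e2 : ea a y = ∑ i, y i * x i := by
      rw [← hea, hMy]; rfl
    have h1 := hell y
    have h2 : (∑ i, y i * x i) ^ 2 ≤ nsq y * nsq fun i => x i :=
      Finset.sum_mul_sq_le_sq_mul_sq _ _ _
    rw [← e2] at h2
    have h0 : 0 ≤ ea a y := (mul_nonneg (inv_nonneg.2 hl.le) (nsq_nonneg y)).trans h1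
    rw [inv_mul_le_iff₀ hl] at h1
    have hx0 := nsq_nonneg fun i => x i
    have h3 : ea a y ≤ lam * nsq fun i => x i := by
      rcases h0.eq_or_lt with h | h
      · rw [← h]; positivity
      · have : ea a y * ea a y ≤ ea a y * (lam * nsq fun i => x i) := by nlinarith
        exact le_of_mul_le_mul_left this h
    rw [norm_sq_eq_nsq, mul_pow, norm_sq_eq_nsq, e1]
    refine h3.trans (mul_le_mul_of_nonneg_right ?_ hx0)
    nlinarith [Nat.cast_nonneg (α := ℝ) n]
  · rw [← mul_apply_eq_comp, hA, hA', ← map_mul, ← Matrix.mul_assoc, ← hB,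
      Matrix.mul_nonsing_inv _ hdet, map_one, one_apply_eq_self]
  · rw [← hBij i j]
    have : ∀ k l, A (EuclideanSpace.single k 1) l = B k l := fun k l => by
      rw [hA, Matrix.ofLp_toEuclideanCLM]
      simp
    simp only [this]

theorem heatOp_eq {A : Sp n →L[ℝ] Sp n} {a : Fin n → Fin n → ℝ}
    (hA : ∀ i j, ∑ k, A (EuclideanSpace.single k 1) i * A (EuclideanSpace.single k 1) j = a i j)
    {U : Sp n → ℝ} (hU : ContDiff ℝ 2 U) (z : Sp n) :
    heatOp A U z = ∑ i, ∑ j, a i j * pd i (pd j U) z := by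
  have hd : DifferentiableAt ℝ (fderiv ℝ U) z :=
    (hU.fderiv_right (m := 1) (by norm_num [one_add_one_eq_two])).differentiable (by simp) z
  have hpp : ∀ i j, pd i (pd j U) z =
      fderiv ℝ (fderiv ℝ U) z (EuclideanSpace.single i 1) (EuclideanSpace.single j 1) := by
    intro i j
    unfold pd
    rw [fderiv_clm_apply hd (differentiableAt_const _)]
    simp
  have hexp : ∀ w : Sp n, fderiv ℝ (fderiv ℝ U) z w w =
      ∑ i, ∑ j, w i * w j * pd i (pd j U) z := by
    intro w
    have hw : w = ∑ i, w i • EuclideanSpace.single i (1 : ℝ) := by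
      have := apply_eq_sum_single (ContinuousLinearMap.id ℝ (Sp n)) w
      simpa using this
    conv_lhs => rw [hw]
    simp only [map_sum, map_smul, sum_apply, smul_apply,
      smul_eq_mul]
    refine Finset.sum_congr rfl fun i _ => ?_
    rw [Finset.mul_sum]
    exact Finset.sum_congr rfl fun j _ => by rw [pd_comm hU.contDiffAt i j, hpp]; ring
  unfold heatOp
  simp only [hexp]
  rw [Finset.sum_comm]
  refine Finset.sum_congr rfl fun i _ => ?_
  rw [Finset.sum_comm]
  refine Finset.sum_congr rfl fun j _ => ?_
  rw [← hA i j, Finset.sum_mul]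

/-! ### Second derivatives of conjugated functions -/

theorem pd_pd_conjW {φ u : Sp n → ℝ} {τ : ℝ} (hφ : ContDiff ℝ 2 φ) (hu : ContDiff ℝ 2 u)
    (i k : Fin n) (x : Sp n) :
    pd i (pd k (conjW φ τ u)) x = Real.exp (τ * φ x) * (pd i (pd k u) x
      + τ * (pd i u x * pd k φ x + pd k u x * pd i φ x) + τ * u x * pd i (pd k φ) x
      + τ ^ 2 * u x * pd i φ x * pd k φ x) := by
  have hφ1 := hφ.differentiable (by simp)
  have hu1 := hu.differentiable (by simp)
  have e : pd k (conjW φ τ u) =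
      fun y => Real.exp (τ * φ y) * (pd k u y + τ * (u y * pd k φ y)) := by
    ext y; rw [pd_conjW (hφ1 y) (hu1 y)]; ring
  have hp := (contDiff_one_pd hφ k).differentiable (by simp) x
  have hq := (contDiff_one_pd hu k).differentiable (by simp) x
  have hd : DifferentiableAt ℝ (fun y => u y * pd k φ y) x := (hu1 x).fun_mul hp
  rw [e, pd_exp_mul (hφ1 x) (hq.fun_add (hd.const_mul τ)), pd_add hq (hd.const_mul τ),
    pd_const_mul τ hd, pd_mul (hu1 x) hp]
  ring

theorem pd_comp_affine {f : Sp n → ℝ} (hf : Differentiable ℝ f) (x : Sp n) (t : ℝ) (j : Fin n)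
    (z : Sp n) : pd j (fun z => f (x + t • z)) z = t * pd j f (x + t • z) := by
  have h1 : HasFDerivAt (fun z : Sp n => x + t • z) (t • ContinuousLinearMap.id ℝ (Sp n)) z :=
    ((hasFDerivAt_id z).const_smul t).const_add x
  have h2 : fderiv ℝ (fun z => f (x + t • z)) z = _ := ((hf _).hasFDerivAt.comp z h1).fderiv
  unfold pd
  rw [h2]
  simp

/-! ### Averages of translates -/

theorem integrable_exp_neg_norm : Integrable fun z : Sp n => Real.exp (-‖z‖) := by
  have h := integrable_one_add_norm (E := Sp n) (μ := volume) (r := n + 1) (by simp)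
  refine (h.const_mul ((n + 1).factorial * Real.exp 1)).mono'
    (by fun_prop : Continuous fun z : Sp n => Real.exp (-‖z‖)).aestronglyMeasurable
    (Filter.Eventually.of_forall fun z => ?_)
  rw [Real.norm_of_nonneg (Real.exp_pos _).le]
  have h1 : 0 ≤ 1 + ‖z‖ := by positivity
  have h2 := Real.pow_div_factorial_le_exp (1 + ‖z‖) h1 (n + 1)
  have h3 : (1 + ‖z‖) ^ (-((n : ℝ) + 1)) = ((1 + ‖z‖) ^ (n + 1))⁻¹ := by
    rw [Real.rpow_neg h1]; congr 1; exact_mod_cast Real.rpow_natCast _ (n + 1)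
  rw [h3, Real.exp_neg]
  rw [div_le_iff₀ (by positivity), Real.exp_add] at h2
  rw [← div_eq_mul_inv, le_div_iff₀ (by positivity), inv_mul_le_iff₀ (Real.exp_pos _)]
  linarith

theorem integrable_translate {ν : Measure (Sp n)} [SFinite ν] {κ Ψ : Sp n → ℝ}
    (hκ : Integrable κ ν) (hΨ : CC Ψ) (t : ℝ) :
    Integrable (fun p : Sp n × Sp n => κ p.2 * Ψ (p.1 + t • p.2)) (volume.prod ν) := by
  have hm : AEStronglyMeasurable (fun p : Sp n × Sp n => κ p.2 * Ψ (p.1 + t • p.2))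
      (volume.prod ν) :=
    hκ.aestronglyMeasurable.comp_snd.mul (hΨ.1.comp (by fun_prop)).aestronglyMeasurable
  rw [integrable_prod_iff' hm]
  refine ⟨Filter.Eventually.of_forall fun z =>
    (hΨ.integrable.comp_add_right (t • z)).const_mul (κ z), ?_⟩
  have e : (fun z => ∫ x, ‖κ z * Ψ (x + t • z)‖) = fun z => ‖κ z‖ * ∫ x, ‖Ψ x‖ := by
    ext z
    simp only [norm_mul]
    rw [integral_const_mul, integral_add_right_eq_self (fun x => ‖Ψ x‖)]
  simp only [e]
  exact hκ.norm.mul_const _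

theorem integral_integral_translate {ν : Measure (Sp n)} [SFinite ν] {κ Ψ : Sp n → ℝ}
    (hκ : Integrable κ ν) (hΨ : CC Ψ) (t : ℝ) :
    ∫ x, ∫ z, κ z * Ψ (x + t • z) ∂ν = (∫ z, κ z ∂ν) * ∫ x, Ψ x := by
  rw [integral_integral_swap (f := fun x z => κ z * Ψ (x + t • z)) (integrable_translate hκ hΨ t)]
  have e : ∀ z, ∫ x, κ z * Ψ (x + t • z) = κ z * ∫ x, Ψ x := fun z => by
    rw [integral_const_mul, integral_add_right_eq_self]
  simp only [e]
  rw [integral_mul_const]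

end Carleman

namespace Carleman

variable {n : ℕ}

/-! ### Estimates for the conjugated function -/

theorem abs_le_sqrt_enr {v : Sp n → ℝ} (τ : ℝ) (x : Sp n) (i : Fin n) :
    |pd i v x| ≤ Real.sqrt (enr τ v x) := by
  refine Real.abs_le_sqrt ?_
  have := sq_le_nsq (fun i => pd i v x) i
  unfold enr
  nlinarith [sq_nonneg (τ * v x)]

theorem abs_le_inv_mul_sqrt_enr {v : Sp n → ℝ} {τ : ℝ} (hτ : 0 < τ) (x : Sp n) :
    |v x| ≤ τ⁻¹ * Real.sqrt (enr τ v x) := by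
  have h : |τ * v x| ≤ Real.sqrt (enr τ v x) := by
    refine Real.abs_le_sqrt ?_
    unfold enr
    nlinarith [nsq_nonneg fun i => pd i v x]
  rw [abs_mul, abs_of_pos hτ] at h
  rwa [le_inv_mul_iff₀ hτ]

theorem exp_mul_nsq_le {φ u : Sp n → ℝ} {τ R : ℝ} {x : Sp n} (hφ : DifferentiableAt ℝ φ x)
    (hu : DifferentiableAt ℝ u x) (hR : x ∈ tsupport u → ∀ i, |pd i φ x| ≤ R) :
    Real.exp (2 * τ * φ x) * nsq (fun i => pd i u x) ≤
      (2 + 2 * n * R ^ 2) * enr τ (conjW φ τ u) x := by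
  by_cases hx : x ∈ tsupport u
  · have hE : Real.exp (2 * τ * φ x) = Real.exp (τ * φ x) ^ 2 := by
      rw [← Real.exp_nat_mul]; congr 1; push_cast; ring
    have h1 : ∀ i, Real.exp (2 * τ * φ x) * pd i u x ^ 2 ≤
        2 * pd i (conjW φ τ u) x ^ 2 + 2 * R ^ 2 * (τ ^ 2 * conjW φ τ u x ^ 2) := fun i => by
      have e : Real.exp (2 * τ * φ x) * pd i u x ^ 2 =
          (pd i (conjW φ τ u) x - τ * conjW φ τ u x * pd i φ x) ^ 2 := by
        rw [pd_conjW hφ hu, hE]; unfold conjW; ring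
      rw [e]
      have h2 : pd i φ x ^ 2 ≤ R ^ 2 := by
        rw [← sq_abs]; exact pow_le_pow_left₀ (abs_nonneg _) (hR hx i) 2
      have h3 : (τ * conjW φ τ u x * pd i φ x) ^ 2 ≤ R ^ 2 * (τ ^ 2 * conjW φ τ u x ^ 2) := by
        calc (τ * conjW φ τ u x * pd i φ x) ^ 2
            = pd i φ x ^ 2 * (τ ^ 2 * conjW φ τ u x ^ 2) := by ring
          _ ≤ _ := by gcongr
      nlinarith [sq_nonneg (pd i (conjW φ τ u) x + τ * conjW φ τ u x * pd i φ x)]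
    have h2 := Finset.sum_le_sum fun i (_ : i ∈ Finset.univ) => h1 i
    rw [← Finset.mul_sum, Finset.sum_add_distrib, ← Finset.mul_sum, Finset.sum_const,
      Finset.card_univ, Fintype.card_fin, nsmul_eq_mul] at h2
    unfold enr
    have h3 := nsq_nonneg fun i => pd i (conjW φ τ u) x
    have h4 : 0 ≤ τ ^ 2 * conjW φ τ u x ^ 2 := by positivity
    have h5 : 0 ≤ 2 * n * R ^ 2 * nsq fun i => pd i (conjW φ τ u) x := by positivity
    change Real.exp (2 * τ * φ x) * ∑ i, pd i u x ^ 2 ≤ _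
    have h6 : ∑ i, pd i (conjW φ τ u) x ^ 2 = nsq fun i => pd i (conjW φ τ u) x := rfl
    rw [h6] at h2
    linarith
  · have hp : ∀ i, pd i u x = 0 := fun i => pd_eq_zero_of_notMem_tsupport hx
    simp only [hp, nsq]
    have := enr_nonneg τ (conjW φ τ u) x
    simp
    positivity

theorem hsq_conjW_le {φ u : Sp n → ℝ} {τ R : ℝ} (hτ : 1 ≤ τ) (hφ : ContDiff ℝ 2 φ)
    (hu : ContDiff ℝ 2 u) {x : Sp n} (hR : ∀ i, |pd i φ x| ≤ R)
    (hH : ∀ i k, |pd i (pd k φ) x| ≤ R) :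
    hsq (conjW φ τ u) x ≤ 5 * (Real.exp (2 * τ * φ x) * hsq u x)
      + n ^ 2 * (5 * (3 * R ^ 2 + R ^ 4)) * (τ ^ 2 * enr τ (conjW φ τ u) x) := by
  set v := conjW φ τ u with hv
  have hτ0 : 0 < τ := by linarith
  have hE : Real.exp (2 * τ * φ x) = Real.exp (τ * φ x) ^ 2 := by
    rw [← Real.exp_nat_mul]; congr 1; push_cast; ring
  have hN : ∀ i, pd i φ x ^ 2 ≤ R ^ 2 := fun i => by
    rw [← sq_abs]; exact pow_le_pow_left₀ (abs_nonneg _) (hR i) 2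
  have hHH : ∀ i k, pd i (pd k φ) x ^ 2 ≤ R ^ 2 := fun i k => by
    rw [← sq_abs]; exact pow_le_pow_left₀ (abs_nonneg _) (hH i k) 2
  have hvi : ∀ i, pd i v x ^ 2 ≤ enr τ v x := fun i => by
    have := sq_le_nsq (fun i => pd i v x) i
    unfold enr; nlinarith [sq_nonneg (τ * v x)]
  have hv0 : τ ^ 2 * v x ^ 2 ≤ enr τ v x := by
    unfold enr; linarith [nsq_nonneg fun i => pd i v x]
  have hen := enr_nonneg τ v x
  have hφ1 := hφ.differentiable (by simp) x
  have hu1 := hu.differentiable (by simp) x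
  have hτ2 : 1 ≤ τ ^ 2 := one_le_pow₀ hτ
  have key : ∀ i k, pd i (pd k v) x ^ 2 ≤ 5 * (Real.exp (2 * τ * φ x) * pd i (pd k u) x ^ 2)
      + 5 * (3 * R ^ 2 + R ^ 4) * (τ ^ 2 * enr τ v x) := by
    intro i k
    -- The gradient of `u` is eliminated in favour of that of `v`, which reverses the sign of the
    -- term with `τ ^ 2`.
    have e : pd i (pd k v) x = Real.exp (τ * φ x) * pd i (pd k u) x + τ * pd i v x * pd k φ x
        + τ * pd k v x * pd i φ x - τ ^ 2 * v x * pd i φ x * pd k φ x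
        + τ * v x * pd i (pd k φ) x := by
      rw [hv, pd_pd_conjW hφ hu, pd_conjW hφ1 hu1, pd_conjW hφ1 hu1]
      unfold conjW; ring
    have five : ∀ x1 x2 x3 x4 x5 : ℝ, (x1 + x2 + x3 - x4 + x5) ^ 2 ≤
        5 * (x1 ^ 2 + x2 ^ 2 + x3 ^ 2 + x4 ^ 2 + x5 ^ 2) := fun x1 x2 x3 x4 x5 => by
      nlinarith [sq_nonneg (x1 - x2), sq_nonneg (x1 - x3), sq_nonneg (x1 + x4), sq_nonneg (x1 - x5),
        sq_nonneg (x2 - x3), sq_nonneg (x2 + x4), sq_nonneg (x2 - x5), sq_nonneg (x3 + x4),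
        sq_nonneg (x3 - x5), sq_nonneg (x4 + x5)]
    rw [e]
    refine (five _ _ _ _ _).trans ?_
    have b1 : (Real.exp (τ * φ x) * pd i (pd k u) x) ^ 2 =
        Real.exp (2 * τ * φ x) * pd i (pd k u) x ^ 2 := by rw [hE]; ring
    have b2 : ∀ i k, (τ * pd i v x * pd k φ x) ^ 2 ≤ R ^ 2 * (τ ^ 2 * enr τ v x) := fun i k => by
      calc (τ * pd i v x * pd k φ x) ^ 2 = pd k φ x ^ 2 * (τ ^ 2 * pd i v x ^ 2) := by ring
        _ ≤ R ^ 2 * (τ ^ 2 * enr τ v x) := mul_le_mul (hN k)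
          (mul_le_mul_of_nonneg_left (hvi i) (by positivity)) (by positivity) (by positivity)
    have b4 : (τ ^ 2 * v x * pd i φ x * pd k φ x) ^ 2 ≤ R ^ 4 * (τ ^ 2 * enr τ v x) := by
      calc (τ ^ 2 * v x * pd i φ x * pd k φ x) ^ 2
          = (pd i φ x ^ 2 * pd k φ x ^ 2) * (τ ^ 2 * (τ ^ 2 * v x ^ 2)) := by ring
        _ ≤ (R ^ 2 * R ^ 2) * (τ ^ 2 * enr τ v x) := mul_le_mul (mul_le_mul (hN i) (hN k)
          (sq_nonneg _) (sq_nonneg _)) (mul_le_mul_of_nonneg_left hv0 (by positivity))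
          (by positivity) (by positivity)
        _ = _ := by ring
    have b5 : (τ * v x * pd i (pd k φ) x) ^ 2 ≤ R ^ 2 * (τ ^ 2 * enr τ v x) := by
      calc (τ * v x * pd i (pd k φ) x) ^ 2 = pd i (pd k φ) x ^ 2 * (τ ^ 2 * v x ^ 2) := by ring
        _ ≤ R ^ 2 * (τ ^ 2 * enr τ v x) := mul_le_mul (hHH i k)
          (hv0.trans (le_mul_of_one_le_left hen hτ2)) (by positivity) (by positivity)
    have b2' := b2 i k
    have b3' := b2 k i
    rw [b1]
    linarith
  have hs := Finset.sum_le_sum fun k (_ : k ∈ Finset.univ) =>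
    Finset.sum_le_sum fun i (_ : i ∈ Finset.univ) => key i k
  simp only [Finset.sum_add_distrib, ← Finset.mul_sum, Finset.sum_const, Finset.card_univ,
    Fintype.card_fin, nsmul_eq_mul] at hs
  unfold hsq
  refine hs.trans (le_of_eq ?_)
  ring

theorem cc_hsq {v : Sp n → ℝ} (hv : ContDiff ℝ 2 v) (hc : HasCompactSupport v) : CC (hsq v) :=
  CC.sum fun k _ => CC.sum fun i _ =>
    (cc_pd (contDiff_one_pd hv k) (hasCompactSupport_pd hc k) i).sq

theorem hsq_eq_zero {v : Sp n → ℝ} {x : Sp n} (hx : x ∉ tsupport v) : hsq v x = 0 := by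
  unfold hsq
  refine Finset.sum_eq_zero fun k _ => Finset.sum_eq_zero fun i _ => ?_
  rw [pd_eq_zero_of_notMem_tsupport fun h => hx (tsupport_pd_subset k v h)]
  simp

/-- The second derivatives of `u`, and those of the conjugated function, in terms of the conjugated
operator and the energy. -/
theorem second_order_estimate (lam L R : ℝ) (hlam : 1 ≤ lam) :
    ∃ C, 0 ≤ C ∧ ∀ (a : Fin n → Fin n → Sp n → ℝ) (φ u : Sp n → ℝ) (τ : ℝ), IsCoeff lam L a →
      1 ≤ τ → ContDiff ℝ 2 φ → ContDiff ℝ 3 u → HasCompactSupport u →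
      (∀ x ∈ tsupport u, ∀ i, |pd i φ x| ≤ R) →
      (∀ x ∈ tsupport u, ∀ i k, |pd i (pd k φ) x| ≤ R) →
      (∫ x, Real.exp (2 * τ * φ x) * hsq u x) ≤
        C * ((∫ x, conjOp a φ τ (conjW φ τ u) x ^ 2) + τ ^ 2 * ∫ x, enr τ (conjW φ τ u) x) ∧
      ∫ x, hsq (conjW φ τ u) x ≤
        C * ((∫ x, conjOp a φ τ (conjW φ τ u) x ^ 2) + τ ^ 2 * ∫ x, enr τ (conjW φ τ u) x) := by
  obtain ⟨C0, hC0, h0⟩ := hessian_estimate (n := n) lam L R hlam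
  set D : ℝ := 2 + 2 * n * R ^ 2 with hD
  have hD1 : 1 ≤ D := by
    have : (0 : ℝ) ≤ 2 * n * R ^ 2 := by positivity
    linarith
  set F : ℝ := n ^ 2 * (5 * (3 * R ^ 2 + R ^ 4)) with hF
  have hF0 : 0 ≤ F := by positivity
  refine ⟨5 * (C0 * D) + F, by positivity, fun a φ u τ ha hτ hφ hu hc hR hH => ?_⟩
  have hu2 : ContDiff ℝ 2 u := hu.of_le (by norm_num)
  have ha1 := fun i j => ha.contDiff 1 i j
  have hv2 := contDiff_conjW (τ := τ) hφ hu2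
  have hvc := hasCompactSupport_conjW (φ := φ) (τ := τ) hc
  have hwc : Continuous fun x => Real.exp (2 * τ * φ x) :=
    Real.continuous_exp.comp (continuous_const.mul hφ.continuous)
  have h1 := h0 a φ u τ ha hτ hφ hu hc hR
  have e1 : ∫ x, Real.exp (2 * τ * φ x) * divOp a u x ^ 2 =
      ∫ x, conjOp a φ τ (conjW φ τ u) x ^ 2 := by
    congr 1; ext x
    rw [conjOp_conjW ha.symm ha1 hφ hu2, mul_pow, ← Real.exp_nat_mul]
    congr 2; push_cast; ring
  have e2 : ∫ x, Real.exp (2 * τ * φ x) * nsq (fun i => pd i u x) ≤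
      D * ∫ x, enr τ (conjW φ τ u) x := by
    rw [← integral_const_mul]
    exact integral_mono (CC.integrable (CC.mul_left (CC.sum fun i _ =>
      (cc_pd (hu2.of_le (by norm_num)) hc i).sq) hwc))
      ((cc_enr hv2 hvc).integrable.const_mul _) fun x =>
      exp_mul_nsq_le (hφ.differentiable (by simp) x) (hu2.differentiable (by simp) x) fun hx i =>
        hR x hx i
  rw [e1] at h1
  set X := ∫ x, conjOp a φ τ (conjW φ τ u) x ^ 2 with hX
  set E := ∫ x, enr τ (conjW φ τ u) x with hE
  have hX0 : 0 ≤ X := integral_nonneg fun x => sq_nonneg _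
  have hE0 : 0 ≤ E := integral_nonneg fun x => enr_nonneg _ _ _
  have hτ2 : 0 ≤ τ ^ 2 := sq_nonneg _
  have h2 : (∫ x, Real.exp (2 * τ * φ x) * hsq u x) ≤ C0 * D * (X + τ ^ 2 * E) := by
    refine h1.trans ?_
    rw [mul_assoc]
    refine mul_le_mul_of_nonneg_left ?_ hC0
    have h3 : X ≤ D * X := le_mul_of_one_le_left hX0 hD1
    have h4 := mul_le_mul_of_nonneg_left e2 hτ2
    calc X + _ ≤ D * X + τ ^ 2 * (D * E) := add_le_add h3 h4
      _ = _ := by ring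
  have hXE : 0 ≤ X + τ ^ 2 * E := by positivity
  constructor
  · refine h2.trans (mul_le_mul_of_nonneg_right ?_ hXE)
    have : 0 ≤ C0 * D := by positivity
    linarith
  · have h5 : ∫ x, hsq (conjW φ τ u) x ≤
        ∫ x, (5 * (Real.exp (2 * τ * φ x) * hsq u x) + F * (τ ^ 2 * enr τ (conjW φ τ u) x)) := by
      refine integral_mono (cc_hsq hv2 hvc).integrable (CC.integrable (CC.add
        (((cc_hsq hu2 hc).mul_left hwc).mul_left continuous_const)
        (((cc_enr hv2 hvc).mul_left continuous_const).mul_left continuous_const))) fun x => ?_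
      by_cases hx : x ∈ tsupport u
      · exact hsq_conjW_le hτ hφ hu2 (hR x hx) (hH x hx)
      · have hz : hsq (conjW φ τ u) x = 0 := hsq_eq_zero (by rwa [tsupport_conjW])
        have := enr_nonneg τ (conjW φ τ u) x
        have := hsq_nonneg u x
        simp only [hz]
        positivity
    rw [integral_add (((cc_hsq hu2 hc).mul_left hwc).integrable.const_mul 5)
      (((cc_enr hv2 hvc).mul_left continuous_const).integrable.const_mul F), integral_const_mul,
      integral_const_mul, integral_const_mul] at h5
    refine h5.trans ?_
    have h6 : F * (τ ^ 2 * E) ≤ F * (X + τ ^ 2 * E) :=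
      mul_le_mul_of_nonneg_left (by linarith) hF0
    calc _ ≤ 5 * (C0 * D * (X + τ ^ 2 * E)) + F * (X + τ ^ 2 * E) := by gcongr
      _ = _ := by ring

end Carleman

namespace Carleman

variable {n : ℕ}

/-! ### Freezing the coefficients -/

/-- The conjugated operator with frozen coefficients, at unit scale. -/
def frozenOp (A : Fin n → Fin n → ℝ) (N : Fin n → ℝ) (τ : ℝ) (v : Sp n → ℝ) (y : Sp n) : ℝ :=
  ∑ i, ∑ j, A i j * (τ⁻¹ ^ 2 * pd i (pd j v) y - τ⁻¹ * (N i * pd j v y + N j * pd i v y)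
    + N i * N j * v y)

theorem sq_sum_sum_abs_le (f : Fin n → Fin n → ℝ) :
    (∑ i, ∑ j, |f i j|) ^ 2 ≤ n ^ 2 * ∑ i, ∑ j, f i j ^ 2 := by
  have h1 : (∑ i, ∑ j, |f i j|) ^ 2 ≤ n * ∑ i, (∑ j, |f i j|) ^ 2 := by
    have := sq_sum_le_card_mul_sum_sq (s := Finset.univ) (f := fun i => ∑ j, |f i j|)
    simpa using this
  have h2 : ∀ i, (∑ j, |f i j|) ^ 2 ≤ n * ∑ j, f i j ^ 2 := fun i => by
    have := sq_sum_le_card_mul_sum_sq (s := Finset.univ) (f := fun j => |f i j|)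
    simpa using this
  calc (∑ i, ∑ j, |f i j|) ^ 2 ≤ n * ∑ i, n * ∑ j, f i j ^ 2 :=
        h1.trans (by gcongr with i _; exact h2 i)
    _ = _ := by rw [← Finset.mul_sum]; ring

/-- In the difference from `τ⁻¹ ^ 2 * conjOp` the second derivatives carry the coefficient error
`b`. Every other term carries one of the small quantities `τ⁻¹`, `b`, `m`, together with `τ⁻¹ |∇v|`
or `|v|`, both at most `τ⁻¹` times the root of the energy density. -/
theorem frozenOp_sq_le {lam L R : ℝ} (hlam : 0 ≤ lam) (hL : 0 ≤ L) (hR0 : 0 ≤ R)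
    {a : Fin n → Fin n → Sp n → ℝ} (ha : IsCoeff lam L a) {φ v : Sp n → ℝ} (hφ : ContDiff ℝ 2 φ)
    (hv : ContDiff ℝ 2 v) {τ : ℝ} (hτ : 0 < τ) {y : Sp n} (hR : ∀ i, |pd i φ y| ≤ R)
    (hH : ∀ i k, |pd i (pd k φ) y| ≤ R) {A : Fin n → Fin n → ℝ} {N : Fin n → ℝ} {b m : ℝ}
    (hA : ∀ i j, |A i j - a i j y| ≤ b) (hN : ∀ i, |N i| ≤ R) (hNm : ∀ i, |N i - pd i φ y| ≤ m)
    (hb : 0 ≤ b) (hm : 0 ≤ m) :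
    frozenOp A N τ v y ^ 2 ≤ 2 * (τ⁻¹ ^ 2 * conjOp a φ τ v y) ^ 2
      + 4 * n ^ 2 * (b ^ 2 * τ⁻¹ ^ 4 * hsq v y)
      + 4 * (n ^ 2 * (L + 2 * R + 2 * lam + R ^ 2 + 2 * lam * R + L * R + lam * R)) ^ 2
        * ((τ⁻¹ + b + m) ^ 2 * τ⁻¹ ^ 2 * enr τ v y) := by
  have ha1 := fun i j => ha.contDiff 1 i j
  set s := Real.sqrt (enr τ v y) with hs
  have hs0 : 0 ≤ s := Real.sqrt_nonneg _
  have hs2 : s ^ 2 = enr τ v y := Real.sq_sqrt (enr_nonneg _ _ _)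
  set t := τ⁻¹ with ht
  have ht0 : 0 < t := inv_pos.2 hτ
  have htτ : t * τ = 1 := inv_mul_cancel₀ hτ.ne'
  have hvj : ∀ j, |pd j v y| ≤ s := fun j => abs_le_sqrt_enr τ y j
  have hv0 : |v y| ≤ t * s := abs_le_inv_mul_sqrt_enr hτ y
  set C1 := L + 2 * R + 2 * lam + R ^ 2 + 2 * lam * R + L * R + lam * R with hC1
  have hC10 : 0 ≤ C1 := by positivity
  set δ := t + b + m with hδ
  -- the conjugated operator as a double sum
  have hconj : t ^ 2 * conjOp a φ τ v y = ∑ i, ∑ j, (t ^ 2 * (pd i (a i j) y * pd j v y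
      + a i j y * pd i (pd j v) y) + a i j y * pd i φ y * pd j φ y * v y
      - t * (a i j y * (pd i φ y * pd j v y + pd j φ y * pd i v y))
      - t * (pd i (a i j) y * pd j φ y + a i j y * pd i (pd j φ) y) * v y) := by
    have e1 : divOp a v y = ∑ i, ∑ j, (pd i (a i j) y * pd j v y + a i j y * pd i (pd j v) y) :=
      Finset.sum_congr rfl fun i _ => pd_flux_eq ha1 hv i i y
    have e2 : ∑ k, pd k (flux a φ k) y =
        ∑ i, ∑ j, (pd i (a i j) y * pd j φ y + a i j y * pd i (pd j φ) y) :=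
      Finset.sum_congr rfl fun i _ => pd_flux_eq ha1 hφ i i y
    have e3 : gradForm a φ y = ∑ i, ∑ j, a i j y * pd i φ y * pd j φ y := by
      unfold gradForm flux
      refine Finset.sum_congr rfl fun i _ => ?_
      rw [Finset.sum_mul]
      exact Finset.sum_congr rfl fun j _ => by ring
    have e4 : ∑ k, flux a φ k y * pd k v y = ∑ i, ∑ j, a i j y * (pd j φ y * pd i v y) := by
      unfold flux
      refine Finset.sum_congr rfl fun i _ => ?_
      rw [Finset.sum_mul]
      exact Finset.sum_congr rfl fun j _ => by ring
    have e5 : ∑ i, ∑ j, a i j y * (pd j φ y * pd i v y) =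
        ∑ i, ∑ j, a i j y * (pd i φ y * pd j v y) := by
      rw [Finset.sum_comm]
      exact Finset.sum_congr rfl fun i _ => Finset.sum_congr rfl fun j _ => by rw [ha.symm j i]
    have e6 : ∑ i, ∑ j, a i j y * (pd i φ y * pd j v y + pd j φ y * pd i v y) =
        2 * ∑ i, ∑ j, a i j y * (pd j φ y * pd i v y) := by
      simp only [mul_add, Finset.sum_add_distrib]
      rw [← e5]; ring
    have : t ^ 2 * conjOp a φ τ v y = t ^ 2 * divOp a v y + (t * τ) ^ 2 * gradForm a φ y * v y
        - t * (t * τ) * (2 * ∑ k, flux a φ k y * pd k v y)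
        - t * (t * τ) * (∑ k, pd k (flux a φ k) y) * v y := by
      unfold conjOp; ring
    rw [this, htτ, one_pow, one_mul, mul_one, e1, e2, e3, e4, ← e6]
    simp only [Finset.mul_sum, Finset.sum_mul, ← Finset.sum_add_distrib, ← Finset.sum_sub_distrib]
  set W : Fin n → Fin n → ℝ := fun i j =>
    (A i j - a i j y) * (t ^ 2 * pd i (pd j v) y)
    - t ^ 2 * (pd i (a i j) y * pd j v y)
    - t * ((A i j - a i j y) * (N i * pd j v y + N j * pd i v y)
      + a i j y * ((N i - pd i φ y) * pd j v y + (N j - pd j φ y) * pd i v y))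
    + ((A i j - a i j y) * (N i * N j) + a i j y * ((N i - pd i φ y) * N j
      + pd i φ y * (N j - pd j φ y))) * v y
    + t * (pd i (a i j) y * pd j φ y + a i j y * pd i (pd j φ) y) * v y with hW
  have hdiff : frozenOp A N τ v y = t ^ 2 * conjOp a φ τ v y + ∑ i, ∑ j, W i j := by
    rw [hconj]
    unfold frozenOp
    simp only [← Finset.sum_add_distrib]
    refine Finset.sum_congr rfl fun i _ => Finset.sum_congr rfl fun j _ => ?_
    rw [hW]
    ring
  have hWb : ∀ i j, |W i j| ≤ b * t ^ 2 * |pd i (pd j v) y| + C1 * (δ * t * s) := by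
    intro i j
    have hab := ha.bound i j y
    have hda := ha.deriv i i j y
    have htb : t ≤ δ := by linarith
    have hbδ : b ≤ δ := by linarith
    have hmδ : m ≤ δ := by linarith
    have hδ0 : 0 ≤ δ := by linarith
    have w1 : |(A i j - a i j y) * (t ^ 2 * pd i (pd j v) y)| ≤ b * t ^ 2 * |pd i (pd j v) y| := by
      rw [abs_mul, abs_mul, abs_of_nonneg (sq_nonneg t), mul_assoc]
      exact mul_le_mul_of_nonneg_right (hA i j) (by positivity)
    have w2 : |t ^ 2 * (pd i (a i j) y * pd j v y)| ≤ L * (δ * t * s) := by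
      rw [abs_mul, abs_mul, abs_of_nonneg (sq_nonneg t)]
      calc t ^ 2 * (|pd i (a i j) y| * |pd j v y|) ≤ t ^ 2 * (L * s) := by
            gcongr; exact hvj j
        _ = L * (t * t * s) := by ring
        _ ≤ _ := by gcongr
    have w3 : |t * ((A i j - a i j y) * (N i * pd j v y + N j * pd i v y)
        + a i j y * ((N i - pd i φ y) * pd j v y + (N j - pd j φ y) * pd i v y))| ≤
        (2 * R + 2 * lam) * (δ * t * s) := by
      rw [abs_mul, abs_of_pos ht0]
      have h1 : |N i * pd j v y + N j * pd i v y| ≤ R * s + R * s := by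
        refine (abs_add_le _ _).trans (add_le_add ?_ ?_) <;> rw [abs_mul]
        · exact mul_le_mul (hN i) (hvj j) (abs_nonneg _) hR0
        · exact mul_le_mul (hN j) (hvj i) (abs_nonneg _) hR0
      have h2 : |(N i - pd i φ y) * pd j v y + (N j - pd j φ y) * pd i v y| ≤ m * s + m * s := by
        refine (abs_add_le _ _).trans (add_le_add ?_ ?_) <;> rw [abs_mul]
        · exact mul_le_mul (hNm i) (hvj j) (abs_nonneg _) hm
        · exact mul_le_mul (hNm j) (hvj i) (abs_nonneg _) hm
      have h3 : |(A i j - a i j y) * (N i * pd j v y + N j * pd i v y)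
          + a i j y * ((N i - pd i φ y) * pd j v y + (N j - pd j φ y) * pd i v y)| ≤
          b * (R * s + R * s) + lam * (m * s + m * s) := by
        refine (abs_add_le _ _).trans (add_le_add ?_ ?_) <;> rw [abs_mul]
        · exact mul_le_mul (hA i j) h1 (abs_nonneg _) hb
        · exact mul_le_mul hab h2 (abs_nonneg _) hlam
      calc _ ≤ t * (b * (R * s + R * s) + lam * (m * s + m * s)) := by gcongr
        _ ≤ t * (δ * (R * s + R * s) + lam * (δ * s + δ * s)) := by gcongr
        _ = _ := by ring
    have w4 : |((A i j - a i j y) * (N i * N j) + a i j y * ((N i - pd i φ y) * N j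
        + pd i φ y * (N j - pd j φ y))) * v y| ≤ (R ^ 2 + 2 * lam * R) * (δ * t * s) := by
      rw [abs_mul]
      have h1 : |(N i - pd i φ y) * N j + pd i φ y * (N j - pd j φ y)| ≤ m * R + R * m := by
        refine (abs_add_le _ _).trans (add_le_add ?_ ?_) <;> rw [abs_mul]
        · exact mul_le_mul (hNm i) (hN j) (abs_nonneg _) hm
        · exact mul_le_mul (hR i) (hNm j) (abs_nonneg _) hR0
      have h2 : |N i * N j| ≤ R * R := by
        rw [abs_mul]; exact mul_le_mul (hN i) (hN j) (abs_nonneg _) hR0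
      have h3 : |(A i j - a i j y) * (N i * N j) + a i j y * ((N i - pd i φ y) * N j
        + pd i φ y * (N j - pd j φ y))| ≤ b * (R * R) + lam * (m * R + R * m) := by
        refine (abs_add_le _ _).trans (add_le_add ?_ ?_) <;> rw [abs_mul]
        · exact mul_le_mul (hA i j) h2 (abs_nonneg _) hb
        · exact mul_le_mul hab h1 (abs_nonneg _) hlam
      calc _ ≤ (b * (R * R) + lam * (m * R + R * m)) * (t * s) := by gcongr
        _ ≤ (δ * (R * R) + lam * (δ * R + R * δ)) * (t * s) := by gcongr
        _ = _ := by ring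
    have w5 : |t * (pd i (a i j) y * pd j φ y + a i j y * pd i (pd j φ) y) * v y| ≤
        (L * R + lam * R) * (δ * t * s) := by
      rw [abs_mul, abs_mul, abs_of_pos ht0]
      have h1 : |pd i (a i j) y * pd j φ y + a i j y * pd i (pd j φ) y| ≤ L * R + lam * R := by
        refine (abs_add_le _ _).trans (add_le_add ?_ ?_) <;> rw [abs_mul]
        · exact mul_le_mul hda (hR j) (abs_nonneg _) hL
        · exact mul_le_mul hab (hH i j) (abs_nonneg _) hlam
      calc _ ≤ δ * (L * R + lam * R) * (t * s) := by gcongr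
        _ = _ := by ring
    have hsum : |W i j| ≤ b * t ^ 2 * |pd i (pd j v) y| + L * (δ * t * s)
        + (2 * R + 2 * lam) * (δ * t * s) + (R ^ 2 + 2 * lam * R) * (δ * t * s)
        + (L * R + lam * R) * (δ * t * s) :=
      (abs_add_le _ _).trans (add_le_add ((abs_add_le _ _).trans (add_le_add
        ((abs_sub _ _).trans (add_le_add ((abs_sub _ _).trans (add_le_add w1 w2)) w3)) w4)) w5)
    refine hsum.trans (le_of_eq ?_)
    rw [hC1]; ring
  have hWs : |∑ i, ∑ j, W i j| ≤ b * t ^ 2 * (∑ i, ∑ j, |pd i (pd j v) y|)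
      + n ^ 2 * (C1 * (δ * t * s)) := by
    refine (Finset.abs_sum_le_sum_abs _ _).trans ((Finset.sum_le_sum fun i _ =>
      (Finset.abs_sum_le_sum_abs _ _).trans (Finset.sum_le_sum fun j _ => hWb i j)).trans ?_)
    simp only [Finset.sum_add_distrib, ← Finset.mul_sum, Finset.sum_const, Finset.card_univ,
      Fintype.card_fin, nsmul_eq_mul]
    refine le_of_eq ?_
    ring
  have hHs : (∑ i, ∑ j, |pd i (pd j v) y|) ^ 2 ≤ n ^ 2 * hsq v y := by
    refine (sq_sum_sum_abs_le fun i j => pd i (pd j v) y).trans (le_of_eq ?_)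
    unfold hsq
    rw [Finset.sum_comm]
  rw [hdiff]
  have hsq1 : (∑ i, ∑ j, W i j) ^ 2 ≤ (b * t ^ 2 * (∑ i, ∑ j, |pd i (pd j v) y|)
      + n ^ 2 * (C1 * (δ * t * s))) ^ 2 := by
    rw [← sq_abs]; exact pow_le_pow_left₀ (abs_nonneg _) hWs 2
  have h2 : (b * t ^ 2 * (∑ i, ∑ j, |pd i (pd j v) y|)) ^ 2 ≤ n ^ 2 * (b ^ 2 * t ^ 4 * hsq v y) := by
    calc (b * t ^ 2 * (∑ i, ∑ j, |pd i (pd j v) y|)) ^ 2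
        = b ^ 2 * t ^ 4 * (∑ i, ∑ j, |pd i (pd j v) y|) ^ 2 := by ring
      _ ≤ b ^ 2 * t ^ 4 * (n ^ 2 * hsq v y) := by gcongr
      _ = _ := by ring
  have h3 : (n ^ 2 * (C1 * (δ * t * s))) ^ 2 =
      (n ^ 2 * C1) ^ 2 * (δ ^ 2 * t ^ 2 * enr τ v y) := by rw [← hs2]; ring
  have h4 := add_sq_le (a := t ^ 2 * conjOp a φ τ v y) (b := ∑ i, ∑ j, W i j)
  have h5 := add_sq_le (a := b * t ^ 2 * (∑ i, ∑ j, |pd i (pd j v) y|))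
    (b := n ^ 2 * (C1 * (δ * t * s)))
  rw [h3] at h5
  linarith

/-- The conjugate of a rescaled function with a linear weight. -/
theorem heatOp_rescaled {T : Sp n →L[ℝ] Sp n} {A : Fin n → Fin n → ℝ}
    (hT : ∀ i j, ∑ k, T (EuclideanSpace.single k 1) i * T (EuclideanSpace.single k 1) j = A i j)
    {v : Sp n → ℝ} (hv : ContDiff ℝ 2 v) (N : Fin n → ℝ) (τ : ℝ) (x z : Sp n) :
    heatOp T (conjW (fun z => -∑ l, N l * z l) 1 fun z => v (x + τ⁻¹ • z)) z =
      Real.exp (-∑ l, N l * z l) * frozenOp A N τ v (x + τ⁻¹ • z) := by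
  set ℓ : Sp n → ℝ := fun z => -∑ l, N l * z l with hℓ
  set V : Sp n → ℝ := fun z => v (x + τ⁻¹ • z) with hV
  have hℓc : ContDiff ℝ 2 ℓ := by rw [hℓ]; fun_prop
  have hVc : ContDiff ℝ 2 V := hv.comp (by fun_prop)
  have hpℓ : ∀ i, pd i ℓ = fun _ => -N i := fun i => by
    ext y
    have h1 : HasFDerivAt ℓ (-∑ l, N l • EuclideanSpace.proj (𝕜 := ℝ) l) y := by
      refine HasFDerivAt.neg (HasFDerivAt.fun_sum fun l _ => ?_)
      exact ((EuclideanSpace.proj (𝕜 := ℝ) l).hasFDerivAt).const_mul (N l)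
    unfold pd
    rw [h1.fderiv]
    simp
  have hpV : ∀ i, pd i V = fun z => τ⁻¹ * pd i v (x + τ⁻¹ • z) := fun i =>
    funext fun z => pd_comp_affine (hv.differentiable (by simp)) x τ⁻¹ i z
  have hppV : ∀ i j, pd i (pd j V) z = τ⁻¹ ^ 2 * pd i (pd j v) (x + τ⁻¹ • z) := fun i j => by
    have hd := (contDiff_one_pd hv j).differentiable (by simp)
    have hc : DifferentiableAt ℝ (fun z => pd j v (x + τ⁻¹ • z)) z :=
      (hd.comp (by fun_prop : Differentiable ℝ fun z : Sp n => x + τ⁻¹ • z)) z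
    rw [hpV, pd_const_mul _ hc, pd_comp_affine hd]
    ring
  rw [heatOp_eq hT (contDiff_conjW hℓc hVc)]
  unfold frozenOp
  rw [Finset.mul_sum]
  refine Finset.sum_congr rfl fun i _ => ?_
  rw [Finset.mul_sum]
  refine Finset.sum_congr rfl fun j _ => ?_
  rw [pd_pd_conjW hℓc hVc, hppV, hpV, hpV, hpℓ, hpℓ, pd_const]
  simp only [hℓ, hV, one_mul]
  ring

end Carleman

namespace Carleman

variable {n : ℕ} {g : Sp n → Matrix (Fin n) (Fin n) ℝ} {lam Lam c₀ : ℝ} {Ω : Set (Sp n)}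
  {φ φ' u : Sp n → ℝ}

/-! ### The region where the complement of `Ω` has positive density -/

theorem CC.comp_affine {Ψ : Sp n → ℝ} (h : CC Ψ) (x : Sp n) {t : ℝ} (ht : t ≠ 0) :
    CC fun z => Ψ (x + t • z) :=
  ⟨h.1.comp (by fun_prop), h.2.comp_homeomorph
    ((Homeomorph.smulOfNeZero t ht).trans (Homeomorph.addLeft x))⟩

/-- The mollifier is bounded by `B`, so a weighted proportion `θ` requires a set of volume at least
`θ / B`. -/
theorem ofReal_le_volume_compl (hΩ : IsOpen Ω) {η : Sp n → ℝ} (hη : IsMollifier η) {B θ ε : ℝ}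
    (hB : 0 < B) (hηB : ∀ z, η z ≤ B) {y : Sp n} (hy : θ ≤ hole η Ω ε y) :
    ENNReal.ofReal (θ / B) ≤ volume {z ∈ Metric.closedBall (0 : Sp n) 1 | y - ε • z ∉ Ω} := by
  set E := {z ∈ Metric.closedBall (0 : Sp n) 1 | y - ε • z ∉ Ω} with hE
  have hEm : MeasurableSet E := by
    refine Metric.isClosed_closedBall.measurableSet.inter ?_
    exact (hΩ.preimage (by fun_prop : Continuous fun z : Sp n => y - ε • z)).measurableSet.compl
  have hEf : volume E ≠ ⊤ :=
    ((measure_mono fun z hz => hz.1).trans_lt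
      (isCompact_closedBall (0 : Sp n) 1).measure_lt_top).ne
  have hle : hole η Ω ε y ≤ ∫ z, E.indicator (fun _ => B) z := by
    unfold hole moll
    refine integral_mono_of_nonneg (Filter.Eventually.of_forall fun z => mul_nonneg (hη.nonneg z)
      (Set.indicator_nonneg (fun _ _ => zero_le_one) _))
      ((integrable_indicator_iff hEm).2 (integrableOn_const hEf))
      (Filter.Eventually.of_forall fun z => ?_)
    by_cases hz : z ∈ E
    · have h2 : y - ε • z ∉ Ω := hz.2
      simpa [hz, h2] using hηB z
    · rw [Set.indicator_of_notMem hz]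
      by_cases hzΩ : y - ε • z ∈ Ω
      · simp [hzΩ]
      · have : 1 < ‖z‖ := by
          by_contra hc
          exact hz ⟨by simpa using hc, hzΩ⟩
        simp [hη.support z this]
  rw [integral_indicator hEm, setIntegral_const, smul_eq_mul] at hle
  refine ENNReal.ofReal_le_of_le_toReal ?_
  rw [div_le_iff₀ hB]
  exact hy.trans hle

open scoped Pointwise in
theorem volume_le_of_image_subset {E F : Set (Sp n)} {κ : ℝ} (hκ : 1 ≤ κ) (p : Sp n)
    (h : ∀ z ∈ E, p - κ • z ∈ F) : volume E ≤ volume F := by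
  rw [← measure_preimage_add volume p F]
  have hsub : (-κ) • E ⊆ (fun z => p + z) ⁻¹' F := by
    rintro _ ⟨z, hz, rfl⟩
    have := h z hz
    simpa [sub_eq_add_neg] using this
  refine le_trans ?_ (measure_mono hsub)
  rw [Measure.addHaar_smul]
  refine le_mul_of_one_le_left (zero_le) ?_
  rw [ENNReal.one_le_ofReal, abs_pow, abs_neg, abs_of_nonneg (by linarith)]
  exact one_le_pow₀ hκ

theorem abs_sum_mul_coord_le {N : Fin n → ℝ} {R : ℝ} (hN : ∀ i, |N i| ≤ R) (z : Sp n) :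
    |∑ l, N l * z l| ≤ n * R * ‖z‖ := by
  refine (Finset.abs_sum_le_sum_abs _ _).trans ((Finset.sum_le_sum (g := fun _ => R * ‖z‖)
    fun l _ => ?_).trans (le_of_eq ?_))
  · rw [abs_mul]
    exact mul_le_mul (hN l) (PiLp.norm_apply_le z l) (abs_nonneg _) ((abs_nonneg _).trans (hN l))
  · simp [mul_assoc]

/-- This explains the rate `2 n R + 3`: `2 n R` pays for the square of the linear exponential, `2`
for the polynomial growth of the freezing error, and `1` is left for integrability. -/
theorem exp_mul_exp_le {N : Fin n → ℝ} {R : ℝ} (hN : ∀ i, |N i| ≤ R) (z : Sp n) :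
    Real.exp (-(2 * n * R + 3) * ‖z‖) * Real.exp (-∑ l, N l * z l) ^ 2 * (1 + ‖z‖) ^ 2 ≤
      Real.exp (-‖z‖) := by
  have h1 := (abs_le.1 (abs_sum_mul_coord_le hN z)).1
  have h2 : (1 + ‖z‖) ^ 2 ≤ Real.exp (2 * ‖z‖) := by
    have h3 : 1 + ‖z‖ ≤ Real.exp ‖z‖ := by linarith [Real.add_one_le_exp ‖z‖]
    calc (1 + ‖z‖) ^ 2 ≤ Real.exp ‖z‖ ^ 2 := pow_le_pow_left₀ (by positivity) h3 2
      _ = _ := by rw [← Real.exp_nat_mul]; norm_num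
  calc _ ≤ Real.exp (-(2 * n * R + 3) * ‖z‖) * Real.exp (-∑ l, N l * z l) ^ 2
        * Real.exp (2 * ‖z‖) := by gcongr
    _ = Real.exp (-(2 * n * R + 3) * ‖z‖ + 2 * (-∑ l, N l * z l) + 2 * ‖z‖) := by
        rw [Real.exp_add, Real.exp_add, ← Real.exp_nat_mul]; norm_num
    _ ≤ _ := Real.exp_le_exp.2 (by linarith)

theorem frozenOp_eq_zero (A : Fin n → Fin n → ℝ) (N : Fin n → ℝ) (τ : ℝ) {v : Sp n → ℝ} {y : Sp n}
    (hy : y ∉ tsupport v) : frozenOp A N τ v y = 0 := by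
  unfold frozenOp
  refine Finset.sum_eq_zero fun i _ => Finset.sum_eq_zero fun j _ => ?_
  rw [pd_eq_zero_of_notMem_tsupport fun h => hy (tsupport_pd_subset j v h),
    pd_eq_zero_of_notMem_tsupport hy, pd_eq_zero_of_notMem_tsupport hy,
    image_eq_zero_of_notMem_tsupport hy]
  simp

theorem Setting.smoothCoeff_lip (S : Setting g lam Lam Ω φ c₀) {η : Sp n → ℝ}
    (hη : IsMollifier η) (ε : ℝ) (i j : Fin n) (x y : Sp n) :
    |smoothCoeff η g ε i j x - smoothCoeff η g ε i j y| ≤ lam ^ 2 * Lam * ‖x - y‖ := by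
  have := abs_moll_sub_le hη.cc (S.ginv_meas i j) (S.abs_ginv i j) (S.ginv_lip i j) ε x y
  rwa [hη.integral_abs, mul_one] at this

/-- The density that controls the conjugated function near a hole of `Ω`. -/
def holeDens (δ C σ τ : ℝ) (a : Fin n → Fin n → Sp n → ℝ) (φ v : Sp n → ℝ) (y : Sp n) : ℝ :=
  δ * v y ^ 2 + C * ((τ⁻¹ ^ 2 * conjOp a φ τ v y) ^ 2 + τ⁻¹ ^ 6 * hsq v y
    + σ ^ 2 * τ⁻¹ ^ 2 * enr τ v y)

theorem holeDens_nonneg {δ C : ℝ} (hδ : 0 ≤ δ) (hC : 0 ≤ C) (σ : ℝ) {τ : ℝ} (hτ : 0 < τ)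
    (a : Fin n → Fin n → Sp n → ℝ) (φ v : Sp n → ℝ) (y : Sp n) :
    0 ≤ holeDens δ C σ τ a φ v y := by
  have := hsq_nonneg v y
  have := enr_nonneg τ v y
  unfold holeDens
  positivity

theorem lin_three_le {p q r X Y Z : ℝ} (hp : 0 ≤ p) (hq : 0 ≤ q) (hr : 0 ≤ r) (hX : 0 ≤ X)
    (hY : 0 ≤ Y) (hZ : 0 ≤ Z) : p * X + q * Y + r * Z ≤ (p + q + r) * (X + Y + Z) := by
  have : (p + q + r) * (X + Y + Z) - (p * X + q * Y + r * Z) =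
      p * (Y + Z) + q * (X + Z) + r * (X + Y) := by ring
  have : 0 ≤ p * (Y + Z) + q * (X + Z) + r * (X + Y) := by positivity
  linarith

/-- The point `x + τ⁻¹ z` is at distance at most `τ⁻¹ (1 + ‖z‖)` from the freezing point, so the
freezing errors grow linearly in `z`. The constant `C` precedes `δ'` and `C'`, so the modulus of
`∇φ` may be chosen afterwards, depending on `C`. -/
theorem frozenOp_sq_le_dens (S : Setting g lam Lam Ω φ c₀) {η : Sp n → ℝ} (hη : IsMollifier η)
    {R : ℝ} (hR0 : 0 ≤ R) (hR : ∀ x ∈ Ω, ∀ i, |pd i φ x| ≤ R)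
    (hH : ∀ x ∈ Ω, ∀ i j, |pd i (pd j φ) x| ≤ R) :
    ∃ C, 0 ≤ C ∧ ∀ δ' C', 0 ≤ δ' → 0 ≤ C' →
      (∀ x ∈ Ω, ∀ y ∈ Ω, ∀ i, |pd i φ x - pd i φ y| ≤ δ' + C' * ‖x - y‖) →
      ∀ φ' u, Adapted Ω φ φ' u → ∀ τ, 0 < τ → ∀ ε, 0 < ε → ∀ y₀ ∈ Ω, ∀ x, ‖y₀ - x‖ ≤ τ⁻¹ → ∀ z,
        frozenOp (fun i j => smoothCoeff η g ε i j y₀) (fun i => pd i φ y₀) τ (conjW φ' τ u)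
          (x + τ⁻¹ • z) ^ 2 ≤ (1 + ‖z‖) ^ 2 * (C *
          ((τ⁻¹ ^ 2 * conjOp (smoothCoeff η g ε) φ' τ (conjW φ' τ u) (x + τ⁻¹ • z)) ^ 2
            + τ⁻¹ ^ 6 * hsq (conjW φ' τ u) (x + τ⁻¹ • z)
            + (δ' + (1 + C') * τ⁻¹) ^ 2 * τ⁻¹ ^ 2 * enr τ (conjW φ' τ u) (x + τ⁻¹ • z))) := by
  set L := lam ^ 2 * Lam with hL
  have hL0 : 0 ≤ L := S.lip_nonneg
  set D : ℝ := n ^ 2 * (L + 2 * R + 2 * lam + R ^ 2 + 2 * lam * R + L * R + lam * R) with hD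
  refine ⟨2 + 4 * n ^ 2 * L ^ 2 + 4 * D ^ 2 * (1 + L) ^ 2, by positivity, ?_⟩
  intro δ' C' hδ' hC' hmod φ' u A τ hτ ε hε y₀ hy₀ x hx z
  set t := τ⁻¹ with ht
  have ht0 : 0 < t := inv_pos.2 hτ
  set v := conjW φ' τ u with hv
  set y := x + t • z with hy
  have hz0 := norm_nonneg z
  have hhs := hsq_nonneg v y
  have hen := enr_nonneg τ v y
  by_cases hyu : y ∈ tsupport u
  · have hyΩ := A.mem hyu
    have hdist : ‖y₀ - y‖ ≤ t * (1 + ‖z‖) := by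
      have : y₀ - y = (y₀ - x) - t • z := by rw [hy]; abel
      rw [this]
      refine (norm_sub_le _ _).trans ?_
      rw [norm_smul, Real.norm_of_nonneg ht0.le]
      linarith
    have hb0 : 0 ≤ L * (t * (1 + ‖z‖)) := by positivity
    have hm0 : 0 ≤ δ' + C' * (t * (1 + ‖z‖)) := by positivity
    have key := frozenOp_sq_le S.lam_pos.le hL0 hR0 (S.isCoeff hη hε.ne') A.contDiff
      (A.contDiff_v τ) hτ (y := y) (fun i => by rw [A.pd_eq hyu]; exact hR y hyΩ i)
      (fun i k => by rw [A.pd_pd_eq hyu]; exact hH y hyΩ i k)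
      (A := fun i j => smoothCoeff η g ε i j y₀) (N := fun i => pd i φ y₀)
      (b := L * (t * (1 + ‖z‖))) (m := δ' + C' * (t * (1 + ‖z‖)))
      (fun i j => (S.smoothCoeff_lip hη ε i j y₀ y).trans (by gcongr)) (hR y₀ hy₀)
      (fun i => by rw [A.pd_eq hyu]; exact (hmod y₀ hy₀ y hyΩ i).trans (by gcongr)) hb0 hm0
    refine key.trans ?_
    rw [← hD, ← hv, ← ht]
    set X := (t ^ 2 * conjOp (smoothCoeff η g ε) φ' τ v y) ^ 2 with hX
    have hX0 : 0 ≤ X := sq_nonneg _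
    set σ := δ' + (1 + C') * t with hσ
    have hσ0 : 0 ≤ σ := by positivity
    have h1 : (1 : ℝ) ≤ (1 + ‖z‖) ^ 2 := one_le_pow₀ (by linarith)
    have h2 : t + L * (t * (1 + ‖z‖)) + (δ' + C' * (t * (1 + ‖z‖))) ≤
        (1 + ‖z‖) * ((1 + L) * σ) := by
      have e : (1 + ‖z‖) * ((1 + L) * σ) - (t + L * (t * (1 + ‖z‖))
          + (δ' + C' * (t * (1 + ‖z‖)))) = t * ‖z‖ + δ' * ‖z‖
          + (1 + ‖z‖) * (L * (δ' + C' * t)) := by rw [hσ]; ring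
      have : 0 ≤ t * ‖z‖ + δ' * ‖z‖ + (1 + ‖z‖) * (L * (δ' + C' * t)) := by positivity
      linarith
    have h3 : (t + L * (t * (1 + ‖z‖)) + (δ' + C' * (t * (1 + ‖z‖)))) ^ 2 ≤
        ((1 + ‖z‖) * ((1 + L) * σ)) ^ 2 := pow_le_pow_left₀ (by positivity) h2 2
    calc _ ≤ 2 * ((1 + ‖z‖) ^ 2 * X) + 4 * n ^ 2 * ((L * (t * (1 + ‖z‖))) ^ 2 * t ^ 4 * hsq v y)
          + 4 * D ^ 2 * (((1 + ‖z‖) * ((1 + L) * σ)) ^ 2 * t ^ 2 * enr τ v y) := by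
          gcongr
          exact le_mul_of_one_le_left hX0 h1
      _ = (1 + ‖z‖) ^ 2 * (2 * X + 4 * n ^ 2 * L ^ 2 * (t ^ 6 * hsq v y)
          + 4 * D ^ 2 * (1 + L) ^ 2 * (σ ^ 2 * t ^ 2 * enr τ v y)) := by ring
      _ ≤ _ := by
          refine mul_le_mul_of_nonneg_left ?_ (by positivity)
          have q1 : 0 ≤ t ^ 6 * hsq v y := by positivity
          have q2 : 0 ≤ σ ^ 2 * t ^ 2 * enr τ v y := by positivity
          exact lin_three_le two_pos.le (by positivity) (by positivity) hX0 q1 q2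
  · rw [frozenOp_eq_zero _ _ _ (by rw [hv, tsupport_conjW]; exact hyu)]
    have : (0 : ℝ) ^ 2 = 0 := by norm_num
    rw [this]
    positivity

end Carleman

namespace Carleman

variable {n : ℕ} {g : Sp n → Matrix (Fin n) (Fin n) ℝ} {lam Lam c₀ : ℝ} {Ω : Set (Sp n)}
  {φ φ' u : Sp n → ℝ}

theorem cc_holeDens {a : Fin n → Fin n → Sp n → ℝ} (ha : ∀ i j, ContDiff ℝ 1 (a i j))
    {φ v : Sp n → ℝ} (hφ : ContDiff ℝ 2 φ) (hv : ContDiff ℝ 2 v) (hc : HasCompactSupport v)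
    (δ C σ τ : ℝ) : CC (holeDens δ C σ τ a φ v) := by
  have hv0 : CC v := ⟨hv.continuous, hc⟩
  have h1 : CC fun y => v y ^ 2 := hv0.sq
  have h2 : CC fun y => (τ⁻¹ ^ 2 * conjOp a φ τ v y) ^ 2 :=
    ((cc_conjOp ha hφ hv hc).mul_left continuous_const).sq
  exact (h1.mul_left continuous_const).add (((h2.add
    ((cc_hsq hv hc).mul_left continuous_const)).add
    ((cc_enr hv hc).mul_left continuous_const)).mul_left continuous_const)

/-- The unique continuation estimate at the scale `τ⁻¹` near a hole of `Ω`. -/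
theorem Setting.local_hole_estimate (S : Setting g lam Lam Ω φ c₀) {η : Sp n → ℝ}
    (hη : IsMollifier η) {R : ℝ} (hR0 : 0 ≤ R) (hR : ∀ x ∈ Ω, ∀ i, |pd i φ x| ≤ R)
    (hH : ∀ x ∈ Ω, ∀ i j, |pd i (pd j φ) x| ≤ R) {κ θ δ : ℝ} (hκ : 1 ≤ κ) (hθ : 0 < θ)
    (hδ : 0 < δ) :
    ∃ C, 0 ≤ C ∧ ∀ δ' C', 0 ≤ δ' → 0 ≤ C' →
      (∀ x ∈ Ω, ∀ y ∈ Ω, ∀ i, |pd i φ x - pd i φ y| ≤ δ' + C' * ‖x - y‖) →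
      ∀ φ' u, Adapted Ω φ φ' u → ∀ τ, 0 < τ → ∀ x : Sp n,
        ∫ z in Metric.closedBall (0 : Sp n) 1, max (hole η Ω (κ / τ) (x + τ⁻¹ • z) - θ) 0
            * conjW φ' τ u (x + τ⁻¹ • z) ^ 2 ≤
          ∫ z, Real.exp (-‖z‖) * holeDens δ C (δ' + (1 + C') * τ⁻¹) τ
            (smoothCoeff η g (κ / τ)) φ' (conjW φ' τ u) (x + τ⁻¹ • z) := by
  obtain ⟨B, -, hB⟩ := hη.cc.exists_bound
  have hB1 : 0 < max B 1 := lt_max_of_lt_right one_pos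
  have hηB : ∀ z, η z ≤ max B 1 := fun z => ((le_abs_self _).trans (hB z)).trans (le_max_left _ _)
  obtain ⟨C₁, hC₁, h₁⟩ := frozenOp_sq_le_dens S hη hR0 hR hH
  set E := Real.exp (2 * (n * R)) with hE
  have hE0 : 0 < E := Real.exp_pos _
  -- `δ / E` because passing from `v` to `U` on the unit ball costs the factor `E`. The radius `κ +
  -- 1` contains the zero set seen from a point of the unit ball.
  obtain ⟨C₀, hC₀, h₀⟩ := continuation_estimate n (α := n * lam + lam) (K := κ + 1)
    (θ := θ / max B 1) (M := 2 * n * R + 3) (δ := δ / E) (by linarith) (by positivity)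
    (by positivity) (by positivity)
  refine ⟨E * C₀ * C₁, by positivity, fun δ' C' hδ' hC' hmod φ' u A τ hτ x => ?_⟩
  set t := τ⁻¹ with ht
  have ht0 : 0 < t := inv_pos.2 hτ
  set v := conjW φ' τ u with hv
  set σ := δ' + (1 + C') * t with hσ
  have hε : 0 < κ / τ := by positivity
  have hcf := S.isCoeff hη hε.ne'
  set a := smoothCoeff η g (κ / τ) with ha
  have hvC : ContDiff ℝ 2 v := A.contDiff_v τ
  have hvc : HasCompactSupport v := A.compact_v τ
  have hv0 : CC v := ⟨hvC.continuous, hvc⟩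
  have hC : 0 ≤ E * C₀ * C₁ := by positivity
  have hΨ0 : ∀ y, 0 ≤ holeDens δ (E * C₀ * C₁) σ τ a φ' v y :=
    holeDens_nonneg hδ.le hC σ hτ a φ' v
  -- If no point of the ball has both a large hole and `v ≠ 0`, the left side vanishes. Otherwise
  -- the coefficients are frozen at such a point, which lies in `Ω`, where `∇φ` is controlled.
  by_cases hex : ∃ z₀ ∈ Metric.closedBall (0 : Sp n) 1, θ ≤ hole η Ω (κ / τ) (x + t • z₀) ∧
      v (x + t • z₀) ≠ 0
  swap
  · have hz : ∀ z ∈ Metric.closedBall (0 : Sp n) 1,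
        max (hole η Ω (κ / τ) (x + t • z) - θ) 0 * v (x + t • z) ^ 2 = 0 := fun z hz => by
      by_cases h1 : θ ≤ hole η Ω (κ / τ) (x + t • z)
      · have h2 : v (x + t • z) = 0 := by
          by_contra h2
          exact hex ⟨z, hz, h1, h2⟩
        rw [h2]; ring
      · rw [max_eq_right (by linarith), zero_mul]
    rw [setIntegral_congr_fun Metric.isClosed_closedBall.measurableSet hz]
    simp only [integral_zero]
    exact integral_nonneg fun z => mul_nonneg (Real.exp_pos _).le (hΨ0 _)
  obtain ⟨z₀, hz₀, hθ₀, hvz⟩ := hex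
  set y₀ := x + t • z₀ with hy₀
  have hz₀' : ‖z₀‖ ≤ 1 := by simpa using hz₀
  have hy₀Ω : y₀ ∈ Ω := A.mem (by
    rw [← tsupport_conjW (φ := φ') (τ := τ)]
    exact subset_tsupport _ hvz)
  have hy₀x : ‖y₀ - x‖ ≤ t := by
    rw [hy₀, add_sub_cancel_left, norm_smul, Real.norm_of_nonneg ht0.le]
    nlinarith
  set N : Fin n → ℝ := fun i => pd i φ y₀ with hN
  obtain ⟨T, T', hT, hT', hTT, hTa⟩ := exists_sqrt_coeff S.one_le (a := fun i j => a i j y₀)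
    (fun i j => hcf.symm i j y₀) (fun i j => hcf.bound i j y₀) (fun ξ => hcf.elliptic y₀ ξ)
  -- The linear exponential undoes the conjugation to leading order: on `U` the frozen operator is a
  -- pure second-order operator with constant coefficients.
  set U : Sp n → ℝ := conjW (fun z => -∑ l, N l * z l) 1 (fun z => v (x + t • z)) with hU
  have hUe : ∀ z, U z = Real.exp (-∑ l, N l * z l) * v (x + t • z) := fun z => by
    rw [hU]; unfold conjW; rw [one_mul]
  have hℓ : ContDiff ℝ 2 fun z : Sp n => -∑ l, N l * z l := by fun_prop
  have hVC : ContDiff ℝ 2 fun z => v (x + t • z) := hvC.comp (by fun_prop)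
  have hUC : ContDiff ℝ 2 U := contDiff_conjW hℓ hVC
  have hUc : HasCompactSupport U := hasCompactSupport_conjW (hv0.comp_affine x ht0.ne').2
  have hUcc : CC U := ⟨hUC.continuous, hUc⟩
  have hNR : ∀ i, |N i| ≤ R := hR y₀ hy₀Ω
  -- A point `y₀ - (κ / τ) z` outside `Ω` corresponds to `z₀ - κ z` in rescaled coordinates. There
  -- `v`, hence `U`, vanishes, and dilation by `κ ≥ 1` does not decrease the measure.
  have hzero : ENNReal.ofReal (θ / max B 1) ≤
      volume {z ∈ Metric.closedBall (0 : Sp n) (κ + 1) | U z = 0} := by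
    refine (ofReal_le_volume_compl S.isOpen hη hB1 hηB hθ₀).trans
      (volume_le_of_image_subset hκ z₀ fun z hz => ⟨?_, ?_⟩)
    · have hz1 : ‖z‖ ≤ 1 := by simpa using hz.1
      rw [mem_closedBall_zero_iff]
      refine (norm_sub_le _ _).trans ?_
      rw [norm_smul, Real.norm_of_nonneg (by linarith)]
      nlinarith
    · have e : x + t • (z₀ - κ • z) = y₀ - (κ / τ) • z := by
        rw [hy₀, smul_sub, smul_smul, ht, div_eq_inv_mul]; abel
      rw [hUe, e]
      have h2 : y₀ - (κ / τ) • z ∉ tsupport v := fun hm => hz.2 (A.mem (by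
        rwa [hv, tsupport_conjW] at hm))
      rw [image_eq_zero_of_notMem_tsupport h2, mul_zero]
  have key := h₀ T T' hT hT' hTT U hUC hUc hzero
  have hleft : ∫ z in Metric.closedBall (0 : Sp n) 1, max (hole η Ω (κ / τ) (x + t • z) - θ) 0
      * v (x + t • z) ^ 2 ≤ E * ∫ z in Metric.closedBall (0 : Sp n) 1, U z ^ 2 := by
    rw [← integral_const_mul]
    refine integral_mono_of_nonneg (Filter.Eventually.of_forall fun z => by positivity)
      (hUcc.sq.integrable.const_mul E).integrableOn
      ((ae_restrict_iff' Metric.isClosed_closedBall.measurableSet).2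
        (Filter.Eventually.of_forall fun z hz => ?_))
    have hz1 : ‖z‖ ≤ 1 := by simpa using hz
    have hm : max (hole η Ω (κ / τ) (x + t • z) - θ) 0 ≤ 1 :=
      max_le (by linarith [hole_le_one (Ω := Ω) hη (κ / τ) (x + t • z)]) zero_le_one
    have hNz := (abs_le.1 (abs_sum_mul_coord_le hNR z)).2
    have h1 : (1 : ℝ) ≤ E * Real.exp (-∑ l, N l * z l) ^ 2 := by
      rw [← Real.exp_nat_mul, hE, ← Real.exp_add]
      refine Real.one_le_exp ?_
      have : n * R * ‖z‖ ≤ n * R := mul_le_of_le_one_right (by positivity) hz1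
      push_cast
      linarith
    calc max (hole η Ω (κ / τ) (x + t • z) - θ) 0 * v (x + t • z) ^ 2
        ≤ 1 * v (x + t • z) ^ 2 := by gcongr
      _ ≤ E * Real.exp (-∑ l, N l * z l) ^ 2 * v (x + t • z) ^ 2 := by gcongr
      _ = E * U z ^ 2 := by rw [hUe]; ring
  have hcv : CC fun z => Real.exp (-‖z‖) * v (x + t • z) ^ 2 :=
    (hv0.sq.comp_affine x ht0.ne').mul_left (by fun_prop)
  set Φ : Sp n → ℝ := fun y => (t ^ 2 * conjOp a φ' τ v y) ^ 2 + t ^ 6 * hsq v y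
    + σ ^ 2 * t ^ 2 * enr τ v y with hΦ
  have hΦc : CC Φ := by
    have h2 : CC fun y => (t ^ 2 * conjOp a φ' τ v y) ^ 2 :=
      ((cc_conjOp (fun i j => hcf.contDiff 1 i j) A.contDiff hvC hvc).mul_left
        continuous_const).sq
    exact (h2.add ((cc_hsq hvC hvc).mul_left continuous_const)).add
      ((cc_enr hvC hvc).mul_left continuous_const)
  have hcΦ : CC fun z => Real.exp (-‖z‖) * Φ (x + t • z) :=
    (hΦc.comp_affine x ht0.ne').mul_left (by fun_prop)
  have hr1 : ∫ z, Real.exp (-(2 * n * R + 3) * ‖z‖) * U z ^ 2 ≤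
      ∫ z, Real.exp (-‖z‖) * v (x + t • z) ^ 2 := by
    refine integral_mono_of_nonneg (Filter.Eventually.of_forall fun z => by positivity)
      hcv.integrable (Filter.Eventually.of_forall fun z => ?_)
    have h1 := exp_mul_exp_le hNR z
    have h2 : (1 : ℝ) ≤ (1 + ‖z‖) ^ 2 := one_le_pow₀ (by linarith [norm_nonneg z])
    have h3 : Real.exp (-(2 * n * R + 3) * ‖z‖) * Real.exp (-∑ l, N l * z l) ^ 2 ≤
        Real.exp (-‖z‖) := (le_mul_of_one_le_right (by positivity) h2).trans h1
    have e : Real.exp (-(2 * n * R + 3) * ‖z‖) * U z ^ 2 =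
        Real.exp (-(2 * n * R + 3) * ‖z‖) * Real.exp (-∑ l, N l * z l) ^ 2
          * v (x + t • z) ^ 2 := by rw [hUe]; ring
    show Real.exp (-(2 * n * R + 3) * ‖z‖) * U z ^ 2 ≤ Real.exp (-‖z‖) * v (x + t • z) ^ 2
    rw [e]
    gcongr
  have hr2 : ∫ z, Real.exp (-(2 * n * R + 3) * ‖z‖) * heatOp T U z ^ 2 ≤
      C₁ * ∫ z, Real.exp (-‖z‖) * Φ (x + t • z) := by
    rw [← integral_const_mul]
    refine integral_mono_of_nonneg (Filter.Eventually.of_forall fun z => by positivity)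
      (hcΦ.integrable.const_mul C₁) (Filter.Eventually.of_forall fun z => ?_)
    have h1 := exp_mul_exp_le hNR z
    have h2 := h₁ δ' C' hδ' hC' hmod φ' u A τ hτ (κ / τ) hε y₀ hy₀Ω x hy₀x z
    have e : heatOp T U z = _ := heatOp_rescaled hTa hvC N τ x z
    have hΦn : 0 ≤ Φ (x + t • z) := by
      have := hsq_nonneg v (x + t • z)
      have := enr_nonneg τ v (x + t • z)
      simp only [hΦ]; positivity
    show Real.exp (-(2 * n * R + 3) * ‖z‖) * heatOp T U z ^ 2 ≤
      C₁ * (Real.exp (-‖z‖) * Φ (x + t • z))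
    rw [e, mul_pow, ← mul_assoc]
    calc _ ≤ Real.exp (-(2 * n * R + 3) * ‖z‖) * Real.exp (-∑ l, N l * z l) ^ 2
          * ((1 + ‖z‖) ^ 2 * (C₁ * Φ (x + t • z))) := by gcongr
      _ = Real.exp (-(2 * n * R + 3) * ‖z‖) * Real.exp (-∑ l, N l * z l) ^ 2 * (1 + ‖z‖) ^ 2
          * (C₁ * Φ (x + t • z)) := by ring
      _ ≤ Real.exp (-‖z‖) * (C₁ * Φ (x + t • z)) := by gcongr
      _ = _ := by ring
  have hright : ∫ z, Real.exp (-‖z‖) * holeDens δ (E * C₀ * C₁) σ τ a φ' v (x + t • z) =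
      δ * (∫ z, Real.exp (-‖z‖) * v (x + t • z) ^ 2)
        + E * C₀ * C₁ * ∫ z, Real.exp (-‖z‖) * Φ (x + t • z) := by
    rw [← integral_const_mul, ← integral_const_mul,
      ← integral_add (hcv.integrable.const_mul _) (hcΦ.integrable.const_mul _)]
    refine integral_congr_ae (Filter.Eventually.of_forall fun z => ?_)
    simp only [holeDens, hΦ]
    ring
  rw [hright]
  refine hleft.trans ((mul_le_mul_of_nonneg_left key hE0.le).trans ?_)
  calc E * (δ / E * (∫ z, Real.exp (-(2 * n * R + 3) * ‖z‖) * U z ^ 2)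
        + C₀ * ∫ z, Real.exp (-(2 * n * R + 3) * ‖z‖) * heatOp T U z ^ 2)
      ≤ E * (δ / E * (∫ z, Real.exp (-‖z‖) * v (x + t • z) ^ 2)
        + C₀ * (C₁ * ∫ z, Real.exp (-‖z‖) * Φ (x + t • z))) := by gcongr
    _ = _ := by field_simp

end Carleman

namespace Carleman

/-! ### Summation of the local estimates -/

variable {n : ℕ} {g : Sp n → Matrix (Fin n) (Fin n) ℝ} {lam Lam c₀ : ℝ} {Ω : Set (Sp n)}
  {φ φ' u : Sp n → ℝ}

/-- Integration over all centres `x` replaces a covering argument: by Fubini and translation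
invariance each side becomes a constant times a plain integral. -/
theorem integral_le_of_translates {b Ψ : Sp n → ℝ} (hb : CC b) (hΨ : CC Ψ) (t : ℝ)
    (h : ∀ x, ∫ z in Metric.closedBall (0 : Sp n) 1, b (x + t • z) ≤
      ∫ z, Real.exp (-‖z‖) * Ψ (x + t • z)) :
    volume.real (Metric.closedBall (0 : Sp n) 1) * ∫ x, b x ≤
      (∫ z : Sp n, Real.exp (-‖z‖)) * ∫ x, Ψ x := by
  have hf : volume (Metric.closedBall (0 : Sp n) 1) ≠ ⊤ :=
    (isCompact_closedBall (0 : Sp n) 1).measure_lt_top.ne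
  have h1 : Integrable (fun _ : Sp n => (1 : ℝ))
      (volume.restrict (Metric.closedBall (0 : Sp n) 1)) := integrableOn_const hf
  have e1 := integral_integral_translate h1 hb t
  have e2 := integral_integral_translate integrable_exp_neg_norm hΨ t
  have i1 := (integrable_translate h1 hb t).integral_prod_left
  have i2 := (integrable_translate integrable_exp_neg_norm hΨ t).integral_prod_left
  have e3 : ∫ _ in Metric.closedBall (0 : Sp n) 1, (1 : ℝ) =
      volume.real (Metric.closedBall (0 : Sp n) 1) := by
    rw [setIntegral_const, smul_eq_mul, mul_one]
  rw [← e3, ← e1, ← e2]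
  refine integral_mono i1 i2 fun x => ?_
  simpa only [one_mul] using h x

theorem Setting.exists_modulus (S : Setting g lam Lam Ω φ c₀) {δ : ℝ} (hδ : 0 < δ) :
    ∃ C, 0 ≤ C ∧ ∀ x ∈ Ω, ∀ y ∈ Ω, ∀ i, |pd i φ x - pd i φ y| ≤ δ + C * ‖x - y‖ := by
  choose C hC h using fun i => (S.weight.2.2.1 i).modulus S.bounded hδ
  refine ⟨∑ i, C i, Finset.sum_nonneg fun i _ => hC i, fun x hx y hy i => (h i x hx y hy).trans ?_⟩
  gcongr
  exact Finset.single_le_sum (fun i _ => hC i) (Finset.mem_univ i)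

theorem integral_holeDens {a : Fin n → Fin n → Sp n → ℝ} (ha : ∀ i j, ContDiff ℝ 1 (a i j))
    {φ v : Sp n → ℝ} (hφ : ContDiff ℝ 2 φ) (hv : ContDiff ℝ 2 v) (hc : HasCompactSupport v)
    (δ C σ τ : ℝ) : ∫ x, holeDens δ C σ τ a φ v x = δ * (∫ x, v x ^ 2)
      + C * (τ⁻¹ ^ 4 * (∫ x, conjOp a φ τ v x ^ 2) + τ⁻¹ ^ 6 * (∫ x, hsq v x)
        + σ ^ 2 * τ⁻¹ ^ 2 * ∫ x, enr τ v x) := by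
  set t := τ⁻¹ with ht
  have hv0 : CC v := ⟨hv.continuous, hc⟩
  have e : ∀ x, holeDens δ C σ τ a φ v x = δ * v x ^ 2 + ((C * t ^ 4) * conjOp a φ τ v x ^ 2
      + (C * t ^ 6) * hsq v x + (C * (σ ^ 2 * t ^ 2)) * enr τ v x) := fun x => by
    unfold holeDens; ring
  simp only [e]
  have i1 := hv0.sq.integrable.const_mul δ
  have i2 := (cc_conjOp (τ := τ) ha hφ hv hc).sq.integrable.const_mul (C * t ^ 4)
  have i3 := (cc_hsq hv hc).integrable.const_mul (C * t ^ 6)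
  have i4 := (cc_enr (τ := τ) hv hc).integrable.const_mul (C * (σ ^ 2 * t ^ 2))
  have i23 : Integrable fun x => (C * t ^ 4) * conjOp a φ τ v x ^ 2 + (C * t ^ 6) * hsq v x :=
    i2.add i3
  have i234 : Integrable fun x => (C * t ^ 4) * conjOp a φ τ v x ^ 2 + (C * t ^ 6) * hsq v x
      + (C * (σ ^ 2 * t ^ 2)) * enr τ v x := i23.add i4
  rw [integral_add i1 i234, integral_add i23 i4, integral_add i2 i3,
    integral_const_mul, integral_const_mul, integral_const_mul, integral_const_mul]
  ring

/-- The allowed `δ` is split into four quarters: points with a small hole, the small term of the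
continuation estimate, the oscillation of `∇φ`, and the second derivatives from freezing the
coefficients. -/
theorem hole_arith {J C C₂ δ δ₁ σ t τ X Y Z H W : ℝ} (hJ0 : 0 ≤ J) (hC : 0 ≤ C) (hY0 : 0 ≤ Y)
    (htτ : t * τ = 1) (hZY : τ ^ 2 * Z ≤ Y)
    (hHt : τ ^ 2 * (t ^ 6 * H) ≤ C₂ * (t ^ 2 * X) + C₂ * (t ^ 2 * Y))
    (hW : W ≤ δ / 4 * Z + J * (δ₁ * Z + C * (t ^ 4 * X + t ^ 6 * H + σ ^ 2 * t ^ 2 * Y)))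
    (hδ : 0 ≤ δ) (hδ₁ : 0 ≤ δ₁)
    (c1 : J * δ₁ ≤ δ / 4) (c2 : J * C * σ ^ 2 ≤ δ / 4) (c3 : J * C * C₂ * t ^ 2 ≤ δ / 4) :
    τ ^ 2 * W ≤ δ * Y + J * C * (1 + C₂) * (t ^ 2 * X) := by
  have h1 : J * δ₁ * (τ ^ 2 * Z) ≤ δ / 4 * Y :=
    (mul_le_mul_of_nonneg_left hZY (by positivity)).trans (mul_le_mul_of_nonneg_right c1 hY0)
  have h2 : δ / 4 * (τ ^ 2 * Z) ≤ δ / 4 * Y := mul_le_mul_of_nonneg_left hZY (by positivity)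
  have h3 : J * C * (τ ^ 2 * (t ^ 6 * H)) ≤ J * C * (C₂ * (t ^ 2 * X) + C₂ * (t ^ 2 * Y)) :=
    mul_le_mul_of_nonneg_left hHt (by positivity)
  have h4 := mul_le_mul_of_nonneg_right c2 hY0
  have h5 := mul_le_mul_of_nonneg_right c3 hY0
  have h6 := mul_le_mul_of_nonneg_left hW (sq_nonneg τ)
  have e : τ ^ 2 * (δ / 4 * Z + J * (δ₁ * Z + C * (t ^ 4 * X + t ^ 6 * H + σ ^ 2 * t ^ 2 * Y))) =
      δ / 4 * (τ ^ 2 * Z) + J * δ₁ * (τ ^ 2 * Z) + J * C * ((t * τ) ^ 2 * (t ^ 2 * X))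
        + J * C * (τ ^ 2 * (t ^ 6 * H)) + J * C * σ ^ 2 * ((t * τ) ^ 2 * Y) := by ring
  rw [e, htτ, one_pow, one_mul, one_mul] at h6
  linarith

set_option maxHeartbeats 800000 in
/-- Near the points where the complement of `Ω` has positive density at the scale `τ⁻¹`, the
conjugated function is controlled by the conjugated operator and a small part of the energy. -/
theorem Setting.hole_estimate (S : Setting g lam Lam Ω φ c₀) {η : Sp n → ℝ} (hη : IsMollifier η)
    {κ : ℝ} (hκ : 1 ≤ κ) {δ : ℝ} (hδ : 0 < δ) :
    ∃ C τ₀ : ℝ, 0 ≤ C ∧ 1 ≤ τ₀ ∧ ∀ φ' u, Adapted Ω φ φ' u → ∀ τ, τ₀ ≤ τ →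
      τ ^ 2 * (∫ x, hole η Ω (κ / τ) x * conjW φ' τ u x ^ 2) ≤
        δ * (∫ x, enr τ (conjW φ' τ u) x) + C * (τ⁻¹ ^ 2 *
          ∫ x, conjOp (smoothCoeff η g (κ / τ)) φ' τ (conjW φ' τ u) x ^ 2) := by
  obtain ⟨R, -, hR0, -, hR, hH, -⟩ := S.exists_weight_bounds
  obtain ⟨C₂, hC₂, h₂⟩ := second_order_estimate (n := n) lam (lam ^ 2 * Lam) R S.one_le
  set V := volume.real (Metric.closedBall (0 : Sp n) 1) with hV
  have hV0 : 0 < V := ENNReal.toReal_pos (Metric.measure_closedBall_pos volume _ one_pos).ne'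
    (isCompact_closedBall (0 : Sp n) 1).measure_lt_top.ne
  set I := ∫ z : Sp n, Real.exp (-‖z‖) with hI
  have hI0 : 0 ≤ I := integral_nonneg fun _ => (Real.exp_pos _).le
  set J := I / V with hJ
  have hJ0 : 0 ≤ J := by positivity
  obtain ⟨C, hC, hloc⟩ := S.local_hole_estimate hη hR0 hR hH (κ := κ) (θ := δ / 4)
    (δ := δ / (4 * (J + 1))) hκ (by positivity) (by positivity)
  -- Order of choices: `C` depends on `δ` but not on the modulus of `∇φ`. So `ρ` may depend on `C`,
  -- the modulus is taken with `ρ / 2`, and large `τ` makes `σ ≤ ρ`.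
  set ρ := min 1 (δ / (4 * (J * C + 1))) with hρ
  have hρ0 : 0 < ρ := lt_min one_pos (by positivity)
  obtain ⟨C', hC', hmod⟩ := S.exists_modulus (half_pos hρ0)
  refine ⟨J * C * (1 + C₂), max (max 1 (2 * (1 + C') / ρ)) (4 * (J * C * C₂) / δ),
    by positivity, (le_max_left _ _).trans (le_max_left _ _), fun φ' u A τ hτ => ?_⟩
  have hτ1 : 1 ≤ τ := ((le_max_left _ _).trans (le_max_left _ _)).trans hτ
  have hτ2 : 2 * (1 + C') / ρ ≤ τ := ((le_max_right _ _).trans (le_max_left _ _)).trans hτ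
  have hτ3 : 4 * (J * C * C₂) / δ ≤ τ := (le_max_right _ _).trans hτ
  have hτ0 : 0 < τ := by linarith
  have hε : 0 < κ / τ := by positivity
  have hcf := S.isCoeff hη hε.ne'
  set t := τ⁻¹ with ht
  have ht0 : 0 < t := inv_pos.2 hτ0
  have ht1 : t ≤ 1 := inv_le_one_of_one_le₀ hτ1
  have htτ : t * τ = 1 := inv_mul_cancel₀ hτ0.ne'
  set v := conjW φ' τ u with hv
  set a := smoothCoeff η g (κ / τ) with ha
  have hvC : ContDiff ℝ 2 v := A.contDiff_v τ
  have hvc : HasCompactSupport v := A.compact_v τ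
  have hv0 : CC v := ⟨hvC.continuous, hvc⟩
  set σ := ρ / 2 + (1 + C') * t with hσ
  have hσ0 : 0 ≤ σ := by positivity
  have hσρ : σ ≤ ρ := by
    rw [div_le_iff₀ hρ0] at hτ2
    have : (1 + C') * t ≤ ρ / 2 := by
      calc (1 + C') * t = 2 * (1 + C') * t / 2 := by ring
        _ ≤ τ * ρ * t / 2 := by gcongr
        _ = ρ / 2 * (t * τ) := by ring
        _ = ρ / 2 := by rw [htτ, mul_one]
    linarith
  set δ₁ := δ / (4 * (J + 1)) with hδ₁
  set b : Sp n → ℝ := fun y => max (hole η Ω (κ / τ) y - δ / 4) 0 * v y ^ 2 with hb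
  have hhole := (contDiff_hole S.isOpen hη hε.ne').continuous
  have hbc : CC b := hv0.sq.mul_left ((hhole.sub continuous_const).max continuous_const)
  have hΨc := cc_holeDens (fun i j => hcf.contDiff 1 i j) A.contDiff hvC hvc δ₁ C σ τ
  have hint := integral_le_of_translates hbc hΨc t
    (hloc (ρ / 2) C' (by positivity) hC' hmod φ' u A τ hτ0)
  set X := ∫ x, conjOp a φ' τ v x ^ 2 with hX
  set Y := ∫ x, enr τ v x with hY
  set H := ∫ x, hsq v x with hHd
  set Z := ∫ x, v x ^ 2 with hZ
  have hX0 : 0 ≤ X := integral_nonneg fun _ => sq_nonneg _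
  have hY0 : 0 ≤ Y := integral_nonneg fun _ => enr_nonneg _ _ _
  have hZ0 : 0 ≤ Z := integral_nonneg fun _ => sq_nonneg _
  have cX : CC fun x => conjOp a φ' τ v x ^ 2 :=
    (cc_conjOp (fun i j => hcf.contDiff 1 i j) A.contDiff hvC hvc).sq
  have cY : CC (enr τ v) := cc_enr hvC hvc
  have cH : CC (hsq v) := cc_hsq hvC hvc
  have cZ : CC fun x => v x ^ 2 := hv0.sq
  have hZY : τ ^ 2 * Z ≤ Y := by
    rw [hZ, ← integral_const_mul]
    refine integral_mono (cZ.integrable.const_mul _) cY.integrable fun x => ?_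
    have := nsq_nonneg fun i => pd i v x
    simp only [enr]
    linarith
  have hHle : H ≤ C₂ * (X + τ ^ 2 * Y) := (h₂ a φ' u τ hcf hτ1 A.contDiff (A.contDiff_u 3)
    A.test.2.1 (fun x hx i => by rw [A.pd_eq hx]; exact hR x (A.mem hx) i)
    (fun x hx i k => by rw [A.pd_pd_eq hx]; exact hH x (A.mem hx) i k)).2
  have eΨ := integral_holeDens (fun i j => hcf.contDiff 1 i j) A.contDiff hvC hvc δ₁ C σ τ
  have hbJ : ∫ x, b x ≤ J * (δ₁ * Z + C * (t ^ 4 * X + t ^ 6 * H + σ ^ 2 * t ^ 2 * Y)) := by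
    rw [← eΨ, hJ, div_mul_eq_mul_div, le_div_iff₀ hV0, mul_comm]
    exact hint
  -- `hole ≤ δ / 4 + max (hole - δ / 4) 0`, and the truncated part is what the local estimate
  -- controls.
  have hsplit : ∫ x, hole η Ω (κ / τ) x * v x ^ 2 ≤ δ / 4 * Z + ∫ x, b x := by
    rw [hZ, ← integral_const_mul, ← integral_add (cZ.integrable.const_mul _) hbc.integrable]
    refine integral_mono (cZ.mul_left hhole).integrable
      ((cZ.integrable.const_mul _).add hbc.integrable) fun x => ?_
    have h1 := le_max_left (hole η Ω (κ / τ) x - δ / 4) 0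
    have h2 := mul_le_mul_of_nonneg_right h1 (sq_nonneg (v x))
    simp only [hb]
    linarith
  have hHt : τ ^ 2 * (t ^ 6 * H) ≤ C₂ * (t ^ 2 * X) + C₂ * (t ^ 2 * Y) := by
    have e : τ ^ 2 * (t ^ 6 * H) = (t * τ) ^ 2 * (t ^ 4 * H) := by ring
    have hX2 : t ^ 4 * X ≤ t ^ 2 * X :=
      mul_le_mul_of_nonneg_right (pow_le_pow_of_le_one ht0.le ht1 (by norm_num)) hX0
    rw [e, htτ, one_pow, one_mul]
    calc t ^ 4 * H ≤ t ^ 4 * (C₂ * (X + τ ^ 2 * Y)) := by gcongr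
      _ = C₂ * (t ^ 4 * X) + C₂ * ((t * τ) ^ 2 * (t ^ 2 * Y)) := by ring
      _ = C₂ * (t ^ 4 * X) + C₂ * (t ^ 2 * Y) := by rw [htτ, one_pow, one_mul]
      _ ≤ _ := by gcongr
  have c1 : J * δ₁ ≤ δ / 4 := by
    have e : J * δ₁ = δ / 4 * (J / (J + 1)) := by
      rw [hδ₁]; field_simp
    rw [e]
    exact mul_le_of_le_one_right (by positivity) ((div_le_one (by linarith)).2 (by linarith))
  have c2 : J * C * σ ^ 2 ≤ δ / 4 := by
    have h1 : σ ^ 2 ≤ ρ := by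
      have : ρ ≤ 1 := min_le_left _ _
      nlinarith
    have h2 : ρ ≤ δ / (4 * (J * C + 1)) := min_le_right _ _
    have hJC : 0 ≤ J * C := by positivity
    calc J * C * σ ^ 2 ≤ J * C * (δ / (4 * (J * C + 1))) := by gcongr; exact h1.trans h2
      _ = δ / 4 * (J * C / (J * C + 1)) := by field_simp
      _ ≤ _ := mul_le_of_le_one_right (by positivity)
        ((div_le_one (by linarith)).2 (by linarith))
  have c3 : J * C * C₂ * t ^ 2 ≤ δ / 4 := by
    rw [div_le_iff₀ hδ] at hτ3
    calc J * C * C₂ * t ^ 2 = 4 * (J * C * C₂) * (t * t) / 4 := by ring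
      _ ≤ τ * δ * (t * 1) / 4 := by gcongr
      _ = δ / 4 * (t * τ) := by ring
      _ = δ / 4 := by rw [htτ, mul_one]
  exact hole_arith hJ0 hC hY0 htτ hZY hHt (hsplit.trans (by linarith)) hδ.le (by positivity)
    c1 c2 c3

end Carleman

namespace Carleman

variable {n : ℕ} {g : Sp n → Matrix (Fin n) (Fin n) ℝ} {lam Lam c₀ : ℝ} {Ω : Set (Sp n)}
  {φ φ' u : Sp n → ℝ}

/-! ### Comparison with the operator with Lipschitz coefficients -/

theorem pd_sum_mul_pd {a : Fin n → Sp n → ℝ} {u : Sp n → ℝ} {x : Sp n}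
    (ha : ∀ j, DifferentiableAt ℝ (a j) x) (hu : ContDiff ℝ 2 u) (i : Fin n) :
    pd i (fun y => ∑ j, a j y * pd j u y) x =
      ∑ j, (pd i (a j) x * pd j u x + a j x * pd i (pd j u) x) := by
  have hp := fun l => (contDiff_one_pd hu l).differentiable (by simp) x
  rw [pd_sum fun j _ => (ha j).fun_mul (hp j)]
  exact Finset.sum_congr rfl fun j _ => pd_mul (ha j) (hp j)

theorem sq_sum_coeff_le {p r : Fin n → Fin n → ℝ} {M N : ℝ} (hp : ∀ i j, |p i j| ≤ M)
    (hr : ∀ i j, |r i j| ≤ N) (u : Sp n → ℝ) (x : Sp n) :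
    (∑ i, ∑ j, (p i j * pd j u x + r i j * pd i (pd j u) x)) ^ 2 ≤
      2 * (n ^ 3 * M ^ 2) * nsq (fun i => pd i u x) + 2 * (n ^ 2 * N ^ 2) * hsq u x := by
  simp only [Finset.sum_add_distrib]
  refine (add_sq_le).trans ?_
  have h1 : (∑ i, ∑ j, p i j * pd j u x) ^ 2 ≤ n ^ 3 * M ^ 2 * nsq (fun i => pd i u x) := by
    have h := sq_sum_le_card_mul_sum_sq (s := Finset.univ) (f := fun i => ∑ j, p i j * pd j u x)
    have h2 : ∑ i, (∑ j, p i j * pd j u x) ^ 2 ≤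
        ∑ _i : Fin n, n * M ^ 2 * nsq (fun i => pd i u x) :=
      Finset.sum_le_sum fun i _ => sq_sum_mul_le (hp i)
    simp only [Finset.card_univ, Fintype.card_fin, Finset.sum_const, nsmul_eq_mul] at h h2
    calc _ ≤ _ := h
      _ ≤ n * (n * (n * M ^ 2 * nsq (fun i => pd i u x))) := by gcongr
      _ = _ := by ring
  have h2 : (∑ i, ∑ j, r i j * pd i (pd j u) x) ^ 2 ≤ n ^ 2 * N ^ 2 * hsq u x := by
    have h3 : (∑ i, ∑ j, r i j * pd i (pd j u) x) ^ 2 ≤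
        (∑ i, ∑ j, |r i j * pd i (pd j u) x|) ^ 2 := by
      rw [← sq_abs]
      exact pow_le_pow_left₀ (abs_nonneg _) ((Finset.abs_sum_le_sum_abs _ _).trans
        (Finset.sum_le_sum fun i _ => Finset.abs_sum_le_sum_abs _ _)) 2
    refine (h3.trans (sq_sum_sum_abs_le _)).trans ?_
    rw [mul_assoc]
    refine mul_le_mul_of_nonneg_left ?_ (by positivity)
    unfold hsq
    rw [Finset.sum_comm, Finset.mul_sum]
    refine Finset.sum_le_sum fun j _ => ?_
    rw [Finset.mul_sum]
    refine Finset.sum_le_sum fun i _ => ?_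
    rw [mul_pow]
    refine mul_le_mul_of_nonneg_right ?_ (sq_nonneg _)
    rw [← sq_abs]
    exact pow_le_pow_left₀ (abs_nonneg _) (hr i j) 2
  linarith

/-- Mollification moves the coefficients by `O(ε)` but their derivatives only by `O(1)`. The
first-order error is not small, yet its square is of the order of the energy without the extra
factor `τ` that the main estimate gains. -/
theorem Setting.ae_sq_divOp_sub_laplG_le (S : Setting g lam Lam Ω φ c₀) {η : Sp n → ℝ}
    (hη : IsMollifier η) {ε : ℝ} (hε : 0 < ε) (hu : ContDiff ℝ 2 u) :
    ∀ᵐ x, (divOp (smoothCoeff η g ε) u x - laplG g u x) ^ 2 ≤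
      8 * n ^ 3 * (lam ^ 2 * Lam) ^ 2 * nsq (fun i => pd i u x)
        + 2 * n ^ 2 * (lam ^ 2 * Lam) ^ 2 * ε ^ 2 * hsq u x := by
  have hcf := S.isCoeff hη hε.ne'
  have had : ∀ᵐ x, ∀ i j, DifferentiableAt ℝ (ginv g i j) x :=
    ae_all_iff.2 fun i => ae_all_iff.2 fun j =>
      ae_differentiableAt_of_lipschitz S.lip_nonneg (S.ginv_lip i j)
  filter_upwards [had] with x hx
  have e : divOp (smoothCoeff η g ε) u x - laplG g u x =
      ∑ i, ∑ j, ((pd i (smoothCoeff η g ε i j) x - pd i (ginv g i j) x) * pd j u x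
        + (smoothCoeff η g ε i j x - ginv g i j x) * pd i (pd j u) x) := by
    unfold divOp laplG gradG flux
    rw [← Finset.sum_sub_distrib]
    refine Finset.sum_congr rfl fun i _ => ?_
    rw [pd_sum_mul_pd (fun j => (hcf.contDiff 1 i j).differentiable (by simp) x) hu,
      pd_sum_mul_pd (hx i) hu, ← Finset.sum_sub_distrib]
    exact Finset.sum_congr rfl fun j _ => by ring
  rw [e]
  refine (sq_sum_coeff_le (M := 2 * (lam ^ 2 * Lam)) (N := lam ^ 2 * Lam * ε) (fun i j => ?_)
    (fun i j => S.smoothCoeff_sub hη hε.le i j x) u x).trans (le_of_eq (by ring))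
  have h1 := hcf.deriv i i j x
  have h2 := S.abs_pd_ginv i i j x
  exact (abs_sub _ _).trans (by linarith)

theorem measurable_laplG (g : Sp n → Matrix (Fin n) (Fin n) ℝ) (u : Sp n → ℝ) :
    Measurable (laplG g u) :=
  Finset.measurable_fun_sum _ fun i _ => measurable_pd i _

theorem laplG_eq_zero {x : Sp n} (hx : x ∉ tsupport u) : laplG g u x = 0 := by
  refine Finset.sum_eq_zero fun i _ => pd_eq_zero_of_notMem_tsupport fun h => hx ?_
  refine closure_minimal (fun y hy => ?_) (isClosed_tsupport u) h
  by_contra hyu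
  refine hy (Finset.sum_eq_zero fun j _ => ?_)
  rw [pd_eq_zero_of_notMem_tsupport hyu, mul_zero]

theorem cc_nsq_grad {u : Sp n → ℝ} (hu : ContDiff ℝ 1 u) (hc : HasCompactSupport u) :
    CC fun x => nsq fun i => pd i u x :=
  CC.sum fun i _ => (cc_pd hu hc i).sq

/-- The conjugated operator with mollified coefficients is controlled by the operator with Lipschitz
coefficients and the energy. -/
theorem Setting.integral_conjOp_sq_le (S : Setting g lam Lam Ω φ c₀) {η : Sp n → ℝ}
    (hη : IsMollifier η) {κ : ℝ} (hκ : 1 ≤ κ) :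
    ∃ C τ₀ : ℝ, 0 ≤ C ∧ 1 ≤ τ₀ ∧ ∀ φ' u, Adapted Ω φ φ' u → ∀ τ, τ₀ ≤ τ →
      ∫ x, conjOp (smoothCoeff η g (κ / τ)) φ' τ (conjW φ' τ u) x ^ 2 ≤
        4 * (∫ x, Real.exp (2 * τ * φ' x) * laplG g u x ^ 2)
          + C * ∫ x, enr τ (conjW φ' τ u) x := by
  obtain ⟨R, -, hR0, -, hR, hH, -⟩ := S.exists_weight_bounds
  obtain ⟨C₂, hC₂, h₂⟩ := second_order_estimate (n := n) lam (lam ^ 2 * Lam) R S.one_le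
  set L := lam ^ 2 * Lam with hL
  have hL0 : 0 ≤ L := S.lip_nonneg
  set D : ℝ := 2 + 2 * n * R ^ 2 with hD
  set F : ℝ := 4 * n ^ 2 * L ^ 2 * κ ^ 2 * C₂ with hF
  have hF0 : 0 ≤ F := by positivity
  refine ⟨2 * (16 * n ^ 3 * L ^ 2 * D + F), max 1 (2 * F), by positivity, le_max_left _ _,
    fun φ' u A τ hτ => ?_⟩
  have hτ1 : 1 ≤ τ := (le_max_left _ _).trans hτ
  have hτF : 2 * F ≤ τ := (le_max_right _ _).trans hτ
  have hτ0 : 0 < τ := by linarith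
  have hε : 0 < κ / τ := by positivity
  have hcf := S.isCoeff hη hε.ne'
  have hu2 := A.contDiff_u 2
  have hu1 := A.contDiff_u 1
  have huc := A.test.2.1
  have hφc := A.contDiff.continuous
  set a := smoothCoeff η g (κ / τ) with ha
  have ha1 := fun i j => hcf.contDiff 1 i j
  have hRu : ∀ x ∈ tsupport u, ∀ i, |pd i φ' x| ≤ R := fun x hx i => by
    rw [A.pd_eq hx]; exact hR x (A.mem hx) i
  have hw : Continuous fun x => Real.exp (2 * τ * φ' x) := by fun_prop
  have cD : CC fun x => Real.exp (2 * τ * φ' x) * divOp a u x ^ 2 :=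
    (cc_divOp ha1 hu2 huc).sq.mul_left hw
  have cN : CC fun x => Real.exp (2 * τ * φ' x) * nsq fun i => pd i u x :=
    (cc_nsq_grad hu1 huc).mul_left hw
  have cH : CC fun x => Real.exp (2 * τ * φ' x) * hsq u x := (cc_hsq hu2 huc).mul_left hw
  have cY : CC (enr τ (conjW φ' τ u)) := cc_enr (A.contDiff_v τ) (A.compact_v τ)
  set X := ∫ x, conjOp a φ' τ (conjW φ' τ u) x ^ 2 with hX
  set Y := ∫ x, enr τ (conjW φ' τ u) x with hY
  set G := ∫ x, Real.exp (2 * τ * φ' x) * laplG g u x ^ 2 with hG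
  have hX0 : 0 ≤ X := integral_nonneg fun _ => sq_nonneg _
  have hY0 : 0 ≤ Y := integral_nonneg fun _ => enr_nonneg _ _ _
  have hXe : X = ∫ x, Real.exp (2 * τ * φ' x) * divOp a u x ^ 2 := by
    refine integral_congr_ae (Filter.Eventually.of_forall fun x => ?_)
    simp only
    rw [conjOp_conjW hcf.symm ha1 A.contDiff hu2, mul_pow, ← Real.exp_nat_mul]
    congr 2; push_cast; ring
  set c₁ : ℝ := 16 * n ^ 3 * L ^ 2 with hc₁
  set c₂ : ℝ := 4 * n ^ 2 * L ^ 2 * (κ / τ) ^ 2 with hc₂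
  have hae := S.ae_sq_divOp_sub_laplG_le hη hε hu2
  have iR : Integrable fun x => 2 * (Real.exp (2 * τ * φ' x) * divOp a u x ^ 2)
      + c₁ * (Real.exp (2 * τ * φ' x) * nsq fun i => pd i u x)
      + c₂ * (Real.exp (2 * τ * φ' x) * hsq u x) :=
    ((cD.integrable.const_mul _).add (cN.integrable.const_mul _)).add (cH.integrable.const_mul _)
  have iG : Integrable fun x => Real.exp (2 * τ * φ' x) * laplG g u x ^ 2 := by
    refine iR.mono' (hw.measurable.mul ((measurable_laplG g u).pow_const 2)).aestronglyMeasurable ?_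
    filter_upwards [hae] with x hx
    rw [Real.norm_of_nonneg (by positivity)]
    have h1 : laplG g u x ^ 2 ≤ 2 * divOp a u x ^ 2
        + (c₁ * (nsq fun i => pd i u x) + c₂ * hsq u x) := by
      have h3 : laplG g u x ^ 2 ≤ 2 * divOp a u x ^ 2 + 2 * (divOp a u x - laplG g u x) ^ 2 := by
        nlinarith [sq_nonneg (2 * divOp a u x - laplG g u x)]
      rw [hc₁, hc₂]
      linarith
    have h2 := mul_le_mul_of_nonneg_left h1 (Real.exp_pos (2 * τ * φ' x)).le
    linarith
  have hXG : X ≤ 2 * G + (c₁ * (∫ x, Real.exp (2 * τ * φ' x) * nsq fun i => pd i u x)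
      + c₂ * ∫ x, Real.exp (2 * τ * φ' x) * hsq u x) := by
    have iNH : Integrable fun x => c₁ * (Real.exp (2 * τ * φ' x) * nsq fun i => pd i u x)
      + c₂ * (Real.exp (2 * τ * φ' x) * hsq u x) :=
      (cN.integrable.const_mul _).add (cH.integrable.const_mul _)
    rw [hXe, hG, ← integral_const_mul, ← integral_const_mul, ← integral_const_mul,
      ← integral_add (cN.integrable.const_mul _) (cH.integrable.const_mul _),
      ← integral_add (iG.const_mul _) iNH]
    refine integral_mono_ae cD.integrable ((iG.const_mul _).add iNH) ?_
    filter_upwards [hae] with x hx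
    have h1 : divOp a u x ^ 2 ≤ 2 * laplG g u x ^ 2
        + (c₁ * (nsq fun i => pd i u x) + c₂ * hsq u x) := by
      have h3 : divOp a u x ^ 2 ≤ 2 * laplG g u x ^ 2 + 2 * (divOp a u x - laplG g u x) ^ 2 := by
        nlinarith [sq_nonneg (divOp a u x - 2 * laplG g u x)]
      rw [hc₁, hc₂]
      linarith
    have h2 := mul_le_mul_of_nonneg_left h1 (Real.exp_pos (2 * τ * φ' x)).le
    linarith
  have hN : ∫ x, Real.exp (2 * τ * φ' x) * nsq (fun i => pd i u x) ≤ D * Y := by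
    rw [hY, ← integral_const_mul]
    exact integral_mono cN.integrable (cY.integrable.const_mul _) fun x =>
      exp_mul_nsq_le (A.contDiff.differentiable (by simp) x) (hu2.differentiable (by simp) x)
        fun hx i => hRu x hx i
  have hHs : ∫ x, Real.exp (2 * τ * φ' x) * hsq u x ≤ C₂ * (X + τ ^ 2 * Y) :=
    (h₂ a φ' u τ hcf hτ1 A.contDiff (A.contDiff_u 3) huc hRu
      (fun x hx i k => by rw [A.pd_pd_eq hx]; exact hH x (A.mem hx) i k)).1
  have hc₁0 : 0 ≤ c₁ := by positivity
  have hc₂0 : 0 ≤ c₂ := by positivity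
  -- Since `ε τ = κ`, the second-derivative error costs only a fixed multiple of the energy. Its
  -- operator part has the factor `F / τ ^ 2 ≤ 1 / 2` and is absorbed on the left.
  have e1 : c₂ * (C₂ * (τ ^ 2 * Y)) = F * Y := by rw [hc₂, hF]; field_simp
  have e2 : c₂ * C₂ ≤ 1 / 2 := by
    have : c₂ * C₂ = F / τ ^ 2 := by rw [hc₂, hF]; field_simp
    rw [this, div_le_iff₀ (by positivity)]
    nlinarith
  have h3 := mul_le_mul_of_nonneg_left hN hc₁0
  have h4 := mul_le_mul_of_nonneg_left hHs hc₂0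
  have h5 := mul_le_mul_of_nonneg_right e2 hX0
  have e3 : c₂ * (C₂ * (X + τ ^ 2 * Y)) = c₂ * C₂ * X + c₂ * (C₂ * (τ ^ 2 * Y)) := by ring
  rw [e3, e1] at h4
  linarith

theorem Setting.normSqG_gradG (S : Setting g lam Lam Ω φ c₀) (u : Sp n → ℝ) (x : Sp n) :
    0 ≤ normSqG g x (gradG g u x) ∧
      normSqG g x (gradG g u x) ≤ lam * nsq fun i => pd i u x := by
  have e : normSqG g x (gradG g u x) = ∑ i, (∑ j, ginv g i j x * pd j u x) * pd i u x :=
    sum_ginv_eq S.one_le S.elliptic x fun i => pd i u x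
  have h := ginv_elliptic S.symm S.one_le S.elliptic x fun i => pd i u x
  have hl := S.lam_pos
  rw [e]
  refine ⟨le_trans ?_ h.1, h.2.1⟩
  positivity

/-! ### Absorption of the remainders -/

/-- The Carleman estimate for the conjugated function. -/
theorem Setting.carleman_conj (S : Setting g lam Lam Ω φ c₀) :
    ∃ C τ₀ : ℝ, 0 < C ∧ 1 ≤ τ₀ ∧ ∀ φ' u, Adapted Ω φ φ' u → ∀ τ, τ₀ ≤ τ →
      τ * (∫ x, enr τ (conjW φ' τ u) x) ≤
        C * ∫ x, Real.exp (2 * τ * φ' x) * laplG g u x ^ 2 := by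
  obtain ⟨η, hη⟩ := exists_isMollifier n
  obtain ⟨κ, c, C₁, τ₁, hκ, hc, hC₁, hτ₁, h₁⟩ := S.energy_estimate hη
  -- The scale `κ` is already fixed by the energy estimate. This `δ` makes the hole remainder take
  -- at most half of the energy on the left.
  obtain ⟨C₂, τ₂, hC₂, hτ₂, h₂⟩ := S.hole_estimate hη hκ (δ := c / (2 * (C₁ + 1))) (by positivity)
  obtain ⟨C₃, τ₃, hC₃, hτ₃, h₃⟩ := S.integral_conjOp_sq_le hη hκ
  set B := 2 + C₁ * C₂ with hB
  have hB0 : 0 < B := by positivity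
  -- With `X` the conjugated operator, `Y` the energy and `G` the right side: `(c/2) τ Y ≤ B X ≤ 4 B
  -- G + B C₃ Y`. The last threshold bounds `B C₃ Y` by `(c/4) τ Y`, which leaves `(c/4) τ Y ≤ 4 B
  -- G`.
  refine ⟨16 * B / c, max (max τ₁ τ₂) (max τ₃ (4 * B * C₃ / c)), by positivity,
    hτ₁.trans ((le_max_left _ _).trans (le_max_left _ _)), fun φ' u A τ hτ => ?_⟩
  have ht1 : τ₁ ≤ τ := ((le_max_left _ _).trans (le_max_left _ _)).trans hτ
  have ht2 : τ₂ ≤ τ := ((le_max_right _ _).trans (le_max_left _ _)).trans hτ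
  have ht3 : τ₃ ≤ τ := ((le_max_left _ _).trans (le_max_right _ _)).trans hτ
  have ht4 : 4 * B * C₃ / c ≤ τ := ((le_max_right _ _).trans (le_max_right _ _)).trans hτ
  have hτ1 : 1 ≤ τ := hτ₁.trans ht1
  have hτ0 : 0 < τ := by linarith
  have k1 := h₁ φ' u A τ ht1
  have k2 := h₂ φ' u A τ ht2
  have k3 := h₃ φ' u A τ ht3
  have hX0 : 0 ≤ ∫ x, conjOp (smoothCoeff η g (κ / τ)) φ' τ (conjW φ' τ u) x ^ 2 :=
    integral_nonneg fun _ => sq_nonneg _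
  have hY0 : 0 ≤ ∫ x, enr τ (conjW φ' τ u) x := integral_nonneg fun _ => enr_nonneg _ _ _
  generalize (∫ x, conjOp (smoothCoeff η g (κ / τ)) φ' τ (conjW φ' τ u) x ^ 2) = X at *
  generalize (∫ x, enr τ (conjW φ' τ u) x) = Y at *
  generalize (∫ x, hole η Ω (κ / τ) x * conjW φ' τ u x ^ 2) = W at *
  generalize (∫ x, Real.exp (2 * τ * φ' x) * laplG g u x ^ 2) = G at *
  have m1 : C₁ * (c / (2 * (C₁ + 1))) ≤ c / 2 := by
    have e : C₁ * (c / (2 * (C₁ + 1))) = c / 2 * (C₁ / (C₁ + 1)) := by field_simp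
    rw [e]
    exact mul_le_of_le_one_right (by positivity) ((div_le_one (by linarith)).2 (by linarith))
  have m2 : C₁ * τ ^ 3 * W ≤ c / 2 * (τ * Y) + C₁ * C₂ * X := by
    calc C₁ * τ ^ 3 * W = C₁ * τ * (τ ^ 2 * W) := by ring
      _ ≤ C₁ * τ * (c / (2 * (C₁ + 1)) * Y + C₂ * (τ⁻¹ ^ 2 * X)) := by gcongr
      _ = C₁ * (c / (2 * (C₁ + 1))) * (τ * Y) + C₁ * C₂ * (τ⁻¹ * X) := by
          have : τ * τ⁻¹ = 1 := mul_inv_cancel₀ hτ0.ne'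
          linear_combination C₁ * C₂ * τ⁻¹ * X * this
      _ ≤ _ := by
          gcongr
          exact mul_le_of_le_one_left hX0 (inv_le_one_of_one_le₀ hτ1)
  have m3 : c / 2 * (τ * Y) ≤ B * X := by rw [hB]; linarith
  have m4 : B * X ≤ 4 * B * G + B * C₃ * Y := by
    have := mul_le_mul_of_nonneg_left k3 hB0.le
    linarith
  have m5 : B * C₃ * Y ≤ c / 4 * (τ * Y) := by
    rw [div_le_iff₀ hc] at ht4
    have := mul_le_mul_of_nonneg_right ht4 hY0
    linarith
  rw [div_mul_eq_mul_div, le_div_iff₀ hc]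
  linarith

/-- The Carleman estimate. -/
theorem Setting.carleman (S : Setting g lam Lam Ω φ c₀) :
    ∃ C τ₀ : ℝ, 0 < C ∧ 0 < τ₀ ∧ ∀ u : Sp n → ℝ, IsTestFunction Ω u → ∀ τ : ℝ, τ₀ ≤ τ →
      τ * ∫ x in Ω, (normSqG g x (gradG g u x) + τ ^ 2 * u x ^ 2) * Real.exp (2 * τ * φ x) ≤
        C * ∫ x in Ω, |laplG g u x| ^ 2 * Real.exp (2 * τ * φ x) := by
  obtain ⟨R, -, hR0, -, hR, -, -⟩ := S.exists_weight_bounds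
  obtain ⟨C, τ₀, hC, hτ₀, h⟩ := S.carleman_conj
  have hl := S.lam_pos
  set D : ℝ := 2 + 2 * n * R ^ 2 with hD
  refine ⟨(lam * D + 1) * C, τ₀, by positivity, by linarith, fun u hu τ hτ => ?_⟩
  obtain ⟨φ', A⟩ := S.exists_adapted hu
  have key := h φ' u A τ hτ
  have hτ0 : 0 < τ := by linarith
  have heq : ∀ x ∈ tsupport u, φ' x = φ x := fun x hx => (A.eventuallyEq hx).eq_of_nhds
  have hu2 := A.contDiff_u 2
  have hgr : ∀ x, x ∉ tsupport u → normSqG g x (gradG g u x) + τ ^ 2 * u x ^ 2 = 0 := fun x hx => by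
    have h1 := S.normSqG_gradG u x
    have h2 : (nsq fun i => pd i u x) = 0 :=
      Finset.sum_eq_zero fun i _ => by simp [pd_eq_zero_of_notMem_tsupport hx]
    rw [h2, mul_zero] at h1
    rw [le_antisymm h1.2 h1.1, image_eq_zero_of_notMem_tsupport hx]; ring
  have hG : ∫ x in Ω, |laplG g u x| ^ 2 * Real.exp (2 * τ * φ x) =
      ∫ x, Real.exp (2 * τ * φ' x) * laplG g u x ^ 2 := by
    rw [setIntegral_eq_integral_of_forall_compl_eq_zero fun x hx => by
      rw [laplG_eq_zero fun h => hx (A.mem h)]; simp]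
    refine integral_congr_ae (Filter.Eventually.of_forall fun x => ?_)
    simp only [sq_abs]
    by_cases hx : x ∈ tsupport u
    · rw [heq x hx, mul_comm]
    · rw [laplG_eq_zero hx]; ring
  have hL : ∫ x in Ω, (normSqG g x (gradG g u x) + τ ^ 2 * u x ^ 2) * Real.exp (2 * τ * φ x) ≤
      (lam * D + 1) * ∫ x, enr τ (conjW φ' τ u) x := by
    rw [setIntegral_eq_integral_of_forall_compl_eq_zero fun x hx => by
      rw [hgr x fun h => hx (A.mem h), zero_mul], ← integral_const_mul]
    refine integral_mono_of_nonneg (Filter.Eventually.of_forall fun x => ?_)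
      ((cc_enr (A.contDiff_v τ) (A.compact_v τ)).integrable.const_mul _)
      (Filter.Eventually.of_forall fun x => ?_)
    · have := (S.normSqG_gradG u x).1
      simp only [Pi.zero_apply]
      positivity
    have hE := enr_nonneg τ (conjW φ' τ u) x
    show (normSqG g x (gradG g u x) + τ ^ 2 * u x ^ 2) * Real.exp (2 * τ * φ x) ≤
      (lam * D + 1) * enr τ (conjW φ' τ u) x
    by_cases hx : x ∈ tsupport u
    · have h1 := (S.normSqG_gradG u x).2
      have h2 := exp_mul_nsq_le (τ := τ) (R := R) (A.contDiff.differentiable (by simp) x)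
        (hu2.differentiable (by simp) x) fun hx i => by rw [A.pd_eq hx]; exact hR x (A.mem hx) i
      -- The zeroth-order part of the energy density is exactly this term; the gradient part of `u`
      -- costs the factor `D`.
      have h3 : Real.exp (2 * τ * φ' x) * (τ ^ 2 * u x ^ 2) ≤ enr τ (conjW φ' τ u) x := by
        have hn := nsq_nonneg fun i => pd i (conjW φ' τ u) x
        have e : Real.exp (2 * τ * φ' x) = Real.exp (τ * φ' x) ^ 2 := by
          rw [← Real.exp_nat_mul]; congr 1; push_cast; ring
        have e2 : enr τ (conjW φ' τ u) x = (nsq fun i => pd i (conjW φ' τ u) x)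
            + Real.exp (2 * τ * φ' x) * (τ ^ 2 * u x ^ 2) := by
          rw [e]; unfold enr; simp only [conjW]; ring
        linarith
      rw [← heq x hx]
      have h4 := mul_le_mul_of_nonneg_left h1 (Real.exp_pos (2 * τ * φ' x)).le
      have h5 := mul_le_mul_of_nonneg_left h2 hl.le
      rw [← hD] at h5
      linarith
    · rw [hgr x hx, zero_mul]
      positivity
  rw [hG]
  calc _ ≤ τ * ((lam * D + 1) * ∫ x, enr τ (conjW φ' τ u) x) := by gcongr
    _ = (lam * D + 1) * (τ * ∫ x, enr τ (conjW φ' τ u) x) := by ring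
    _ ≤ (lam * D + 1) * (C * ∫ x, Real.exp (2 * τ * φ' x) * laplG g u x ^ 2) := by gcongr
    _ = _ := by ring

end Carleman

end

open Carleman in
theorem theorem3p1 (n : ℕ) (hn : 2 ≤ n)
    (g : Sp n → Matrix (Fin n) (Fin n) ℝ) (hsymm : ∀ x, (g x).IsSymm)
    (lam Lam : ℝ) (hlam : 1 ≤ lam) (hLam : 0 < Lam)
    (hell : IsElliptic g lam) (hlip : IsLipschitzField g Lam)
    (Ω : Set (Sp n)) (hopen : IsOpen Ω) (hbdd : Bornology.IsBounded Ω)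
    (φ : Sp n → ℝ) (hφ : IsC2Closure Ω φ)
    -- `∇φ ≠ 0` on `Ω̄`, where `∇φ` on the boundary is the continuous extension from `Ω`
    (hgrad : ∀ x ∈ closure Ω, extendFrom Ω (grad φ) x ≠ 0)
    (c₀ : ℝ) (hc₀ : 0 < c₀) (hmain : MainAssumption g φ Ω c₀) :
    ∃ C τ₀ : ℝ, 0 < C ∧ 0 < τ₀ ∧
      ∀ u : Sp n → ℝ, IsTestFunction Ω u → ∀ τ : ℝ, τ₀ ≤ τ →
        τ * ∫ x in Ω, (normSqG g x (gradG g u x) + τ ^ 2 * u x ^ 2) * Real.exp (2 * τ * φ x) ≤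
          C * ∫ x in Ω, |laplG g u x| ^ 2 * Real.exp (2 * τ * φ x) := by
  exact Setting.carleman (c₀ := c₀)
    ⟨hsymm, hlam, hLam, hell, hlip, hopen, hbdd, hφ, hgrad, hc₀, hmain⟩
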